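/- **Data.** Let $I$ be a set with a parity $p:I\to\{0,1\}$, $I=I_{\rm even}\sqcup I_{\rm odd}$. Let $P$ be a free $\mathbb Z$-module with a symmetric $\mathbb Q$-valued bilinear form, and let $\alpha_i\in P$, $h_i\in P^*=\mathrm{Hom}(P,\mathbb Z)$, $\ell_i\in\mathbb Z\setminus\{0\}$ $(i\in I)$ satisfy $\ell_i\langle h_i,\lambda\rangle=(\alpha_i,\lambda)$ for all $\lambda\in P$; $\langle h_i,\alpha_i\rangle=2$ for $i$ even, $\langle h_i,\alpha_i\rangle=0$ for $i$ odd, and $\langle h_i,\alpha_j\rangle\le 0$ for $i$ even and $j\ne i$. **Algebra.** Put $q_i=q^{\ell_i}$ and $t_i=q^{\ell_ih_i}$. $U=U_q(\mathfrak g)$ is the universal $\mathbb Q(q)$-algebra with generators $e_i,f_i$ $(i\in I)$, $q^h$ $(h\in P^*)$, $\sigma$ satisfying $q^0=1$, $q^{h+h'}=q^hq^{h'}$, $q^he_i=q^{\langle h,\alpha_i\rangle}e_iq^h$, $q^hf_i=q^{-\langle h,\alpha_i\rangle}f_iq^h$, $e_if_j-(-1)^{p(i)p(j)}f_je_i=\delta_{ij}(t_i-t_i^{-1})/(q_i-q_i^{-1})$,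 $\sigma^2=1$, $\sigma e_i\sigma=(-1)^{p(i)}e_i$, $\sigma f_i\sigma=(-1)^{p(i)}f_i$, $\sigma q^h\sigma=q^h$, and the following two conditions: if $a$ lies in the ideal generated by the $e_i$ of the subalgebra $U^+$ generated by the $e_i$, and $f_ia\in U^+f_i$ for all $i$, then $a=0$; and the same with the roles of $e$ and $f$ exchanged. Its comultiplication $\Delta:U\to U\otimes U$ is the algebra homomorphism with $\Delta(\sigma)=\sigma\otimes\sigma$, $\Delta(q^h)=q^h\otimes q^h$, $\Delta(e_i)=e_i\otimes t_i^{-1}+\sigma^{p(i)}\otimes e_i$, $\Delta(f_i)=f_i\otimes1+\sigma^{p(i)}t_i\otimes f_i$. **Modules.** For a $U$-module $M$ let $M_\mu=\{u: q^hu=q^{\langle h,\mu\rangle}u\ \forall h\in P^*\}$. Call $M$ *integrable* if $M=\bigoplus_{\mu\in P}M_\mu$; for $i$ even, $M$ is locally finite over the subalgebra generated by $e_i,f_i,t_i$; for $i$ odd, $M_\mu\neq0$ implies $\langle h_i,\mu\rangle\ge0$; and for $i$ odd, $\langle h_i,\mu\rangle=0$ implies $e_iM_\mu=f_iM_\mu=0$.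 The category $\mathcal O_{\rm int}$ consists of the integrable modules with $\dim M_\mu<\infty$ for all $\mu$. **Operators.** Let $M$ be integrable, $[n]_i=(q_i^n-q_i^{-n})/(q_i-q_i^{-1})$, $f_i^{(n)}=f_i^n/[n]_i!$ for $n\ge0$ and $f_i^{(-1)}=0$. For $i$ even, $\tilde e_i,\tilde f_i$ are the linear operators such that, for every $v\in M_\mu$ with $e_iv=0$ and $0\le k\le l:=\langle h_i,\mu\rangle$, - if $\ell_i>0$: $\tilde e_if_i^{(k)}v=f_i^{(k-1)}v$ and $\tilde f_if_i^{(k)}v=f_i^{(k+1)}v$; - if $\ell_i<0$: $\tilde e_if_i^{(k)}v=q_i^{l-2k+1}f_i^{(k-1)}v$ and $\tilde f_if_i^{(k)}v=q_i^{-l+2k+1}f_i^{(k+1)}v$. For $i$ odd: $\tilde e_i=q_i^{-1}t_ie_i$, $\tilde f_i=f_i$ if $\ell_i>0$; $\tilde e_i=e_i$, $\tilde f_i=q_if_it_i^{-1}$ if $\ell_i<0$. **Crystal bases.** Let $A\subset\mathbb Q(q)$ be the ring of rational functions $f/g$ with $g(0)\ne0$. A *crystal lattice* of $M$ is a free $A$-submodule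 $L$ that spans $M$ over $\mathbb Q(q)$, with $\sigma L=L$, $L=\bigoplus_\mu L_\mu$ where $L_\mu=L\cap M_\mu$, and $\tilde e_iL\subset L$, $\tilde f_iL\subset L$ for all $i$. A *crystal base* is a pair $(L,B)$, where $L$ is a crystal lattice and $B\subset L/qL$ satisfies: $\sigma b=\pm b$ for $b\in B$; $B=\bigsqcup_\mu B_\mu$ where $B_\mu=B\cap(L_\mu/qL_\mu)$; $B=B^\bullet\cup(-B^\bullet)$ for a $\mathbb Q$-basis $B^\bullet$ of $L/qL$; $\tilde e_iB\subset B\cup\{0\}$, $\tilde f_iB\subset B\cup\{0\}$; and for $b,b'\in B$, $b=\tilde f_ib'\iff b'=\tilde e_ib$. Write $\mathrm{wt}(b)=\mu$ for $b\in B_\mu$, $\varepsilon_i(b)=\max\{n:\tilde e_i^nb\ne0\}$, $\varphi_i(b)=\max\{n:\tilde f_i^nb\neq0\}$. **Proposition.** The comultiplication $\Delta$ exists. Let $M_1,M_2$ be modules in $\mathcal O_{\rm int}$ with crystal bases $(L_1,B_1)$, $(L_2,B_2)$, and let $U$ act on $M_1\otimes M_2$ through $\Delta$. Put $L=L_1\otimes_AL_2$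 and $B=B_1\otimes B_2=\{b_1\otimes b_2\}\subset(L_1/qL_1)\otimes(L_2/qL_2)=L/qL$. Then $M_1\otimes M_2$ is integrable and: (i) $(L,B)$ is a crystal base of $M_1\otimes M_2$. (ii) For $b_1\in B_1$, $b_2\in B_2$: (a) if $i$ is even and $\ell_i>0$, then $\tilde e_i(b_1\otimes b_2)=\tilde e_ib_1\otimes b_2$ if $\varphi_i(b_1)\ge\varepsilon_i(b_2)$, and $=b_1\otimes\tilde e_ib_2$ if $\varphi_i(b_1)<\varepsilon_i(b_2)$; $\tilde f_i(b_1\otimes b_2)=\tilde f_ib_1\otimes b_2$ if $\varphi_i(b_1)>\varepsilon_i(b_2)$, and $=b_1\otimes\tilde f_ib_2$ if $\varphi_i(b_1)\le\varepsilon_i(b_2)$. (b) if $i$ is even and $\ell_i<0$, then $\tilde e_i(b_1\otimes b_2)=b_1\otimes\tilde e_ib_2$ if $\varphi_i(b_2)\ge\varepsilon_i(b_1)$, and $=\tilde e_ib_1\otimes b_2$ if $\varphi_i(b_2)<\varepsilon_i(b_1)$; $\tilde f_i(b_1\otimes b_2)=b_1\otimes\tilde f_ib_2$ if $\varphi_i(b_2)>\varepsilon_i(b_1)$,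 and $=\tilde f_ib_1\otimes b_2$ if $\varphi_i(b_2)\le\varepsilon_i(b_1)$. (c) if $i$ is odd and $\ell_i>0$, then for $\tilde x_i\in\{\tilde e_i,\tilde f_i\}$: $\tilde x_i(b_1\otimes b_2)=\tilde x_ib_1\otimes b_2$ if $\langle h_i,\mathrm{wt}(b_1)\rangle>0$, and $=\sigma b_1\otimes\tilde x_ib_2$ if $\langle h_i,\mathrm{wt}(b_1)\rangle=0$. (d) if $i$ is odd and $\ell_i<0$, then for $\tilde x_i\in\{\tilde e_i,\tilde f_i\}$: $\tilde x_i(b_1\otimes b_2)=\sigma b_1\otimes\tilde x_ib_2$ if $\langle h_i,\mathrm{wt}(b_2)\rangle>0$, and $=\tilde x_ib_1\otimes b_2$ if $\langle h_i,\mathrm{wt}(b_2)\rangle=0$. -/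

import Mathlib

open scoped TensorProduct

noncomputable section

namespace QSuper

/-! ## The ground field and the local ring at `q = 0` -/

/-- The field `ℚ(q)`. -/
abbrev Kq : Type := RatFunc ℚ

/-- The indeterminate `q`. -/
def q : Kq := RatFunc.X

/-- The ring `A` of rational functions `f / g` with `g(0) ≠ 0`, as a subalgebra of `ℚ(q)`. -/
def Asub : Subalgebra ℚ Kq where
  carrier := {x | ∃ f g : Polynomial ℚ, g.eval 0 ≠ 0 ∧
    x = algebraMap (Polynomial ℚ) Kq f / algebraMap (Polynomial ℚ) Kq g}
  mul_mem' := by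
    rintro _ _ ⟨f, g, hg, rfl⟩ ⟨f', g', hg', rfl⟩
    refine ⟨f * f', g * g', by simp [hg, hg'], ?_⟩
    rw [map_mul, map_mul, div_mul_div_comm]
  add_mem' := by
    rintro _ _ ⟨f, g, hg, rfl⟩ ⟨f', g', hg', rfl⟩
    have h1 : algebraMap (Polynomial ℚ) Kq g ≠ 0 := by
      intro h
      rw [map_eq_zero_iff _ (RatFunc.algebraMap_injective ℚ)] at h
      simp [h] at hg
    have h2 : algebraMap (Polynomial ℚ) Kq g' ≠ 0 := by
      intro h
      rw [map_eq_zero_iff _ (RatFunc.algebraMap_injective ℚ)] at h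
      simp [h] at hg'
    refine ⟨f * g' + g * f', g * g', by simp [hg, hg'], ?_⟩
    rw [map_add, map_mul, map_mul, map_mul, div_add_div _ _ h1 h2]
  algebraMap_mem' := by
    intro r
    refine ⟨Polynomial.C r, 1, by simp, ?_⟩
    rw [map_one, div_one]
    simp

/-- The ring `A` of rational functions `f / g` with `g(0) ≠ 0`, as a type. -/
def A : Type := Asub

instance : CommRing A := inferInstanceAs (CommRing Asub)

instance : Algebra ℚ A := inferInstanceAs (Algebra ℚ Asub)

instance : Algebra A Kq := inferInstanceAs (Algebra Asub Kq)

/-- Every `ℚ(q)`-vector space is an `A`-module by restriction of scalars. -/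
instance instModuleA {M : Type*} [AddCommGroup M] [Module Kq M] : Module A M :=
  Module.compHom M (algebraMap A Kq)

theorem A_smul_def {M : Type*} [AddCommGroup M] [Module Kq M] (a : A) (u : M) :
    a • u = algebraMap A Kq a • u := rfl

/-- The indeterminate `q` as an element of `A`. -/
def qA : A := (⟨q, Polynomial.X, 1, by simp, by simp [q]⟩ : Asub)

/-! ## The quantum superalgebra -/

/-- The data defining the algebra: a parity `p` on the index set `I` (`0` even, `1` odd), a
symmetric `ℚ`-valued bilinear form on the weight lattice `P`, simple roots `α i ∈ P`, simple
coroots `h i ∈ P*` and nonzero integers `ℓ i`. -/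
structure Datum (I P : Type*) [AddCommGroup P] where
  p : I → Fin 2
  form : P →ₗ[ℤ] P →ₗ[ℤ] ℚ
  form_symm : ∀ x y, form x y = form y x
  α : I → P
  h : I → Module.Dual ℤ P
  ℓ : I → ℤ
  even_two : ∀ i, p i = 0 → h i (α i) = 2
  odd_zero_or_two : ∀ i, p i = 1 → h i (α i) = 0 ∨ h i (α i) = 2
  even_nonpos : ∀ i j, p i = 0 → j ≠ i → h i (α j) ≤ 0
  ℓ_ne_zero : ∀ i, ℓ i ≠ 0
  ℓ_mul : ∀ i x, (ℓ i : ℚ) * (h i x : ℚ) = form (α i) x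

/-- Names of the generators `e i`, `f i`, `q ^ h` (`h ∈ P*`) and `σ`. -/
inductive Gen (I P : Type*) [AddCommGroup P] where
  | e (i : I) : Gen I P
  | f (i : I) : Gen I P
  | qpow (h : Module.Dual ℤ P) : Gen I P
  | σ : Gen I P

variable {I P : Type*} [AddCommGroup P]

/-- `q_i = q ^ ℓ i`. -/
def Datum.qi (D : Datum I P) (i : I) : Kq := q ^ D.ℓ i

/-- The subalgebra generated by a family `x i`. -/
def plusAlg {S : Type*} [Ring S] [Algebra Kq S] (x : I → S) : Subalgebra Kq S :=
  Algebra.adjoin Kq (Set.range x)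

/-- The ideal of `plusAlg x` generated by the `x i`. -/
def plusIdeal {S : Type*} [Ring S] [Algebra Kq S] (x : I → S) : Submodule Kq S :=
  Submodule.span Kq {z | ∃ a ∈ plusAlg x, ∃ b ∈ plusAlg x, ∃ i, z = a * x i * b}

/-- The elements `g x` of the algebra `S` satisfy all the relations imposed on the generators of
the quantum superalgebra `U_q(g)`; here `t i = q ^ (ℓ i • h i)`. -/
structure Relations (D : Datum I P) (S : Type*) [Ring S] [Algebra Kq S]
    (g : Gen I P → S) : Prop where
  qpow_zero : g (.qpow 0) = 1
  qpow_add : ∀ h h', g (.qpow (h + h')) = g (.qpow h) * g (.qpow h')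
  qpow_e : ∀ h i, g (.qpow h) * g (.e i) = (q ^ h (D.α i)) • (g (.e i) * g (.qpow h))
  qpow_f : ∀ h i, g (.qpow h) * g (.f i) = (q ^ (-h (D.α i))) • (g (.f i) * g (.qpow h))
  e_f_same : ∀ i, g (.e i) * g (.f i) -
      ((-1 : Kq) ^ ((D.p i : ℕ) * (D.p i : ℕ))) • (g (.f i) * g (.e i)) =
    (D.qi i - (D.qi i)⁻¹)⁻¹ • (g (.qpow (D.ℓ i • D.h i)) - g (.qpow (-(D.ℓ i • D.h i))))
  e_f_diff : ∀ i j, i ≠ j → g (.e i) * g (.f j) -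
      ((-1 : Kq) ^ ((D.p i : ℕ) * (D.p j : ℕ))) • (g (.f j) * g (.e i)) = 0
  σ_sq : g .σ * g .σ = 1
  σ_e : ∀ i, g .σ * g (.e i) * g .σ = ((-1 : Kq) ^ (D.p i : ℕ)) • g (.e i)
  σ_f : ∀ i, g .σ * g (.f i) * g .σ = ((-1 : Kq) ^ (D.p i : ℕ)) • g (.f i)
  σ_qpow : ∀ h, g .σ * g (.qpow h) * g .σ = g (.qpow h)
  no_singular_e : ∀ a ∈ plusIdeal (fun i => g (.e i)),
    (∀ i, ∃ b ∈ plusAlg (fun i => g (.e i)), g (.f i) * a = b * g (.f i)) → a = 0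
  no_singular_f : ∀ a ∈ plusIdeal (fun i => g (.f i)),
    (∀ i, ∃ b ∈ plusAlg (fun i => g (.f i)), g (.e i) * a = b * g (.e i)) → a = 0

/-- The congruence on the free algebra which defines `U_q(g)`: the intersection of all the
congruences whose quotient satisfies the relations. -/
def con (D : Datum I P) : RingCon (FreeAlgebra Kq (Gen I P)) :=
  sInf {c | Relations D c.Quotient (fun x => c.mk' (FreeAlgebra.ι Kq x))}

/-- The quantum superalgebra `U_q(g)` (with the parity operator `σ` adjoined), the universal
algebra on the generators satisfying the relations. -/
def Uq (D : Datum I P) : Type _ := (con D).Quotient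

instance (D : Datum I P) : Ring (Uq D) := inferInstanceAs (Ring (con D).Quotient)

instance (D : Datum I P) : Algebra Kq (Uq D) := inferInstanceAs (Algebra Kq (con D).Quotient)

/-- The generators of `U_q(g)`. -/
def gen (D : Datum I P) (x : Gen I P) : Uq D := (con D).mk' (FreeAlgebra.ι Kq x)


/-- The map from `U_q(g)` to the quotient by an admissible congruence. -/
def toQuot (D : Datum I P) (c : RingCon (FreeAlgebra Kq (Gen I P)))
    (hc : Relations D c.Quotient (fun x => c.mk' (FreeAlgebra.ι Kq x))) :
    Uq D →ₐ[Kq] c.Quotient :=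
  { RingCon.lift (con D) c.mk' (fun _ _ h => (RingCon.eq c).mpr
      (RingCon.le_def.mp (sInf_le (a := c) hc) h)) with
    commutes' := fun _ => rfl }

theorem toQuot_gen (D : Datum I P) (c : RingCon (FreeAlgebra Kq (Gen I P)))
    (hc : Relations D c.Quotient (fun x => c.mk' (FreeAlgebra.ι Kq x))) (x : Gen I P) :
    toQuot D c hc (gen D x) = c.mk' (FreeAlgebra.ι Kq x) := rfl

theorem eq_of_toQuot (D : Datum I P) (a b : Uq D)
    (h : ∀ c hc, toQuot D c hc a = toQuot D c hc b) : a = b := by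
  induction a using Quotient.inductionOn' with | _ x =>
  induction b using Quotient.inductionOn' with | _ y =>
  refine (RingCon.eq (con D)).mpr ?_
  have : ∀ c ∈ {c : RingCon (FreeAlgebra Kq (Gen I P)) | Relations D c.Quotient (fun x => c.mk' (FreeAlgebra.ι Kq x))}, c x y :=
    fun c hc => (RingCon.eq c).mp (h c hc)
  simpa [con, RingCon.coe_sInf] using this

theorem map_plusAlg {S T : Type*} [Ring S] [Algebra Kq S] [Ring T] [Algebra Kq T]
    (φ : S →ₐ[Kq] T) (x : I → S) (a : S) (ha : a ∈ plusAlg x) :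
    φ a ∈ plusAlg (fun i => φ (x i)) := by
  have : φ a ∈ (plusAlg x).map φ := ⟨a, ha, rfl⟩
  rw [plusAlg, AlgHom.map_adjoin, ← Set.range_comp] at this
  exact this

theorem map_plusIdeal {S T : Type*} [Ring S] [Algebra Kq S] [Ring T] [Algebra Kq T]
    (φ : S →ₐ[Kq] T) (x : I → S) (a : S) (ha : a ∈ plusIdeal x) :
    φ a ∈ plusIdeal (fun i => φ (x i)) := by
  refine Submodule.span_induction (p := fun a _ => φ a ∈ plusIdeal (fun i => φ (x i)))
    ?_ ?_ ?_ ?_ ha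
  · rintro _ ⟨u, hu, v, hv, i, rfl⟩
    refine Submodule.subset_span ⟨_, map_plusAlg φ x u hu, _, map_plusAlg φ x v hv, i, ?_⟩
    simp
  · rw [map_zero]; exact Submodule.zero_mem _
  · intro u v _ _ hu hv; rw [map_add]; exact Submodule.add_mem _ hu hv
  · intro c u _ hu; rw [map_smul]; exact Submodule.smul_mem _ _ hu

set_option maxHeartbeats 1000000 in
/-- The generators of `U_q(g)` do satisfy all the relations. -/
theorem relations_gen (D : Datum I P) : Relations D (Uq D) (gen D) where
  qpow_zero := eq_of_toQuot D _ _ fun c hc => by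
    simpa [toQuot_gen] using hc.qpow_zero
  qpow_add h h' := eq_of_toQuot D _ _ fun c hc => by
    simpa [toQuot_gen] using hc.qpow_add h h'
  qpow_e h i := eq_of_toQuot D _ _ fun c hc => by
    rw [map_smul, map_mul, map_mul]; exact hc.qpow_e h i
  qpow_f h i := eq_of_toQuot D _ _ fun c hc => by
    rw [map_smul, map_mul, map_mul]; exact hc.qpow_f h i
  e_f_same i := eq_of_toQuot D _ _ fun c hc => by
    rw [map_smul, map_sub, map_sub, map_smul, map_mul, map_mul]; exact hc.e_f_same i
  e_f_diff i j hij := eq_of_toQuot D _ _ fun c hc => by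
    rw [map_sub, map_smul, map_mul, map_mul, map_zero]; exact hc.e_f_diff i j hij
  σ_sq := eq_of_toQuot D _ _ fun c hc => by
    rw [map_mul, map_one]; exact hc.σ_sq
  σ_e i := eq_of_toQuot D _ _ fun c hc => by
    rw [map_smul, map_mul, map_mul]; exact hc.σ_e i
  σ_f i := eq_of_toQuot D _ _ fun c hc => by
    rw [map_smul, map_mul, map_mul]; exact hc.σ_f i
  σ_qpow h := eq_of_toQuot D _ _ fun c hc => by
    rw [map_mul, map_mul]; exact hc.σ_qpow h
  no_singular_e a ha h := eq_of_toQuot D _ _ fun c hc => by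
    rw [map_zero]
    have h1 := map_plusIdeal (toQuot D c hc) _ a ha
    simp only [toQuot_gen] at h1
    refine hc.no_singular_e _ h1 fun i => ?_
    obtain ⟨b, hb, hab⟩ := h i
    have h2 := map_plusAlg (toQuot D c hc) _ b hb
    simp only [toQuot_gen] at h2
    refine ⟨_, h2, ?_⟩
    have := congrArg (toQuot D c hc) hab
    rwa [map_mul, map_mul, toQuot_gen] at this
  no_singular_f a ha h := eq_of_toQuot D _ _ fun c hc => by
    rw [map_zero]
    have h1 := map_plusIdeal (toQuot D c hc) _ a ha
    simp only [toQuot_gen] at h1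
    refine hc.no_singular_f _ h1 fun i => ?_
    obtain ⟨b, hb, hab⟩ := h i
    have h2 := map_plusAlg (toQuot D c hc) _ b hb
    simp only [toQuot_gen] at h2
    refine ⟨_, h2, ?_⟩
    have := congrArg (toQuot D c hc) hab
    rwa [map_mul, map_mul, toQuot_gen] at this

/-- `t i = q ^ (ℓ i • h i)`. -/
def t (D : Datum I P) (i : I) : Uq D := gen D (.qpow (D.ℓ i • D.h i))

/-- The inverse of `t i`. -/
def tinv (D : Datum I P) (i : I) : Uq D := gen D (.qpow (-(D.ℓ i • D.h i)))

/-- `Δ` is the comultiplication of `U_q(g)` (it is determined by its values on generators). -/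
structure IsComul (D : Datum I P) (Δ : Uq D →ₐ[Kq] Uq D ⊗[Kq] Uq D) : Prop where
  σ : Δ (gen D .σ) = gen D .σ ⊗ₜ gen D .σ
  qpow : ∀ h, Δ (gen D (.qpow h)) = gen D (.qpow h) ⊗ₜ gen D (.qpow h)
  e : ∀ i, Δ (gen D (.e i)) =
    gen D (.e i) ⊗ₜ tinv D i + (gen D .σ ^ (D.p i : ℕ)) ⊗ₜ gen D (.e i)
  f : ∀ i, Δ (gen D (.f i)) =
    gen D (.f i) ⊗ₜ 1 + (gen D .σ ^ (D.p i : ℕ) * t D i) ⊗ₜ gen D (.f i)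

/-! ## Modules; a module is a vector space `M` with an algebra map `ρ : U_q(g) → End M` -/

variable {D : Datum I P} {M : Type*} [AddCommGroup M] [Module Kq M]

/-- The weight space `M_μ`. -/
def weightSpace (ρ : Uq D →ₐ[Kq] Module.End Kq M) (μ : P) : Submodule Kq M where
  carrier := {u | ∀ h : Module.Dual ℤ P, ρ (gen D (.qpow h)) u = (q ^ h μ) • u}
  zero_mem' := by intro h; simp
  add_mem' := by
    intro u v hu hv h
    rw [map_add, hu h, hv h, smul_add]
  smul_mem' := by
    intro c u hu h
    rw [map_smul, hu h, smul_comm]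

/-- For even `i`, the subalgebra `U_q(g)_i` generated by `e i`, `f i` and `t i`. -/
def rankOne (D : Datum I P) (i : I) : Subalgebra Kq (Uq D) :=
  Algebra.adjoin Kq {gen D (.e i), gen D (.f i), t D i}

/-- All the conditions defining the category `O_int`, except the finite dimensionality of the
weight spaces. -/
structure IsIntegrable (ρ : Uq D →ₐ[Kq] Module.End Kq M) : Prop where
  weight_indep : iSupIndep (weightSpace ρ)
  weight_top : ⨆ μ, weightSpace ρ μ = ⊤
  locally_finite : ∀ i, D.p i = 0 → ∀ u : M, FiniteDimensional Kq
    (Submodule.span Kq {v | ∃ x ∈ rankOne D i, v = ρ x u})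
  odd_nonneg : ∀ i, D.p i = 1 → ∀ μ, weightSpace ρ μ ≠ ⊥ → 0 ≤ D.h i μ
  odd_zero : ∀ i, D.p i = 1 → ∀ μ, D.h i μ = 0 → ∀ u ∈ weightSpace ρ μ,
    ρ (gen D (.e i)) u = 0 ∧ ρ (gen D (.f i)) u = 0

/-- The module belongs to the category `O_int`. -/
structure InOint (ρ : Uq D →ₐ[Kq] Module.End Kq M) : Prop extends IsIntegrable ρ where
  weight_finite : ∀ μ, FiniteDimensional Kq (weightSpace ρ μ)

/-- The module structure on the tensor product obtained through a comultiplication. -/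
def tensorRep {M₁ M₂ : Type*} [AddCommGroup M₁] [Module Kq M₁] [AddCommGroup M₂] [Module Kq M₂]
    (Δ : Uq D →ₐ[Kq] Uq D ⊗[Kq] Uq D)
    (ρ₁ : Uq D →ₐ[Kq] Module.End Kq M₁) (ρ₂ : Uq D →ₐ[Kq] Module.End Kq M₂) :
    Uq D →ₐ[Kq] Module.End Kq (M₁ ⊗[Kq] M₂) :=
  ((Module.endTensorEndAlgHom (R := Kq) (S := Kq) (A := Kq) (M := M₁) (N := M₂)).comp
    (Algebra.TensorProduct.map ρ₁ ρ₂)).comp Δ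

/-! ## Kashiwara operators -/

/-- The quantum integer `[n]_i`. -/
def qint (D : Datum I P) (i : I) (n : ℕ) : Kq :=
  (D.qi i ^ n - (D.qi i)⁻¹ ^ n) / (D.qi i - (D.qi i)⁻¹)

/-- The quantum factorial `[n]_i!`. -/
def qfact (D : Datum I P) (i : I) (n : ℕ) : Kq := ∏ k ∈ Finset.Icc 1 n, qint D i k

/-- The divided power `f_i^{(n)}` acting on a module. -/
def fdiv (ρ : Uq D →ₐ[Kq] Module.End Kq M) (i : I) (n : ℕ) : Module.End Kq M :=
  (qfact D i n)⁻¹ • ρ (gen D (.f i)) ^ n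

/-- Case of even `i`: `T` is the operator `ẽ_i`. Every weight vector has a unique expression
`∑ f_i^{(k)} u_k` with `u_k` weight vectors killed by `e_i` and `k` at most the value `l` of `h_i`
on the weight of `u_k`; the operator `ẽ_i` is prescribed on each term of it. -/
def IsEvenE (ρ : Uq D →ₐ[Kq] Module.End Kq M) (i : I) (T : Module.End Kq M) : Prop :=
  ∀ (μ : P), ∀ v ∈ weightSpace ρ μ, ρ (gen D (.e i)) v = 0 → ∀ k : ℕ, (k : ℤ) ≤ D.h i μ →
    T (fdiv ρ i k v) =
      if k = 0 then 0
      else if 0 < D.ℓ i then fdiv ρ i (k - 1) v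
      else (D.qi i ^ (D.h i μ - 2 * (k : ℤ) + 1)) • fdiv ρ i (k - 1) v

/-- Case of even `i`: `T` is the operator `f̃_i`. -/
def IsEvenF (ρ : Uq D →ₐ[Kq] Module.End Kq M) (i : I) (T : Module.End Kq M) : Prop :=
  ∀ (μ : P), ∀ v ∈ weightSpace ρ μ, ρ (gen D (.e i)) v = 0 → ∀ k : ℕ, (k : ℤ) ≤ D.h i μ →
    T (fdiv ρ i k v) =
      if 0 < D.ℓ i then fdiv ρ i (k + 1) v
      else (D.qi i ^ (-D.h i μ + 2 * (k : ℤ) + 1)) • fdiv ρ i (k + 1) v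

/-- The operator `ẽ_i`. For even `i` it is the unique operator with the property `IsEvenE`
(existence and uniqueness hold on every integrable module). -/
def kashE (ρ : Uq D →ₐ[Kq] Module.End Kq M) (i : I) : Module.End Kq M :=
  if D.p i = 0 then Classical.epsilon (IsEvenE ρ i)
  else if 0 < D.ℓ i then (D.qi i)⁻¹ • ρ (t D i * gen D (.e i))
  else ρ (gen D (.e i))

/-- The operator `f̃_i`. -/
def kashF (ρ : Uq D →ₐ[Kq] Module.End Kq M) (i : I) : Module.End Kq M :=
  if D.p i = 0 then Classical.epsilon (IsEvenF ρ i)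
  else if 0 < D.ℓ i then ρ (gen D (.f i))
  else D.qi i • ρ (gen D (.f i) * tinv D i)

/-! ## Crystal lattices and crystal bases -/

/-- `L_μ = L ∩ M_μ`. -/
def latticeWeight (ρ : Uq D →ₐ[Kq] Module.End Kq M) (L : Submodule A M) (μ : P) :
    Submodule A M where
  carrier := {u | u ∈ L ∧ u ∈ weightSpace ρ μ}
  zero_mem' := ⟨L.zero_mem, Submodule.zero_mem _⟩
  add_mem' := fun hu hv => ⟨L.add_mem hu.1 hv.1, Submodule.add_mem _ hu.2 hv.2⟩
  smul_mem' := fun c _ hu => ⟨L.smul_mem c hu.1, Submodule.smul_mem _ (algebraMap A Kq c) hu.2⟩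

/-- The module `L` is a crystal lattice. -/
structure IsCrystalLattice (ρ : Uq D →ₐ[Kq] Module.End Kq M) (L : Submodule A M) : Prop where
  free : Module.Free A L
  span : Submodule.span Kq (L : Set M) = ⊤
  σ_image : ρ (gen D .σ) '' (L : Set M) = (L : Set M)
  weight_indep : iSupIndep (latticeWeight ρ L)
  weight_sup : ⨆ μ, latticeWeight ρ L μ = L
  kashE_mem : ∀ i, ∀ u ∈ L, kashE ρ i u ∈ L
  kashF_mem : ∀ i, ∀ u ∈ L, kashF ρ i u ∈ L

/-- The submodule `qL` of `L`. -/
def qSub (L : Submodule A M) : Submodule A L := Ideal.span {qA} • (⊤ : Submodule A L)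

/-- The quotient `L / qL`. -/
def Lbar (L : Submodule A M) : Type _ := L ⧸ qSub L

instance (L : Submodule A M) : AddCommGroup (Lbar L) :=
  inferInstanceAs (AddCommGroup (L ⧸ qSub L))

instance (L : Submodule A M) : Module A (Lbar L) :=
  inferInstanceAs (Module A (L ⧸ qSub L))

/-- The class modulo `qL` of an element of `L`. -/
def toBar (L : Submodule A M) : L →ₗ[A] Lbar L := (qSub L).mkQ

/-- An `A`-linear map on `L` which kills `qL` induces a map on `L / qL`. -/
def liftBar (L : Submodule A M) {N : Type*} [AddCommGroup N] [Module A N] (g : L →ₗ[A] N)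
    (hg : ∀ u : L, g (qA • u) = 0) : Lbar L →ₗ[A] N :=
  (qSub L).liftQ g (by
    unfold qSub
    rw [Submodule.smul_le]
    intro r hr u _
    obtain ⟨s, rfl⟩ := Ideal.mem_span_singleton'.mp hr
    rw [LinearMap.mem_ker, mul_smul, map_smul, hg, smul_zero])

theorem toBar_q_smul (L : Submodule A M) (u : L) : toBar L (qA • u) = 0 := by
  refine (Submodule.Quotient.mk_eq_zero _).mpr ?_
  exact Submodule.smul_mem_smul (Ideal.mem_span_singleton_self _) Submodule.mem_top

/-- The `ℚ`-vector space structure on `L / qL`, through the map from `ℚ` to `A`. -/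
@[reducible] def ratModule (L : Submodule A M) : Module ℚ (Lbar L) :=
  Module.compHom (Lbar L) (algebraMap ℚ A)

/-- An operator on `M` as an `A`-linear map. -/
def opA (T : Module.End Kq M) : M →ₗ[A] M where
  toFun := T
  map_add' := T.map_add
  map_smul' := fun c u => T.map_smul (algebraMap A Kq c) u

/-- The map induced on `L / qL` by an operator on `M` which preserves `L`
(by convention `0` for an operator which does not preserve `L`). -/
def bar (L : Submodule A M) (T : Module.End Kq M) : Lbar L →ₗ[A] Lbar L :=
  open Classical in
  if hT : ∀ u ∈ L, opA T u ∈ L then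
    liftBar L ((toBar L).comp ((opA T).restrict hT)) (fun u => by
      rw [map_smul, LinearMap.comp_apply, ← map_smul, toBar_q_smul])
  else 0

/-- The subspace `L_μ / qL_μ` of `L / qL`. -/
def barWeight (ρ : Uq D →ₐ[Kq] Module.End Kq M) (L : Submodule A M) (μ : P) : Set (Lbar L) :=
  {b | ∃ u : L, (u : M) ∈ latticeWeight ρ L μ ∧ b = toBar L u}

/-- `B` is a pseudo-base of `L / qL`: the union of a `ℚ`-basis and its negative. -/
def IsPseudoBase (L : Submodule A M) (B : Set (Lbar L)) : Prop :=
  letI := ratModule L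
  ∃ B₀ : Set (Lbar L), LinearIndependent ℚ (fun b : B₀ => (b : Lbar L)) ∧
    Submodule.span ℚ B₀ = ⊤ ∧ B = B₀ ∪ {b | -b ∈ B₀}

/-- The pair `(L, B)` is a crystal base of the module. -/
structure IsCrystalBase (ρ : Uq D →ₐ[Kq] Module.End Kq M) (L : Submodule A M)
    (B : Set (Lbar L)) : Prop where
  lattice : IsCrystalLattice ρ L
  σ_mem : ∀ b ∈ B, bar L (ρ (gen D .σ)) b = b ∨ bar L (ρ (gen D .σ)) b = -b
  weight : ∀ b ∈ B, ∃! μ, b ∈ barWeight ρ L μ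
  pseudoBase : IsPseudoBase L B
  kashE_mem : ∀ i, ∀ b ∈ B, bar L (kashE ρ i) b ∈ B ∨ bar L (kashE ρ i) b = 0
  kashF_mem : ∀ i, ∀ b ∈ B, bar L (kashF ρ i) b ∈ B ∨ bar L (kashF ρ i) b = 0
  kash_iff : ∀ i, ∀ b ∈ B, ∀ b' ∈ B, b = bar L (kashF ρ i) b' ↔ b' = bar L (kashE ρ i) b

/-- `ε_i(b)`, the largest `n` with `ẽ_i^n b ≠ 0`. -/
def eps (ρ : Uq D →ₐ[Kq] Module.End Kq M) (L : Submodule A M) (i : I) (b : Lbar L) : ℕ :=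
  sSup {n : ℕ | (bar L (kashE ρ i) ^ n) b ≠ 0}

/-- `φ_i(b)`, the largest `n` with `f̃_i^n b ≠ 0`. -/
def phi (ρ : Uq D →ₐ[Kq] Module.End Kq M) (L : Submodule A M) (i : I) (b : Lbar L) : ℕ :=
  sSup {n : ℕ | (bar L (kashF ρ i) ^ n) b ≠ 0}

/-! ## Tensor products of lattices -/

section Tensor

variable {M₁ M₂ : Type*} [AddCommGroup M₁] [Module Kq M₁] [AddCommGroup M₂] [Module Kq M₂]

/-- The lattice `L₁ ⊗_A L₂` in `M₁ ⊗ M₂`. -/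
def tensorLattice (L₁ : Submodule A M₁) (L₂ : Submodule A M₂) : Submodule A (M₁ ⊗[Kq] M₂) :=
  Submodule.span A {x | ∃ u ∈ L₁, ∃ v ∈ L₂, x = u ⊗ₜ[Kq] v}

/-- The `A`-bilinear map `(u, v) ↦ u ⊗ v` from `L₁ × L₂` to `L₁ ⊗_A L₂`. -/
def tensorMk (L₁ : Submodule A M₁) (L₂ : Submodule A M₂) :
    L₁ →ₗ[A] L₂ →ₗ[A] tensorLattice L₁ L₂ :=
  LinearMap.mk₂ A
    (fun u v => ⟨(u : M₁) ⊗ₜ[Kq] (v : M₂), Submodule.subset_span ⟨u, u.2, v, v.2, rfl⟩⟩)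
    (fun _ _ _ => Subtype.ext (TensorProduct.add_tmul _ _ _))
    (fun c u v => Subtype.ext (TensorProduct.smul_tmul' (algebraMap A Kq c) (u : M₁) (v : M₂)).symm)
    (fun _ _ _ => Subtype.ext (TensorProduct.tmul_add _ _ _))
    (fun c u v => Subtype.ext (TensorProduct.tmul_smul (algebraMap A Kq c) (u : M₁) (v : M₂)))

/-- The map `(u, v mod q) ↦ u ⊗ v mod q`. -/
def tensorBarAux (L₁ : Submodule A M₁) (L₂ : Submodule A M₂) :
    L₁ →ₗ[A] Lbar L₂ →ₗ[A] Lbar (tensorLattice L₁ L₂) where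
  toFun u := liftBar L₂ ((toBar (tensorLattice L₁ L₂)).comp (tensorMk L₁ L₂ u)) (fun v => by
    rw [map_smul, LinearMap.comp_apply, ← map_smul, toBar_q_smul])
  map_add' u u' := by
    refine LinearMap.ext fun b => ?_
    obtain ⟨v, rfl⟩ := Submodule.mkQ_surjective (qSub L₂) b
    change toBar _ (tensorMk L₁ L₂ (u + u') v) =
      toBar _ (tensorMk L₁ L₂ u v) + toBar _ (tensorMk L₁ L₂ u' v)
    rw [map_add, LinearMap.add_apply, map_add]
  map_smul' c u := by
    refine LinearMap.ext fun b => ?_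
    obtain ⟨v, rfl⟩ := Submodule.mkQ_surjective (qSub L₂) b
    change toBar _ (tensorMk L₁ L₂ (c • u) v) = c • toBar _ (tensorMk L₁ L₂ u v)
    rw [map_smul, LinearMap.smul_apply, map_smul]

/-- The map `(b₁, b₂) ↦ b₁ ⊗ b₂` from `(L₁ / qL₁) × (L₂ / qL₂)` to
`(L₁ / qL₁) ⊗ (L₂ / qL₂) = (L₁ ⊗_A L₂) / q (L₁ ⊗_A L₂)`. -/
def tensorBar (L₁ : Submodule A M₁) (L₂ : Submodule A M₂) :
    Lbar L₁ →ₗ[A] Lbar L₂ →ₗ[A] Lbar (tensorLattice L₁ L₂) :=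
  liftBar L₁ (tensorBarAux L₁ L₂) (fun u => by
    refine LinearMap.ext fun b => ?_
    obtain ⟨v, rfl⟩ := Submodule.mkQ_surjective (qSub L₂) b
    change toBar _ (tensorMk L₁ L₂ (qA • u) v) = 0
    rw [map_smul, LinearMap.smul_apply, toBar_q_smul])

/-- `B₁ ⊗ B₂`. -/
def tensorB (L₁ : Submodule A M₁) (L₂ : Submodule A M₂) (B₁ : Set (Lbar L₁))
    (B₂ : Set (Lbar L₂)) : Set (Lbar (tensorLattice L₁ L₂)) :=
  {b | ∃ b₁ ∈ B₁, ∃ b₂ ∈ B₂, b = tensorBar L₁ L₂ b₁ b₂}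

end Tensor

end QSuper

end

/-! Existence of `Δ`. The algebra `U` is a quotient of a free algebra by an intersection of
congruences, so a map out of it needs more than the relations on generators: the two conditions on
singular elements must be made explicit. Moving `f_i` through a polynomial in the `e_j` produces two
skew derivations of that polynomial, one for the bicharacter `chi` and one for its inverse `chi'`.
Let `rad` be the largest subspace of the free algebra that has no constant terms and is stable under
the skew derivations. By induction on the degree its elements are singular, so they vanish wherever
the relations hold (`Relations.lift_tmul_eq_zero`). Conversely, Verma-type modules on the free
algebra modulo `rad` show that a singular polynomial lies in `rad` (`mem_rad_of_verma_singular`).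
Hence an algebra with the plain relations in which `rad` vanishes, for the `e_i` and for the `f_i`,
receives a map from `U` (`exists_algHom_of_plainRel`). The proposed values of `Δ` qualify because
`rad` is a coideal (`lift_add_eq_zero_of_mem_rad`) and each `Δ(e_i)`, `Δ(f_i)` is a sum of two
skew-commuting terms, each of which already kills `rad`.

Even indices. After a rescaling when `ℓ_i < 0`, the operators generate a quantum `sl₂` with
parameter `p = q^|ℓ_i|`, and the sign of `ℓ_i` only decides which tensor factor comes first. Vectors
split into divided powers of highest weight vectors, so everything reduces to the product of two
irreducible strings, a grid `f^(a)u ⊗ f^(b)v`. There the highest weight vectors are explicit.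
Estimating the `p`-orders of the coefficients shows that each divided power of such a vector is
congruent modulo `p` to one grid vector (`IsGrid.exists_strVec`). By Nakayama the divided powers
span the same lattice as the grid (`IsGrid.gridLattice_le`), so the Kashiwara operators preserve the
lattice and follow the tensor product rule modulo `p`. Each element of a crystal base is the class
of a divided power of a highest weight vector (`IsCrystalBase.exists_isStrRep`), which carries the
rule to `B₁ ⊗ B₂`.

Odd indices. The coproducts of the operators are two-term sums in which one term carries the factor
`q^(|ℓ_i|⟨h_i, weight⟩)`. If the pairing is positive that term vanishes modulo `q`; if it is zero
the factor is `1` and integrability kills the other term.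

The remaining axioms of a crystal base come from bases: products of `A`-bases of `L₁` and `L₂` form
an `A`-basis of `L`, so the reduction modulo `q` is the tensor product of the reductions. -/

noncomputable section

namespace QSuper

/-! ## Skew derivations of the free algebra -/

section Free

variable {K I : Type*} [Field K]

local notation "𝔽" => FreeAlgebra K I

/-- Induction on the left multiplication by letters. -/
theorem free_left_induction (S : Submodule K 𝔽) (h1 : 1 ∈ S)
    (hm : ∀ i, ∀ x ∈ S, FreeAlgebra.ι K i * x ∈ S) (x : 𝔽) : x ∈ S := by
  have key : ∀ x : 𝔽, ∀ y ∈ S, x * y ∈ S := by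
    intro x
    induction x using FreeAlgebra.induction with
    | grade0 r =>
      intro y hy
      rw [← Algebra.smul_def]
      exact S.smul_mem _ hy
    | grade1 i => exact hm i
    | mul a b ha hb =>
      intro y hy
      rw [mul_assoc]
      exact ha _ (hb _ hy)
    | add a b ha hb =>
      intro y hy
      rw [add_mul]
      exact S.add_mem (ha _ hy) (hb _ hy)
  simpa using key x 1 h1

/-- Maps such as skew derivations are not multiplicative and cannot be compared on letters alone.
Words are built by left multiplication, so comparing the values at `1` and the recursion along left
multiplication is enough. -/
theorem free_hom_ext {V : Type*} [AddCommGroup V] [Module K V] {f g : 𝔽 →ₗ[K] V}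
    (h1 : f 1 = g 1)
    (hm : ∀ i x, f x = g x → f (FreeAlgebra.ι K i * x) = g (FreeAlgebra.ι K i * x)) : f = g := by
  ext x
  exact free_left_induction (LinearMap.eqLocus f g) h1 (fun i x hx => hm i x hx) x

/-- The constant term. -/
def cst : 𝔽 →ₐ[K] K := FreeAlgebra.lift K (fun _ => 0)

@[simp] theorem cst_ι (i : I) : cst (FreeAlgebra.ι K i) = (0 : K) := by simp [cst]

/-- The endomorphism rescaling the letters by `c`. -/
def scale (c : I → K) : 𝔽 →ₐ[K] 𝔽 := FreeAlgebra.lift K (fun i => c i • FreeAlgebra.ι K i)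

@[simp] theorem scale_ι (c : I → K) (i : I) :
    scale c (FreeAlgebra.ι K i) = c i • FreeAlgebra.ι K i := by simp [scale]

theorem scale_scale (c c' : I → K) (x : 𝔽) : scale c (scale c' x) = scale (c * c') x := by
  have : (scale c).comp (scale c') = (scale (c * c') : 𝔽 →ₐ[K] 𝔽) := by
    ext i
    simp [smul_smul, mul_comm]
  exact DFunLike.congr_fun this x

@[simp] theorem scale_one_apply (x : 𝔽) : scale 1 x = x := by
  have : scale 1 = AlgHom.id K 𝔽 := by
    ext i
    simp
  exact DFunLike.congr_fun this x

@[simp] theorem cst_scale (c : I → K) (x : 𝔽) : cst (scale c x) = cst x := by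
  have : cst.comp (scale c) = (cst : 𝔽 →ₐ[K] K) := by
    ext i
    simp
  exact DFunLike.congr_fun this x

open Classical in
/-- The algebra map from which the skew derivations are read off. -/
def skewAux (χ : I → I → K) (η : I → K) (i : I) : 𝔽 →ₐ[K] Module.End K (𝔽 × 𝔽) :=
  FreeAlgebra.lift K (fun j =>
    -- A letter acts on pairs by a triangular matrix whose off-diagonal entry is the derivation
    -- term. The second coordinate of the image of `(1, 0)` then satisfies the twisted Leibniz rule
    -- automatically.
    LinearMap.prod ((LinearMap.mulLeft K (FreeAlgebra.ι K j)).comp (LinearMap.fst K 𝔽 𝔽))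
      ((if i = j then η i else 0) • LinearMap.fst K 𝔽 𝔽 +
        χ i j • (LinearMap.mulLeft K (FreeAlgebra.ι K j)).comp (LinearMap.snd K 𝔽 𝔽)))

/-- The skew derivation `d_i` of the free algebra, with `d_i (e_j y) = δ_ij η_i y + χ_ij e_j d_i y`. -/
def skew (χ : I → I → K) (η : I → K) (i : I) : 𝔽 →ₗ[K] 𝔽 :=
  (LinearMap.snd K 𝔽 𝔽).comp ((LinearMap.applyₗ ((1 : 𝔽), (0 : 𝔽))).comp
    (skewAux χ η i).toLinearMap)

variable (χ : I → I → K) (η : I → K)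

theorem skewAux_apply (i : I) (x : 𝔽) : skewAux χ η i x (1, 0) = (x, skew χ η i x) := by
  have : (LinearMap.fst K 𝔽 𝔽).comp ((LinearMap.applyₗ ((1 : 𝔽), (0 : 𝔽))).comp
    (skewAux χ η i).toLinearMap) = LinearMap.id := by
    refine free_hom_ext (by simp) fun j y hy => ?_
    simp only [LinearMap.comp_apply, LinearMap.applyₗ_apply_apply, AlgHom.toLinearMap_apply,
      LinearMap.fst_apply, LinearMap.id_apply, map_mul, Module.End.mul_apply] at hy ⊢
    have : ∀ w, (skewAux χ η i (FreeAlgebra.ι K j) w).1 = FreeAlgebra.ι K j * w.1 := by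
      intro w
      rw [skewAux, FreeAlgebra.lift_ι_apply]
      rfl
    rw [this, hy]
  exact Prod.ext (DFunLike.congr_fun this x) rfl

@[simp] theorem skew_one (i : I) : skew χ η i 1 = 0 := by simp [skew]

open Classical in
theorem skew_ι_mul (i j : I) (x : 𝔽) : skew χ η i (FreeAlgebra.ι K j * x) =
    (if i = j then η i else 0) • x + χ i j • (FreeAlgebra.ι K j * skew χ η i x) := by
  have h := skewAux_apply χ η i (FreeAlgebra.ι K j * x)
  rw [map_mul, Module.End.mul_apply, skewAux_apply] at h
  refine (congrArg Prod.snd h).symm.trans ?_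
  simp only [skewAux, FreeAlgebra.lift_ι_apply, LinearMap.prod_apply, Function.prod,
    LinearMap.add_apply, LinearMap.smul_apply, LinearMap.comp_apply, LinearMap.fst_apply,
    LinearMap.snd_apply, LinearMap.mulLeft_apply]

theorem skew_mul (i : I) (x y : 𝔽) : skew χ η i (x * y) =
    skew χ η i x * y + scale (χ i) x * skew χ η i y := by
  have : (skew χ η i).comp (LinearMap.mulRight K y) =
      (LinearMap.mulRight K y).comp (skew χ η i) +
      (LinearMap.mulRight K (skew χ η i y)).comp (scale (χ i)).toLinearMap := by
    refine free_hom_ext (by simp) fun j z hz => ?_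
    simp only [LinearMap.comp_apply, LinearMap.mulRight_apply, LinearMap.add_apply,
      AlgHom.toLinearMap_apply, map_mul, scale_ι, mul_assoc, skew_ι_mul] at hz ⊢
    rw [hz]
    simp only [add_mul, smul_mul_assoc, mul_add, smul_add, mul_assoc]
    abel
  exact DFunLike.congr_fun this x

theorem skew_scale (c : I → K) (i : I) (x : 𝔽) :
    skew χ η i (scale c x) = c i • scale c (skew χ η i x) := by
  have : (skew χ η i).comp (scale c).toLinearMap =
      c i • (scale c).toLinearMap.comp (skew χ η i) := by
    refine free_hom_ext (by simp) fun j z hz => ?_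
    simp only [LinearMap.comp_apply, LinearMap.smul_apply,
      AlgHom.toLinearMap_apply, map_mul, scale_ι, smul_mul_assoc, map_smul, skew_ι_mul,
      map_add] at hz ⊢
    rw [hz]
    simp only [smul_add, smul_smul, mul_smul_comm]
    congr 1
    · split_ifs with h
      · subst h; rfl
      · simp
    · congr 1; ring
  exact DFunLike.congr_fun this x

/-- On a letter the two orders of derivation differ by the product `χ i j * χ' j i`, which is `1`.
This transfers the stability of the radical from the derivations for `χ` to those for `χ'`. -/
theorem skew_comm (χ' : I → I → K) (hχ : ∀ i j, χ i j * χ' j i = 1) (i j : I) (x : 𝔽) :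
    skew χ' η i (skew χ η j x) = χ j i • skew χ η j (skew χ' η i x) := by
  classical
  have : (skew χ' η i).comp (skew χ η j) = χ j i • (skew χ η j).comp (skew χ' η i) := by
    refine free_hom_ext (by simp) fun k z hz => ?_
    simp only [LinearMap.comp_apply, LinearMap.smul_apply, map_smul, skew_ι_mul,
      map_add, smul_add, smul_smul] at hz ⊢
    rw [hz]
    have h1 : χ j k * (if i = k then η i else 0) = χ j i * (if i = k then η i else 0) := by
      split_ifs with h
      · rw [h]
      · simp
    have h2 : (if j = k then η j else 0) = χ j i * (χ' i k * if j = k then η j else 0) := by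
      split_ifs with h
      · rw [← h, ← mul_assoc, hχ, one_mul]
      · simp
    rw [h1]
    nth_rewrite 1 [h2]
    simp only [mul_smul_comm, smul_smul]
    rw [show χ j k * χ' i k * χ j i = χ j i * (χ' i k * χ j k) by ring]
    abel
  exact DFunLike.congr_fun this x

/-- The bicharacter only multiplies terms that still begin with a letter, and these have no constant
term. -/
theorem cst_skew (χ' : I → I → K) (i : I) (x : 𝔽) :
    cst (skew χ η i x) = cst (skew χ' η i x) := by
  have : cst.toLinearMap.comp (skew χ η i) = (cst.toLinearMap.comp (skew χ' η i)) := by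
    refine free_hom_ext (by simp) fun k z hz => ?_
    simp [skew_ι_mul]
  exact DFunLike.congr_fun this x

theorem skew_eq_zero (i : I) (hi : η i = 0) (x : 𝔽) : skew χ η i x = 0 := by
  have : skew χ η i = 0 := by
    refine free_hom_ext (by simp) fun k z hz => ?_
    simp only [skew_ι_mul, hz, hi]
    simp
  exact DFunLike.congr_fun this x

/-- The radical: the largest subspace of the augmentation ideal stable under all `d_i`. -/
def rad : Submodule K 𝔽 :=
  sSup {S | S ≤ LinearMap.ker cst.toLinearMap ∧ ∀ i, S ≤ S.comap (skew χ η i)}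

variable {χ η}

theorem le_rad {S : Submodule K 𝔽} (h1 : ∀ x ∈ S, cst x = 0)
    (h2 : ∀ i, ∀ x ∈ S, skew χ η i x ∈ S) : S ≤ rad χ η := le_sSup ⟨h1, h2⟩

theorem cst_of_mem_rad {x : 𝔽} (hx : x ∈ rad χ η) : cst x = 0 := by
  have : rad χ η ≤ LinearMap.ker cst.toLinearMap := sSup_le fun S hS => hS.1
  exact this hx

theorem skew_mem_rad {x : 𝔽} (i : I) (hx : x ∈ rad χ η) : skew χ η i x ∈ rad χ η := by
  have : rad χ η ≤ (rad χ η).comap (skew χ η i) :=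
    sSup_le fun S hS => (hS.2 i).trans (Submodule.comap_mono (le_sSup hS))
  exact this hx

/-- The pattern for all closure properties of the radical: the image of the radical again has no
constant terms and is stable under the skew derivations, so it lies in the radical by maximality. -/
theorem scale_mem_rad {x : 𝔽} (c : I → K) (hx : x ∈ rad χ η) : scale c x ∈ rad χ η := by
  have : (rad χ η).map (scale c).toLinearMap ≤ rad χ η := by
    refine le_rad ?_ ?_
    · rintro _ ⟨y, hy, rfl⟩
      simpa using cst_of_mem_rad hy
    · rintro i _ ⟨y, hy, rfl⟩
      rw [AlgHom.toLinearMap_apply, skew_scale]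
      exact Submodule.smul_mem _ _ ⟨_, skew_mem_rad i hy, rfl⟩
  exact this ⟨x, hx, rfl⟩

theorem skew'_mem_rad {χ' : I → I → K} (hχ : ∀ i j, χ i j * χ' j i = 1) {x : 𝔽} (i : I)
    (hx : x ∈ rad χ η) : skew χ' η i x ∈ rad χ η := by
  have : (rad χ η).map (skew χ' η i) ≤ rad χ η := by
    refine le_rad ?_ ?_
    · rintro _ ⟨y, hy, rfl⟩
      rw [cst_skew χ' η χ]
      exact cst_of_mem_rad (skew_mem_rad i hy)
    · rintro j _ ⟨y, hy, rfl⟩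
      refine ⟨χ' i j • skew χ η j y, Submodule.smul_mem _ _ (skew_mem_rad j hy), ?_⟩
      rw [map_smul, skew_comm χ η χ' hχ, smul_smul, mul_comm, hχ, one_smul]
  exact this ⟨x, hx, rfl⟩

/-- The Leibniz rule keeps the span of the products stable under the derivations, since rescaling
preserves the radical. -/
theorem mul_mem_rad_right {x : 𝔽} (y : 𝔽) (hx : x ∈ rad χ η) : x * y ∈ rad χ η := by
  have : Submodule.span K {z | ∃ a ∈ rad χ η, ∃ b : 𝔽, z = a * b} ≤ rad χ η := by
    refine le_rad ?_ ?_
    · intro z hz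
      induction hz using Submodule.span_induction with
      | mem z hz =>
        obtain ⟨a, ha, b, rfl⟩ := hz
        rw [map_mul, cst_of_mem_rad ha, zero_mul]
      | zero => simp
      | add z w _ _ hz hw => rw [map_add, hz, hw, add_zero]
      | smul c z _ hz => rw [map_smul, hz, smul_zero]
    · intro i z hz
      induction hz using Submodule.span_induction with
      | mem z hz =>
        obtain ⟨a, ha, b, rfl⟩ := hz
        rw [skew_mul]
        exact Submodule.add_mem _ (Submodule.subset_span ⟨_, skew_mem_rad i ha, _, rfl⟩)
          (Submodule.subset_span ⟨_, scale_mem_rad _ ha, _, rfl⟩)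
      | zero => simp
      | add z w _ _ hz hw => rw [map_add]; exact Submodule.add_mem _ hz hw
      | smul c z _ hz => rw [map_smul]; exact Submodule.smul_mem _ _ hz
  exact this (Submodule.subset_span ⟨x, hx, y, rfl⟩)

theorem mul_mem_rad_left {x : 𝔽} (y : 𝔽) (hx : x ∈ rad χ η) : y * x ∈ rad χ η := by
  have : Submodule.span K {z | ∃ a ∈ rad χ η, ∃ b : 𝔽, z = b * a} ≤ rad χ η := by
    refine le_rad ?_ ?_
    · intro z hz
      induction hz using Submodule.span_induction with
      | mem z hz =>
        obtain ⟨a, ha, b, rfl⟩ := hz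
        rw [map_mul, cst_of_mem_rad ha, mul_zero]
      | zero => simp
      | add z w _ _ hz hw => rw [map_add, hz, hw, add_zero]
      | smul c z _ hz => rw [map_smul, hz, smul_zero]
    · intro i z hz
      induction hz using Submodule.span_induction with
      | mem z hz =>
        obtain ⟨a, ha, b, rfl⟩ := hz
        rw [skew_mul]
        exact Submodule.add_mem _ (Submodule.subset_span ⟨_, ha, _, rfl⟩)
          (Submodule.subset_span ⟨_, skew_mem_rad i ha, _, rfl⟩)
      | zero => simp
      | add z w _ _ hz hw => rw [map_add]; exact Submodule.add_mem _ hz hw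
      | smul c z _ hz => rw [map_smul]; exact Submodule.smul_mem _ _ hz
  exact this (Submodule.subset_span ⟨x, hx, y, rfl⟩)

/-- The span of the radical and `x` still has the two defining properties, so it is no larger than
the radical. Thus, modulo the radical, an element without constant term is detected by its skew
derivatives. -/
theorem mem_rad_of_skew_mem {x : 𝔽} (h0 : cst x = 0) (h : ∀ i, skew χ η i x ∈ rad χ η) :
    x ∈ rad χ η := by
  have : rad χ η ⊔ Submodule.span K {x} ≤ rad χ η := by
    refine le_rad ?_ ?_
    · intro z hz
      obtain ⟨a, ha, b, hb, rfl⟩ := Submodule.mem_sup.mp hz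
      obtain ⟨c, rfl⟩ := Submodule.mem_span_singleton.mp hb
      rw [map_add, cst_of_mem_rad ha, map_smul, h0, smul_zero, add_zero]
    · intro i z hz
      obtain ⟨a, ha, b, hb, rfl⟩ := Submodule.mem_sup.mp hz
      obtain ⟨c, rfl⟩ := Submodule.mem_span_singleton.mp hb
      rw [map_add, map_smul]
      exact Submodule.mem_sup_left
        (Submodule.add_mem _ (skew_mem_rad i ha) (Submodule.smul_mem _ _ (h i)))
  exact this (Submodule.mem_sup_right (Submodule.mem_span_singleton_self x))

variable (χ η) in
/-- The elements killed by all the words of length `n` in the skew derivations for `χ` and `χ'`. -/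
def nilp (χ' : I → I → K) : ℕ → Submodule K 𝔽
  | 0 => ⊥
  | n + 1 => ⨅ i, ((nilp χ' n).comap (skew χ η i) ⊓ (nilp χ' n).comap (skew χ' η i))

theorem mem_nilp_succ {χ' : I → I → K} {n : ℕ} {x : 𝔽} : x ∈ nilp χ η χ' (n + 1) ↔
    ∀ i, skew χ η i x ∈ nilp χ η χ' n ∧ skew χ' η i x ∈ nilp χ η χ' n := by
  simp [nilp, Submodule.mem_iInf]

theorem nilp_mono_succ (χ' : I → I → K) (n : ℕ) : nilp χ η χ' n ≤ nilp χ η χ' (n + 1) := by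
  induction n with
  | zero => simp [nilp]
  | succ n ih =>
    intro x hx
    rw [mem_nilp_succ] at hx ⊢
    exact fun i => ⟨ih (hx i).1, ih (hx i).2⟩

theorem ι_mul_mem_nilp {χ' : I → I → K} (j : I) {n : ℕ} {x : 𝔽} (hx : x ∈ nilp χ η χ' n) :
    FreeAlgebra.ι K j * x ∈ nilp χ η χ' (n + 1) := by
  induction n generalizing x with
  | zero =>
    have : x = 0 := by simpa [nilp] using hx
    simp [this]
  | succ n ih =>
    rw [mem_nilp_succ]
    intro i
    rw [skew_ι_mul, skew_ι_mul]
    have := mem_nilp_succ.mp hx i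
    exact ⟨Submodule.add_mem _ (Submodule.smul_mem _ _ hx) (Submodule.smul_mem _ _ (ih this.1)),
      Submodule.add_mem _ (Submodule.smul_mem _ _ hx) (Submodule.smul_mem _ _ (ih this.2))⟩

/-- Each skew derivation lowers the degree by one, so a polynomial of degree less than `n` dies
under any `n` of them. Membership in `nilp` replaces the degree in the inductions and serves both
families of derivations at once. -/
theorem exists_mem_nilp (χ' : I → I → K) (x : 𝔽) : ∃ n, x ∈ nilp χ η χ' n := by
  have hmono : Monotone (nilp χ η χ') := monotone_nat_of_le_succ (nilp_mono_succ χ')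
  have := free_left_induction (K := K) (I := I) (⨆ n, nilp χ η χ' n)
    (Submodule.mem_iSup_of_mem 1 (by rw [mem_nilp_succ]; simp)) (fun i y hy => by
      obtain ⟨n, hn⟩ := (Submodule.mem_iSup_of_directed _ hmono.directed_le).mp hy
      exact Submodule.mem_iSup_of_mem (n + 1) (ι_mul_mem_nilp i hn)) x
  exact (Submodule.mem_iSup_of_directed _ hmono.directed_le).mp this

theorem scale_mem_nilp {χ' : I → I → K} (c : I → K) {n : ℕ} {x : 𝔽} (hx : x ∈ nilp χ η χ' n) :
    scale c x ∈ nilp χ η χ' n := by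
  induction n generalizing x with
  | zero =>
    have : x = 0 := by simpa [nilp] using hx
    simp [this]
  | succ n ih =>
    rw [mem_nilp_succ] at hx ⊢
    intro i
    rw [skew_scale, skew_scale]
    exact ⟨Submodule.smul_mem _ _ (ih (hx i).1), Submodule.smul_mem _ _ (ih (hx i).2)⟩

/-! ### The coproduct of the free algebra modulo the radical -/

variable (χ η) in
/-- The quotient of the free algebra by the radical. -/
def Nich : Type _ := 𝔽 ⧸ rad χ η

instance : AddCommGroup (Nich χ η) := inferInstanceAs (AddCommGroup (𝔽 ⧸ rad χ η))

instance : Module K (Nich χ η) := inferInstanceAs (Module K (𝔽 ⧸ rad χ η))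

variable (χ η) in
/-- Left multiplication by `e_i` modulo the radical. -/
def nMul (i : I) : Module.End K (Nich χ η) :=
  (rad χ η).mapQ (rad χ η) (LinearMap.mulLeft K (FreeAlgebra.ι K i))
    (fun _ hx => mul_mem_rad_left _ hx)

variable (χ η) in
/-- Rescaling modulo the radical. -/
def nScale (c : I → K) : Module.End K (Nich χ η) :=
  (rad χ η).mapQ (rad χ η) (scale c).toLinearMap (fun _ hx => scale_mem_rad _ hx)

variable (χ η) in
/-- The skew derivation modulo the radical. -/
def nSkew (i : I) : Module.End K (Nich χ η) :=
  (rad χ η).mapQ (rad χ η) (skew χ η i) (fun _ hx => skew_mem_rad _ hx)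

/-- The opposite skew derivation modulo the radical. -/
def nSkew' {χ' : I → I → K} (hχ : ∀ i j, χ i j * χ' j i = 1) (i : I) : Module.End K (Nich χ η) :=
  (rad χ η).mapQ (rad χ η) (skew χ' η i) (fun _ hx => skew'_mem_rad hχ _ hx)

variable (χ η) in
/-- The constant term modulo the radical. -/
def nCst : Nich χ η →ₗ[K] K :=
  (rad χ η).liftQ cst.toLinearMap (fun _ hx => cst_of_mem_rad hx)

variable (χ η) in
/-- The class modulo the radical. -/
def nMk : 𝔽 →ₗ[K] Nich χ η := (rad χ η).mkQ

theorem nMk_surjective : Function.Surjective (nMk χ η) := (rad χ η).mkQ_surjective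

theorem nMk_eq_zero {x : 𝔽} : nMk χ η x = 0 ↔ x ∈ rad χ η := Submodule.Quotient.mk_eq_zero _

@[simp] theorem nMul_mk (i : I) (x : 𝔽) :
    nMul χ η i (nMk χ η x) = nMk χ η (FreeAlgebra.ι K i * x) := rfl
@[simp] theorem nScale_mk (c : I → K) (x : 𝔽) :
    nScale χ η c (nMk χ η x) = nMk χ η (scale c x) := rfl
@[simp] theorem nSkew_mk (i : I) (x : 𝔽) : nSkew χ η i (nMk χ η x) = nMk χ η (skew χ η i x) := rfl
@[simp] theorem nSkew'_mk {χ' : I → I → K} (hχ : ∀ i j, χ i j * χ' j i = 1) (i : I) (x : 𝔽) :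
    nSkew' (η := η) hχ i (nMk χ η x) = nMk χ η (skew χ' η i x) := rfl
@[simp] theorem nCst_mk (x : 𝔽) : nCst χ η (nMk χ η x) = cst x := rfl

theorem nich_ext {V : Type*} [AddCommGroup V] [Module K V] {f g : Nich χ η →ₗ[K] V}
    (h : ∀ x : 𝔽, f (nMk χ η x) = g (nMk χ η x)) : f = g :=
  Submodule.linearMap_qext _ (LinearMap.ext h)

/-- After subtracting its constant term, a representative satisfies the criterion
`mem_rad_of_skew_mem`. -/
theorem nSkew_eq_zero_imp (z : Nich χ η) (h : ∀ i, nSkew χ η i z = 0) :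
    z = nCst χ η z • nMk χ η 1 := by
  obtain ⟨x, rfl⟩ := nMk_surjective z
  have hx : x - cst x • 1 ∈ rad χ η := by
    refine mem_rad_of_skew_mem (by simp) fun i => ?_
    rw [map_sub, map_smul, skew_one, smul_zero, sub_zero]
    exact nMk_eq_zero.mp (h i)
  rw [nCst_mk, ← map_smul]
  exact (Submodule.Quotient.eq _).mpr hx

variable (χ η) in
/-- Left multiplication by the coproduct of `e_i`. -/
def copStep (i : I) : Module.End K (Nich χ η ⊗[K] Nich χ η) :=
  TensorProduct.map (nMul χ η i) LinearMap.id + TensorProduct.map (nScale χ η (χ i)) (nMul χ η i)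

variable (χ η) in
/-- The coproduct modulo the radical. -/
def cop : 𝔽 →ₗ[K] Nich χ η ⊗[K] Nich χ η :=
  (LinearMap.applyₗ (nMk χ η 1 ⊗ₜ nMk χ η 1)).comp (FreeAlgebra.lift K (copStep χ η)).toLinearMap

@[simp] theorem cop_one : cop χ η (1 : 𝔽) = (nMk χ η 1 ⊗ₜ[K] nMk χ η 1 : Nich χ η ⊗[K] Nich χ η) := by
  simp [cop]

theorem cop_ι_mul (i : I) (x : 𝔽) : cop χ η (FreeAlgebra.ι K i * x) =
    copStep χ η i (cop χ η x) := by
  simp [cop]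

/-- The derivation acts on the left tensor factor only. Passing it through the rescaling in
`copStep` gives `χ j i`, while the Leibniz rule gives `χ i j`; this is where the symmetry of `χ`
enters. -/
theorem cop_skew (hs : ∀ i j, χ i j = χ j i) (i : I) (x : 𝔽) :
    TensorProduct.map (nSkew χ η i) LinearMap.id (cop χ η x) =
      (cop χ η (skew χ η i x) : Nich χ η ⊗[K] Nich χ η) := by
  classical
  have : (TensorProduct.map (nSkew χ η i) LinearMap.id).comp (cop χ η) =
      (cop χ η : 𝔽 →ₗ[K] Nich χ η ⊗[K] Nich χ η).comp (skew χ η i) := by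
    refine free_hom_ext (by simp) fun j z hz => ?_
    simp only [LinearMap.comp_apply, skew_ι_mul, map_add, map_smul, cop_ι_mul] at hz ⊢
    rw [← hz]
    generalize cop χ η z = w
    have key : (TensorProduct.map (nSkew χ η i) LinearMap.id).comp
        (copStep χ η j) =
        (if i = j then η i else 0) • LinearMap.id +
        χ i j • (copStep χ η j).comp
            (TensorProduct.map (nSkew χ η i) LinearMap.id) := by
      refine TensorProduct.ext (nich_ext fun x => nich_ext fun y => ?_)
      simp only [copStep, TensorProduct.mk_apply, LinearMap.comp_apply,
        LinearMap.add_apply, LinearMap.smul_apply, TensorProduct.map_tmul, LinearMap.id_apply,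
        nSkew_mk, nMul_mk, nScale_mk, map_add, skew_ι_mul, skew_scale, map_smul,
        TensorProduct.add_tmul, TensorProduct.smul_tmul', smul_add, hs j i, LinearMap.compr₂ₛₗ_apply]
      abel
    exact DFunLike.congr_fun key w
  exact DFunLike.congr_fun this x

theorem nCst_cop χ η (x : 𝔽) : TensorProduct.lid K (Nich χ η)
    (TensorProduct.map (nCst χ η) LinearMap.id (cop χ η x)) = nMk χ η x := by
  have : (TensorProduct.lid K (Nich χ η)).toLinearMap.comp
    ((TensorProduct.map (nCst χ η) LinearMap.id).comp (cop χ η)) = nMk χ η := by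
    refine free_hom_ext (by simp) fun j z hz => ?_
    simp only [LinearMap.comp_apply, cop_ι_mul, LinearEquiv.coe_coe] at hz ⊢
    rw [← nMul_mk, ← hz]
    generalize cop χ η z = w
    induction w using TensorProduct.induction_on with
    | zero => simp
    | add a b ha hb => rw [map_add, map_add, map_add, ha, hb, map_add, map_add, map_add]
    | tmul a b =>
      obtain ⟨a, rfl⟩ := nMk_surjective a
      simp [copStep]
  exact DFunLike.congr_fun this x

theorem tensor_eq_zero_of_functionals {V W : Type*} [AddCommGroup V] [Module K V]
    [AddCommGroup W] [Module K W] (z : V ⊗[K] W)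
    (h : ∀ φ : W →ₗ[K] K, TensorProduct.rid K V (TensorProduct.map LinearMap.id φ z) = 0) :
    z = 0 := by
  classical
  let b := Module.Basis.ofVectorSpace K W
  apply (TensorProduct.equivFinsuppOfBasisRight (M := V) b).injective
  rw [map_zero]
  ext k
  rw [Finsupp.zero_apply, ← h (b.coord k), TensorProduct.equivFinsuppOfBasisRight_apply]
  rfl

/-- Induction on the degree. The derivatives of `x` are in the radical and smaller, so `nSkew ⊗ 1`
kills `cop x`. Contracting the second factor with any functional leaves an element killed by all
derivations, hence a constant, and the counit identity `nCst_cop` shows that this constant is zero.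
-/
theorem cop_eq_zero_of_mem_rad (hs : ∀ i j, χ i j = χ j i) {x : 𝔽} (hx : x ∈ rad χ η) :
    cop χ η x = 0 := by
  obtain ⟨n, hn⟩ := exists_mem_nilp (χ := χ) (η := η) χ x
  induction n generalizing x with
  | zero =>
    have : x = 0 := by simpa [nilp] using hn
    simp [this]
  | succ n ih =>
    have h1 : ∀ i, TensorProduct.map (nSkew χ η i) LinearMap.id (cop χ η x) = 0 := fun i => by
      rw [cop_skew hs]
      exact ih (skew_mem_rad i hx) (mem_nilp_succ.mp hn i).1
    refine tensor_eq_zero_of_functionals _ fun φ => ?_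
    have comm : ∀ (g : Nich χ η →ₗ[K] Nich χ η) (w : Nich χ η ⊗[K] Nich χ η),
        g (TensorProduct.rid K _ (TensorProduct.map LinearMap.id φ w)) =
        TensorProduct.rid K _ (TensorProduct.map LinearMap.id φ
          (TensorProduct.map g LinearMap.id w)) := by
      intro g w
      induction w using TensorProduct.induction_on with
      | zero => simp
      | add a b ha hb => simp only [map_add, ha, hb]
      | tmul a b => simp
    have comm2 : ∀ w : Nich χ η ⊗[K] Nich χ η,
        nCst χ η (TensorProduct.rid K _ (TensorProduct.map LinearMap.id φ w)) =
        φ (TensorProduct.lid K _ (TensorProduct.map (nCst χ η) LinearMap.id w)) := by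
      intro w
      induction w using TensorProduct.induction_on with
      | zero => simp
      | add a b ha hb => simp only [map_add, ha, hb]
      | tmul a b => simp [mul_comm]
    rw [nSkew_eq_zero_imp (TensorProduct.rid K _ (TensorProduct.map LinearMap.id φ (cop χ η x))) (fun i => by rw [comm, h1, map_zero, map_zero]), comm2, nCst_cop,
      nMk_eq_zero.mpr hx, map_zero, zero_smul]

/-- The radical is a coideal: a sum of two skew-commuting maps killing it kills it. -/
theorem lift_add_eq_zero_of_mem_rad {S : Type*} [Ring S] [Algebra K S]
    (hs : ∀ i j, χ i j = χ j i) (u v : I → S) (huv : ∀ i j, v i * u j = χ i j • (u j * v i))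
    (hu : ∀ x ∈ rad χ η, FreeAlgebra.lift K u x = 0)
    (hv : ∀ x ∈ rad χ η, FreeAlgebra.lift K v x = 0) {x : 𝔽} (hx : x ∈ rad χ η) :
    FreeAlgebra.lift K (fun i => u i + v i) x = 0 := by
  -- `Θ` evaluates the two factors through `u` and `v` and multiplies; it is well defined because
  -- both kill the radical. Composed with `cop` it becomes the evaluation at `u + v`, because the
  -- commutation rule of `v` past `u` reproduces the rescaling in the coproduct.
  let Θ : Nich χ η ⊗[K] Nich χ η →ₗ[K] S := LinearMap.mul' K S ∘ₗ TensorProduct.map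
    ((rad χ η).liftQ (FreeAlgebra.lift K u).toLinearMap hu)
    ((rad χ η).liftQ (FreeAlgebra.lift K v).toLinearMap hv)
  have hΘ : ∀ a b : 𝔽, Θ (nMk χ η a ⊗ₜ nMk χ η b) =
    FreeAlgebra.lift K u a * FreeAlgebra.lift K v b := fun _ _ => rfl
  have hvu : ∀ i (a : 𝔽), v i * FreeAlgebra.lift K u a =
      FreeAlgebra.lift K u (scale (χ i) a) * v i := by
    intro i a
    have : (LinearMap.mulLeft K (v i)).comp (FreeAlgebra.lift K u).toLinearMap =
        (LinearMap.mulRight K (v i)).comp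
          ((FreeAlgebra.lift K u).toLinearMap.comp (scale (χ i)).toLinearMap) := by
      refine free_hom_ext (by simp) fun j z hz => ?_
      simp only [LinearMap.comp_apply, LinearMap.mulLeft_apply, LinearMap.mulRight_apply,
        AlgHom.toLinearMap_apply, map_mul, FreeAlgebra.lift_ι_apply, scale_ι, map_smul] at hz ⊢
      rw [← mul_assoc, huv, smul_mul_assoc, mul_assoc, hz, smul_mul_assoc, smul_mul_assoc,
        mul_assoc]
    exact DFunLike.congr_fun this a
  have key : ∀ a : 𝔽, Θ (cop χ η a) = FreeAlgebra.lift K (fun i => u i + v i) a := by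
    intro a
    have : Θ.comp (cop χ η) = (FreeAlgebra.lift K (fun i => u i + v i)).toLinearMap := by
      refine free_hom_ext ?_ fun j z hz => ?_
      · rw [LinearMap.comp_apply, cop_one, hΘ]
        simp
      · simp only [LinearMap.comp_apply, AlgHom.toLinearMap_apply, map_mul,
          FreeAlgebra.lift_ι_apply, cop_ι_mul] at hz ⊢
        rw [← hz]
        generalize cop χ η z = w
        induction w using TensorProduct.induction_on with
        | zero => simp
        | add a b ha hb => rw [map_add, map_add, map_add, ha, hb, mul_add]
        | tmul a b =>
          obtain ⟨a, rfl⟩ := nMk_surjective a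
          obtain ⟨b, rfl⟩ := nMk_surjective b
          rw [copStep, LinearMap.add_apply, TensorProduct.map_tmul, TensorProduct.map_tmul, map_add,
            nMul_mk, nMul_mk, nScale_mk, LinearMap.id_apply, hΘ, hΘ, hΘ, map_mul, map_mul, add_mul,
            FreeAlgebra.lift_ι_apply, FreeAlgebra.lift_ι_apply, mul_assoc, ← mul_assoc (v j), hvu,
            mul_assoc]
    exact DFunLike.congr_fun this a
  rw [← key, cop_eq_zero_of_mem_rad hs hx, map_zero]

end Free

end QSuper

end

noncomputable section

namespace QSuper

/-! ## The relations without the conditions on singular elements -/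

variable {I P : Type*} [AddCommGroup P]

theorem q_ne_zero : q ≠ 0 := RatFunc.X_ne_zero

/-- The sign `(-1) ^ (p i * p j)`. -/
def sgn (D : Datum I P) (i j : I) : Kq := (-1 : Kq) ^ ((D.p i : ℕ) * (D.p j : ℕ))

/-- The bicharacter of the quantum superalgebra. -/
def chi (D : Datum I P) (i j : I) : Kq := sgn D i j * q ^ (D.ℓ i * D.h i (D.α j))

/-- The bicharacter with `q` replaced by `q⁻¹`. -/
def chi' (D : Datum I P) (i j : I) : Kq := sgn D i j * q ^ (-(D.ℓ i * D.h i (D.α j)))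

open Classical in
/-- The indicator of the indices with nonzero coroot. -/
def eta (D : Datum I P) (i : I) : Kq := if D.h i = 0 then 0 else 1

/-- The parity sign `(-1) ^ p i`. -/
def par (D : Datum I P) (i : I) : Kq := (-1 : Kq) ^ (D.p i : ℕ)

theorem sgn_mul_self (D : Datum I P) (i j : I) : sgn D i j * sgn D i j = 1 := by
  rw [sgn, ← mul_pow]; simp

theorem par_mul_self (D : Datum I P) (i : I) : par D i * par D i = 1 := by
  rw [par, ← mul_pow]; simp

theorem sgn_comm (D : Datum I P) (i j : I) : sgn D i j = sgn D j i := by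
  rw [sgn, sgn, mul_comm]

theorem sgn_eq_par (D : Datum I P) (i j : I) : sgn D i j = par D j ^ (D.p i : ℕ) := by
  rw [sgn, par, ← pow_mul, mul_comm]

theorem sgn_same (D : Datum I P) (i : I) : sgn D i i = par D i := by
  rw [sgn, par]
  generalize D.p i = a
  fin_cases a <;> simp

theorem pairing_symm (D : Datum I P) (i j : I) :
    D.ℓ i * D.h i (D.α j) = D.ℓ j * D.h j (D.α i) := by
  have h1 := D.ℓ_mul i (D.α j)
  rw [D.form_symm, ← D.ℓ_mul j (D.α i)] at h1
  exact_mod_cast h1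

theorem chi_symm (D : Datum I P) (i j : I) : chi D i j = chi D j i := by
  rw [chi, chi, sgn_comm, pairing_symm]

theorem chi_mul_chi' (D : Datum I P) (i j : I) : chi D i j * chi' D j i = 1 := by
  rw [chi, chi', sgn_comm D j i, pairing_symm D j i, mul_mul_mul_comm, sgn_mul_self, one_mul,
    ← zpow_add₀ q_ne_zero, add_neg_cancel, zpow_zero]

/-- The relations of the quantum superalgebra other than the conditions on singular elements. -/
structure PlainRel (D : Datum I P) {S : Type*} [Ring S] [Algebra Kq S]
    (g : Gen I P → S) : Prop where
  qpow_zero : g (.qpow 0) = 1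
  qpow_add : ∀ h h', g (.qpow (h + h')) = g (.qpow h) * g (.qpow h')
  qpow_e : ∀ h i, g (.qpow h) * g (.e i) = (q ^ h (D.α i)) • (g (.e i) * g (.qpow h))
  qpow_f : ∀ h i, g (.qpow h) * g (.f i) = (q ^ (-h (D.α i))) • (g (.f i) * g (.qpow h))
  e_f_same : ∀ i, g (.e i) * g (.f i) - sgn D i i • (g (.f i) * g (.e i)) =
    (D.qi i - (D.qi i)⁻¹)⁻¹ • (g (.qpow (D.ℓ i • D.h i)) - g (.qpow (-(D.ℓ i • D.h i))))
  e_f_diff : ∀ i j, i ≠ j → g (.e i) * g (.f j) - sgn D i j • (g (.f j) * g (.e i)) = 0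
  σ_sq : g .σ * g .σ = 1
  σ_e : ∀ i, g .σ * g (.e i) * g .σ = par D i • g (.e i)
  σ_f : ∀ i, g .σ * g (.f i) * g .σ = par D i • g (.f i)
  σ_qpow : ∀ h, g .σ * g (.qpow h) * g .σ = g (.qpow h)

theorem Relations.plain {D : Datum I P} {S : Type*} [Ring S] [Algebra Kq S]
    {g : Gen I P → S} (h : Relations D S g) : PlainRel D g :=
  ⟨h.qpow_zero, h.qpow_add, h.qpow_e, h.qpow_f, h.e_f_same, h.e_f_diff, h.σ_sq, h.σ_e, h.σ_f,
    h.σ_qpow⟩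

/-- The twist `e ↦ f`, `f ↦ (-1)^p e`, `q^h ↦ q^(-h)`. -/
def twist (D : Datum I P) {S : Type*} [Ring S] [Algebra Kq S] (g : Gen I P → S) : Gen I P → S
  | .e i => g (.f i)
  | .f i => par D i • g (.e i)
  | .qpow h => g (.qpow (-h))
  | .σ => g .σ

/-- The inverse twist `e ↦ (-1)^p f`, `f ↦ e`, `q^h ↦ q^(-h)`. -/
def twistInv (D : Datum I P) {S : Type*} [Ring S] [Algebra Kq S] (g : Gen I P → S) : Gen I P → S
  | .e i => par D i • g (.f i)
  | .f i => g (.e i)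
  | .qpow h => g (.qpow (-h))
  | .σ => g .σ

theorem twist_twistInv (D : Datum I P) {S : Type*} [Ring S] [Algebra Kq S] (g : Gen I P → S) :
    twist D (twistInv D g) = g := by
  funext x
  cases x <;> simp [twist, twistInv, smul_smul, par_mul_self]

/-- The sign on one of the two families compensates for the reversed order in the super commutator,
and `q^h ↦ q^(-h)` reverses its right-hand side. -/
theorem PlainRel.twist {D : Datum I P} {S : Type*} [Ring S] [Algebra Kq S]
    {g : Gen I P → S} (h : PlainRel D g) : PlainRel D (twist D g) where
  qpow_zero := by simp [QSuper.twist, h.qpow_zero]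
  qpow_add a b := by
    simp only [QSuper.twist]
    rw [neg_add, h.qpow_add]
  qpow_e a i := by
    simp only [QSuper.twist]
    rw [h.qpow_f]
    simp
  qpow_f a i := by
    simp only [QSuper.twist, mul_smul_comm, smul_mul_assoc]
    rw [h.qpow_e, smul_comm]
    simp
  e_f_same i := by
    simp only [QSuper.twist, mul_smul_comm, smul_mul_assoc]
    rw [sgn_same, smul_smul, par_mul_self, one_smul, neg_neg]
    have := h.e_f_same i
    rw [sgn_same] at this
    rw [← neg_sub (g _), smul_neg, ← this, neg_sub]
  e_f_diff i j hij := by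
    simp only [QSuper.twist, mul_smul_comm, smul_mul_assoc]
    have := h.e_f_diff j i hij.symm
    rw [sub_eq_zero.mp this, smul_smul, smul_smul, sgn_comm D j i]
    rw [sub_eq_zero]
    congr 1
    rw [mul_right_comm, sgn_mul_self, one_mul]
  σ_sq := h.σ_sq
  σ_e i := h.σ_f i
  σ_f i := by
    simp only [QSuper.twist, mul_smul_comm, smul_mul_assoc]
    rw [h.σ_e]
  σ_qpow a := h.σ_qpow _

theorem PlainRel.twistInv {D : Datum I P} {S : Type*} [Ring S] [Algebra Kq S]
    {g : Gen I P → S} (h : PlainRel D g) : PlainRel D (twistInv D g) where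
  qpow_zero := by simp [QSuper.twistInv, h.qpow_zero]
  qpow_add a b := by
    simp only [QSuper.twistInv]
    rw [neg_add, h.qpow_add]
  qpow_e a i := by
    simp only [QSuper.twistInv, mul_smul_comm, smul_mul_assoc]
    rw [h.qpow_f, smul_comm]
    simp
  qpow_f a i := by
    simp only [QSuper.twistInv]
    rw [h.qpow_e]
    simp
  e_f_same i := by
    simp only [QSuper.twistInv, mul_smul_comm, smul_mul_assoc]
    have := h.e_f_same i
    rw [sgn_same] at this ⊢
    rw [smul_smul, par_mul_self, one_smul, neg_neg]
    rw [← neg_sub (g (.qpow (D.ℓ i • D.h i))), smul_neg, ← this, neg_sub]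
  e_f_diff i j hij := by
    simp only [QSuper.twistInv, mul_smul_comm, smul_mul_assoc]
    have := h.e_f_diff j i hij.symm
    rw [sub_eq_zero.mp this, smul_smul, smul_smul, sgn_comm D j i]
    rw [sub_eq_zero]
    congr 1
    rw [mul_right_comm, sgn_mul_self, one_mul]
  σ_sq := h.σ_sq
  σ_e i := by
    simp only [QSuper.twistInv, mul_smul_comm, smul_mul_assoc]
    rw [h.σ_f]
  σ_f i := h.σ_e i
  σ_qpow a := h.σ_qpow _

/-- The two conditions on singular elements are exchanged, and signs on generators change neither
the subalgebra nor the ideal they generate. Every result about the `e_i` therefore yields one about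
the `f_i`. -/
theorem Relations.twist {D : Datum I P} {S : Type*} [Ring S] [Algebra Kq S]
    {g : Gen I P → S} (h : Relations D S g) : Relations D S (twist D g) := by
  have hp := h.plain.twist
  refine ⟨hp.qpow_zero, hp.qpow_add, hp.qpow_e, hp.qpow_f, hp.e_f_same, hp.e_f_diff, hp.σ_sq,
    hp.σ_e, hp.σ_f, hp.σ_qpow, ?_, ?_⟩
  · intro a ha hb
    refine h.no_singular_f a ha fun i => ?_
    obtain ⟨b, hb1, hb2⟩ := hb i
    refine ⟨b, hb1, ?_⟩
    simp only [QSuper.twist, smul_mul_assoc, mul_smul_comm] at hb2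
    have := congrArg (par D i • ·) hb2
    simpa only [smul_smul, par_mul_self, one_smul] using this
  · have hpl : plusAlg (fun i => par D i • g (.e i)) = plusAlg (fun i => g (.e i)) := by
      refine le_antisymm (Algebra.adjoin_le ?_) (Algebra.adjoin_le ?_)
      · rintro _ ⟨i, rfl⟩
        exact Subalgebra.smul_mem _ (Algebra.subset_adjoin (Set.mem_range_self i)) _
      · rintro _ ⟨i, rfl⟩
        have := Subalgebra.smul_mem (plusAlg (fun i => par D i • g (.e i)))
          (Algebra.subset_adjoin (Set.mem_range_self i)) (par D i)
        rw [SetLike.mem_coe]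
        simpa only [smul_smul, par_mul_self, one_smul] using this
    intro a ha hb
    simp only [QSuper.twist] at ha hb
    rw [hpl] at hb
    refine h.no_singular_e a ?_ hb
    refine Submodule.span_le.mpr ?_ ha
    rintro _ ⟨u, hu, v, hv, i, rfl⟩
    rw [hpl] at hu hv
    rw [mul_smul_comm, smul_mul_assoc]
    exact Submodule.smul_mem _ _ (Submodule.subset_span ⟨u, hu, v, hv, i, rfl⟩)

/-! ### The commutator of `f_i` with polynomials in the `e_j` -/

-- Moving `F` through each letter in turn leaves terms with `T` and `T'`, and collecting these on
-- the left rescales the letters passed by inverse characters. The coefficients so produced are the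
-- skew derivatives for `chi'` and for `chi`. The central factor `c` allows the letters `e_j ⊗ c_j`.
-- If the coroot is zero then `T = T'`, in agreement with `eta = 0`.
open Classical in
theorem comm_formula (D : Datum I P) {S : Type*} [Ring S] [Algebra Kq S] (E : I → S) (i : I)
    (F T T' c : S) (k : Kq)
    (hEF : ∀ j, F * E j = sgn D i j • (E j * F) + (if i = j then k else 0) • (c * (T - T')))
    (hT : ∀ j, E j * T = q ^ (-(D.ℓ i * D.h i (D.α j))) • (T * E j))
    (hT' : ∀ j, E j * T' = q ^ (D.ℓ i * D.h i (D.α j)) • (T' * E j))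
    (hc : ∀ j, E j * c = c * E j) (hη : D.h i = 0 → T = T') (y : FreeAlgebra Kq I) :
    F * FreeAlgebra.lift Kq E y = FreeAlgebra.lift Kq E (scale (sgn D i) y) * F +
      k • (c * (T * FreeAlgebra.lift Kq E (skew (chi' D) (eta D) i y) -
        T' * FreeAlgebra.lift Kq E (skew (chi D) (eta D) i y))) := by
  let φ := FreeAlgebra.lift Kq E
  have : (LinearMap.mulLeft Kq F).comp φ.toLinearMap =
      (LinearMap.mulRight Kq F).comp (φ.toLinearMap.comp (scale (sgn D i)).toLinearMap) +
      k • (LinearMap.mulLeft Kq c).comp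
        ((LinearMap.mulLeft Kq T).comp (φ.toLinearMap.comp (skew (chi' D) (eta D) i)) -
         (LinearMap.mulLeft Kq T').comp (φ.toLinearMap.comp (skew (chi D) (eta D) i))) := by
    refine free_hom_ext (by simp) fun j z hz => ?_
    simp only [LinearMap.comp_apply, LinearMap.mulLeft_apply, LinearMap.mulRight_apply,
      LinearMap.add_apply, LinearMap.smul_apply, LinearMap.sub_apply, skew_ι_mul,
      AlgHom.toLinearMap_apply, map_mul, scale_ι, map_smul, map_add,
      show ∀ j, φ (FreeAlgebra.ι Kq j) = E j from fun j => FreeAlgebra.lift_ι_apply _ _] at hz ⊢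
    generalize hu : φ (skew (chi' D) (eta D) i z) = u at *
    generalize hv : φ (skew (chi D) (eta D) i z) = v at *
    rw [← mul_assoc, hEF, add_mul, smul_mul_assoc, mul_assoc, hz]
    have h1 : E j * (c * (T * u - T' * v)) =
        c * (q ^ (-(D.ℓ i * D.h i (D.α j))) • (T * (E j * u)) -
          q ^ (D.ℓ i * D.h i (D.α j)) • (T' * (E j * v))) := by
      rw [← mul_assoc, hc, mul_assoc, mul_sub, ← mul_assoc (E j), hT, ← mul_assoc (E j), hT']
      simp only [smul_mul_assoc, mul_assoc]
    rw [mul_add, mul_smul_comm, h1, smul_add, smul_mul_assoc, mul_assoc, smul_mul_assoc, add_assoc,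
      smul_mul_assoc]
    rw [← mul_assoc (E j)]
    congr 1
    have h2 : (if i = j then k else 0) • (c * ((T - T') * φ z)) =
        k • (c * ((if i = j then eta D i else 0) • (T * φ z) -
          (if i = j then eta D i else 0) • (T' * φ z))) := by
      by_cases hij : i = j
      · by_cases hh : D.h i = 0
        · simp [hη hh]
        · subst hij
          simp [eta, sub_mul, mul_sub, hh]
      · simp [hij]
    rw [h2]
    simp only [chi, chi', mul_add, mul_sub, smul_sub, smul_add, mul_smul_comm, smul_smul]
    rw [mul_left_comm (sgn D i j) k, mul_left_comm (sgn D i j) k]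
    abel
  exact DFunLike.congr_fun this y

end QSuper

end

/-! ### Vanishing of the radical in algebras with the relations. -/

noncomputable section

namespace QSuper

variable {I P : Type*} [AddCommGroup P]

/-- The constant in the commutator of `f_i` with a polynomial in the `e_j`. -/
def kk (D : Datum I P) (i : I) : Kq := -(par D i * (D.qi i - (D.qi i)⁻¹)⁻¹)

section PlainConsequences

variable {D : Datum I P} {S : Type*} [Ring S] [Algebra Kq S] {g : Gen I P → S}

open Classical in
theorem PlainRel.f_e (h : PlainRel D g) (i j : I) : g (.f i) * g (.e j) =
    sgn D i j • (g (.e j) * g (.f i)) + (if i = j then kk D i else 0) •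
      (g (.qpow (D.ℓ i • D.h i)) - g (.qpow (-(D.ℓ i • D.h i)))) := by
  by_cases hij : i = j
  · subst hij
    have h1 := h.e_f_same i
    rw [if_pos rfl, kk, neg_smul, mul_smul, ← h1, sgn_same, smul_sub, smul_smul, par_mul_self,
      one_smul]
    abel
  · have h1 := sub_eq_zero.mp (h.e_f_diff j i (Ne.symm hij))
    rw [if_neg hij, zero_smul, add_zero, h1, smul_smul, sgn_comm D j i, sgn_mul_self, one_smul]

theorem PlainRel.e_qpow (h : PlainRel D g) (a : Module.Dual ℤ P) (i : I) :
    g (.e i) * g (.qpow a) = q ^ (-a (D.α i)) • (g (.qpow a) * g (.e i)) := by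
  rw [h.qpow_e, smul_smul, ← zpow_add₀ q_ne_zero, neg_add_cancel, zpow_zero, one_smul]

theorem PlainRel.comm_lift (h : PlainRel D g) (i : I) (y : FreeAlgebra Kq I) :
    g (.f i) * FreeAlgebra.lift Kq (fun j => g (.e j)) y =
      FreeAlgebra.lift Kq (fun j => g (.e j)) (scale (sgn D i) y) * g (.f i) +
      kk D i • (g (.qpow (D.ℓ i • D.h i)) *
          FreeAlgebra.lift Kq (fun j => g (.e j)) (skew (chi' D) (eta D) i y) -
        g (.qpow (-(D.ℓ i • D.h i))) *
          FreeAlgebra.lift Kq (fun j => g (.e j)) (skew (chi D) (eta D) i y)) := by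
  classical
  have := comm_formula D (fun j => g (.e j)) i (g (.f i)) (g (.qpow (D.ℓ i • D.h i)))
    (g (.qpow (-(D.ℓ i • D.h i)))) 1 (kk D i) (fun j => by rw [one_mul]; convert h.f_e i j)
    (fun j => by rw [h.e_qpow]; simp) (fun j => by rw [h.e_qpow]; simp) (fun j => by simp)
    (fun hh => by simp [hh]) y
  simpa using this

end PlainConsequences

section RadicalVanishes

variable {D : Datum I P} {S : Type*} [Ring S] [Algebra Kq S] {g : Gen I P → S}
  {C : Type*} [Ring C] [Algebra Kq C]

/-- The contraction of the second tensor factor. -/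
def contr (φ : C →ₗ[Kq] Kq) : S ⊗[Kq] C →ₗ[Kq] S :=
  (TensorProduct.rid Kq S).toLinearMap.comp (TensorProduct.map LinearMap.id φ)

theorem contr_mul_left (φ : C →ₗ[Kq] Kq) (a : S) (c : C) (z : S ⊗[Kq] C) :
    contr φ ((a ⊗ₜ c) * z) = a * contr (φ.comp (LinearMap.mulLeft Kq c)) z := by
  induction z using TensorProduct.induction_on with
  | zero => simp
  | add x y hx hy => rw [mul_add, map_add, map_add, hx, hy, mul_add]
  | tmul x y => simp [contr]

theorem contr_mul_right (φ : C →ₗ[Kq] Kq) (a : S) (z : S ⊗[Kq] C) :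
    contr φ (z * (a ⊗ₜ 1)) = contr φ z * a := by
  induction z using TensorProduct.induction_on with
  | zero => simp
  | add x y hx hy => rw [add_mul, map_add, map_add, hx, hy, add_mul]
  | tmul x y => simp [contr]

theorem contr_mem_plusAlg (E : I → S) (cc : I → C) (y : FreeAlgebra Kq I) (φ : C →ₗ[Kq] Kq) :
    contr φ (FreeAlgebra.lift Kq (fun j => E j ⊗ₜ[Kq] cc j) y) ∈ plusAlg E := by
  -- The claim is made for all functionals at once: left multiplication by `E i ⊗ cc i` changes the
  -- functional to its composite with multiplication by `cc i`.
  let T : Submodule Kq (FreeAlgebra Kq I) := ⨅ φ : C →ₗ[Kq] Kq,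
    (Subalgebra.toSubmodule (plusAlg E)).comap ((contr φ).comp
      (FreeAlgebra.lift Kq (fun j => E j ⊗ₜ[Kq] cc j)).toLinearMap)
  have hT : ∀ y, y ∈ T ↔ ∀ φ : C →ₗ[Kq] Kq,
      contr φ (FreeAlgebra.lift Kq (fun j => E j ⊗ₜ[Kq] cc j) y) ∈ plusAlg E := fun y => by
    simp [T, Submodule.mem_iInf]
  refine (hT y).mp (free_left_induction T ((hT 1).mpr fun φ => ?_) (fun i x hx => ?_) y) φ
  · rw [map_one, Algebra.TensorProduct.one_def]
    simp only [contr, LinearMap.comp_apply, TensorProduct.map_tmul, LinearEquiv.coe_coe,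
      TensorProduct.rid_tmul, LinearMap.id_apply]
    exact Subalgebra.smul_mem _ (Subalgebra.one_mem _) _
  · rw [hT] at hx ⊢
    intro φ
    rw [map_mul, FreeAlgebra.lift_ι_apply, contr_mul_left]
    exact Subalgebra.mul_mem _ (Algebra.subset_adjoin (Set.mem_range_self i)) (hx _)

theorem contr_mem_plusIdeal (E : I → S) (cc : I → C) (y : FreeAlgebra Kq I) (hy : cst y = 0)
    (φ : C →ₗ[Kq] Kq) :
    contr φ (FreeAlgebra.lift Kq (fun j => E j ⊗ₜ[Kq] cc j) y) ∈ plusIdeal E := by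
  let T : Submodule Kq (FreeAlgebra Kq I) := (plusIdeal E).comap ((contr φ).comp
      ((FreeAlgebra.lift Kq (fun j => E j ⊗ₜ[Kq] cc j)).toLinearMap -
        (Algebra.linearMap Kq (S ⊗[Kq] C)).comp cst.toLinearMap))
  have := free_left_induction T (by simp [T, Algebra.TensorProduct.one_def]) (fun i x _ => by
    simp only [T, Submodule.mem_comap, LinearMap.comp_apply, LinearMap.sub_apply,
      AlgHom.toLinearMap_apply, map_mul, cst_ι, zero_mul, map_zero, sub_zero,
      FreeAlgebra.lift_ι_apply, contr_mul_left]
    refine Submodule.subset_span ⟨1, Subalgebra.one_mem _, _, contr_mem_plusAlg E cc x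
      (φ.comp (LinearMap.mulLeft Kq (cc i))), i, by rw [one_mul]⟩) y
  simpa [T, hy] using this

/-- The radical vanishes in every algebra with the relations, even after the generators are
multiplied by commuting elements of another algebra. -/
theorem Relations.lift_tmul_eq_zero (h : Relations D S g) (cc : I → C)
    (hcc : ∀ i j, cc i * cc j = cc j * cc i) {x : FreeAlgebra Kq I}
    (hx : x ∈ rad (chi D) (eta D)) :
    FreeAlgebra.lift Kq (fun j => g (.e j) ⊗ₜ[Kq] cc j) x = 0 := by
  classical
  obtain ⟨n, hn⟩ := exists_mem_nilp (χ := chi D) (η := eta D) (chi' D) x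
  induction n generalizing x with
  | zero =>
    have : x = 0 := by simpa [nilp] using hn
    simp [this]
  | succ n ih =>
    -- The two skew derivatives of `x` lie in the radical and in the previous step of `nilp`, so
    -- they vanish by induction. What remains of the commutator formula is a sign rule.
    have key : ∀ i, (g (.f i) ⊗ₜ[Kq] (1 : C)) *
        FreeAlgebra.lift Kq (fun j => g (.e j) ⊗ₜ[Kq] cc j) x =
        FreeAlgebra.lift Kq (fun j => g (.e j) ⊗ₜ[Kq] cc j) (scale (sgn D i) x) *
          (g (.f i) ⊗ₜ[Kq] (1 : C)) := by
      intro i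
      have := comm_formula D (fun j => g (.e j) ⊗ₜ[Kq] cc j) i (g (.f i) ⊗ₜ[Kq] (1 : C))
        (g (.qpow (D.ℓ i • D.h i)) ⊗ₜ[Kq] (1 : C))
        (g (.qpow (-(D.ℓ i • D.h i))) ⊗ₜ[Kq] (1 : C)) ((1 : S) ⊗ₜ[Kq] cc i) (kk D i)
        (fun j => by
          simp only [Algebra.TensorProduct.tmul_mul_tmul, one_mul, mul_one, h.plain.f_e i j,
            ← TensorProduct.sub_tmul, TensorProduct.add_tmul, TensorProduct.smul_tmul']
          by_cases hij : i = j
          · subst hij; simp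
          · simp [hij])
        (fun j => by
          simp only [Algebra.TensorProduct.tmul_mul_tmul, one_mul, mul_one, h.plain.e_qpow,
            TensorProduct.smul_tmul']
          simp)
        (fun j => by
          simp only [Algebra.TensorProduct.tmul_mul_tmul, one_mul, mul_one, h.plain.e_qpow,
            TensorProduct.smul_tmul']
          simp)
        (fun j => by simp [hcc i j])
        (fun hh => by simp [hh]) x
      have hnx := mem_nilp_succ.mp hn i
      rw [ih (skew_mem_rad i hx) hnx.1, ih (skew'_mem_rad (chi_mul_chi' D) i hx) hnx.2] at this
      simpa using this
    -- Each contraction of the second factor lies in the ideal generated by the `e_i`, and `f_i`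
    -- moves through it into the form `U⁺ f_i`. It is singular, so it is zero.
    refine tensor_eq_zero_of_functionals _ fun φ => ?_
    change contr φ _ = 0
    refine h.no_singular_e _ (contr_mem_plusIdeal (fun j => g (.e j)) cc x (cst_of_mem_rad hx) φ)
      fun i => ⟨_, contr_mem_plusAlg (fun j => g (.e j)) cc (scale (sgn D i) x) φ, ?_⟩
    rw [← contr_mul_right, ← key, contr_mul_left]
    congr 2
    ext
    simp

end RadicalVanishes

/-! ## Verma-type modules -/

section Verma

variable (D : Datum I P)

/-- The half of the quantum superalgebra, as a quotient of the free algebra. -/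
abbrev Nn : Type _ := Nich (chi D) (eta D)

/-- The action of `q ^ h` on the Verma-type module of lowest weight `lam`. -/
def vq (lam : P) (h : Module.Dual ℤ P) : Module.End Kq (Nn D) :=
  q ^ h lam • nScale (chi D) (eta D) (fun j => q ^ h (D.α j))

/-- The action of the generators on the Verma-type module of lowest weight `lam`. -/
def verma (lam : P) : Gen I P → Module.End Kq (Nn D)
  | .e i => nMul (chi D) (eta D) i
  -- This is the action dictated by the commutator formula once `f_i` kills the lowest weight vector
  -- `1`.
  | .f i => kk D i • (vq D lam (D.ℓ i • D.h i) * nSkew' (chi_mul_chi' D) i -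
      vq D lam (-(D.ℓ i • D.h i)) * nSkew (chi D) (eta D) i)
  | .qpow h => vq D lam h
  | .σ => nScale (chi D) (eta D) (par D)

theorem nScale_mul (c c' : I → Kq) : nScale (chi D) (eta D) c * nScale (chi D) (eta D) c' =
    nScale (chi D) (eta D) (c * c') := nich_ext fun x => by
  simp [scale_scale]

theorem nScale_one : nScale (chi D) (eta D) 1 = 1 := nich_ext fun x => by simp

theorem nScale_nMul (c : I → Kq) (i : I) :
    nScale (chi D) (eta D) c * nMul (chi D) (eta D) i =
      c i • (nMul (chi D) (eta D) i * nScale (chi D) (eta D) c) := nich_ext fun x => by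
  simp

theorem nSkew_nScale (c : I → Kq) (i : I) :
    nSkew (chi D) (eta D) i * nScale (chi D) (eta D) c =
      c i • (nScale (chi D) (eta D) c * nSkew (chi D) (eta D) i) := nich_ext fun x => by
  simp [skew_scale]

theorem nSkew'_nScale (c : I → Kq) (i : I) :
    nSkew' (η := eta D) (chi_mul_chi' D) i * nScale (chi D) (eta D) c =
      c i • (nScale (chi D) (eta D) c * nSkew' (chi_mul_chi' D) i) := nich_ext fun x => by
  simp [skew_scale]

open Classical in
theorem nSkew_nMul (i j : I) :
    nSkew (chi D) (eta D) i * nMul (chi D) (eta D) j = (if i = j then eta D i else 0) • 1 +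
      chi D i j • (nMul (chi D) (eta D) j * nSkew (chi D) (eta D) i) := nich_ext fun x => by
  simp only [Module.End.mul_apply, nMul_mk, nSkew_mk, skew_ι_mul, map_add, map_smul,
    LinearMap.add_apply, LinearMap.smul_apply, Module.End.one_apply]

open Classical in
theorem nSkew'_nMul (i j : I) :
    nSkew' (chi_mul_chi' D) i * nMul (chi D) (eta D) j = (if i = j then eta D i else 0) • 1 +
      chi' D i j • (nMul (chi D) (eta D) j * nSkew' (chi_mul_chi' D) i) := nich_ext fun x => by
  simp only [Module.End.mul_apply, nMul_mk, nSkew'_mk, skew_ι_mul, map_add, map_smul,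
    LinearMap.add_apply, LinearMap.smul_apply, Module.End.one_apply]

theorem vq_zero (lam : P) : vq D lam 0 = 1 := by
  have : (fun j => q ^ (0 : Module.Dual ℤ P) (D.α j)) = (1 : I → Kq) := by ext; simp
  rw [vq, this, nScale_one]; simp

theorem vq_add (lam : P) (a b : Module.Dual ℤ P) :
    vq D lam (a + b) = vq D lam a * vq D lam b := by
  have : (fun j => q ^ (a + b) (D.α j)) = (fun j => q ^ a (D.α j)) * fun j => q ^ b (D.α j) := by
    ext; simp [zpow_add₀ q_ne_zero]
  rw [vq, vq, vq, this, ← nScale_mul, smul_mul_smul_comm, LinearMap.add_apply,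
    zpow_add₀ q_ne_zero]

theorem vq_comm (lam : P) (a b : Module.Dual ℤ P) :
    vq D lam a * vq D lam b = vq D lam b * vq D lam a := by
  rw [← vq_add, ← vq_add, add_comm]

theorem vq_nMul (lam : P) (a : Module.Dual ℤ P) (i : I) : vq D lam a * nMul (chi D) (eta D) i =
    q ^ a (D.α i) • (nMul (chi D) (eta D) i * vq D lam a) := by
  rw [vq, smul_mul_assoc, nScale_nMul, mul_smul_comm, smul_comm]

theorem vq_nSkew (lam : P) (a : Module.Dual ℤ P) (i : I) : vq D lam a * nSkew (chi D) (eta D) i =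
    q ^ (-a (D.α i)) • (nSkew (chi D) (eta D) i * vq D lam a) := by
  rw [vq, mul_smul_comm, nSkew_nScale, smul_mul_assoc, smul_comm (q ^ a lam),
    smul_smul (q ^ (-a (D.α i))), ← zpow_add₀ q_ne_zero, neg_add_cancel, zpow_zero, one_smul]

theorem vq_nSkew' (lam : P) (a : Module.Dual ℤ P) (i : I) :
    vq D lam a * nSkew' (chi_mul_chi' D) i =
    q ^ (-a (D.α i)) • (nSkew' (η := eta D) (chi_mul_chi' D) i * vq D lam a) := by
  rw [vq, mul_smul_comm, nSkew'_nScale, smul_mul_assoc, smul_comm (q ^ a lam),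
    smul_smul (q ^ (-a (D.α i))), ← zpow_add₀ q_ne_zero, neg_add_cancel, zpow_zero, one_smul]

-- The power of `q` from moving `q^h` past a letter cancels the one in `chi` or `chi'`, so only the
-- sign survives in front of the reordered product. The inhomogeneous terms of the two skew
-- derivations give the commutator with `j = i`.
open Classical in
theorem verma_f_e (lam : P) (i j : I) : verma D lam (.f i) * verma D lam (.e j) =
    sgn D i j • (verma D lam (.e j) * verma D lam (.f i)) + (if i = j then kk D i else 0) •
      (vq D lam (D.ℓ i • D.h i) - vq D lam (-(D.ℓ i • D.h i))) := by
  have hz : ∀ a : ℤ, q ^ (-a) * q ^ a = 1 := fun a => by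
    rw [← zpow_add₀ q_ne_zero, neg_add_cancel, zpow_zero]
  have h1 : vq D lam (D.ℓ i • D.h i) * (nMul (chi D) (eta D) j * nSkew' (chi_mul_chi' D) i) =
      q ^ (D.ℓ i * D.h i (D.α j)) •
        (nMul (chi D) (eta D) j * (vq D lam (D.ℓ i • D.h i) * nSkew' (chi_mul_chi' D) i)) := by
    rw [← mul_assoc, vq_nMul, smul_mul_assoc, mul_assoc]
    simp
  have h2 : vq D lam (-(D.ℓ i • D.h i)) * (nMul (chi D) (eta D) j * nSkew (chi D) (eta D) i) =
      q ^ (-(D.ℓ i * D.h i (D.α j))) •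
        (nMul (chi D) (eta D) j * (vq D lam (-(D.ℓ i • D.h i)) * nSkew (chi D) (eta D) i)) := by
    rw [← mul_assoc, vq_nMul, smul_mul_assoc, mul_assoc]
    simp
  simp only [verma, smul_mul_assoc, sub_mul, mul_assoc, nSkew_nMul, nSkew'_nMul, mul_add,
    mul_smul_comm, mul_one, h1, h2, smul_smul, chi, chi', mul_assoc, hz]
  rw [mul_comm (q ^ (D.ℓ i * D.h i (D.α j))), hz, mul_one]
  by_cases hij : i = j
  · subst hij
    -- For a zero coroot both inhomogeneous terms are absent: `eta` is zero on one side, and `t_i =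
    -- t_i⁻¹` on the other.
    by_cases hh : D.h i = 0
    · simp only [hh, smul_zero, neg_zero, sub_self, eta, if_true, zero_smul, zero_add, mul_sub]
      rw [← smul_sub, smul_smul, mul_comm, add_zero]
    · simp only [eta, if_true, if_neg hh, one_smul, mul_sub]
      rw [mul_comm (sgn D i i), mul_smul, ← smul_add]
      congr 1
      rw [smul_sub]
      abel
  · simp only [if_neg hij, zero_smul, zero_add, mul_sub]
    rw [← smul_sub, smul_smul, mul_comm, add_zero]

theorem verma_plain (lam : P) : PlainRel D (verma D lam) where
  qpow_zero := vq_zero D lam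
  qpow_add := vq_add D lam
  qpow_e a i := vq_nMul D lam a i
  qpow_f a i := by
    simp only [verma, mul_smul_comm, mul_sub, ← mul_assoc, vq_comm D lam a]
    rw [mul_assoc, vq_nSkew', mul_assoc _ (vq D lam a), vq_nSkew]
    simp only [mul_smul_comm, sub_mul, smul_mul_assoc, mul_assoc]
    rw [← smul_sub, smul_comm]
  e_f_same i := by
    have := verma_f_e D lam i i
    rw [this, if_pos rfl, smul_add, smul_smul, sgn_mul_self, one_smul, smul_smul, kk, sgn_same,
      mul_neg, ← mul_assoc, par_mul_self, one_mul, neg_smul]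
    simp [verma]
  e_f_diff i j hij := by
    have := verma_f_e D lam j i
    rw [this, if_neg (Ne.symm hij), zero_smul, add_zero, smul_smul, sgn_comm D j i, sgn_mul_self,
      one_smul, sub_self]
  σ_sq := by
    simp only [verma]
    rw [nScale_mul, ← nScale_one]
    congr 1
    ext i
    exact par_mul_self D i
  σ_e i := by
    simp only [verma]
    rw [nScale_nMul, smul_mul_assoc, mul_assoc, nScale_mul]
    rw [show par D * par D = 1 from funext fun i => par_mul_self D i, nScale_one, mul_one]
  σ_f i := by
    have hc : ∀ a, nScale (chi D) (eta D) (par D) * vq D lam a =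
        vq D lam a * nScale (chi D) (eta D) (par D) := fun a => by
      rw [vq, mul_smul_comm, smul_mul_assoc, nScale_mul, nScale_mul, mul_comm]
    have hone : nScale (chi D) (eta D) (par D) * nScale (chi D) (eta D) (par D) = 1 := by
      rw [nScale_mul, show par D * par D = 1 from funext fun i => par_mul_self D i, nScale_one]
    simp only [verma, mul_smul_comm, mul_sub, sub_mul, smul_mul_assoc, mul_assoc, nSkew_nScale,
      nSkew'_nScale]
    simp only [← mul_assoc, hc]
    simp only [mul_assoc (vq D lam _), hone, mul_one, smul_sub]
    rw [smul_comm (par D i), smul_comm (par D i)]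
  σ_qpow a := by
    simp only [verma]
    rw [vq, mul_smul_comm, smul_mul_assoc, nScale_mul, nScale_mul]
    congr 2
    ext j
    simp only [Pi.mul_apply]
    rw [mul_right_comm, par_mul_self, one_mul]

end Verma

end QSuper

end

/-! ### Detection of the radical by the Verma-type modules. -/

noncomputable section

namespace QSuper

variable {I P : Type*} [AddCommGroup P]

theorem q_zpow_injective : Function.Injective (fun n : ℤ => q ^ n) := by
  have hpos : ∀ n : ℕ, q ^ n = 1 → n = 0 := by
    intro n hn
    have h1 : algebraMap (Polynomial ℚ) Kq (Polynomial.X ^ n) = algebraMap (Polynomial ℚ) Kq 1 := by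
      rw [map_pow, RatFunc.algebraMap_X, map_one]
      exact hn
    have h2 := RatFunc.algebraMap_injective ℚ h1
    simpa using congrArg Polynomial.natDegree h2
  intro a b hab
  have h : q ^ (a - b) = 1 := by
    rw [zpow_sub₀ q_ne_zero]
    simp only at hab
    rw [hab, div_self (zpow_ne_zero _ q_ne_zero)]
  rcases Int.le_total 0 (a - b) with h0 | h0
  · obtain ⟨n, hn⟩ := Int.eq_ofNat_of_zero_le h0
    rw [hn, zpow_natCast] at h
    have := hpos n h
    omega
  · obtain ⟨n, hn⟩ := Int.eq_ofNat_of_zero_le (neg_nonneg.mpr h0)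
    have h' : q ^ (-(a - b)) = 1 := by rw [zpow_neg, h, inv_one]
    rw [hn, zpow_natCast] at h'
    have := hpos n h'
    omega

theorem q_zpow_eq_one {n : ℤ} (h : q ^ n = 1) : n = 0 := q_zpow_injective (by simpa using h)

section

variable (D : Datum I P)

theorem qi_ne_zero (i : I) : D.qi i ≠ 0 := zpow_ne_zero _ q_ne_zero

theorem qi_sub_ne_zero (i : I) : D.qi i - (D.qi i)⁻¹ ≠ 0 := by
  intro h
  have h1 : q ^ (D.ℓ i + D.ℓ i) = 1 := by
    rw [zpow_add₀ q_ne_zero]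
    change D.qi i * D.qi i = 1
    nth_rewrite 1 [sub_eq_zero.mp h]
    exact inv_mul_cancel₀ (qi_ne_zero D i)
  have := q_zpow_eq_one h1
  have := D.ℓ_ne_zero i
  omega

theorem kk_ne_zero (i : I) : kk D i ≠ 0 :=
  neg_ne_zero.mpr (mul_ne_zero (pow_ne_zero _ (by norm_num)) (inv_ne_zero (qi_sub_ne_zero D i)))

theorem verma_f_one (lam : P) (i : I) : verma D lam (.f i) (nMk _ _ 1) = 0 := by
  simp [verma]

theorem verma_lift_e (lam : P) (y x : FreeAlgebra Kq I) :
    FreeAlgebra.lift Kq (fun j => verma D lam (.e j)) y (nMk _ _ x) =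
      nMk (chi D) (eta D) (y * x) := by
  induction y using FreeAlgebra.induction generalizing x with
  | grade0 r => simp [← Algebra.smul_def]
  | grade1 i => simp [verma]
  | mul a b ha hb => rw [map_mul, Module.End.mul_apply, hb, ha, mul_assoc]
  | add a b ha hb => rw [map_add, LinearMap.add_apply, hb, ha, add_mul, map_add]

theorem nScale_inv_apply (c c' : I → Kq) (h : c * c' = 1) (z : Nn D) :
    nScale (chi D) (eta D) c (nScale (chi D) (eta D) c' z) = z := by
  rw [← Module.End.mul_apply, nScale_mul, h, nScale_one, Module.End.one_apply]

/-- A polynomial without constant term whose image in the Verma-type modules is singular lies in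
the radical. -/
theorem mem_rad_of_verma_singular {y : FreeAlgebra Kq I} (hy : cst y = 0)
    (h : ∀ lam i, verma D lam (.f i)
      (FreeAlgebra.lift Kq (fun j => verma D lam (.e j)) y (nMk _ _ 1)) = 0) :
    y ∈ rad (chi D) (eta D) := by
  refine mem_rad_of_skew_mem hy fun i => ?_
  -- With zero coroot the derivation itself is zero, so the index imposes no condition.
  by_cases hh : D.h i = 0
  · rw [skew_eq_zero _ _ _ (by simp [eta, hh])]
    exact Submodule.zero_mem _
  obtain ⟨lam, hlam⟩ : ∃ lam, D.h i lam ≠ 0 := by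
    by_contra hcon
    push Not at hcon
    exact hh (LinearMap.ext hcon)
  set u := nMk (chi D) (eta D) (skew (chi' D) (eta D) i y) with hu
  set v := nMk (chi D) (eta D) (skew (chi D) (eta D) i y) with hv
  -- Singularity at lowest weight `lam` reads `t_i d'_i(y) = t_i⁻¹ d_i(y)` modulo the radical.
  -- Comparing weight `0` with a weight on which `h_i` is nonzero gives the same identity with the
  -- unequal factors `q^(±ℓ_i⟨h_i, lam⟩)`, which forces the derivative to vanish.
  have key : ∀ lam, vq D lam (D.ℓ i • D.h i) u = vq D lam (-(D.ℓ i • D.h i)) v := by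
    intro lam
    have := h lam i
    rw [verma_lift_e, mul_one] at this
    simp only [verma, LinearMap.smul_apply, LinearMap.sub_apply, Module.End.mul_apply, nSkew_mk,
      nSkew'_mk] at this
    exact sub_eq_zero.mp ((smul_eq_zero.mp this).resolve_left (kk_ne_zero D i))
  have key0 := key 0
  have key1 := key lam
  simp only [vq, LinearMap.smul_apply, map_zero, zpow_zero, one_smul] at key0 key1
  rw [key0, ← sub_eq_zero, ← sub_smul] at key1
  have hv0 := (smul_eq_zero.mp key1).resolve_left (by
    intro h0
    have h2 := q_zpow_injective (sub_eq_zero.mp h0)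
    simp only [LinearMap.smul_apply, LinearMap.neg_apply, smul_eq_mul] at h2
    have h3 : D.ℓ i * D.h i lam = 0 := by omega
    exact (mul_ne_zero (D.ℓ_ne_zero i) hlam) h3)
  have hv1 := congrArg (nScale (chi D) (eta D) (fun j => q ^ (D.ℓ i • D.h i) (D.α j))) hv0
  rw [map_zero, nScale_inv_apply] at hv1
  · exact nMk_eq_zero.mp hv1
  · ext j
    simp only [Pi.mul_apply, Pi.one_apply]
    rw [← zpow_add₀ q_ne_zero]
    simp

theorem verma_lift_e_of_mem_rad (lam : P) {y : FreeAlgebra Kq I} (hy : y ∈ rad (chi D) (eta D)) :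
    FreeAlgebra.lift Kq (fun j => verma D lam (.e j)) y = 0 := nich_ext fun x => by
  rw [verma_lift_e, nMk_eq_zero.mpr (mul_mem_rad_right x hy), LinearMap.zero_apply]

/-- Induction on the degree. By the twisted commutator formula, a polynomial from the radical
evaluated at the `f_j` commutes with every `e_i` up to signs on the letters. It acts on the lowest
weight vector by its constant term, which is zero, and the `e_i` generate the module from that
vector. -/
theorem verma_lift_f_of_mem_rad (lam : P) {y : FreeAlgebra Kq I} (hy : y ∈ rad (chi D) (eta D)) :
    FreeAlgebra.lift Kq (fun j => verma D lam (.f j)) y = 0 := by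
  obtain ⟨n, hn⟩ := exists_mem_nilp (χ := chi D) (η := eta D) (chi' D) y
  induction n generalizing y with
  | zero =>
    have : y = 0 := by simpa [nilp] using hn
    simp [this]
  | succ n ih =>
    set φ := FreeAlgebra.lift Kq (fun j => verma D lam (.f j)) with hφ
    have hcomm : ∀ i, ∀ z ∈ rad (chi D) (eta D), z ∈ nilp (chi D) (eta D) (chi' D) (n + 1) →
        verma D lam (.e i) * φ z = φ (scale (sgn D i) z) * verma D lam (.e i) := by
      intro i z hz hzn
      have := (verma_plain D lam).twist.comm_lift i z
      simp only [twist] at this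
      rw [mem_nilp_succ] at hzn
      rw [ih (skew_mem_rad i hz) (hzn i).1, ih (skew'_mem_rad (chi_mul_chi' D) i hz) (hzn i).2,
        mul_zero, mul_zero, sub_zero, smul_zero, add_zero, smul_mul_assoc, mul_smul_comm] at this
      have h2 := congrArg (par D i • ·) this
      simpa only [smul_smul, par_mul_self, one_smul] using h2
    have hone : ∀ z, φ z (nMk _ _ 1) = cst z • nMk _ _ 1 := by
      intro z
      induction z using FreeAlgebra.induction with
      | grade0 r => simp [Module.algebraMap_end_apply]
      | grade1 i => simp [φ, verma_f_one]
      | mul a b ha hb => rw [map_mul, Module.End.mul_apply, hb, map_smul, ha, map_mul, smul_smul,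
          mul_comm]
      | add a b ha hb => rw [map_add, LinearMap.add_apply, hb, ha, map_add, add_smul]
    -- The common kernel of all such polynomials is needed, not that of one of them, because passing
    -- an `e_i` rescales the letters of the polynomial.
    let T : Submodule Kq (FreeAlgebra Kq I) :=
      ⨅ z : ↥(rad (chi D) (eta D) ⊓ nilp (chi D) (eta D) (chi' D) (n + 1)),
        LinearMap.ker ((φ z).comp (nMk (chi D) (eta D)))
    have hT : ∀ x, x ∈ T ↔ ∀ z ∈ rad (chi D) (eta D),
        z ∈ nilp (chi D) (eta D) (chi' D) (n + 1) → φ z (nMk _ _ x) = 0 := fun x => by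
      simp [T, Submodule.mem_iInf]
    refine nich_ext fun x => ?_
    rw [LinearMap.zero_apply]
    refine (hT x).mp (free_left_induction T ?_ ?_ x) y hy hn
    · rw [hT]
      intro z hz _
      rw [hone, cst_of_mem_rad hz, zero_smul]
    · intro i x hx
      rw [hT] at hx ⊢
      intro z hz hzn
      have h1 := DFunLike.congr_fun (hcomm i _ (scale_mem_rad (sgn D i) hz)
        (scale_mem_nilp (sgn D i) hzn)) (nMk _ _ x)
      rw [scale_scale, show sgn D i * sgn D i = 1 from funext fun j => sgn_mul_self D i j,
        scale_one_apply, Module.End.mul_apply, Module.End.mul_apply,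
        hx _ (scale_mem_rad _ hz) (scale_mem_nilp _ hzn), map_zero] at h1
      exact h1.symm

theorem lift_smul_of_mem_rad {S : Type*} [Ring S] [Algebra Kq S] (E : I → S) (c : I → Kq)
    (h : ∀ y ∈ rad (chi D) (eta D), FreeAlgebra.lift Kq E y = 0) :
    ∀ y ∈ rad (chi D) (eta D), FreeAlgebra.lift Kq (fun j => c j • E j) y = 0 := by
  intro y hy
  have : FreeAlgebra.lift Kq (fun j => c j • E j) = (FreeAlgebra.lift Kq E).comp (scale c) := by
    ext j
    simp
  rw [this, AlgHom.comp_apply, h _ (scale_mem_rad c hy)]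

/-! ## The universal property of the quantum superalgebra -/

theorem mem_plusAlg_iff {S : Type*} [Ring S] [Algebra Kq S] (E : I → S) (a : S) :
    a ∈ plusAlg E ↔ ∃ y, FreeAlgebra.lift Kq E y = a := by
  rw [plusAlg, Algebra.adjoin_range_eq_range_freeAlgebra_lift]
  rfl

theorem exists_lift_of_mem_plusIdeal {S : Type*} [Ring S] [Algebra Kq S] (E : I → S) (a : S)
    (ha : a ∈ plusIdeal E) : ∃ y, cst y = 0 ∧ FreeAlgebra.lift Kq E y = a := by
  induction ha using Submodule.span_induction with
  | mem z hz =>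
    obtain ⟨u, hu, v, hv, i, rfl⟩ := hz
    obtain ⟨x, rfl⟩ := (mem_plusAlg_iff E u).mp hu
    obtain ⟨y, rfl⟩ := (mem_plusAlg_iff E v).mp hv
    exact ⟨x * FreeAlgebra.ι Kq i * y, by simp, by simp⟩
  | zero => exact ⟨0, by simp, by simp⟩
  | add z w _ _ hz hw =>
    obtain ⟨x, hx, rfl⟩ := hz
    obtain ⟨y, hy, rfl⟩ := hw
    exact ⟨x + y, by simp [hx, hy], by simp⟩
  | smul c z _ hz =>
    obtain ⟨x, hx, rfl⟩ := hz
    exact ⟨c • x, by simp [hx], by simp⟩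

theorem algHom_lift_apply {S T : Type*} [Ring S] [Algebra Kq S] [Ring T] [Algebra Kq T]
    (φ : S →ₐ[Kq] T) (E : I → S) (y : FreeAlgebra Kq I) :
    φ (FreeAlgebra.lift Kq E y) = FreeAlgebra.lift Kq (fun j => φ (E j)) y := by
  have : φ.comp (FreeAlgebra.lift Kq E) = FreeAlgebra.lift Kq (fun j => φ (E j)) := by
    ext j
    simp
  exact DFunLike.congr_fun this y

/-- An algebra with the relations, acting on all Verma-type modules, in which the radical
vanishes, has no singular elements. -/
theorem no_singular_of_verma {S : Type*} [Ring S] [Algebra Kq S] (g : Gen I P → S)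
    (κ : P → S →ₐ[Kq] Module.End Kq (Nn D)) (hκ : ∀ lam x, κ lam (g x) = verma D lam x)
    (h : ∀ y ∈ rad (chi D) (eta D), FreeAlgebra.lift Kq (fun j => g (.e j)) y = 0)
    (a : S) (ha : a ∈ plusIdeal (fun i => g (.e i)))
    (hb : ∀ i, ∃ b ∈ plusAlg (fun i => g (.e i)), g (.f i) * a = b * g (.f i)) : a = 0 := by
  obtain ⟨y, hy, rfl⟩ := exists_lift_of_mem_plusIdeal _ a ha
  refine h y (mem_rad_of_verma_singular D hy fun lam i => ?_)
  obtain ⟨b, _, hb2⟩ := hb i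
  -- On the lowest weight vector the right-hand side dies, since it ends with `f_i`; the image of
  -- `a` there is a singular vector.
  have h1 := DFunLike.congr_fun (congrArg (κ lam) hb2) (nMk _ _ 1)
  rw [map_mul, map_mul, hκ, Module.End.mul_apply, Module.End.mul_apply, verma_f_one, map_zero] at h1
  have h2 : (κ lam).comp (FreeAlgebra.lift Kq (fun j => g (.e j))) =
      FreeAlgebra.lift Kq (fun j => verma D lam (.e j)) := by
    ext1
    funext j
    simp [hκ]
  rw [← h2]
  exact h1

theorem PlainRel.map {D : Datum I P} {S T : Type*} [Ring S] [Algebra Kq S] [Ring T] [Algebra Kq T]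
    {g : Gen I P → S} (φ : S →ₐ[Kq] T) (hφ : Function.Injective φ)
    (h : PlainRel D (fun x => φ (g x))) : PlainRel D g where
  qpow_zero := hφ (by simpa using h.qpow_zero)
  qpow_add a b := hφ (by simpa using h.qpow_add a b)
  qpow_e a i := hφ (by rw [map_smul, map_mul, map_mul]; exact h.qpow_e a i)
  qpow_f a i := hφ (by rw [map_smul, map_mul, map_mul]; exact h.qpow_f a i)
  e_f_same i := hφ (by
    rw [map_smul, map_sub, map_sub, map_smul, map_mul, map_mul]; exact h.e_f_same i)
  e_f_diff i j hij := hφ (by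
    rw [map_sub, map_smul, map_mul, map_mul, map_zero]; exact h.e_f_diff i j hij)
  σ_sq := hφ (by rw [map_mul, map_one]; exact h.σ_sq)
  σ_e i := hφ (by rw [map_smul, map_mul, map_mul]; exact h.σ_e i)
  σ_f i := hφ (by rw [map_smul, map_mul, map_mul]; exact h.σ_f i)
  σ_qpow a := hφ (by rw [map_mul, map_mul]; exact h.σ_qpow a)

theorem PlainRel.prod {D : Datum I P} {S T : Type*} [Ring S] [Algebra Kq S] [Ring T] [Algebra Kq T]
    {g : Gen I P → S} {g' : Gen I P → T} (h : PlainRel D g) (h' : PlainRel D g') :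
    PlainRel D (fun x => (g x, g' x)) where
  qpow_zero := Prod.ext h.qpow_zero h'.qpow_zero
  qpow_add a b := Prod.ext (h.qpow_add a b) (h'.qpow_add a b)
  qpow_e a i := Prod.ext (h.qpow_e a i) (h'.qpow_e a i)
  qpow_f a i := Prod.ext (h.qpow_f a i) (h'.qpow_f a i)
  e_f_same i := Prod.ext (h.e_f_same i) (h'.e_f_same i)
  e_f_diff i j hij := Prod.ext (h.e_f_diff i j hij) (h'.e_f_diff i j hij)
  σ_sq := Prod.ext h.σ_sq h'.σ_sq
  σ_e i := Prod.ext (h.σ_e i) (h'.σ_e i)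
  σ_f i := Prod.ext (h.σ_f i) (h'.σ_f i)
  σ_qpow a := Prod.ext (h.σ_qpow a) (h'.σ_qpow a)

theorem PlainRel.pi {D : Datum I P} {ι : Type*} {S : ι → Type*} [∀ k, Ring (S k)]
    [∀ k, Algebra Kq (S k)] {g : ∀ k, Gen I P → S k} (h : ∀ k, PlainRel D (g k)) :
    PlainRel D (fun x k => g k x) where
  qpow_zero := funext fun k => (h k).qpow_zero
  qpow_add a b := funext fun k => (h k).qpow_add a b
  qpow_e a i := funext fun k => (h k).qpow_e a i
  qpow_f a i := funext fun k => (h k).qpow_f a i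
  e_f_same i := funext fun k => (h k).e_f_same i
  e_f_diff i j hij := funext fun k => (h k).e_f_diff i j hij
  σ_sq := funext fun k => (h k).σ_sq
  σ_e i := funext fun k => (h k).σ_e i
  σ_f i := funext fun k => (h k).σ_f i
  σ_qpow a := funext fun k => (h k).σ_qpow a

/-- An algebra with the plain relations in which the radical vanishes receives an algebra map
from the quantum superalgebra. -/
theorem exists_algHom_of_plainRel {S : Type*} [Ring S] [Algebra Kq S] (g : Gen I P → S)
    (hg : PlainRel D g)
    (he : ∀ y ∈ rad (chi D) (eta D), FreeAlgebra.lift Kq (fun j => g (.e j)) y = 0)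
    (hf : ∀ y ∈ rad (chi D) (eta D), FreeAlgebra.lift Kq (fun j => g (.f j)) y = 0) :
    ∃ Φ : Uq D →ₐ[Kq] S, ∀ x, Φ (gen D x) = g x := by
  -- `S` alone may contain singular elements. The generators are therefore placed in the product of
  -- `S` with all Verma-type modules and all their twists, which detect them. The algebra generated
  -- there, presented as a quotient of the free algebra, satisfies all the relations and projects to
  -- `S`.
  let V := P → Module.End Kq (Nn D)
  let G : Gen I P → S × V × V := fun x =>
    (g x, fun lam => verma D lam x, fun lam => twistInv D (verma D lam) x)
  have hG : PlainRel D G :=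
    hg.prod ((PlainRel.pi fun lam => verma_plain D lam).prod
      (PlainRel.pi fun lam => (verma_plain D lam).twistInv))
  let ψ : FreeAlgebra Kq (Gen I P) →ₐ[Kq] S × V × V := FreeAlgebra.lift Kq G
  let c : RingCon (FreeAlgebra Kq (Gen I P)) := RingCon.ker ψ.toRingHom
  let π : c.Quotient →ₐ[Kq] S × V × V :=
    { RingCon.lift c ψ.toRingHom (fun _ _ h => h) with
      commutes' := fun r => ψ.commutes r }
  have hπ : Function.Injective π := by
    intro a b
    induction a using Quotient.inductionOn' with | _ x =>
    induction b using Quotient.inductionOn' with | _ y =>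
    intro h
    exact (RingCon.eq c).mpr h
  let gc : Gen I P → c.Quotient := fun x => c.mk' (FreeAlgebra.ι Kq x)
  have hgc : ∀ x, π (gc x) = G x := fun x => FreeAlgebra.lift_ι_apply G x
  have hplain : PlainRel D gc := PlainRel.map π hπ (by simpa only [hgc] using hG)
  let κ₁ : P → (S × V × V) →ₐ[Kq] Module.End Kq (Nn D) := fun lam =>
    (Pi.evalAlgHom Kq _ lam).comp ((AlgHom.fst Kq V V).comp (AlgHom.snd Kq S (V × V)))
  let κ₂ : P → (S × V × V) →ₐ[Kq] Module.End Kq (Nn D) := fun lam =>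
    (Pi.evalAlgHom Kq _ lam).comp ((AlgHom.snd Kq V V).comp (AlgHom.snd Kq S (V × V)))
  have hzero : ∀ (E : I → c.Quotient) (y : FreeAlgebra Kq I),
      FreeAlgebra.lift Kq (fun j => (π (E j)).1) y = 0 →
      (∀ lam, FreeAlgebra.lift Kq (fun j => κ₁ lam (π (E j))) y = 0) →
      (∀ lam, FreeAlgebra.lift Kq (fun j => κ₂ lam (π (E j))) y = 0) →
      FreeAlgebra.lift Kq E y = 0 := by
    intro E y h0 h1 h2
    refine hπ ?_
    rw [map_zero]
    refine Prod.ext ?_ (Prod.ext (funext fun lam => ?_) (funext fun lam => ?_))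
    · exact (algHom_lift_apply ((AlgHom.fst Kq S (V × V)).comp π) E y).trans h0
    · exact (algHom_lift_apply ((κ₁ lam).comp π) E y).trans (h1 lam)
    · exact (algHom_lift_apply ((κ₂ lam).comp π) E y).trans (h2 lam)
  have hrel : Relations D c.Quotient gc := by
    refine ⟨hplain.qpow_zero, hplain.qpow_add, hplain.qpow_e, hplain.qpow_f, hplain.e_f_same,
      hplain.e_f_diff, hplain.σ_sq, hplain.σ_e, hplain.σ_f, hplain.σ_qpow, ?_, ?_⟩
    · refine no_singular_of_verma D gc (fun lam => (κ₁ lam).comp π)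
        (fun lam x => by rw [AlgHom.comp_apply, hgc]; rfl) fun y hy => hzero _ y ?_ ?_ ?_
      · simp only [hgc]
        exact he y hy
      · intro lam
        simp only [hgc]
        exact verma_lift_e_of_mem_rad D lam hy
      · intro lam
        simp only [hgc]
        exact lift_smul_of_mem_rad D _ (par D) (fun z hz => verma_lift_f_of_mem_rad D lam hz) y hy
    -- The condition on the `f_i` is the condition on the `e_i` for the twisted generators; the
    -- second family of modules becomes the plain Verma-type family after this twist.
    · intro a ha hb
      refine no_singular_of_verma D (twist D gc) (fun lam => (κ₂ lam).comp π) (fun lam x => ?_)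
        (fun y hy => hzero _ y ?_ ?_ ?_) a ha fun i => ?_
      · rw [← twist_twistInv D (verma D lam)]
        cases x <;> simp only [twist, AlgHom.comp_apply, map_smul, hgc] <;> rfl
      · simp only [twist, hgc]
        exact hf y hy
      · intro lam
        simp only [twist, hgc]
        exact verma_lift_f_of_mem_rad D lam hy
      · intro lam
        simp only [twist, hgc]
        exact verma_lift_e_of_mem_rad D lam hy
      · obtain ⟨b, hb1, hb2⟩ := hb i
        exact ⟨b, hb1, by simp only [twist, smul_mul_assoc, mul_smul_comm, hb2]⟩
  exact ⟨((AlgHom.fst Kq S (V × V)).comp π).comp (toQuot D c hrel), fun x => by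
    rw [AlgHom.comp_apply, toQuot_gen]
    exact congrArg Prod.fst (hgc x)⟩

end

end QSuper

end

noncomputable section

namespace QSuper

variable {I P : Type*} [AddCommGroup P]

/-! ## The comultiplication -/

section PlainSigma

variable {D : Datum I P} {S : Type*} [Ring S] [Algebra Kq S] {g : Gen I P → S}

theorem PlainRel.σ_mul_e (h : PlainRel D g) (j : I) :
    g .σ * g (.e j) = par D j • (g (.e j) * g .σ) := by
  rw [← smul_mul_assoc, ← h.σ_e, mul_assoc _ (g .σ), h.σ_sq, mul_one]

theorem PlainRel.σ_mul_f (h : PlainRel D g) (j : I) :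
    g .σ * g (.f j) = par D j • (g (.f j) * g .σ) := by
  rw [← smul_mul_assoc, ← h.σ_f, mul_assoc _ (g .σ), h.σ_sq, mul_one]

theorem PlainRel.σ_mul_qpow (h : PlainRel D g) (a : Module.Dual ℤ P) :
    g .σ * g (.qpow a) = g (.qpow a) * g .σ := by
  nth_rewrite 2 [← h.σ_qpow]
  rw [mul_assoc _ (g .σ), h.σ_sq, mul_one]

theorem PlainRel.σ_pow_mul_e (h : PlainRel D g) (i j : I) :
    g .σ ^ (D.p i : ℕ) * g (.e j) = sgn D i j • (g (.e j) * g .σ ^ (D.p i : ℕ)) := by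
  rw [sgn_eq_par]
  generalize D.p i = n
  fin_cases n
  · simp
  · simpa using h.σ_mul_e j

theorem PlainRel.σ_pow_mul_f (h : PlainRel D g) (i j : I) :
    g .σ ^ (D.p i : ℕ) * g (.f j) = sgn D i j • (g (.f j) * g .σ ^ (D.p i : ℕ)) := by
  rw [sgn_eq_par]
  generalize D.p i = n
  fin_cases n
  · simp
  · simpa using h.σ_mul_f j

theorem PlainRel.σ_pow_mul_qpow (h : PlainRel D g) (i : I) (a : Module.Dual ℤ P) :
    g .σ ^ (D.p i : ℕ) * g (.qpow a) = g (.qpow a) * g .σ ^ (D.p i : ℕ) :=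
  (Commute.pow_left (h.σ_mul_qpow a) _)

theorem PlainRel.qpow_comm (h : PlainRel D g) (a b : Module.Dual ℤ P) :
    g (.qpow a) * g (.qpow b) = g (.qpow b) * g (.qpow a) := by
  rw [← h.qpow_add, ← h.qpow_add, add_comm]

theorem PlainRel.f_qpow (h : PlainRel D g) (a : Module.Dual ℤ P) (i : I) :
    g (.f i) * g (.qpow a) = q ^ (a (D.α i)) • (g (.qpow a) * g (.f i)) := by
  rw [h.qpow_f, smul_smul, ← zpow_add₀ q_ne_zero, add_neg_cancel, zpow_zero, one_smul]

theorem PlainRel.σ_pow_mul_self (h : PlainRel D g) (i : I) :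
    g .σ ^ (D.p i : ℕ) * g .σ ^ (D.p i : ℕ) = 1 := by
  rw [← pow_add, ← two_mul, pow_mul, pow_two, h.σ_sq, one_pow]

end PlainSigma

variable (D : Datum I P)

/-- The values of the comultiplication on the generators. -/
def comulGen : Gen I P → Uq D ⊗[Kq] Uq D
  | .e i => gen D (.e i) ⊗ₜ tinv D i + (gen D .σ ^ (D.p i : ℕ)) ⊗ₜ gen D (.e i)
  | .f i => gen D (.f i) ⊗ₜ 1 + (gen D .σ ^ (D.p i : ℕ) * t D i) ⊗ₜ gen D (.f i)
  | .qpow h => gen D (.qpow h) ⊗ₜ gen D (.qpow h)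
  | .σ => gen D .σ ⊗ₜ gen D .σ

theorem gen_plain : PlainRel D (gen D) := (relations_gen D).plain

/-- The cross terms cancel. Moving `t_j` past `e_i` and `t_i⁻¹` past `f_j` gives inverse powers of
`q`, because the form is symmetric, and the two signs from `σ` square to one. -/
theorem comulGen_e_f (i j : I) : comulGen D (.e i) * comulGen D (.f j) -
    sgn D i j • (comulGen D (.f j) * comulGen D (.e i)) =
    (gen D (.e i) * gen D (.f j) - sgn D i j • (gen D (.f j) * gen D (.e i))) ⊗ₜ tinv D i +
    (gen D .σ ^ (D.p i : ℕ) * (gen D .σ ^ (D.p j : ℕ) * t D j)) ⊗ₜ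
      (gen D (.e i) * gen D (.f j) - sgn D i j • (gen D (.f j) * gen D (.e i))) := by
  have h := gen_plain D
  have h1 : gen D .σ ^ (D.p j : ℕ) * t D j * gen D (.e i) =
      (sgn D i j * q ^ (D.ℓ j * D.h j (D.α i))) •
        (gen D (.e i) * (gen D .σ ^ (D.p j : ℕ) * t D j)) := by
    rw [mul_assoc, t, h.qpow_e, mul_smul_comm, ← mul_assoc, h.σ_pow_mul_e, smul_mul_assoc,
      smul_smul, mul_assoc, sgn_comm, mul_comm (sgn D i j)]
    simp
  have h2 : gen D (.f j) * tinv D i = q ^ (-(D.ℓ j * D.h j (D.α i))) • (tinv D i * gen D (.f j)) := by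
    rw [tinv, h.f_qpow, pairing_symm]
    simp
  have h3 : gen D .σ ^ (D.p j : ℕ) * t D j * gen D .σ ^ (D.p i : ℕ) =
      gen D .σ ^ (D.p i : ℕ) * (gen D .σ ^ (D.p j : ℕ) * t D j) := by
    rw [t, mul_assoc, ← h.σ_pow_mul_qpow, ← mul_assoc, ← mul_assoc, ← pow_add, ← pow_add, add_comm]
  simp only [comulGen, mul_add, add_mul, Algebra.TensorProduct.tmul_mul_tmul, one_mul, mul_one,
    h.σ_pow_mul_f i j, h1, h2, h3]
  simp only [TensorProduct.smul_tmul', TensorProduct.tmul_smul, TensorProduct.sub_tmul,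
    TensorProduct.tmul_sub, smul_add, smul_smul]
  have hz : sgn D i j * (q ^ (-(D.ℓ j * D.h j (D.α i))) * (sgn D i j * q ^ (D.ℓ j * D.h j (D.α i))))
      = 1 := by
    rw [mul_comm (sgn D i j) (q ^ _), ← mul_assoc (q ^ _), ← zpow_add₀ q_ne_zero, neg_add_cancel,
      zpow_zero, one_mul, sgn_mul_self]
  simp only [hz, one_smul]
  abel

theorem comulGen_plain : PlainRel D (comulGen D) := by
  have h := gen_plain D
  refine ⟨?_, ?_, ?_, ?_, ?_, ?_, ?_, ?_, ?_, ?_⟩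
  · simp only [comulGen]
    rw [h.qpow_zero, Algebra.TensorProduct.one_def]
  · intro a b
    simp only [comulGen]
    rw [h.qpow_add, Algebra.TensorProduct.tmul_mul_tmul]
  · intro a i
    simp only [comulGen, mul_add, add_mul, Algebra.TensorProduct.tmul_mul_tmul, h.qpow_e, tinv,
      h.qpow_comm a, h.σ_pow_mul_qpow, TensorProduct.smul_tmul', TensorProduct.tmul_smul, smul_add]
  · intro a i
    simp only [comulGen, mul_add, add_mul, Algebra.TensorProduct.tmul_mul_tmul, h.qpow_f, t,
      TensorProduct.smul_tmul', TensorProduct.tmul_smul, smul_add, one_mul, mul_one]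
    rw [← mul_assoc, ← h.σ_pow_mul_qpow, mul_assoc, mul_assoc, h.qpow_comm]
  · intro i
    rw [comulGen_e_f, h.e_f_same]
    simp only [comulGen]
    rw [← mul_assoc, h.σ_pow_mul_self, one_mul, TensorProduct.tmul_smul, ← TensorProduct.smul_tmul',
      ← smul_add, t, tinv, TensorProduct.sub_tmul, TensorProduct.tmul_sub]
    congr 1
    abel
  · intro i j hij
    rw [comulGen_e_f, h.e_f_diff i j hij, TensorProduct.zero_tmul, TensorProduct.tmul_zero, add_zero]
  · simp only [comulGen]
    rw [Algebra.TensorProduct.tmul_mul_tmul, h.σ_sq, Algebra.TensorProduct.one_def]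
  · intro i
    have h2 : gen D .σ * gen D .σ ^ (D.p i : ℕ) * gen D .σ = gen D .σ ^ (D.p i : ℕ) := by
      rw [← pow_succ', pow_succ, mul_assoc, h.σ_sq, mul_one]
    simp only [comulGen, mul_add, add_mul, Algebra.TensorProduct.tmul_mul_tmul, h.σ_e, tinv,
      h.σ_qpow, h2, TensorProduct.smul_tmul', TensorProduct.tmul_smul, smul_add]
  · intro i
    have h2 : gen D .σ * (gen D .σ ^ (D.p i : ℕ) * t D i) * gen D .σ =
        gen D .σ ^ (D.p i : ℕ) * t D i := by
      rw [t, ← mul_assoc, ← pow_succ', pow_succ, mul_assoc, mul_assoc, ← mul_assoc (gen D .σ),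
        h.σ_qpow]
    simp only [comulGen, mul_add, add_mul, Algebra.TensorProduct.tmul_mul_tmul, h.σ_f, h2, mul_one,
      h.σ_sq, TensorProduct.smul_tmul', TensorProduct.tmul_smul, smul_add]
  · intro a
    simp only [comulGen, Algebra.TensorProduct.tmul_mul_tmul, h.σ_qpow]

/-- The two summands commute up to `chi`. Each consists of the `e_i` tensored with a commuting
family, the `t_i⁻¹` or the powers of `σ`, up to exchange of the factors, so each kills the radical
and the coideal property applies. -/
theorem comulGen_lift_e {y : FreeAlgebra Kq I} (hy : y ∈ rad (chi D) (eta D)) :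
    FreeAlgebra.lift Kq (fun j => comulGen D (.e j)) y = 0 := by
  have h := gen_plain D
  refine lift_add_eq_zero_of_mem_rad (chi_symm D) (fun i => gen D (.e i) ⊗ₜ[Kq] tinv D i)
    (fun i => (gen D .σ ^ (D.p i : ℕ)) ⊗ₜ[Kq] gen D (.e i)) (fun i j => ?_) (fun x hx => ?_)
    (fun x hx => ?_) hy
  · simp only [Algebra.TensorProduct.tmul_mul_tmul, h.σ_pow_mul_e, tinv, h.e_qpow, chi,
      TensorProduct.tmul_smul, ← TensorProduct.smul_tmul', smul_smul]
    rw [pairing_symm, mul_comm]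
    simp
  · exact (relations_gen D).lift_tmul_eq_zero (tinv D) (fun i j => h.qpow_comm _ _) hx
  · have h1 := (relations_gen D).lift_tmul_eq_zero (fun i => gen D .σ ^ (D.p i : ℕ))
      (fun i j => by rw [← pow_add, ← pow_add, add_comm]) hx
    have h2 := congrArg (Algebra.TensorProduct.comm Kq (Uq D) (Uq D)).toAlgHom h1
    rw [algHom_lift_apply, map_zero] at h2
    simpa using h2

/-- Same argument after the twist, with the two summands taken in the opposite order so that they
commute by `chi` and not by its inverse. -/
theorem comulGen_lift_f {y : FreeAlgebra Kq I} (hy : y ∈ rad (chi D) (eta D)) :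
    FreeAlgebra.lift Kq (fun j => comulGen D (.f j)) y = 0 := by
  have h := gen_plain D
  have := lift_add_eq_zero_of_mem_rad (chi_symm D)
    (fun i => (gen D .σ ^ (D.p i : ℕ) * t D i) ⊗ₜ[Kq] gen D (.f i))
    (fun i => gen D (.f i) ⊗ₜ[Kq] (1 : Uq D)) (fun i j => ?_) (fun x hx => ?_)
    (fun x hx => ?_) hy
  · simp only [comulGen]
    simpa only [add_comm] using this
  · simp only [Algebra.TensorProduct.tmul_mul_tmul, one_mul, mul_one, chi]
    rw [mul_assoc _ (t D j), t, h.qpow_f, mul_smul_comm, ← mul_assoc _ (gen D (.f i)),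
      h.σ_pow_mul_f, ← TensorProduct.smul_tmul', smul_mul_assoc, ← TensorProduct.smul_tmul',
      smul_smul, smul_smul, pairing_symm, sgn_comm D i j]
    rw [show sgn D j i * q ^ (D.ℓ j * (D.h j) (D.α i)) *
      q ^ (-(D.ℓ j • D.h j) (D.α i)) * sgn D j i = (sgn D j i * sgn D j i) *
        (q ^ (D.ℓ j * (D.h j) (D.α i)) * q ^ (-(D.ℓ j • D.h j) (D.α i))) by ring,
      sgn_mul_self, ← zpow_add₀ q_ne_zero]
    simp [mul_assoc]
  · have h1 := (relations_gen D).twist.lift_tmul_eq_zero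
      (fun i => gen D .σ ^ (D.p i : ℕ) * t D i) (fun i j => ?_) hx
    · have h2 := congrArg (Algebra.TensorProduct.comm Kq (Uq D) (Uq D)).toAlgHom h1
      rw [algHom_lift_apply, map_zero] at h2
      simpa [twist] using h2
    · have c1 : Commute (gen D .σ) (gen D .σ) := Commute.refl _
      have c2 : ∀ k, Commute (gen D .σ) (t D k) := fun k => h.σ_mul_qpow _
      have c3 : Commute (t D i) (t D j) := h.qpow_comm _ _
      exact ((c1.pow_pow _ _).mul_right ((c2 j).pow_left _)).mul_left
        ((((c2 i).pow_left _).symm).mul_right c3)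
  · exact (relations_gen D).twist.lift_tmul_eq_zero (fun _ => (1 : Uq D)) (fun i j => rfl) hx

theorem exists_isComul : ∃ Δ : Uq D →ₐ[Kq] Uq D ⊗[Kq] Uq D, IsComul D Δ := by
  obtain ⟨Δ, hΔ⟩ := exists_algHom_of_plainRel D (comulGen D) (comulGen_plain D)
    (fun _ hy => comulGen_lift_e D hy) (fun _ hy => comulGen_lift_f D hy)
  exact ⟨Δ, hΔ _, fun h => hΔ _, fun i => hΔ _, fun i => hΔ _⟩

end QSuper

end

noncomputable section

namespace QSuper

/-! ## Integrable representations of rank one -/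

section Graded

variable {K P M : Type*} [Field K] [AddCommGroup M] [Module K M]

open Classical in
theorem exists_linearMap_of_graded {W : P → Submodule K M} (hi : iSupIndep W) (ht : ⨆ μ, W μ = ⊤)
    {N : Type*} [AddCommGroup N] [Module K N] (T : ∀ μ, W μ →ₗ[K] N) :
    ∃ S : M →ₗ[K] N, ∀ μ (u : W μ), S u = T μ u := by
  have h := DirectSum.isInternal_submodule_of_iSupIndep_of_iSup_eq_top hi ht
  let φ := LinearEquiv.ofBijective (DirectSum.coeLinearMap W) h
  refine ⟨(DirectSum.toModule K P N T).comp φ.symm.toLinearMap, fun μ u => ?_⟩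
  have : φ.symm (u : M) = DirectSum.lof K P (fun μ => W μ) μ u := by
    rw [LinearEquiv.symm_apply_eq]
    exact (DirectSum.coeLinearMap_lof W μ u).symm
  rw [LinearMap.comp_apply, LinearEquiv.coe_coe, this, DirectSum.toModule_lof]

theorem graded_induction {W : P → Submodule K M} (ht : ⨆ μ, W μ = ⊤) {p : M → Prop}
    (h0 : p 0) (ha : ∀ u v, p u → p v → p (u + v)) (hw : ∀ μ, ∀ u ∈ W μ, p u) (u : M) : p u :=
  Submodule.iSup_induction W (motive := p) (by rw [ht]; trivial) hw h0 ha

end Graded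

section QInt

variable {K : Type*} [Field K]

/-- The quantum integer `[n]` for `n : ℤ` and the parameter `p`. -/
def qn (p : K) (n : ℤ) : K := (p ^ n - p ^ (-n)) / (p - p⁻¹)

@[simp] theorem qn_zero (p : K) : qn p 0 = 0 := by simp [qn]

theorem qn_neg (p : K) (n : ℤ) : qn p (-n) = -qn p n := by
  rw [qn, qn, neg_neg, ← neg_sub, neg_div]

theorem qn_inv (p : K) (n : ℤ) : qn p⁻¹ n = qn p n := by
  rw [qn, qn, inv_zpow', inv_zpow', inv_inv, neg_neg, ← neg_sub (p ^ n), ← neg_sub p, neg_div_neg_eq]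

theorem qn_one {p : K} (hp : p - p⁻¹ ≠ 0) : qn p 1 = 1 := by
  rw [qn, zpow_one, zpow_neg_one, div_self hp]

/-- With `b` the weight lowered by `a`, this is the arithmetic of the induction in `RankOne.e_dpow`.
-/
theorem qn_mul_identity {p : K} (h0 : p ≠ 0) (hp : p - p⁻¹ ≠ 0) (a b : ℤ) :
    qn p (a + 1) * qn p b = qn p a * qn p (b + 1) + qn p (b - a) := by
  have h1 : ∀ m n : ℤ, p ^ (m + n) = p ^ m * p ^ n := fun m n => zpow_add₀ h0 m n
  have ha : p ^ a * p ^ (-a) = 1 := by rw [← h1, add_neg_cancel, zpow_zero]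
  have hb : p ^ b * p ^ (-b) = 1 := by rw [← h1, add_neg_cancel, zpow_zero]
  rw [qn, qn, qn, qn, qn, neg_add, neg_add, sub_eq_add_neg b a, neg_add b, neg_neg,
    div_mul_div_comm, div_mul_div_comm, div_add_div _ _ (mul_ne_zero hp hp) hp,
    div_eq_div_iff (mul_ne_zero hp hp) (mul_ne_zero (mul_ne_zero hp hp) hp)]
  simp only [h1, zpow_one, zpow_neg_one]
  generalize p ^ a = x at *
  generalize p ^ (-a) = x' at *
  generalize p ^ b = y at *
  generalize p ^ (-b) = y' at *
  generalize p⁻¹ = p' at *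
  ring

/-- The quantum factorial. -/
def qf (p : K) : ℕ → K
  | 0 => 1
  | n + 1 => qn p (n + 1 : ℕ) * qf p n

end QInt

variable {K P M : Type*} [Field K] [AddCommGroup P] [AddCommGroup M] [Module K M]

/-- The pair of operators `e`, `f` makes the `P`-graded vector space `M` an integrable
representation of the quantum enveloping algebra of rank one with the parameter `p`. -/
structure RankOne (p : K) (h : Module.Dual ℤ P) (α : P) (W : P → Submodule K M)
    (e f : Module.End K M) : Prop where
  h_α : h α = 2
  p_ne : p ≠ 0
  qn_ne : ∀ n : ℤ, n ≠ 0 → qn p n ≠ 0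
  indep : iSupIndep W
  top : ⨆ μ, W μ = ⊤
  e_mem : ∀ μ, ∀ u ∈ W μ, e u ∈ W (μ + α)
  f_mem : ∀ μ, ∀ u ∈ W μ, f u ∈ W (μ - α)
  comm : ∀ μ, ∀ u ∈ W μ, e (f u) - f (e u) = qn p (h μ) • u
  e_nil : ∀ μ, ∀ u ∈ W μ, ∃ N : ℕ, (e ^ N) u = 0
  f_nil : ∀ μ, ∀ u ∈ W μ, ∃ N : ℕ, (f ^ N) u = 0

/-- The divided power of an operator. -/
def dpow (p : K) (f : Module.End K M) (k : ℕ) : Module.End K M := (qf p k)⁻¹ • f ^ k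

@[simp] theorem dpow_zero (p : K) (f : Module.End K M) (v : M) : dpow p f 0 v = v := by
  simp [dpow, qf]

namespace RankOne

variable {p : K} {h : Module.Dual ℤ P} {α : P} {W : P → Submodule K M} {e f : Module.End K M}

theorem sub_inv_ne (H : RankOne p h α W e f) : p - p⁻¹ ≠ 0 := by
  intro h0
  apply H.qn_ne 1 one_ne_zero
  rw [qn, h0, div_zero]

theorem f_dpow (H : RankOne p h α W e f) (k : ℕ) (v : M) :
    f (dpow p f k v) = qn p (k + 1 : ℕ) • dpow p f (k + 1) v := by
  have h1 := H.qn_ne (k + 1 : ℕ) (by omega)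
  rw [dpow, dpow, LinearMap.smul_apply, LinearMap.smul_apply, map_smul, smul_smul, qf, mul_inv,
    ← mul_assoc, mul_inv_cancel₀ h1, one_mul, pow_succ', Module.End.mul_apply]

/-- Reversing the grading exchanges raising and lowering operators, so statements about highest
weight vectors also serve for lowest weight vectors. -/
theorem swap (H : RankOne p h α W e f) : RankOne p h α (fun μ => W (-μ)) f e where
  h_α := H.h_α
  p_ne := H.p_ne
  qn_ne := H.qn_ne
  indep := H.indep.comp neg_injective
  top := by
    rw [← H.top]
    exact (Equiv.neg P).iSup_comp (g := W)
  e_mem μ u hu := by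
    have := H.f_mem _ u hu
    rwa [← neg_add'] at this
  f_mem μ u hu := by
    have := H.e_mem _ u hu
    rwa [show -μ + α = -(μ - α) by abel] at this
  comm μ u hu := by
    rw [← neg_sub, H.comm _ u hu, map_neg, qn_neg, neg_smul, neg_neg]
  e_nil μ u hu := H.f_nil _ u hu
  f_nil μ u hu := H.e_nil _ u hu

theorem dpow_mem (H : RankOne p h α W e f) {μ : P} {v : M} (hv : v ∈ W μ) (k : ℕ) :
    dpow p f k v ∈ W (μ - k • α) := by
  refine Submodule.smul_mem _ _ ?_
  induction k with
  | zero => simpa using hv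
  | succ k ih =>
    rw [pow_succ', Module.End.mul_apply, show μ - (k + 1) • α = μ - k • α - α by
      rw [succ_nsmul]; abel]
    exact H.f_mem _ _ ih

theorem h_add (H : RankOne p h α W e f) (μ : P) (k : ℕ) : h (μ + k • α) = h μ + 2 * k := by
  rw [map_add, map_nsmul, H.h_α, nsmul_eq_mul, mul_comm]

theorem h_sub (H : RankOne p h α W e f) (μ : P) (k : ℕ) : h (μ - k • α) = h μ - 2 * k := by
  rw [map_sub, map_nsmul, H.h_α, nsmul_eq_mul, mul_comm]

theorem e_dpow (H : RankOne p h α W e f) {μ : P} {v : M} (hv : v ∈ W μ) (he : e v = 0) (k : ℕ) :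
    e (dpow p f (k + 1) v) = qn p (h μ - k) • dpow p f k v := by
  have h1 := H.qn_ne (k + 1 : ℕ) (by omega)
  have key : e (f (dpow p f k v)) = (qn p (k + 1 : ℕ) * qn p (h μ - k)) • dpow p f k v := by
    rw [← sub_add_cancel (e (f (dpow p f k v))) (f (e (dpow p f k v))),
      H.comm _ _ (H.dpow_mem hv k), H.h_sub]
    have hid := qn_mul_identity H.p_ne H.sub_inv_ne k (h μ - k)
    rw [Nat.cast_succ, hid, add_smul, add_comm, show h μ - k - k = h μ - 2 * k by ring]
    congr 1
    cases k with
    | zero => simp [he]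
    | succ k =>
      rw [H.e_dpow hv he k, map_smul, H.f_dpow, smul_smul, mul_comm]
      congr 3
      push_cast
      ring
  rw [H.f_dpow, map_smul, mul_smul] at key
  exact smul_right_injective _ h1 key

/-- If `f^(n) v` is the last nonzero divided power, applying `e` to the next one gives `[h μ - n] =
0`, so the string ends exactly at the weight. -/
theorem string_end (H : RankOne p h α W e f) {μ : P} {v : M} (hv : v ∈ W μ) (he : e v = 0)
    (h0 : v ≠ 0) : 0 ≤ h μ ∧ ∀ k : ℕ, h μ < k → dpow p f k v = 0 := by
  classical
  have hex : ∃ N : ℕ, dpow p f N v = 0 := by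
    obtain ⟨N, hN⟩ := H.f_nil μ v hv
    exact ⟨N, by rw [dpow, LinearMap.smul_apply, hN, smul_zero]⟩
  obtain ⟨n, hn⟩ : ∃ n, Nat.find hex = n + 1 := by
    refine Nat.exists_eq_succ_of_ne_zero fun h1 => h0 ?_
    have := Nat.find_spec hex
    rwa [h1, dpow_zero] at this
  have h1 : dpow p f (n + 1) v = 0 := hn ▸ Nat.find_spec hex
  have h2 : dpow p f n v ≠ 0 := Nat.find_min hex (by omega)
  have h3 := H.e_dpow hv he n
  rw [h1, map_zero] at h3
  have h4 : h μ - n = 0 := by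
    by_contra hc
    exact (smul_ne_zero (H.qn_ne _ hc) h2) h3.symm
  have h5 : ∀ m, dpow p f (n + 1 + m) v = 0 := by
    intro m
    induction m with
    | zero => exact h1
    | succ m ih =>
      have := H.f_dpow (n + 1 + m) v
      rw [ih, map_zero] at this
      exact (smul_eq_zero.mp this.symm).resolve_left (H.qn_ne _ (by omega))
  refine ⟨by omega, fun k hk => ?_⟩
  obtain ⟨m, rfl⟩ := Nat.exists_eq_add_of_le (show n + 1 ≤ k by omega)
  exact h5 m

theorem dpow_eq_zero (H : RankOne p h α W e f) {μ : P} {v : M} (hv : v ∈ W μ) (he : e v = 0)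
    {k : ℕ} (hk : h μ < k) : dpow p f k v = 0 := by
  by_cases h0 : v = 0
  · rw [h0, map_zero]
  · exact (H.string_end hv he h0).2 k hk

theorem e_pow_dpow (H : RankOne p h α W e f) {μ : P} {v : M} (hv : v ∈ W μ) (he : e v = 0)
    (k r : ℕ) (hkr : (k + r : ℕ) ≤ h μ) :
    ∃ c : K, c ≠ 0 ∧ (e ^ r) (dpow p f (k + r) v) = c • dpow p f k v := by
  induction r with
  | zero => exact ⟨1, one_ne_zero, by simp⟩
  | succ r ih =>
    obtain ⟨c, hc, h1⟩ := ih (by omega)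
    refine ⟨qn p (h μ - (k + r : ℕ)) * c, mul_ne_zero (H.qn_ne _ (by omega)) hc, ?_⟩
    rw [pow_succ, Module.End.mul_apply, ← add_assoc, H.e_dpow hv he, map_smul, h1, smul_smul]

theorem e_pow_dpow_eq_zero (H : RankOne p h α W e f) {μ : P} {v : M} (hv : v ∈ W μ)
    (he : e v = 0) (k r : ℕ) (hkr : k < r) : (e ^ r) (dpow p f k v) = 0 := by
  induction k generalizing r with
  | zero =>
    obtain ⟨r, rfl⟩ := Nat.exists_eq_add_of_lt hkr
    rw [dpow_zero, pow_succ, Module.End.mul_apply, he, map_zero]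
  | succ k ih =>
    obtain ⟨r, rfl⟩ := Nat.exists_eq_add_of_le' (show 1 ≤ r by omega)
    rw [pow_succ, Module.End.mul_apply, H.e_dpow hv he, map_smul, ih _ (by omega), smul_zero]

/-- The string generated downwards from `e^(l) w` is the string generated upwards from `w`, read
backwards. The normalisations agree because `f` multiplies consecutive vectors by the same quantum
integers in both descriptions. -/
theorem dpow_dpow_swap (H : RankOne p h α W e f) {μ : P} {w : M} (hw : w ∈ W μ) (hf : f w = 0)
    {l : ℕ} (hl : h μ = -l) (j : ℕ) (hj : j ≤ l) :
    dpow p f j (dpow p e l w) = dpow p e (l - j) w := by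
  induction j with
  | zero => simp
  | succ j ih =>
    have h1 := H.f_dpow j (dpow p e l w)
    have hw' : w ∈ (fun μ => W (-μ)) (-μ) := by simpa using hw
    obtain ⟨m, hm⟩ := Nat.exists_eq_add_of_lt (show j < l by omega)
    rw [ih (by omega), show l - j = (l - (j + 1)) + 1 by omega, H.swap.e_dpow hw' hf, map_neg, hl,
      neg_neg, show (l : ℤ) - (l - (j + 1) : ℕ) = (j + 1 : ℕ) by omega] at h1
    exact (smul_right_injective _ (H.qn_ne _ (by omega)) h1).symm

/-- A family of highest weight vectors of the weights `μ + k • α`, the components of a vector of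
weight `μ`. -/
structure IsStr (h : Module.Dual ℤ P) (α : P) (W : P → Submodule K M) (e : Module.End K M) (μ : P)
    (c : ℕ →₀ M) : Prop where
  mem : ∀ k, c k ∈ W (μ + k • α)
  e_eq : ∀ k, e (c k) = 0
  le : ∀ k, c k ≠ 0 → (k : ℤ) ≤ h (μ + k • α)

/-- The vector with the given components. -/
def strSum (p : K) (f : Module.End K M) : (ℕ →₀ M) →ₗ[K] M :=
  Finsupp.lsum K (fun k => dpow p f k)

@[simp] theorem strSum_single (p : K) (f : Module.End K M) (k : ℕ) (v : M) :
    strSum p f (Finsupp.single k v) = dpow p f k v := by simp [strSum]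

theorem IsStr.add {μ : P} {c c' : ℕ →₀ M} (hc : IsStr h α W e μ c) (hc' : IsStr h α W e μ c') :
    IsStr h α W e μ (c + c') where
  mem k := Submodule.add_mem _ (hc.mem k) (hc'.mem k)
  e_eq k := by rw [Finsupp.add_apply, map_add, hc.e_eq, hc'.e_eq, add_zero]
  le k hk := by
    by_cases h1 : c k = 0
    · exact hc'.le k (by rwa [Finsupp.add_apply, h1, zero_add] at hk)
    · exact hc.le k h1

theorem IsStr.smul {μ : P} {c : ℕ →₀ M} (a : K) (hc : IsStr h α W e μ c) :
    IsStr h α W e μ (a • c) where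
  mem k := Submodule.smul_mem _ _ (hc.mem k)
  e_eq k := by rw [Finsupp.smul_apply, map_smul, hc.e_eq, smul_zero]
  le k hk := hc.le k fun h1 => hk (by rw [Finsupp.smul_apply, h1, smul_zero])

theorem IsStr.zero {μ : P} : IsStr h α W e μ 0 := ⟨by simp, by simp, by simp⟩

theorem IsStr.single {μ : P} (k : ℕ) {v : M} (hv : v ∈ W (μ + k • α)) (he : e v = 0)
    (hk : (k : ℤ) ≤ h (μ + k • α)) : IsStr h α W e μ (Finsupp.single k v) where
  mem j := by
    rcases eq_or_ne k j with rfl | hj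
    · simpa using hv
    · simp [Finsupp.single_eq_of_ne' hj]
  e_eq j := by
    rcases eq_or_ne k j with rfl | hj
    · simpa using he
    · simp [Finsupp.single_eq_of_ne' hj]
  le j h1 := by
    rcases eq_or_ne k j with rfl | hj
    · exact hk
    · simp [Finsupp.single_eq_of_ne' hj] at h1

theorem IsStr.erase {μ : P} (k : ℕ) {c : ℕ →₀ M} (hc : IsStr h α W e μ c) :
    IsStr h α W e μ (c.erase k) where
  mem j := by
    rcases eq_or_ne j k with rfl | hj
    · simp
    · simpa [Finsupp.erase_ne hj] using hc.mem j
  e_eq j := by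
    rcases eq_or_ne j k with rfl | hj
    · simp
    · simpa [Finsupp.erase_ne hj] using hc.e_eq j
  le j h1 := by
    rcases eq_or_ne j k with rfl | hj
    · simp at h1
    · exact hc.le j (by simpa [Finsupp.erase_ne hj] using h1)

/-- The vector `e^r u` is of highest weight. Since `0 ≤ h μ`, its string is long enough for `e^r
f^(r)` to act on it by a nonzero scalar, so subtracting a multiple of `f^(r) e^r u` lowers the
nilpotency index of `u`. -/
theorem exists_isStr_of_nonneg (H : RankOne p h α W e f) (r : ℕ) {μ : P} (hμ : 0 ≤ h μ) {u : M}
    (hu : u ∈ W μ) (hr : (e ^ r) u = 0) : ∃ c, IsStr h α W e μ c ∧ strSum p f c = u := by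
  induction r generalizing u with
  | zero => exact ⟨0, IsStr.zero, by simpa using hr.symm⟩
  | succ r ih =>
    have hmem : ∀ m : ℕ, (e ^ m) u ∈ W (μ + m • α) := by
      intro m
      induction m with
      | zero => simpa using hu
      | succ m ih =>
        rw [pow_succ', Module.End.mul_apply, succ_nsmul, ← add_assoc]
        exact H.e_mem _ _ ih
    have he : e ((e ^ r) u) = 0 := by rw [← Module.End.mul_apply, ← pow_succ', hr]
    have hle : ((r : ℕ) : ℤ) ≤ h (μ + r • α) := by rw [H.h_add]; omega
    obtain ⟨a, ha, h1⟩ := H.e_pow_dpow (hmem r) he 0 r (by simpa using hle)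
    rw [zero_add, dpow_zero] at h1
    have h2 : dpow p f r ((e ^ r) u) ∈ W μ := by
      have := H.dpow_mem (hmem r) r
      rwa [add_sub_cancel_right] at this
    obtain ⟨c, hc, h3⟩ := ih (u := u - a⁻¹ • dpow p f r ((e ^ r) u))
      (Submodule.sub_mem _ hu (Submodule.smul_mem _ _ h2))
      (by rw [map_sub, map_smul, h1, smul_smul, inv_mul_cancel₀ ha, one_smul, sub_self])
    refine ⟨c + a⁻¹ • Finsupp.single r ((e ^ r) u),
      hc.add ((IsStr.single r (hmem r) he hle).smul _), ?_⟩
    rw [map_add, map_smul, strSum_single, h3, sub_add_cancel]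

/-- For a negative weight the roles of `e` and `f` are exchanged first. A term `e^(k) w` with `w` of
lowest weight `-l` is then rewritten as `f^(l-k)` of the highest weight vector `e^(l) w`. -/
theorem exists_isStr (H : RankOne p h α W e f) {μ : P} {u : M} (hu : u ∈ W μ) :
    ∃ c, IsStr h α W e μ c ∧ strSum p f c = u := by
  by_cases hμ : 0 ≤ h μ
  · obtain ⟨r, hr⟩ := H.e_nil μ u hu
    exact H.exists_isStr_of_nonneg r hμ hu hr
  obtain ⟨r, hr⟩ := H.f_nil μ u hu
  obtain ⟨c, hc, rfl⟩ := H.swap.exists_isStr_of_nonneg r (μ := -μ) (by rw [map_neg]; omega)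
    (by simpa using hu) hr
  clear hu hr
  have key : ∀ k, ∃ c', IsStr h α W e μ c' ∧ strSum p f c' = dpow p e k (c k) := by
    intro k
    by_cases h0 : c k = 0
    · exact ⟨0, IsStr.zero, by simp [h0]⟩
    have h1 := hc.le k h0
    have h2 := hc.mem k
    have h3 := hc.e_eq k
    obtain ⟨l, hl⟩ := Int.eq_ofNat_of_zero_le (show 0 ≤ h (-μ + k • α) by omega)
    have hkl : k ≤ l := by omega
    have hl' : h (-(-μ + k • α)) = -l := by rw [map_neg, hl]
    have h4 : dpow p e l (c k) ∈ W (μ + (l - k) • α) := by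
      have := H.swap.dpow_mem (h2) l
      convert this using 2
      obtain ⟨m, rfl⟩ := Nat.exists_eq_add_of_le hkl
      rw [Nat.add_sub_cancel_left, add_nsmul]
      abel
    have h5 : e (dpow p e l (c k)) = 0 := by
      rw [H.swap.f_dpow, H.swap.dpow_eq_zero h2 h3 (by rw [hl]; norm_cast; omega), smul_zero]
    refine ⟨Finsupp.single (l - k) (dpow p e l (c k)), IsStr.single _ h4 h5 ?_, ?_⟩
    · rw [H.h_add]
      rw [H.h_add, map_neg] at hl
      omega
    · rw [strSum_single, H.dpow_dpow_swap h2 h3 hl' (l - k) (by omega)]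
      congr 2
      omega
  choose d hd1 hd2 using key
  refine ⟨∑ k ∈ c.support, d k, ?_, ?_⟩
  · refine Finset.sum_induction _ (IsStr h α W e μ) (fun _ _ => IsStr.add) IsStr.zero
      fun k _ => hd1 k
  · rw [map_sum, Finset.sum_congr rfl fun k _ => hd2 k]
    rfl

/-- Applying `e` as often as the top exponent kills every shorter divided power and isolates the top
component; uniqueness of the components follows. -/
theorem e_pow_strSum (H : RankOne p h α W e f) {μ : P} {c : ℕ →₀ M} (hc : IsStr h α W e μ c)
    {k : ℕ} (hk : ∀ j, k < j → c j = 0) :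
    ∃ a : K, a ≠ 0 ∧ (e ^ k) (strSum p f c) = a • c k := by
  classical
  obtain ⟨a, ha, h1⟩ : ∃ a : K, a ≠ 0 ∧ (e ^ k) (dpow p f k (c k)) = a • c k := by
    by_cases h0 : c k = 0
    · exact ⟨1, one_ne_zero, by simp [h0]⟩
    · have := H.e_pow_dpow (hc.mem k) (hc.e_eq k) 0 k (by simpa using hc.le k h0)
      simpa using this
  refine ⟨a, ha, ?_⟩
  have h2 : strSum p f c = c.sum fun j v => dpow p f j v := rfl
  rw [h2, Finsupp.sum, map_sum, Finset.sum_eq_single k, h1]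
  · intro j _ hj
    rcases lt_or_gt_of_ne hj with h3 | h3
    · exact H.e_pow_dpow_eq_zero (hc.mem j) (hc.e_eq j) j k h3
    · rw [hk j h3, map_zero, map_zero]
  · intro h3
    rw [Finsupp.notMem_support_iff.mp h3, map_zero, map_zero]

theorem isStr_eq_zero (H : RankOne p h α W e f) {μ : P} {c : ℕ →₀ M} (hc : IsStr h α W e μ c)
    (h0 : strSum p f c = 0) : c = 0 := by
  by_contra hne
  have hs : c.support.Nonempty := Finsupp.support_nonempty_iff.mpr hne
  obtain ⟨a, ha, h1⟩ := H.e_pow_strSum hc (k := c.support.max' hs) fun j hj => by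
    by_contra h2
    exact absurd (c.support.le_max' j (Finsupp.mem_support_iff.mpr h2)) (by omega)
  rw [h0, map_zero] at h1
  exact Finsupp.mem_support_iff.mp (c.support.max'_mem hs)
    ((smul_eq_zero.mp h1.symm).resolve_left ha)

theorem isStr_unique (H : RankOne p h α W e f) {μ : P} {c c' : ℕ →₀ M}
    (hc : IsStr h α W e μ c) (hc' : IsStr h α W e μ c') (h0 : strSum p f c = strSum p f c') :
    c = c' := by
  have := H.isStr_eq_zero (hc.add (hc'.smul (-1))) (by rw [map_add, map_smul, h0]; simp)
  rwa [neg_smul, one_smul, ← sub_eq_add_neg, sub_eq_zero] at this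

/-- Operators prescribed on the divided powers of the highest weight vectors exist. -/
theorem exists_operator (H : RankOne p h α W e f) (g : ℕ → ℤ → Module.End K M) :
    ∃ T : Module.End K M, ∀ μ, ∀ v ∈ W μ, e v = 0 → ∀ k : ℕ, (k : ℤ) ≤ h μ →
      T (dpow p f k v) = g k (h μ) v := by
  have hex : ∀ μ (u : W μ), ∃ c, IsStr h α W e μ c ∧ strSum p f c = u :=
    fun μ u => H.exists_isStr u.2
  choose c hc1 hc2 using hex
  -- Uniqueness of the components makes them depend linearly on the vector.
  let C : ∀ μ, W μ →ₗ[K] ℕ →₀ M := fun μ =>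
    { toFun := c μ
      map_add' := fun u v => H.isStr_unique (hc1 _ _) ((hc1 _ _).add (hc1 _ _)) (by
        rw [map_add, hc2, hc2, hc2]; rfl)
      map_smul' := fun a u => H.isStr_unique (hc1 _ _) ((hc1 _ _).smul a) (by
        rw [RingHom.id_apply, map_smul, hc2, hc2]; rfl) }
  obtain ⟨T, hT⟩ := exists_linearMap_of_graded H.indep H.top (fun μ =>
    (Finsupp.lsum K (fun k : ℕ => g k (h (μ + k • α)))).comp (C μ))
  refine ⟨T, fun μ v hv he k hk => ?_⟩
  have hμ : μ - k • α + k • α = μ := sub_add_cancel _ _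
  have h1 := hT (μ - k • α) ⟨_, H.dpow_mem hv k⟩
  have h2 : C (μ - k • α) ⟨_, H.dpow_mem hv k⟩ = Finsupp.single k v :=
    H.isStr_unique (hc1 _ _) (IsStr.single k (by rwa [hμ]) he (by rwa [hμ]))
      ((hc2 _ _).trans (strSum_single _ _ _ _).symm)
  rw [LinearMap.comp_apply, h2] at h1
  simpa [hμ] using h1

/-- The operator `T` removes one divided power. -/
def IsE (p : K) (h : Module.Dual ℤ P) (W : P → Submodule K M) (e f T : Module.End K M) : Prop :=
  ∀ μ, ∀ v ∈ W μ, e v = 0 → ∀ k : ℕ, (k : ℤ) ≤ h μ →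
    T (dpow p f k v) = if k = 0 then 0 else dpow p f (k - 1) v

/-- The operator `T` adds one divided power. -/
def IsF (p : K) (h : Module.Dual ℤ P) (W : P → Submodule K M) (e f T : Module.End K M) : Prop :=
  ∀ μ, ∀ v ∈ W μ, e v = 0 → ∀ k : ℕ, (k : ℤ) ≤ h μ → T (dpow p f k v) = dpow p f (k + 1) v

variable {E F : Module.End K M}

theorem IsE.pow_dpow (hE : IsE p h W e f E) {μ : P} {v : M} (hv : v ∈ W μ) (he : e v = 0) (r k : ℕ)
    (hk : (k + r : ℕ) ≤ h μ) : (E ^ r) (dpow p f (k + r) v) = dpow p f k v := by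
  induction r with
  | zero => rfl
  | succ r ih =>
    rw [pow_succ, Module.End.mul_apply, hE μ v hv he _ hk, if_neg (by omega)]
    exact ih (by omega)

theorem IsE.pow_dpow_eq_zero (hE : IsE p h W e f E) {μ : P} {v : M} (hv : v ∈ W μ) (he : e v = 0)
    (r k : ℕ) (hk : (k : ℤ) ≤ h μ) (hr : k < r) : (E ^ r) (dpow p f k v) = 0 := by
  induction r generalizing k with
  | zero => omega
  | succ r ih =>
    rw [pow_succ, Module.End.mul_apply, hE μ v hv he _ hk]
    split_ifs with h0
    · simp
    · exact ih _ (by omega) (by omega)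

theorem IsF.pow_dpow (hF : IsF p h W e f F) {μ : P} {v : M} (hv : v ∈ W μ) (he : e v = 0) (r k : ℕ)
    (hk : (k + r : ℕ) ≤ h μ) : (F ^ r) (dpow p f k v) = dpow p f (k + r) v := by
  induction r with
  | zero => rfl
  | succ r ih =>
    rw [pow_succ', Module.End.mul_apply, ih (by omega), hF μ v hv he _ (by omega), add_assoc]

theorem IsE.pow_strSum (hE : IsE p h W e f E) {μ : P} {c : ℕ →₀ M} (hc : IsStr h α W e μ c)
    {k : ℕ} (hk : ∀ j, k < j → c j = 0) : (E ^ k) (strSum p f c) = c k := by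
  classical
  have h2 : strSum p f c = c.sum fun j v => dpow p f j v := rfl
  rw [h2, Finsupp.sum, map_sum, Finset.sum_eq_single k]
  · by_cases h0 : c k = 0
    · simp [h0]
    · have := hE.pow_dpow (hc.mem k) (hc.e_eq k) k 0 (by simpa using hc.le k h0)
      simpa using this
  · intro j _ hj
    rcases lt_or_gt_of_ne hj with h3 | h3
    · by_cases h0 : c j = 0
      · simp [h0]
      · exact hE.pow_dpow_eq_zero (hc.mem j) (hc.e_eq j) k j (hc.le j h0) h3
    · rw [hk j h3, map_zero, map_zero]
  · intro h3
    rw [Finsupp.notMem_support_iff.mp h3, map_zero, map_zero]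

/-- The components of an element of a lattice stable under the Kashiwara operators lie in the
lattice. -/
theorem IsStr.mem_lattice (hE : IsE p h W e f E) (hF : IsF p h W e f F) (L : AddSubgroup M)
    (hEL : ∀ u ∈ L, E u ∈ L) (hFL : ∀ u ∈ L, F u ∈ L) {μ : P} {c : ℕ →₀ M}
    (hc : IsStr h α W e μ c) (hL : strSum p f c ∈ L) (k : ℕ) : c k ∈ L := by
  classical
  have hEr : ∀ (r : ℕ), ∀ u ∈ L, (E ^ r) u ∈ L := by
    intro r u hu
    induction r with
    | zero => exact hu
    | succ r ih => rw [pow_succ', Module.End.mul_apply]; exact hEL _ ih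
  have hFr : ∀ (r : ℕ), ∀ u ∈ L, (F ^ r) u ∈ L := by
    intro r u hu
    induction r with
    | zero => exact hu
    | succ r ih => rw [pow_succ', Module.End.mul_apply]; exact hFL _ ih
  obtain ⟨n, hn⟩ : ∃ n, ∀ j, n ≤ j → c j = 0 := by
    obtain ⟨n, hn⟩ := c.support.exists_nat_subset_range
    refine ⟨n, fun j hj => ?_⟩
    by_contra h0
    have := Finset.mem_range.mp (hn (Finsupp.mem_support_iff.mpr h0))
    omega
  induction n generalizing c with
  | zero => rw [hn k (Nat.zero_le _)]; exact L.zero_mem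
  | succ n ih =>
    -- The top component equals `E^n` of the vector, so it is in the lattice; so is its divided
    -- power, obtained with `F^n`. Subtracting it leaves a shorter sum.
    have hcn : c n ∈ L := by
      rw [← hE.pow_strSum hc (k := n) fun j hj => hn j hj]
      exact hEr _ _ hL
    rcases eq_or_ne k n with rfl | hkn
    · exact hcn
    have h1 : dpow p f n (c n) ∈ L := by
      by_cases h0 : c n = 0
      · rw [h0, map_zero]; exact L.zero_mem
      · have := hF.pow_dpow (hc.mem n) (hc.e_eq n) n 0 (by simpa using hc.le n h0)
        rw [zero_add, dpow_zero] at this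
        rw [← this]
        exact hFr _ _ hcn
    have h2 : strSum p f (c.erase n) = strSum p f c - dpow p f n (c n) := by
      rw [eq_sub_iff_add_eq, ← strSum_single p f n (c n), ← map_add, Finsupp.erase_add_single]
    have h3 := ih (hc.erase n) (by rw [h2]; exact L.sub_mem hL h1) fun j hj => by
      rcases eq_or_ne j n with rfl | hj'
      · simp
      · rw [Finsupp.erase_ne hj']; exact hn j (by omega)
    rwa [Finsupp.erase_ne hkn] at h3

end RankOne

end QSuper

end

noncomputable section

namespace QSuper

/-! ## The tensor product of two irreducible representations of rank one -/

section Order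

variable {K : Type*} [Field K]

/-- The element `p` of the subring `R` is a nonzero element of its Jacobson radical. -/
structure IsLocalParam (R : Subring K) (p : K) : Prop where
  ne_zero : p ≠ 0
  mem : p ∈ R
  one_add_ne : ∀ x ∈ R, 1 + p * x ≠ 0
  inv_mem : ∀ x ∈ R, (1 + p * x)⁻¹ ∈ R

/-- The element `x` is divisible by `p ^ g`. -/
def InO (R : Subring K) (p : K) (g : ℤ) (x : K) : Prop := p ^ (-g) * x ∈ R

variable {R : Subring K} {p : K}

theorem inO_zero (g : ℤ) : InO R p g 0 := by simp [InO]

theorem inO_zero_iff {x : K} : InO R p 0 x ↔ x ∈ R := by simp [InO]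

theorem InO.add {g : ℤ} {x y : K} (hx : InO R p g x) (hy : InO R p g y) : InO R p g (x + y) := by
  rw [InO, mul_add]
  exact R.add_mem hx hy

theorem InO.neg {g : ℤ} {x : K} (hx : InO R p g x) : InO R p g (-x) := by
  rw [InO, mul_neg]
  exact R.neg_mem hx

namespace IsLocalParam

variable (hp : IsLocalParam R p)
include hp

theorem mul {g g' : ℤ} {x y : K} (hx : InO R p g x) (hy : InO R p g' y) :
    InO R p (g + g') (x * y) := by
  rw [InO, neg_add, zpow_add₀ hp.ne_zero, mul_mul_mul_comm]
  exact R.mul_mem hx hy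

theorem mono {g g' : ℤ} {x : K} (hx : InO R p g x) (hg : g' ≤ g) : InO R p g' x := by
  obtain ⟨n, hn⟩ := Int.eq_ofNat_of_zero_le (sub_nonneg.mpr hg)
  rw [InO, show -g' = (n : ℤ) + -g by omega, zpow_add₀ hp.ne_zero, mul_assoc, zpow_natCast]
  exact R.mul_mem (R.pow_mem hp.mem n) hx

theorem zpow (g : ℤ) : InO R p g (p ^ g) := by
  rw [InO, ← zpow_add₀ hp.ne_zero, neg_add_cancel, zpow_zero]
  exact R.one_mem

theorem exists_of_inO_one {x : K} (hx : InO R p 1 x) : ∃ y ∈ R, x = p * y := by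
  refine ⟨_, hx, ?_⟩
  rw [zpow_neg_one, ← mul_assoc, mul_inv_cancel₀ hp.ne_zero, one_mul]

theorem sub_inv_ne : p - p⁻¹ ≠ 0 := by
  intro h
  have h1 : p * p = 1 := by
    nth_rewrite 1 [sub_eq_zero.mp h]
    exact inv_mul_cancel₀ hp.ne_zero
  exact hp.one_add_ne (-p) (R.neg_mem hp.mem) (by rw [mul_neg, h1, add_neg_cancel])

/-- From `[n+2] = p^(-n-1) + p [n+1]`. It fixes the exact order of quantum integers, hence of their
inverses, on which all estimates below rest. -/
theorem qn_eq (n : ℕ) : ∃ r ∈ R, qn p (n + 1 : ℕ) = p ^ (-(n : ℤ)) * (1 + p * r) := by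
  induction n with
  | zero => exact ⟨0, R.zero_mem, by simp [qn_one hp.sub_inv_ne]⟩
  | succ n ih =>
    obtain ⟨r, hr, h1⟩ := ih
    have h2 : qn p (n + 1 + 1 : ℕ) = p ^ (-((n + 1 : ℕ) : ℤ)) + p * qn p (n + 1 : ℕ) := by
      have h3 := hp.sub_inv_ne
      have h4 : p * p⁻¹ = 1 := mul_inv_cancel₀ hp.ne_zero
      rw [qn, qn, mul_div_assoc', ← sub_eq_iff_eq_add', eq_div_iff h3, sub_mul, div_mul_cancel₀ _ h3]
      have h5 : ∀ m k : ℤ, p ^ (m + k) = p ^ m * p ^ k := fun m k => zpow_add₀ hp.ne_zero m k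
      rw [Nat.cast_succ (n + 1), neg_add, h5, h5, zpow_one, zpow_neg_one]
      ring
    refine ⟨p * (1 + p * r), R.mul_mem hp.mem (R.add_mem R.one_mem (R.mul_mem hp.mem hr)), ?_⟩
    rw [h2, h1, Nat.cast_succ, neg_add, zpow_add₀ hp.ne_zero, zpow_neg_one]
    field_simp [hp.ne_zero]

theorem qn_ne {n : ℤ} (hn : n ≠ 0) : qn p n ≠ 0 := by
  have key : ∀ k : ℕ, qn p (k + 1 : ℕ) ≠ 0 := by
    intro k
    obtain ⟨r, hr, h1⟩ := hp.qn_eq k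
    rw [h1]
    exact mul_ne_zero (zpow_ne_zero _ hp.ne_zero) (hp.one_add_ne r hr)
  rcases lt_or_gt_of_ne hn with h | h
  · obtain ⟨k, hk⟩ := Int.eq_ofNat_of_zero_le (show 0 ≤ -n - 1 by omega)
    have := key k
    rwa [show ((k + 1 : ℕ) : ℤ) = -n by omega, qn_neg, neg_ne_zero] at this
  · obtain ⟨k, hk⟩ := Int.eq_ofNat_of_zero_le (show 0 ≤ n - 1 by omega)
    have := key k
    rwa [show ((k + 1 : ℕ) : ℤ) = n by omega] at this

theorem qn_inO {n : ℤ} (hn : 0 ≤ n) : InO R p (1 - n) (qn p n) := by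
  rcases hn.eq_or_lt with rfl | h
  · simpa using inO_zero (R := R) (p := p) 1
  · obtain ⟨k, hk⟩ := Int.eq_ofNat_of_zero_le (show 0 ≤ n - 1 by omega)
    obtain ⟨r, hr, h1⟩ := hp.qn_eq k
    rw [show ((k + 1 : ℕ) : ℤ) = n by omega] at h1
    have := hp.mul (hp.zpow (-(k : ℤ))) (inO_zero_iff.mpr
      (R.add_mem R.one_mem (R.mul_mem hp.mem hr)))
    rw [← h1] at this
    exact hp.mono this (by omega)

theorem qn_inv_inO {n : ℤ} (hn : 0 < n) : InO R p (n - 1) (qn p n)⁻¹ := by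
  obtain ⟨k, hk⟩ := Int.eq_ofNat_of_zero_le (show 0 ≤ n - 1 by omega)
  obtain ⟨r, hr, h1⟩ := hp.qn_eq k
  rw [show ((k + 1 : ℕ) : ℤ) = n by omega] at h1
  have := hp.mul (hp.zpow (k : ℤ)) (inO_zero_iff.mpr (hp.inv_mem r hr))
  rw [h1, mul_inv, ← zpow_neg, neg_neg]
  exact hp.mono this (by omega)

end IsLocalParam

end Order

section Grid

variable {K M : Type*} [Field K] [AddCommGroup M] [Module K M]

/-- The vectors `x a b` behave like the tensor products `f^(a) u ⊗ f^(b) v` for highest weight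
vectors of weights `l` and `m`. -/
structure IsGrid (p : K) (e f : Module.End K M) (l m : ℕ) (x : ℤ → ℤ → M) : Prop where
  zero : ∀ a b, a < 0 ∨ (l : ℤ) < a ∨ b < 0 ∨ (m : ℤ) < b → x a b = 0
  e_apply : ∀ a b, e (x a b) =
    (p ^ (2 * b - m) * qn p (l - a + 1)) • x (a - 1) b + qn p (m - b + 1) • x a (b - 1)
  f_apply : ∀ a b, f (x a b) =
    qn p (a + 1) • x (a + 1) b + (p ^ (l - 2 * a) * qn p (b + 1)) • x a (b + 1)
  dual : ∀ a b : ℤ, 0 ≤ a → a ≤ l → 0 ≤ b → b ≤ m → ∃ φ : M →ₗ[K] K, ∀ a' b',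
    φ (x a' b') = if a' = a ∧ b' = b then 1 else 0

variable {p : K} {e f : Module.End K M} {l m : ℕ} {x : ℤ → ℤ → M}

/-- Reading both strings from the bottom and exchanging the factors turns the formula for `f` into
the one for `e`. Estimates on the upper part of a string thereby give the lower part. -/
theorem IsGrid.flip (G : IsGrid p e f l m x) :
    IsGrid p f e m l (fun b a => x (l - a) (m - b)) where
  zero b a h := G.zero _ _ (by omega)
  e_apply b a := by
    rw [G.f_apply, add_comm, show (l : ℤ) - 2 * (l - a) = 2 * a - l by ring,
      show (m : ℤ) - (b - 1) = m - b + 1 by ring, show (l : ℤ) - (a - 1) = l - a + 1 by ring]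
  f_apply b a := by
    rw [G.e_apply, add_comm, show 2 * ((m : ℤ) - b) - m = m - 2 * b by ring,
      show (l : ℤ) - (l - a) + 1 = a + 1 by ring, show (m : ℤ) - (m - b) + 1 = b + 1 by ring,
      show (m : ℤ) - b - 1 = m - (b + 1) by ring, show (l : ℤ) - a - 1 = l - (a + 1) by ring]
  dual b a hb hb' ha ha' := by
    obtain ⟨φ, hφ⟩ := G.dual (l - a) (m - b) (by omega) (by omega) (by omega) (by omega)
    refine ⟨φ, fun b' a' => ?_⟩
    rw [hφ]
    congr 1
    rw [eq_iff_iff]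
    omega

/-- The vector of level `n` with the coefficients `C`. -/
def gvec (l : ℕ) (x : ℤ → ℤ → M) (n : ℤ) (C : ℕ → K) : M :=
  ∑ s ∈ Finset.range (l + 1), C s • x s (n - s)

theorem sum_range_shift {G : ℕ → M} (l : ℕ) (h0 : G 0 = 0) (hl : G (l + 1) = 0) :
    ∑ s ∈ Finset.range (l + 1), G s = ∑ s ∈ Finset.range (l + 1), G (s + 1) := by
  have h1 := Finset.sum_range_succ G (l + 1)
  rw [Finset.sum_range_succ' G (l + 1), h0, hl, add_zero, add_zero] at h1
  exact h1.symm

theorem gvec_congr {n : ℤ} {C C' : ℕ → K} (h : ∀ s : ℕ, s ≤ l → (x s (n - s) = 0 ∨ C s = C' s)) :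
    gvec l x n C = gvec l x n C' := by
  refine Finset.sum_congr rfl fun s hs => ?_
  rcases h s (Nat.lt_succ_iff.mp (Finset.mem_range.mp hs)) with h | h
  · rw [h, smul_zero, smul_zero]
  · rw [h]

theorem IsGrid.e_gvec (G : IsGrid p e f l m x) (n : ℤ) (C : ℕ → K) :
    e (gvec l x n C) = gvec l x (n - 1) (fun s =>
      C (s + 1) * (p ^ (2 * (n - 1 - s) - m) * qn p (l - s)) + C s * qn p (m - (n - s) + 1)) := by
  simp only [gvec, map_sum, map_smul, G.e_apply, smul_add, add_smul, Finset.sum_add_distrib,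
    smul_smul]
  congr 1
  · rw [sum_range_shift (G := fun s : ℕ =>
      (C s * (p ^ (2 * (n - s) - m) * qn p (l - s + 1))) • x ((s : ℤ) - 1) (n - s))]
    · refine Finset.sum_congr rfl fun s _ => ?_
      push_cast
      rw [show n - ((s : ℤ) + 1) = n - 1 - s by ring, show (l : ℤ) - (s + 1) + 1 = l - s by ring,
        add_sub_cancel_right]
    · rw [G.zero _ _ (by left; simp), smul_zero]
    · push_cast
      rw [show (l : ℤ) - (l + 1) + 1 = 0 by ring, qn_zero, mul_zero, mul_zero, zero_smul]
  · refine Finset.sum_congr rfl fun s _ => ?_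
    rw [show n - (s : ℤ) - 1 = n - 1 - s by ring]

/-- At `s = 0` the truncated `C (s - 1)` is harmless because its factor `qn p 0` vanishes. -/
theorem IsGrid.f_gvec (G : IsGrid p e f l m x) (n : ℤ) (C : ℕ → K) :
    f (gvec l x n C) = gvec l x (n + 1) (fun s =>
      qn p s * C (s - 1) + p ^ ((l : ℤ) - 2 * s) * qn p (n + 1 - s) * C s) := by
  simp only [gvec, map_sum, map_smul, G.f_apply, smul_add, add_smul, Finset.sum_add_distrib,
    smul_smul]
  congr 1
  · rw [sum_range_shift (G := fun s : ℕ => (qn p s * C (s - 1)) • x (s : ℤ) (n + 1 - s))]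
    · refine Finset.sum_congr rfl fun s _ => ?_
      rw [Nat.add_sub_cancel]
      push_cast
      rw [show n + 1 - ((s : ℤ) + 1) = n - s by ring, mul_comm]
    · simp
    · rw [G.zero _ _ (by right; left; push_cast; omega), smul_zero]
  · refine Finset.sum_congr rfl fun s _ => ?_
    rw [show n - (s : ℤ) + 1 = n + 1 - s by ring, mul_comm]

/-- The coefficients of the highest weight vector of level `n`. -/
def hwCoeff (p : K) (l m n : ℕ) : ℕ → K
  | 0 => 1
  -- The value that cancels the coefficient at position `s` in `IsGrid.e_gvec`.
  | s + 1 => -(hwCoeff p l m n s * qn p (m - n + s + 1) * p ^ ((m : ℤ) - 2 * (n - s - 1)) *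
      (qn p (l - s))⁻¹)

/-- The coefficients of the divided powers of `f` on the highest weight vector of level `n`. -/
def strCoeff (p : K) (l m n : ℕ) : ℕ → ℕ → K
  | 0, s => hwCoeff p l m n s
  | k + 1, s => (qn p (k + 1 : ℕ))⁻¹ * (qn p s * strCoeff p l m n k (s - 1) +
      p ^ ((l : ℤ) - 2 * s) * qn p (n + k + 1 - s) * strCoeff p l m n k s)

/-- For `s < n ≤ l` the divisor `[l - s]` is nonzero and the recursion cancels the coefficient; for
`s ≥ n` the grid vector has a negative second index and is zero. -/
theorem IsGrid.e_hw {R : Subring K} (hp : IsLocalParam R p) (G : IsGrid p e f l m x) {n : ℕ}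
    (hl : n ≤ l) : e (gvec l x n (hwCoeff p l m n)) = 0 := by
  rw [G.e_gvec, gvec]
  refine Finset.sum_eq_zero fun s _ => ?_
  by_cases hs : (s : ℤ) < n
  · have h1 : qn p ((l : ℤ) - s) ≠ 0 := hp.qn_ne (by omega)
    have h2 : p ^ ((m : ℤ) - 2 * (n - s - 1)) * p ^ (2 * ((n : ℤ) - 1 - s) - m) = 1 := by
      rw [← zpow_add₀ hp.ne_zero, ← zpow_zero p]
      congr 1
      ring
    rw [hwCoeff, show (m : ℤ) - (n - s) + 1 = m - n + s + 1 by ring]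
    have h3 : -(hwCoeff p l m n s * qn p (m - n + s + 1) * p ^ ((m : ℤ) - 2 * (n - s - 1)) *
        (qn p (l - s))⁻¹) * (p ^ (2 * ((n : ℤ) - 1 - s) - m) * qn p (l - s)) =
        -(hwCoeff p l m n s * qn p (m - n + s + 1)) *
          (p ^ ((m : ℤ) - 2 * (n - s - 1)) * p ^ (2 * ((n : ℤ) - 1 - s) - m)) *
            ((qn p (l - s))⁻¹ * qn p (l - s)) := by ring
    rw [h3, h2, inv_mul_cancel₀ h1, mul_one, mul_one, neg_add_cancel, zero_smul]
  · rw [G.zero _ _ (by omega), smul_zero]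

theorem IsGrid.dpow_hw (G : IsGrid p e f l m x) (n k : ℕ) :
    dpow p f k (gvec l x n (hwCoeff p l m n)) = gvec l x (n + k : ℕ) (strCoeff p l m n k) := by
  induction k with
  | zero =>
    rw [dpow_zero, add_zero]
    rfl
  | succ k ih =>
    have h1 : dpow p f (k + 1) (gvec l x n (hwCoeff p l m n)) =
        (qn p (k + 1 : ℕ))⁻¹ • f (dpow p f k (gvec l x n (hwCoeff p l m n))) := by
      rw [dpow, dpow, LinearMap.smul_apply, LinearMap.smul_apply, map_smul, smul_smul, qf, mul_inv,
        pow_succ', Module.End.mul_apply]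
    rw [h1, ih, G.f_gvec, gvec, gvec, Finset.smul_sum]
    refine Finset.sum_congr rfl fun s _ => ?_
    rw [smul_smul, strCoeff]
    push_cast
    rw [add_assoc (n : ℤ)]

/-- Each step of the recursion adds `-(m-n+s) + (m-2(n-s-1)) + (l-s-1) = l-n+1` to the order. -/
theorem hwCoeff_inO {R : Subring K} (hp : IsLocalParam R p) {n : ℕ} (hl : n ≤ l) (hm : n ≤ m)
    {s : ℕ} (hs : s ≤ n) : InO R p (s * (l - n + 1)) (hwCoeff p l m n s) := by
  induction s with
  | zero => simpa [hwCoeff] using inO_zero_iff.mpr R.one_mem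
  | succ s ih =>
    have h1 := hp.mul (hp.mul (hp.mul (ih (by omega))
      (hp.qn_inO (show (0 : ℤ) ≤ m - n + s + 1 by omega)))
      (hp.zpow ((m : ℤ) - 2 * (n - s - 1)))) (hp.qn_inv_inO (show (0 : ℤ) < l - s by omega))
    refine hp.mono h1.neg (le_of_eq ?_)
    push_cast
    ring

/-- The order of divisibility of the coefficients. -/
def strOrd (l n k s : ℤ) : ℤ := if s ≤ k then (k - s) * (l - n - s) else (s - k) * (l - n + 1 - k)

/-- For `k ≤ l - n` the bound `strOrd` is zero at `s = k` and positive at every other `s`. Both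
terms of the recursion meet it; this is a quadratic inequality on either side of `s = k`. -/
theorem strCoeff_inO {R : Subring K} (hp : IsLocalParam R p) {n : ℕ} (hl : n ≤ l) (hm : n ≤ m)
    {k : ℕ} (hk : k ≤ l - n) {s : ℕ} (hs : s ≤ n + k) :
    InO R p (strOrd l n k s) (strCoeff p l m n k s) := by
  induction k generalizing s with
  | zero =>
    refine hp.mono (hwCoeff_inO hp hl hm (by omega)) (le_of_eq ?_)
    rw [strOrd]
    split_ifs with h
    · have : s = 0 := by omega
      subst this
      simp
    · push_cast
      ring
  | succ k ih =>
    have hinv := hp.qn_inv_inO (show (0 : ℤ) < (k + 1 : ℕ) by omega)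
    rw [strCoeff, mul_add]
    refine InO.add ?_ ?_
    · rcases Nat.eq_zero_or_pos s with rfl | hs0
      · simpa using inO_zero _
      have h1 := hp.mul hinv (hp.mul (hp.qn_inO (show (0 : ℤ) ≤ s by omega))
        (ih (by omega) (s := s - 1) (by omega)))
      refine hp.mono h1 ?_
      obtain ⟨s, rfl⟩ := Nat.exists_eq_add_of_lt hs0
      -- With `l = n + k + 1 + j` the bounds become polynomial inequalities in nonnegative
      -- variables.
      obtain ⟨j, hj⟩ := Nat.exists_eq_add_of_le hk
      have hj' : (l : ℤ) = n + k + 1 + j := by omega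
      simp only [strOrd, hj']
      push_cast
      simp only [zero_add]
      split_ifs with h2 h3 h3
      · nlinarith
      · omega
      · have : (s : ℤ) = k + 1 := by omega
        nlinarith
      · nlinarith
    · by_cases hs1 : s = n + k + 1
      · rw [hs1]
        push_cast
        simpa using inO_zero _
      have h1 := hp.mul hinv (hp.mul (hp.mul (hp.zpow ((l : ℤ) - 2 * s))
        (hp.qn_inO (show (0 : ℤ) ≤ n + k + 1 - s by omega))) (ih (by omega) (s := s) (by omega)))
      refine hp.mono h1 ?_
      obtain ⟨j, hj⟩ := Nat.exists_eq_add_of_le hk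
      have hj' : (l : ℤ) = n + k + 1 + j := by omega
      simp only [strOrd, hj']
      push_cast
      split_ifs with h2 h3 h3
      · nlinarith
      · have : (s : ℤ) = k + 1 := by omega
        nlinarith
      · omega
      · nlinarith

/-- At `s = k + 1` the first term of the recursion reproduces the previous leading coefficient
exactly, as `[k+1]` cancels. The second term is divisible by `p`, except for `n = 0`, when it
contains `[0] = 0`. -/
theorem strCoeff_leading {R : Subring K} (hp : IsLocalParam R p) {n : ℕ} (hl : n ≤ l) (hm : n ≤ m)
    {k : ℕ} (hk : k ≤ l - n) : InO R p 1 (strCoeff p l m n k k - 1) := by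
  induction k with
  | zero => simpa [strCoeff, hwCoeff] using inO_zero _
  | succ k ih =>
    have h0 : qn p (k + 1 : ℕ) ≠ 0 := hp.qn_ne (by omega)
    have hinv := hp.qn_inv_inO (show (0 : ℤ) < (k + 1 : ℕ) by omega)
    rw [strCoeff, mul_add, ← mul_assoc, inv_mul_cancel₀ h0, one_mul, Nat.add_sub_cancel,
      add_sub_right_comm]
    refine (ih (by omega)).add ?_
    by_cases hn : n = 0
    · subst hn
      push_cast
      simpa using inO_zero _
    have h1 := hp.mul hinv (hp.mul (hp.mul (hp.zpow ((l : ℤ) - 2 * (k + 1 : ℕ)))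
      (hp.qn_inO (show (0 : ℤ) ≤ n + k + 1 - (k + 1 : ℕ) by omega)))
      (strCoeff_inO hp hl hm (show k ≤ l - n by omega) (s := k + 1) (by omega)))
    refine hp.mono h1 ?_
    obtain ⟨j, hj⟩ := Nat.exists_eq_add_of_le hk
    have hj' : (l : ℤ) = n + k + 1 + j := by omega
    simp only [strOrd, hj']
    push_cast
    rw [if_neg (by omega)]
    nlinarith

/-- The lattice spanned by the grid. -/
def gridLattice (R : Subring K) (x : ℤ → ℤ → M) : Submodule R M :=
  Submodule.span R {y | ∃ a b, y = x a b}

/-- The multiples of `p` in the lattice spanned by the grid. -/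
def gridRadical (R : Subring K) (p : K) (x : ℤ → ℤ → M) : Submodule R M where
  carrier := {y | ∃ w ∈ gridLattice R x, y = p • w}
  zero_mem' := ⟨0, Submodule.zero_mem _, by simp⟩
  add_mem' := by
    rintro _ _ ⟨w, hw, rfl⟩ ⟨w', hw', rfl⟩
    exact ⟨w + w', Submodule.add_mem _ hw hw', by rw [smul_add]⟩
  smul_mem' := by
    rintro c _ ⟨w, hw, rfl⟩
    exact ⟨c • w, Submodule.smul_mem _ _ hw, by rw [smul_comm]⟩

theorem grid_mem (R : Subring K) (x : ℤ → ℤ → M) (a b : ℤ) : x a b ∈ gridLattice R x :=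
  Submodule.subset_span ⟨a, b, rfl⟩

theorem gridRadical_le {R : Subring K} (hp : IsLocalParam R p) :
    gridRadical R p x ≤ gridLattice R x := by
  rintro _ ⟨w, hw, rfl⟩
  exact Submodule.smul_mem _ (⟨p, hp.mem⟩ : R) hw

theorem smul_mem_gridRadical {R : Subring K} (hp : IsLocalParam R p) {c : K} (hc : InO R p 1 c)
    {w : M} (hw : w ∈ gridLattice R x) : c • w ∈ gridRadical R p x := by
  obtain ⟨y, hy, rfl⟩ := hp.exists_of_inO_one hc
  exact ⟨(⟨y, hy⟩ : R) • w, Submodule.smul_mem _ _ hw, by rw [mul_smul]; rfl⟩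

/-- All coefficients but the one at `s = k` are divisible by `p`. This describes the first stretch
of a string: the left exponent grows while the right one stays at `n`. -/
theorem IsGrid.dpow_hw_sub_mem {R : Subring K} (hp : IsLocalParam R p) (G : IsGrid p e f l m x)
    {n : ℕ} (hl : n ≤ l) (hm : n ≤ m) {k : ℕ} (hk : k ≤ l - n) :
    dpow p f k (gvec l x n (hwCoeff p l m n)) - x k n ∈ gridRadical R p x := by
  have h1 : x k n = ∑ s ∈ Finset.range (l + 1),
      (if s = k then (1 : K) else 0) • x s ((n + k : ℕ) - s) := by
    rw [Finset.sum_eq_single k]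
    · rw [if_pos rfl, one_smul]
      push_cast
      rw [add_sub_cancel_right]
    · intro s _ hs
      rw [if_neg hs, zero_smul]
    · intro h
      exact absurd (Finset.mem_range.mpr (by omega)) h
  rw [G.dpow_hw, gvec, h1, ← Finset.sum_sub_distrib]
  refine Submodule.sum_mem _ fun s hs => ?_
  rw [← sub_smul]
  by_cases hs1 : s ≤ n + k
  · refine smul_mem_gridRadical hp ?_ (grid_mem R x _ _)
    split_ifs with h
    · subst h
      exact strCoeff_leading hp hl hm hk
    · rw [sub_zero]
      refine hp.mono (strCoeff_inO hp hl hm hk hs1) ?_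
      rw [strOrd]
      obtain ⟨j, hj⟩ := Nat.exists_eq_add_of_le hk
      have hj' : (l : ℤ) = n + k + j := by omega
      split_ifs with h2
      · have h3 : (1 : ℤ) ≤ k - s := by omega
        have h4 : (1 : ℤ) ≤ l - n - s := by omega
        nlinarith
      · have h3 : (1 : ℤ) ≤ s - k := by omega
        have h4 : (1 : ℤ) ≤ l - n + 1 - k := by omega
        nlinarith
  · rw [G.zero _ _ (by right; right; left; push_cast; omega), smul_zero]
    exact Submodule.zero_mem _

end Grid

end QSuper

end

/-! ### Strings in a grid, and the tensor product rule modulo `p`. -/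

noncomputable section

namespace QSuper

section GridStrings

variable {K P M : Type*} [Field K] [AddCommGroup P] [AddCommGroup M] [Module K M]
variable {p : K} {e f : Module.End K M} {l m : ℕ} {x : ℤ → ℤ → M}

/-- The span of the grid vectors of level `n`. -/
def gridLevel (K : Type*) {M : Type*} [Field K] [AddCommGroup M] [Module K M] (x : ℤ → ℤ → M)
    (n : ℤ) : Submodule K M :=
  Submodule.span K {y | ∃ a b, a + b = n ∧ y = x a b}

theorem gvec_mem (n : ℤ) (C : ℕ → K) : gvec l x n C ∈ gridLevel K x n :=
  Submodule.sum_mem _ fun s _ => Submodule.smul_mem _ _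
    (Submodule.subset_span ⟨_, _, by ring, rfl⟩)

theorem gvec_smul (n : ℤ) (a : K) (C : ℕ → K) : gvec l x n (a • C) = a • gvec l x n C := by
  rw [gvec, gvec, Finset.smul_sum]
  exact Finset.sum_congr rfl fun s _ => by rw [Pi.smul_apply, smul_assoc]

theorem gvec_add (n : ℤ) (C C' : ℕ → K) :
    gvec l x n (C + C') = gvec l x n C + gvec l x n C' := by
  rw [gvec, gvec, gvec, ← Finset.sum_add_distrib]
  exact Finset.sum_congr rfl fun s _ => by rw [Pi.add_apply, add_smul]

namespace IsGrid

theorem exists_gvec (G : IsGrid p e f l m x) {n : ℤ} {v : M} (hv : v ∈ gridLevel K x n) :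
    ∃ C : ℕ → K, v = gvec l x n C := by
  refine Submodule.span_induction (p := fun v _ => ∃ C : ℕ → K, v = gvec l x n C) ?_ ?_ ?_ ?_ hv
  · rintro _ ⟨a, b, hab, rfl⟩
    by_cases ha : 0 ≤ a ∧ a ≤ l
    · obtain ⟨s, rfl⟩ := Int.eq_ofNat_of_zero_le ha.1
      refine ⟨fun s' => if s' = s then 1 else 0, ?_⟩
      rw [gvec, Finset.sum_eq_single s]
      · rw [if_pos rfl, one_smul, ← hab, add_sub_cancel_left]
      · intro s' _ hs
        rw [if_neg hs, zero_smul]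
      · intro h
        exact absurd (Finset.mem_range.mpr (by omega)) h
    · exact ⟨0, by rw [G.zero _ _ (by omega)]; simp [gvec]⟩
  · exact ⟨0, by simp [gvec]⟩
  · rintro _ _ _ _ ⟨C, rfl⟩ ⟨C', rfl⟩
    exact ⟨C + C', (gvec_add n C C').symm⟩
  · rintro a _ _ ⟨C, rfl⟩
    exact ⟨a • C, (gvec_smul n a C).symm⟩

theorem exists_coeff (G : IsGrid p e f l m x) {n : ℤ} {s : ℕ} (hs : s ≤ l) (h0 : (s : ℤ) ≤ n)
    (h1 : n - s ≤ m) : ∃ φ : M →ₗ[K] K, ∀ C : ℕ → K, φ (gvec l x n C) = C s := by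
  obtain ⟨φ, hφ⟩ := G.dual s (n - s) (by omega) (by omega) (by omega) h1
  refine ⟨φ, fun C => ?_⟩
  rw [gvec, map_sum, Finset.sum_eq_single s]
  · rw [map_smul, hφ, if_pos ⟨rfl, rfl⟩, smul_eq_mul, mul_one]
  · intro s' _ hs'
    rw [map_smul, hφ, if_neg (by omega), smul_zero]
  · intro h
    exact absurd (Finset.mem_range.mpr (by omega)) h

/-- The equation `e v = 0` forces the recursion that defines `hwCoeff`, so a highest weight vector
of level `n` is determined by its coefficient at `s = 0`. -/
theorem eq_smul_hw {R : Subring K} (hp : IsLocalParam R p) (G : IsGrid p e f l m x) {n : ℕ}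
    (_ : n ≤ l) (hm : n ≤ m) {v : M} (hv : v ∈ gridLevel K x n) (he : e v = 0) :
    ∃ a : K, v = a • gvec l x n (hwCoeff p l m n) := by
  obtain ⟨C, rfl⟩ := G.exists_gvec hv
  refine ⟨C 0, ?_⟩
  rw [← gvec_smul]
  refine gvec_congr fun s _ => ?_
  by_cases hs : s ≤ n
  swap
  · exact Or.inl (G.zero _ _ (by omega))
  right
  clear hv
  induction s with
  | zero => simp [hwCoeff]
  | succ s ih =>
    have ih := ih (by omega) (by omega)
    obtain ⟨φ, hφ⟩ := G.exists_coeff (n := n - 1) (s := s) (by omega) (by omega) (by omega)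
    have h1 := congrArg φ he
    rw [G.e_gvec, hφ, map_zero] at h1
    have h2 : qn p ((l : ℤ) - s) ≠ 0 := hp.qn_ne (by omega)
    have h3 : p ^ ((m : ℤ) - 2 * (n - s - 1)) * p ^ (2 * ((n : ℤ) - 1 - s) - m) = 1 := by
      rw [← zpow_add₀ hp.ne_zero, ← zpow_zero p]
      congr 1
      ring
    rw [show (m : ℤ) - (n - s) + 1 = m - n + s + 1 by ring] at h1
    have h4 : C (s + 1) = -(C s * qn p (m - n + s + 1) * p ^ ((m : ℤ) - 2 * (n - s - 1)) *
        (qn p (l - s))⁻¹) := by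
      rw [← div_eq_mul_inv, ← neg_div, eq_div_iff h2]
      linear_combination p ^ ((m : ℤ) - 2 * (n - s - 1)) * h1 - C (s + 1) * qn p (l - s) * h3
    rw [h4, ih, Pi.smul_apply, Pi.smul_apply, hwCoeff, smul_eq_mul, smul_eq_mul]
    ring

theorem gridLevel_flip (l m : ℕ) (x : ℤ → ℤ → M) (n : ℤ) :
    gridLevel K (fun b a => x (l - a) (m - b)) n = gridLevel K x (l + m - n) := by
  rw [gridLevel, gridLevel]
  congr 1
  ext y
  constructor
  · rintro ⟨b, a, hab, rfl⟩
    exact ⟨_, _, by omega, rfl⟩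
  · rintro ⟨a, b, hab, rfl⟩
    exact ⟨m - b, l - a, by omega, by simp⟩

theorem gridLattice_flip (R : Subring K) (l m : ℕ) (x : ℤ → ℤ → M) :
    gridLattice R (fun b a => x (l - a) (m - b)) = gridLattice R x := by
  rw [gridLattice, gridLattice]
  congr 1
  ext y
  constructor
  · rintro ⟨b, a, rfl⟩
    exact ⟨_, _, rfl⟩
  · rintro ⟨a, b, rfl⟩
    exact ⟨m - b, l - a, by simp⟩

theorem gridRadical_flip (R : Subring K) (p : K) (l m : ℕ) (x : ℤ → ℤ → M) :
    gridRadical R p (fun b a => x (l - a) (m - b)) = gridRadical R p x := by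
  ext y
  change (∃ w ∈ gridLattice R _, _) ↔ ∃ w ∈ gridLattice R _, _
  rw [gridLattice_flip]

theorem exists_coeff_mem (R : Subring K) (G : IsGrid p e f l m x) {a b : ℤ}
    (ha : 0 ≤ a) (ha' : a ≤ l) (hb : 0 ≤ b) (hb' : b ≤ m) :
    ∃ φ : M →ₗ[K] K, φ (x a b) = 1 ∧ ∀ w ∈ gridRadical R p x, ∃ r ∈ R, φ w = p * r := by
  obtain ⟨φ, hφ⟩ := G.dual a b ha ha' hb hb'
  refine ⟨φ, by simp [hφ], ?_⟩
  rintro _ ⟨w, hw, rfl⟩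
  refine ⟨φ w, ?_, by simp⟩
  refine Submodule.span_induction (p := fun w _ => φ w ∈ R) ?_ ?_ ?_ ?_ hw
  · rintro _ ⟨a', b', rfl⟩
    rw [hφ]
    split_ifs
    · exact R.one_mem
    · exact R.zero_mem
  · rw [map_zero]; exact R.zero_mem
  · intro u v _ _ hu hv
    rw [map_add]; exact R.add_mem hu hv
  · intro c u _ hu
    have : φ (c • u) = c * φ u := φ.map_smul (c : K) u
    rw [this]
    exact R.mul_mem c.2 hu

variable {h : Module.Dual ℤ P} {α : P} {W : P → Submodule K M} {R : Subring K} {μ₀ : P}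

theorem hw_mem (hW : ∀ a b, x a b ∈ W (μ₀ - (a + b) • α)) (n : ℕ) (C : ℕ → K) :
    gvec l x n C ∈ W (μ₀ - n • α) := by
  refine Submodule.sum_mem _ fun s _ => Submodule.smul_mem _ _ ?_
  have := hW s (n - s)
  rwa [add_sub_cancel, natCast_zsmul] at this

/-- The second stretch of a string, where the left exponent stays at `l - n`. The last vector of the
string is a lowest weight vector, so by uniqueness it is a multiple `a` of the highest weight vector
of the flipped grid. The flipped estimate then controls the string from below, provided that `a` is
`1` modulo `p`. -/
theorem dpow_hw_sub_mem' (H : RankOne p h α W e f) (hp : IsLocalParam R p)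
    (G : IsGrid p e f l m x) (hW : ∀ a b, x a b ∈ W (μ₀ - (a + b) • α)) (hμ : h μ₀ = l + m)
    {n : ℕ} (hl : n ≤ l) (hm : n ≤ m) {k : ℕ} (hk : l - n ≤ k) (hk' : k + 2 * n ≤ l + m) :
    dpow p f k (gvec l x n (hwCoeff p l m n)) - x (l - n) (k + 2 * n - l) ∈ gridRadical R p x := by
  have hz := hw_mem (l := l) hW n (hwCoeff p l m n)
  have hez := G.e_hw hp (n := n) hl
  obtain ⟨N, hN⟩ := Nat.exists_eq_add_of_le (show 2 * n ≤ l + m by omega)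
  have hhz : h (μ₀ - n • α) = N := by rw [H.h_sub, hμ]; omega
  have hfz : f (dpow p f N (gvec l x n (hwCoeff p l m n))) = 0 := by
    rw [H.f_dpow, H.dpow_eq_zero hz hez (by rw [hhz]; omega), smul_zero]
  have hlev : dpow p f N (gvec l x n (hwCoeff p l m n)) ∈
      gridLevel K (fun b a => x (l - a) (m - b)) n := by
    rw [gridLevel_flip, G.dpow_hw, show (l : ℤ) + m - n = (n + N : ℕ) by omega]
    exact gvec_mem _ _
  obtain ⟨a, ha⟩ := G.flip.eq_smul_hw hp hm hl hlev hfz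
  set z := gvec l x n (hwCoeff p l m n) with hzdef
  set z' := gvec m (fun b a => x (l - a) (m - b)) n (hwCoeff p m l n) with hzdef'
  have hdp : ∀ j, j ≤ N → dpow p f (N - j) z = a • dpow p e j z' := by
    intro j hj
    have := H.swap.dpow_dpow_swap (μ := -(μ₀ - n • α)) (by rwa [neg_neg]) hez (l := N)
      (by rw [map_neg, hhz]) j hj
    rw [← this, ha, map_smul]
  have hdp' : ∀ j, j ≤ m - n → dpow p e j z' - x (l - n) (m - j) ∈ gridRadical R p x := by
    intro j hj
    have := G.flip.dpow_hw_sub_mem hp hm hl hj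
    rwa [gridRadical_flip] at this
  -- Both stretches contain the corner `x (l - n) n`. Comparing its coefficient in the two
  -- descriptions gives `1 + p r = a (1 + p r')`.
  have ha1 : InO R p 1 (a - 1) := by
    obtain ⟨φ, hφ1, hφ⟩ := G.exists_coeff_mem R (a := l - n) (b := n) (by omega) (by omega)
      (by omega) (by omega)
    have h1 := G.dpow_hw_sub_mem hp hl hm le_rfl
    have h2 := hdp' (m - n) le_rfl
    rw [← hzdef, Nat.cast_sub hl] at h1
    rw [Nat.cast_sub hm, sub_sub_cancel] at h2
    obtain ⟨r, hr, h3⟩ := hφ _ h1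
    obtain ⟨r', hr', h4⟩ := hφ _ h2
    rw [map_sub, hφ1, sub_eq_iff_eq_add] at h3 h4
    have h5 := congrArg φ (hdp (m - n) (by omega))
    rw [show N - (m - n) = l - n by omega, map_smul, h3, h4, smul_eq_mul] at h5
    have h6 := hp.one_add_ne r' hr'
    have h7 : a = (1 + p * r) * (1 + p * r')⁻¹ := by
      rw [eq_mul_inv_iff_mul_eq₀ h6]
      linear_combination -h5
    have h8 : a - 1 = p * ((r - r') * (1 + p * r')⁻¹) := by
      rw [h7]
      field_simp
      ring
    rw [h8, InO, zpow_neg_one, ← mul_assoc, inv_mul_cancel₀ hp.ne_zero, one_mul]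
    exact R.mul_mem (R.sub_mem hr hr') (hp.inv_mem r' hr')
  have h1 := hdp' (N - k) (by omega)
  have h2 := hdp (N - k) (by omega)
  rw [show N - (N - k) = k by omega] at h2
  rw [show (m : ℤ) - (N - k : ℕ) = k + 2 * n - l by omega] at h1
  have h3 : dpow p e (N - k) z' ∈ gridLattice R x := by
    rw [← sub_add_cancel (dpow p e (N - k) z') (x (l - n) (k + 2 * n - l))]
    exact Submodule.add_mem _ (gridRadical_le hp h1) (grid_mem R x _ _)
  have h4 : a • dpow p e (N - k) z' - x (l - n) (k + 2 * n - l) =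
      (a - 1) • dpow p e (N - k) z' + (dpow p e (N - k) z' - x (l - n) (k + 2 * n - l)) := by
    rw [sub_smul, one_smul]
    abel
  rw [h2, h4]
  exact Submodule.add_mem _ (smul_mem_gridRadical hp ha1 h3) h1

/-- The divided powers of the highest weight vector of level `n`. -/
def strVec (p : K) (f : Module.End K M) (l m : ℕ) (x : ℤ → ℤ → M) (n k : ℕ) : M :=
  dpow p f k (gvec l x n (hwCoeff p l m n))

/-- The stretches, read backwards. For `a + b ≤ l` the grid vector is on the first stretch, with `n
= b` and `k = a`; otherwise it is on the second, with `n = l - a` and `k = b + 2a - l`. The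
neighbours along the string are the grid vectors of the tensor product rule; the turn is at `a + b =
l`. -/
theorem exists_strVec (H : RankOne p h α W e f) (hp : IsLocalParam R p)
    (G : IsGrid p e f l m x) (hW : ∀ a b, x a b ∈ W (μ₀ - (a + b) • α)) (hμ : h μ₀ = l + m)
    {a b : ℤ} (ha : 0 ≤ a) (ha' : a ≤ l) (hb : 0 ≤ b) (hb' : b ≤ m) :
    ∃ n k : ℕ, n ≤ l ∧ n ≤ m ∧ k + 2 * n ≤ l + m ∧
      strVec p f l m x n k - x a b ∈ gridRadical R p x ∧
      (if k = 0 then 0 else strVec p f l m x n (k - 1)) -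
        (if a + b ≤ l then x (a - 1) b else x a (b - 1)) ∈ gridRadical R p x ∧
      strVec p f l m x n (k + 1) - (if a + b < l then x (a + 1) b else x a (b + 1)) ∈
        gridRadical R p x := by
  obtain ⟨a, rfl⟩ := Int.eq_ofNat_of_zero_le ha
  obtain ⟨b, rfl⟩ := Int.eq_ofNat_of_zero_le hb
  have low : ∀ n k : ℕ, n ≤ l → n ≤ m → k + n ≤ l →
      strVec p f l m x n k - x k n ∈ gridRadical R p x := fun n k h1 h2 h3 =>
    G.dpow_hw_sub_mem hp h1 h2 (by omega)
  have high : ∀ n k : ℕ, n ≤ l → n ≤ m → l ≤ k + n →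
      strVec p f l m x n k - x (l - n) (k + 2 * n - l) ∈ gridRadical R p x := by
    intro n k h1 h2 h3
    by_cases h4 : k + 2 * n ≤ l + m
    · exact G.dpow_hw_sub_mem' H hp hW hμ h1 h2 (by omega) h4
    · rw [G.zero _ _ (by omega), strVec, H.dpow_eq_zero (hw_mem hW n _) (G.e_hw hp h1)
        (by rw [H.h_sub, hμ]; omega), sub_zero]
      exact Submodule.zero_mem _
  by_cases hab : a + b ≤ l
  · refine ⟨b, a, by omega, by omega, by omega, low b a (by omega) (by omega) hab, ?_, ?_⟩
    · rw [if_pos (show (a : ℤ) + b ≤ l by omega)]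
      split_ifs with h0
      · rw [G.zero _ _ (by omega), sub_zero]
        exact Submodule.zero_mem _
      · have := low b (a - 1) (by omega) (by omega) (by omega)
        rwa [Nat.cast_sub (by omega), Nat.cast_one] at this
    · split_ifs with h0
      · have := low b (a + 1) (by omega) (by omega) (by omega)
        rwa [Nat.cast_succ] at this
      · have := high b (a + 1) (by omega) (by omega) (by omega)
        rwa [show (l : ℤ) - b = a by omega,
          show ((a + 1 : ℕ) : ℤ) + 2 * b - l = b + 1 by omega] at this
  · refine ⟨l - a, b + 2 * a - l, by omega, by omega, by omega, ?_, ?_, ?_⟩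
    · have := high (l - a) (b + 2 * a - l) (by omega) (by omega) (by omega)
      rwa [show (l : ℤ) - (l - a : ℕ) = a by omega,
        show ((b + 2 * a - l : ℕ) : ℤ) + 2 * (l - a : ℕ) - l = b by omega] at this
    · rw [if_neg (by omega), if_neg (show ¬(a : ℤ) + b ≤ l by omega)]
      have := high (l - a) (b + 2 * a - l - 1) (by omega) (by omega) (by omega)
      rwa [show (l : ℤ) - (l - a : ℕ) = a by omega,
        show ((b + 2 * a - l - 1 : ℕ) : ℤ) + 2 * (l - a : ℕ) - l = b - 1 by omega] at this
    · rw [if_neg (by omega)]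
      have := high (l - a) (b + 2 * a - l + 1) (by omega) (by omega) (by omega)
      rwa [show (l : ℤ) - (l - a : ℕ) = a by omega,
        show ((b + 2 * a - l + 1 : ℕ) : ℤ) + 2 * (l - a : ℕ) - l = b + 1 by omega] at this

theorem strVec_mem (H : RankOne p h α W e f) (hp : IsLocalParam R p)
    (G : IsGrid p e f l m x) (hW : ∀ a b, x a b ∈ W (μ₀ - (a + b) • α)) (hμ : h μ₀ = l + m)
    {n : ℕ} (hl : n ≤ l) (hm : n ≤ m) (k : ℕ) : strVec p f l m x n k ∈ gridLattice R x := by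
  by_cases h1 : k ≤ l - n
  · have := gridRadical_le hp (G.dpow_hw_sub_mem hp hl hm h1)
    rw [← sub_add_cancel (strVec p f l m x n k) (x k n)]
    exact Submodule.add_mem _ this (grid_mem R x _ _)
  by_cases h2 : k + 2 * n ≤ l + m
  · have := gridRadical_le hp (G.dpow_hw_sub_mem' H hp hW hμ hl hm (by omega) h2)
    rw [← sub_add_cancel (strVec p f l m x n k) (x (l - n) (k + 2 * n - l))]
    exact Submodule.add_mem _ this (grid_mem R x _ _)
  · rw [strVec, H.dpow_eq_zero (hw_mem hW n _) (G.e_hw hp hl) (by rw [H.h_sub, hμ]; omega)]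
    exact Submodule.zero_mem _

theorem _root_.QSuper.IsLocalParam.mem_jacobson (hp : IsLocalParam R p) :
    (⟨p, hp.mem⟩ : R) ∈ Ideal.jacobson (⊥ : Ideal R) := by
  rw [Ideal.mem_jacobson_bot]
  intro y
  have h1 := hp.one_add_ne y y.2
  refine IsUnit.of_mul_eq_one ⟨_, hp.inv_mem y y.2⟩ (Subtype.ext ?_)
  change (p * (y : K) + 1) * (1 + p * y)⁻¹ = 1
  rw [add_comm, mul_inv_cancel₀ h1]

theorem gridLattice_fg (R : Subring K) (G : IsGrid p e f l m x) : (gridLattice R x).FG := by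
  have h1 : gridLattice R x = Submodule.span R
      (Set.image2 x (Set.Icc 0 (l : ℤ)) (Set.Icc 0 (m : ℤ))) := by
    refine le_antisymm (Submodule.span_le.mpr ?_) (Submodule.span_mono ?_)
    · rintro _ ⟨a, b, rfl⟩
      by_cases h0 : (0 ≤ a ∧ a ≤ l) ∧ 0 ≤ b ∧ b ≤ m
      · exact Submodule.subset_span ⟨a, h0.1, b, h0.2, rfl⟩
      · rw [G.zero _ _ (by omega)]
        exact Submodule.zero_mem _
    · rintro _ ⟨a, _, b, _, rfl⟩
      exact ⟨a, b, rfl⟩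
  rw [h1]
  exact Submodule.fg_span ((Set.finite_Icc _ _).image2 _ (Set.finite_Icc _ _))

/-- Nakayama's lemma: modulo `p` every grid vector is a string vector, the lattice is finitely
generated, and `p` is in the Jacobson radical. -/
theorem gridLattice_le (H : RankOne p h α W e f) (hp : IsLocalParam R p)
    (G : IsGrid p e f l m x) (hW : ∀ a b, x a b ∈ W (μ₀ - (a + b) • α)) (hμ : h μ₀ = l + m) :
    gridLattice R x ≤ Submodule.span R
      {y | ∃ n k : ℕ, n ≤ l ∧ n ≤ m ∧ k + 2 * n ≤ l + m ∧ y = strVec p f l m x n k} := by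
  refine Submodule.le_of_le_smul_of_le_jacobson_bot (I := Ideal.span {⟨p, hp.mem⟩})
    (G.gridLattice_fg R) ?_ ?_
  · rw [Ideal.span_singleton_le_iff_mem]
    exact hp.mem_jacobson
  · nth_rewrite 1 [gridLattice]
    rw [Submodule.span_le]
    rintro _ ⟨a, b, rfl⟩
    by_cases h0 : (0 ≤ a ∧ a ≤ l) ∧ 0 ≤ b ∧ b ≤ m
    · obtain ⟨n, k, h1, h2, h3, ⟨w, hw, h4⟩, -⟩ :=
        G.exists_strVec H hp hW hμ h0.1.1 h0.1.2 h0.2.1 h0.2.2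
      rw [sub_eq_iff_eq_add', ← sub_eq_iff_eq_add] at h4
      rw [← h4, sub_eq_add_neg]
      refine Submodule.add_mem_sup (Submodule.subset_span ⟨n, k, h1, h2, h3, rfl⟩)
        (Submodule.neg_mem _ ?_)
      exact Submodule.smul_mem_smul (Ideal.mem_span_singleton_self _) hw
    · rw [G.zero _ _ (by omega)]
      exact Submodule.zero_mem _

variable {E F : Module.End K M}

/-- The operator shifts the string vectors, and these span the lattice. -/
theorem isE_mem (H : RankOne p h α W e f) (hp : IsLocalParam R p)
    (G : IsGrid p e f l m x) (hW : ∀ a b, x a b ∈ W (μ₀ - (a + b) • α)) (hμ : h μ₀ = l + m)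
    (hE : RankOne.IsE p h W e f E) {w : M} (hw : w ∈ gridLattice R x) : E w ∈ gridLattice R x := by
  have h1 := G.gridLattice_le H hp hW hμ hw
  refine Submodule.span_induction (p := fun w _ => E w ∈ gridLattice R x) ?_ ?_ ?_ ?_ h1
  · rintro _ ⟨n, k, h2, h3, h4, rfl⟩
    rw [strVec, hE _ _ (hw_mem hW n _) (G.e_hw hp h2) k (by rw [H.h_sub, hμ]; omega)]
    split_ifs
    · exact Submodule.zero_mem _
    · exact G.strVec_mem H hp hW hμ h2 h3 _
  · rw [map_zero]; exact Submodule.zero_mem _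
  · intro u v _ _ hu hv
    rw [map_add]; exact Submodule.add_mem _ hu hv
  · intro c u _ hu
    have : E (c • u) = c • E u := E.map_smul (c : K) u
    rw [this]
    exact Submodule.smul_mem _ _ hu

theorem isF_mem (H : RankOne p h α W e f) (hp : IsLocalParam R p)
    (G : IsGrid p e f l m x) (hW : ∀ a b, x a b ∈ W (μ₀ - (a + b) • α)) (hμ : h μ₀ = l + m)
    (hF : RankOne.IsF p h W e f F) {w : M} (hw : w ∈ gridLattice R x) : F w ∈ gridLattice R x := by
  have h1 := G.gridLattice_le H hp hW hμ hw
  refine Submodule.span_induction (p := fun w _ => F w ∈ gridLattice R x) ?_ ?_ ?_ ?_ h1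
  · rintro _ ⟨n, k, h2, h3, h4, rfl⟩
    rw [strVec, hF _ _ (hw_mem hW n _) (G.e_hw hp h2) k (by rw [H.h_sub, hμ]; omega)]
    exact G.strVec_mem H hp hW hμ h2 h3 _
  · rw [map_zero]; exact Submodule.zero_mem _
  · intro u v _ _ hu hv
    rw [map_add]; exact Submodule.add_mem _ hu hv
  · intro c u _ hu
    have : F (c • u) = c • F u := F.map_smul (c : K) u
    rw [this]
    exact Submodule.smul_mem _ _ hu

theorem map_mem_gridRadical {T : Module.End K M}
    (hT : ∀ w ∈ gridLattice R x, T w ∈ gridLattice R x) {w : M} (hw : w ∈ gridRadical R p x) :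
    T w ∈ gridRadical R p x := by
  obtain ⟨y, hy, rfl⟩ := hw
  exact ⟨T y, hT y hy, by rw [map_smul]⟩

/-- The tensor product rule for the operator lowering the degree of the divided powers. -/
theorem isE_apply (H : RankOne p h α W e f) (hp : IsLocalParam R p)
    (G : IsGrid p e f l m x) (hW : ∀ a b, x a b ∈ W (μ₀ - (a + b) • α)) (hμ : h μ₀ = l + m)
    (hE : RankOne.IsE p h W e f E) {a b : ℤ} (ha : 0 ≤ a) (ha' : a ≤ l) (hb : 0 ≤ b) (hb' : b ≤ m) :
    E (x a b) - (if a + b ≤ l then x (a - 1) b else x a (b - 1)) ∈ gridRadical R p x := by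
  obtain ⟨n, k, h1, h2, h3, h4, h5, -⟩ := G.exists_strVec H hp hW hμ ha ha' hb hb'
  have h6 := map_mem_gridRadical (fun w hw => G.isE_mem H hp hW hμ hE hw) h4
  rw [map_sub, strVec, hE _ _ (hw_mem hW n _) (G.e_hw hp h1) k (by rw [H.h_sub, hμ]; omega)] at h6
  have h7 := Submodule.sub_mem _ h5 h6
  convert h7 using 1
  rw [strVec]
  abel

/-- The tensor product rule for the operator raising the degree of the divided powers. -/
theorem isF_apply (H : RankOne p h α W e f) (hp : IsLocalParam R p)
    (G : IsGrid p e f l m x) (hW : ∀ a b, x a b ∈ W (μ₀ - (a + b) • α)) (hμ : h μ₀ = l + m)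
    (hF : RankOne.IsF p h W e f F) {a b : ℤ} (ha : 0 ≤ a) (ha' : a ≤ l) (hb : 0 ≤ b) (hb' : b ≤ m) :
    F (x a b) - (if a + b < l then x (a + 1) b else x a (b + 1)) ∈ gridRadical R p x := by
  obtain ⟨n, k, h1, h2, h3, h4, -, h5⟩ := G.exists_strVec H hp hW hμ ha ha' hb hb'
  have h6 := map_mem_gridRadical (fun w hw => G.isF_mem H hp hW hμ hF hw) h4
  rw [map_sub, strVec, hF _ _ (hw_mem hW n _) (G.e_hw hp h1) k (by rw [H.h_sub, hμ]; omega)] at h6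
  have h7 := Submodule.sub_mem _ h5 h6
  convert h7 using 1
  rw [strVec]
  abel

end IsGrid

end GridStrings

end QSuper

end

noncomputable section

namespace QSuper

/-! ## The operators of an even index on an integrable module -/

section LocalRing

theorem algebraMap_eval_zero_ne {g : Polynomial ℚ} (hg : g.eval 0 ≠ 0) :
    algebraMap (Polynomial ℚ) Kq g ≠ 0 := by
  intro h
  rw [map_eq_zero_iff _ (RatFunc.algebraMap_injective ℚ)] at h
  simp [h] at hg

theorem q_pow_mem (n : ℕ) : q ^ n ∈ Asub.toSubring :=
  Subring.pow_mem _ (show q ∈ Asub.toSubring from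
    ⟨Polynomial.X, 1, by simp, by simp [q]⟩) n

/-- For `x = f / g` the numerator of `1 + q^n x` is `g + X^n f`, whose value at `0` is that of `g`;
both the fraction and its inverse are then regular at `0`. -/
theorem isLocalParam_q_pow {n : ℕ} (hn : n ≠ 0) : IsLocalParam Asub.toSubring (q ^ n) := by
  have key : ∀ x ∈ Asub.toSubring, ∃ f g : Polynomial ℚ, f.eval 0 ≠ 0 ∧ g.eval 0 ≠ 0 ∧
      1 + q ^ n * x = algebraMap (Polynomial ℚ) Kq f / algebraMap (Polynomial ℚ) Kq g := by
    rintro x ⟨f, g, hg, rfl⟩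
    refine ⟨g + Polynomial.X ^ n * f, g, by simpa [hn] using hg, hg, ?_⟩
    have h1 := algebraMap_eval_zero_ne hg
    rw [map_add, map_mul, map_pow, RatFunc.algebraMap_X, add_div, div_self h1, mul_div_assoc]
    rfl
  refine ⟨pow_ne_zero _ q_ne_zero, q_pow_mem n, fun x hx => ?_, fun x hx => ?_⟩
  · obtain ⟨f, g, hf, hg, h⟩ := key x hx
    rw [h]
    exact div_ne_zero (algebraMap_eval_zero_ne hf) (algebraMap_eval_zero_ne hg)
  · obtain ⟨f, g, hf, hg, h⟩ := key x hx
    exact ⟨g, f, hf, by rw [h, inv_div]⟩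

end LocalRing

variable {I P : Type*} [AddCommGroup P] {D : Datum I P}
variable {M : Type*} [AddCommGroup M] [Module Kq M] (ρ : Uq D →ₐ[Kq] Module.End Kq M) (i : I)

/-- The parameter of the rank one algebra attached to `i`, a positive power of `q`. -/
def evP (D : Datum I P) (i : I) : Kq := q ^ (D.ℓ i).natAbs

/-- The raising operator of the rank one algebra attached to `i`. -/
def evE : Module.End Kq M :=
  -- For `ℓ i < 0` the parameter is `q_i⁻¹`. The factors `t_i^(±1)` keep the `sl₂` relation but
  -- change the divided powers by powers of `q_i`, chosen to absorb the powers in the definition of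
  -- the Kashiwara operators.
  if 0 < D.ℓ i then ρ (gen D (.e i)) else evP D i • ρ (t D i * gen D (.e i))

/-- The lowering operator of the rank one algebra attached to `i`. -/
def evF : Module.End Kq M :=
  if 0 < D.ℓ i then ρ (gen D (.f i)) else (evP D i)⁻¹ • ρ (gen D (.f i) * tinv D i)

variable {ρ i}

theorem evP_isLocalParam (D : Datum I P) (i : I) : IsLocalParam Asub.toSubring (evP D i) :=
  isLocalParam_q_pow (Int.natAbs_ne_zero.mpr (D.ℓ_ne_zero i))

theorem evP_of_pos (h : 0 < D.ℓ i) : evP D i = D.qi i := by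
  rw [evP, Datum.qi, ← zpow_natCast, Int.natAbs_of_nonneg h.le]

theorem evP_of_neg (h : ¬0 < D.ℓ i) : evP D i = (D.qi i)⁻¹ := by
  rw [evP, Datum.qi, ← zpow_natCast, Int.ofNat_natAbs_of_nonpos (not_lt.mp h), zpow_neg]

theorem qn_evP (D : Datum I P) (i : I) (n : ℤ) : qn (evP D i) n = qn (D.qi i) n := by
  by_cases h : 0 < D.ℓ i
  · rw [evP_of_pos h]
  · rw [evP_of_neg h, qn_inv]

theorem t_apply {μ : P} {u : M} (hu : u ∈ weightSpace ρ μ) (i : I) :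
    ρ (t D i) u = (D.qi i ^ D.h i μ) • u := by
  rw [t, hu, Datum.qi, ← zpow_mul]
  rfl

theorem tinv_apply {μ : P} {u : M} (hu : u ∈ weightSpace ρ μ) (i : I) :
    ρ (tinv D i) u = (D.qi i ^ (-D.h i μ)) • u := by
  rw [tinv, hu, Datum.qi, ← zpow_mul, mul_neg]
  rfl

theorem e_mem_weightSpace {μ : P} {u : M} (hu : u ∈ weightSpace ρ μ) (i : I) :
    ρ (gen D (.e i)) u ∈ weightSpace ρ (μ + D.α i) := by
  intro h
  rw [← Module.End.mul_apply, ← map_mul, (relations_gen D).qpow_e, map_smul, map_mul,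
    LinearMap.smul_apply, Module.End.mul_apply, hu h, map_smul, smul_smul, map_add,
    zpow_add₀ q_ne_zero, mul_comm]

theorem f_mem_weightSpace {μ : P} {u : M} (hu : u ∈ weightSpace ρ μ) (i : I) :
    ρ (gen D (.f i)) u ∈ weightSpace ρ (μ - D.α i) := by
  intro h
  rw [← Module.End.mul_apply, ← map_mul, (relations_gen D).qpow_f, map_smul, map_mul,
    LinearMap.smul_apply, Module.End.mul_apply, hu h, map_smul, smul_smul, map_sub,
    sub_eq_add_neg, zpow_add₀ q_ne_zero, mul_comm]

theorem e_f_apply (hi : D.p i = 0) {μ : P} {u : M} (hu : u ∈ weightSpace ρ μ) :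
    ρ (gen D (.e i)) (ρ (gen D (.f i)) u) - ρ (gen D (.f i)) (ρ (gen D (.e i)) u) =
      qn (D.qi i) (D.h i μ) • u := by
  have h1 := congrArg (fun x => ρ x u) ((relations_gen D).e_f_same i)
  simp only [hi, Fin.val_zero, mul_zero, pow_zero, one_smul, map_sub, map_mul, map_smul,
    LinearMap.sub_apply, LinearMap.smul_apply, Module.End.mul_apply] at h1
  have h2 := t_apply hu i
  have h3 := tinv_apply hu i
  rw [t] at h2
  rw [tinv] at h3
  rw [h1, h2, h3, ← sub_smul, smul_smul, qn, div_eq_inv_mul]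

theorem evE_apply (hi : D.p i = 0) {μ : P} {u : M} (hu : u ∈ weightSpace ρ μ) :
    evE ρ i u = (if 0 < D.ℓ i then 1 else D.qi i ^ (D.h i μ + 1)) • ρ (gen D (.e i)) u := by
  rw [evE]
  split_ifs with h
  · rw [one_smul]
  · rw [LinearMap.smul_apply, map_mul, Module.End.mul_apply, t_apply (e_mem_weightSpace hu i),
      smul_smul, evP_of_neg h, map_add, D.even_two i hi, ← zpow_neg_one,
      ← zpow_add₀ (qi_ne_zero D i)]
    congr 2
    ring

theorem evF_apply {μ : P} {u : M} (hu : u ∈ weightSpace ρ μ) :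
    evF ρ i u = (if 0 < D.ℓ i then 1 else D.qi i ^ (1 - D.h i μ)) • ρ (gen D (.f i)) u := by
  rw [evF]
  split_ifs with h
  · rw [one_smul]
  · rw [LinearMap.smul_apply, map_mul, Module.End.mul_apply, tinv_apply hu, map_smul,
      smul_smul, evP_of_neg h, inv_inv, sub_eq_add_neg, zpow_add₀ (qi_ne_zero D i), zpow_one]

theorem evE_mem (hi : D.p i = 0) {μ : P} {u : M} (hu : u ∈ weightSpace ρ μ) :
    evE ρ i u ∈ weightSpace ρ (μ + D.α i) := by
  rw [evE_apply hi hu]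
  exact Submodule.smul_mem _ _ (e_mem_weightSpace hu i)

theorem evF_mem {μ : P} {u : M} (hu : u ∈ weightSpace ρ μ) :
    evF ρ i u ∈ weightSpace ρ (μ - D.α i) := by
  rw [evF_apply hu]
  exact Submodule.smul_mem _ _ (f_mem_weightSpace hu i)

theorem evE_eq_zero_iff (hi : D.p i = 0) {μ : P} {u : M} (hu : u ∈ weightSpace ρ μ) :
    evE ρ i u = 0 ↔ ρ (gen D (.e i)) u = 0 := by
  rw [evE_apply hi hu, smul_eq_zero_iff_right]
  split_ifs
  · exact one_ne_zero
  · exact zpow_ne_zero _ (qi_ne_zero D i)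

theorem ev_comm (hi : D.p i = 0) {μ : P} {u : M} (hu : u ∈ weightSpace ρ μ) :
    evE ρ i (evF ρ i u) - evF ρ i (evE ρ i u) = qn (evP D i) (D.h i μ) • u := by
  rw [evE_apply hi (evF_mem hu), evF_apply (evE_mem hi hu), evE_apply hi hu, evF_apply hu,
    qn_evP, ← e_f_apply hi hu]
  split_ifs with h
  · simp only [one_smul]
  · rw [map_smul, map_smul, smul_smul, smul_smul, ← zpow_add₀ (qi_ne_zero D i),
      ← zpow_add₀ (qi_ne_zero D i), map_sub, map_add, D.even_two i hi]
    rw [show D.h i μ - 2 + 1 + (1 - D.h i μ) = 0 by ring,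
      show 1 - (D.h i μ + 2) + (D.h i μ + 1) = 0 by ring, zpow_zero, one_smul, one_smul]

/-- Vectors of infinitely many weights in a finite-dimensional space vanish at some place. -/
theorem exists_eq_zero_of_weights {K N : Type*} [Field K] [AddCommGroup N] [Module K N]
    {P : Type*} {W : P → Submodule K N} (hW : iSupIndep W) {w : ℕ → P} (hw : Function.Injective w)
    {v : ℕ → N} (hv : ∀ n, v n ∈ W (w n)) (S : Submodule K N) [FiniteDimensional K S]
    (hS : ∀ n, v n ∈ S) : ∃ n, v n = 0 := by
  by_contra! h
  have h1 : LinearIndependent K v := (hW.comp hw).linearIndependent _ hv h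
  have h2 : LinearIndependent K (fun n => (⟨v n, hS n⟩ : S)) :=
    LinearIndependent.of_comp S.subtype h1
  have := h2.finite
  exact not_finite ℕ

theorem weight_seq_injective {h : Module.Dual ℤ P} {α : P} (hα : h α = 2) (μ : P) :
    Function.Injective (fun n : ℕ => μ + n • α) := by
  intro a b hab
  have h1 := congrArg h hab
  simp only [map_add, map_nsmul, hα] at h1
  simp at h1
  omega

theorem e_pow_mem_weightSpace {μ : P} {u : M} (hu : u ∈ weightSpace ρ μ) (i : I) (n : ℕ) :
    (ρ (gen D (.e i)) ^ n) u ∈ weightSpace ρ (μ + n • D.α i) := by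
  induction n with
  | zero => simpa using hu
  | succ n ih =>
    rw [pow_succ', Module.End.mul_apply, succ_nsmul, ← add_assoc]
    exact e_mem_weightSpace ih i

theorem f_pow_mem_weightSpace {μ : P} {u : M} (hu : u ∈ weightSpace ρ μ) (i : I) (n : ℕ) :
    (ρ (gen D (.f i)) ^ n) u ∈ weightSpace ρ (μ - n • D.α i) := by
  induction n with
  | zero => simpa using hu
  | succ n ih =>
    rw [pow_succ', Module.End.mul_apply, succ_nsmul, ← sub_sub]
    exact f_mem_weightSpace ih i

/-- The vectors `e^n u` have distinct weights and lie in a finite-dimensional space, so they cannot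
all be nonzero. -/
theorem IsIntegrable.e_nil (hM : IsIntegrable ρ) (hi : D.p i = 0) {μ : P} {u : M}
    (hu : u ∈ weightSpace ρ μ) : ∃ n : ℕ, (ρ (gen D (.e i)) ^ n) u = 0 := by
  have := hM.locally_finite i hi u
  refine exists_eq_zero_of_weights hM.weight_indep (weight_seq_injective (D.even_two i hi) μ)
    (fun n => e_pow_mem_weightSpace hu i n)
    (Submodule.span Kq {v | ∃ x ∈ rankOne D i, v = ρ x u}) fun n => Submodule.subset_span ⟨gen D (.e i) ^ n, ?_, ?_⟩
  · exact Subalgebra.pow_mem _ (Algebra.subset_adjoin (by simp)) n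
  · rw [map_pow]

theorem IsIntegrable.f_nil (hM : IsIntegrable ρ) (hi : D.p i = 0) {μ : P} {u : M}
    (hu : u ∈ weightSpace ρ μ) : ∃ n : ℕ, (ρ (gen D (.f i)) ^ n) u = 0 := by
  have := hM.locally_finite i hi u
  refine exists_eq_zero_of_weights (w := fun n => μ - n • D.α i) hM.weight_indep ?_
    (fun n => f_pow_mem_weightSpace hu i n)
    (Submodule.span Kq {v | ∃ x ∈ rankOne D i, v = ρ x u}) fun n => Submodule.subset_span ⟨gen D (.f i) ^ n, ?_, ?_⟩
  · intro a b hab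
    refine weight_seq_injective (D.even_two i hi) (-μ) (neg_injective ?_)
    simpa [sub_eq_add_neg, add_comm] using hab
  · exact Subalgebra.pow_mem _ (Algebra.subset_adjoin (by simp)) n
  · rw [map_pow]

theorem evE_pow (hi : D.p i = 0) {μ : P} {u : M} (hu : u ∈ weightSpace ρ μ) (n : ℕ) :
    ∃ c : Kq, (evE ρ i ^ n) u = c • (ρ (gen D (.e i)) ^ n) u := by
  induction n with
  | zero => exact ⟨1, by simp⟩
  | succ n ih =>
    obtain ⟨c, hc⟩ := ih
    refine ⟨c * if 0 < D.ℓ i then 1 else D.qi i ^ (D.h i (μ + n • D.α i) + 1), ?_⟩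
    rw [pow_succ', Module.End.mul_apply, hc, map_smul, evE_apply hi (e_pow_mem_weightSpace hu i n),
      smul_smul, pow_succ', Module.End.mul_apply]

/-- The exponent is the sum of `h μ - 1 - 2k` over `k < n`, one term for each application of the
rescaled operator. -/
theorem evF_pow {μ : P} (hi : D.p i = 0) {u : M} (hu : u ∈ weightSpace ρ μ) (n : ℕ) :
    (evF ρ i ^ n) u = (if 0 < D.ℓ i then 1 else evP D i ^ ((n : ℤ) * (D.h i μ - n))) •
      (ρ (gen D (.f i)) ^ n) u := by
  induction n with
  | zero => simp
  | succ n ih =>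
    rw [pow_succ', Module.End.mul_apply, ih, map_smul, evF_apply (f_pow_mem_weightSpace hu i n),
      smul_smul, pow_succ', Module.End.mul_apply]
    congr 1
    split_ifs with h
    · rw [mul_one]
    · have h0 : evP D i ≠ 0 := (evP_isLocalParam D i).ne_zero
      rw [← inv_inv (D.qi i), ← evP_of_neg h, inv_zpow', ← zpow_add₀ h0, map_sub, map_nsmul,
        D.even_two i hi, nsmul_eq_mul]
      congr 1
      push_cast
      ring

theorem IsIntegrable.rankOne_ev (hM : IsIntegrable ρ) (hi : D.p i = 0) :
    RankOne (evP D i) (D.h i) (D.α i) (weightSpace ρ) (evE ρ i) (evF ρ i) where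
  h_α := D.even_two i hi
  p_ne := (evP_isLocalParam D i).ne_zero
  qn_ne _ := (evP_isLocalParam D i).qn_ne
  indep := hM.weight_indep
  top := hM.weight_top
  e_mem _ _ hu := evE_mem hi hu
  f_mem _ _ hu := evF_mem hu
  comm _ _ hu := ev_comm hi hu
  e_nil μ u hu := by
    obtain ⟨n, hn⟩ := hM.e_nil hi hu
    obtain ⟨c, hc⟩ := evE_pow hi hu n
    exact ⟨n, by rw [hc, hn, smul_zero]⟩
  f_nil μ u hu := by
    obtain ⟨n, hn⟩ := hM.f_nil hi hu
    exact ⟨n, by rw [evF_pow hi hu, hn, smul_zero]⟩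

theorem qint_eq (D : Datum I P) (i : I) (n : ℕ) : qint D i n = qn (evP D i) n := by
  rw [qn_evP, qint, qn, zpow_natCast, zpow_neg, zpow_natCast, inv_pow]

theorem qfact_eq (D : Datum I P) (i : I) (n : ℕ) : qfact D i n = qf (evP D i) n := by
  induction n with
  | zero => simp [qfact, qf]
  | succ n ih =>
    rw [qfact, Finset.prod_Icc_succ_top (by omega), ← qfact, ih, qf, qint_eq, mul_comm]

theorem dpow_evF (hi : D.p i = 0) {μ : P} {u : M} (hu : u ∈ weightSpace ρ μ) (n : ℕ) :
    dpow (evP D i) (evF ρ i) n u =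
      (if 0 < D.ℓ i then 1 else evP D i ^ ((n : ℤ) * (D.h i μ - n))) • fdiv ρ i n u := by
  rw [dpow, fdiv, LinearMap.smul_apply, LinearMap.smul_apply, evF_pow hi hu, qfact_eq, smul_comm]

/-- For `ℓ i < 0`, the normalisations of the divided powers `k` and `k - 1` differ by
`q_i^(l-2k+1)`, the factor prescribed in the definition. From here on both signs of `ℓ i` are
covered by one rule. -/
theorem isEvenE_iff (hi : D.p i = 0) (T : Module.End Kq M) :
    IsEvenE ρ i T ↔
      RankOne.IsE (evP D i) (D.h i) (weightSpace ρ) (evE ρ i) (evF ρ i) T := by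
  have h0 : evP D i ≠ 0 := (evP_isLocalParam D i).ne_zero
  refine forall_congr' fun μ => forall₂_congr fun v hv => ?_
  rw [evE_eq_zero_iff hi hv]
  refine forall_congr' fun _ => forall₂_congr fun k hk => ?_
  rw [dpow_evF hi hv, dpow_evF hi hv, map_smul]
  by_cases h : 0 < D.ℓ i
  · simp only [if_pos h, one_smul]
  · simp only [if_neg h]
    by_cases hk0 : k = 0
    · simp [hk0]
    · obtain ⟨k, rfl⟩ := Nat.exists_eq_succ_of_ne_zero hk0
      rw [if_neg hk0, if_neg hk0, ← inv_inv (D.qi i), ← evP_of_neg h, inv_zpow',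
        Nat.succ_sub_one,
        show ((k : ℕ) : ℤ) * (D.h i μ - k) = (k.succ : ℤ) * (D.h i μ - (k.succ : ℕ)) +
          -(D.h i μ - 2 * (k.succ : ℕ) + 1) by push_cast; ring, zpow_add₀ h0, mul_smul,
        (smul_right_injective M (zpow_ne_zero _ h0)).eq_iff]

theorem isEvenF_iff (hi : D.p i = 0) (T : Module.End Kq M) :
    IsEvenF ρ i T ↔
      RankOne.IsF (evP D i) (D.h i) (weightSpace ρ) (evE ρ i) (evF ρ i) T := by
  have h0 : evP D i ≠ 0 := (evP_isLocalParam D i).ne_zero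
  refine forall_congr' fun μ => forall₂_congr fun v hv => ?_
  rw [evE_eq_zero_iff hi hv]
  refine forall_congr' fun _ => forall₂_congr fun k hk => ?_
  rw [dpow_evF hi hv, dpow_evF hi hv, map_smul]
  by_cases h : 0 < D.ℓ i
  · simp only [if_pos h, one_smul]
  · simp only [if_neg h]
    rw [← inv_inv (D.qi i), ← evP_of_neg h, inv_zpow',
      show ((k + 1 : ℕ) : ℤ) * (D.h i μ - (k + 1 : ℕ)) = (k : ℤ) * (D.h i μ - (k : ℕ)) +
          -(-D.h i μ + 2 * (k : ℕ) + 1) by push_cast; ring, zpow_add₀ h0, mul_smul,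
        (smul_right_injective M (zpow_ne_zero _ h0)).eq_iff]

/-- The choice in `kashE` is meaningful because the string decomposition supplies an operator with
the prescribed values. -/
theorem IsIntegrable.isE_kashE (hM : IsIntegrable ρ) (hi : D.p i = 0) :
    RankOne.IsE (evP D i) (D.h i) (weightSpace ρ) (evE ρ i) (evF ρ i) (kashE ρ i) := by
  rw [kashE, if_pos hi, ← isEvenE_iff hi]
  refine Classical.epsilon_spec (p := IsEvenE ρ i) ?_
  obtain ⟨T, hT⟩ := (hM.rankOne_ev hi).exists_operator fun k _ =>
    if k = 0 then 0 else dpow (evP D i) (evF ρ i) (k - 1)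
  refine ⟨T, (isEvenE_iff hi T).mpr fun μ v hv he k hk => ?_⟩
  rw [hT μ v hv he k hk]
  split_ifs <;> rfl

theorem IsIntegrable.isF_kashF (hM : IsIntegrable ρ) (hi : D.p i = 0) :
    RankOne.IsF (evP D i) (D.h i) (weightSpace ρ) (evE ρ i) (evF ρ i) (kashF ρ i) := by
  rw [kashF, if_pos hi, ← isEvenF_iff hi]
  refine Classical.epsilon_spec (p := IsEvenF ρ i) ?_
  obtain ⟨T, hT⟩ := (hM.rankOne_ev hi).exists_operator fun k _ =>
    dpow (evP D i) (evF ρ i) (k + 1)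
  exact ⟨T, (isEvenF_iff hi T).mpr hT⟩

end QSuper

end

noncomputable section

namespace QSuper

/-! ## Strings in a crystal base -/

section Rank

variable {K P M : Type*} [Field K] [AddCommGroup P] [AddCommGroup M] [Module K M]
  {p : K} {h : Module.Dual ℤ P} {α : P} {W : P → Submodule K M} {e f E F : Module.End K M}

namespace RankOne

theorem IsF.pow_dpow_eq_zero (H : RankOne p h α W e f) (hF : IsF p h W e f F) {μ : P} {v : M}
    (hv : v ∈ W μ) (he : e v = 0) (r k : ℕ) (hk : (k : ℤ) ≤ h μ) (hr : h μ < (k + r : ℕ)) :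
    (F ^ r) (dpow p f k v) = 0 := by
  induction r with
  | zero => omega
  | succ r ih =>
    rw [pow_succ', Module.End.mul_apply]
    by_cases h1 : h μ < (k + r : ℕ)
    · rw [ih h1, map_zero]
    · rw [hF.pow_dpow hv he r k (by omega), hF μ v hv he _ (by omega), add_assoc,
        H.dpow_eq_zero hv he hr]

theorem pow_mem {L : AddSubgroup M} {T : Module.End K M} (hT : ∀ u ∈ L, T u ∈ L) (r : ℕ) {u : M}
    (hu : u ∈ L) : (T ^ r) u ∈ L := by
  induction r with
  | zero => exact hu
  | succ r ih => rw [pow_succ', Module.End.mul_apply]; exact hT _ ih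

theorem IsF.dpow_mem (hF : IsF p h W e f F) {L : AddSubgroup M} (hFL : ∀ u ∈ L, F u ∈ L) {μ : P}
    {v : M} (hv : v ∈ W μ) (he : e v = 0) (hL : v ∈ L) {k : ℕ} (hk : (k : ℤ) ≤ h μ) :
    dpow p f k v ∈ L := by
  have := hF.pow_dpow hv he k 0 (by simpa using hk)
  rw [zero_add, dpow_zero] at this
  rw [← this]
  exact pow_mem hFL _ hL

/-- The components with positive index can be recovered from `E` of the vector, so they are in `L`
as soon as that image is. With `qL` for `L`, a vector killed by `E` modulo `q` is congruent to its
highest weight component. -/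
theorem IsStr.strSum_sub_mem (hE : IsE p h W e f E) (hF : IsF p h W e f F) (L : AddSubgroup M)
    (hEL : ∀ u ∈ L, E u ∈ L) (hFL : ∀ u ∈ L, F u ∈ L) {μ : P} {c : ℕ →₀ M}
    (hc : IsStr h α W e μ c) (hL : E (strSum p f c) ∈ L) : strSum p f c - c 0 ∈ L := by
  obtain ⟨n, hn⟩ : ∃ n, ∀ j, n < j → c j = 0 := by
    obtain ⟨n, hn⟩ := c.support.exists_nat_subset_range
    refine ⟨n, fun j hj => ?_⟩
    by_contra h0
    have := Finset.mem_range.mp (hn (Finsupp.mem_support_iff.mpr h0))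
    omega
  induction n generalizing c with
  | zero =>
    have h1 : c = Finsupp.single 0 (c 0) := by
      ext j
      rcases Nat.eq_zero_or_pos j with rfl | hj
      · simp
      · rw [hn j hj, Finsupp.single_eq_of_ne (by omega)]
    have h2 : strSum p f c = c 0 := by
      rw [h1, strSum_single, dpow_zero, ← h1]
    rw [h2, sub_self]
    exact L.zero_mem
  | succ n ih =>
    have hcn : c (n + 1) ∈ L := by
      rw [← hE.pow_strSum hc (k := n + 1) hn, pow_succ, Module.End.mul_apply]
      exact pow_mem hEL _ hL
    have h1 : dpow p f (n + 1) (c (n + 1)) ∈ L := by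
      by_cases h0 : c (n + 1) = 0
      · rw [h0, map_zero]; exact L.zero_mem
      · exact hF.dpow_mem hFL (hc.mem _) (hc.e_eq _) hcn (hc.le _ h0)
    have h2 : strSum p f (c.erase (n + 1)) = strSum p f c - dpow p f (n + 1) (c (n + 1)) := by
      rw [eq_sub_iff_add_eq, ← strSum_single p f (n + 1) (c (n + 1)), ← map_add,
        Finsupp.erase_add_single]
    have h3 := ih (hc.erase (n + 1)) (by rw [h2, map_sub]; exact L.sub_mem hL (hEL _ h1))
      fun j hj => by
        rcases eq_or_ne j (n + 1) with rfl | hj'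
        · simp
        · rw [Finsupp.erase_ne hj']; exact hn j (by omega)
    rw [h2, Finsupp.erase_ne (by omega)] at h3
    have h4 := L.add_mem h3 h1
    convert h4 using 1
    abel

end RankOne

end Rank

/-! ### Classes modulo `q` of lattice vectors. -/

section Classes

variable {M : Type*} [AddCommGroup M] [Module Kq M] {L : Submodule A M}

theorem algebraMap_qA : algebraMap A Kq qA = q := rfl

/-- The element `u` of `L` has the class `b` in `L / qL`. -/
def IsCls (L : Submodule A M) (u : M) (b : Lbar L) : Prop := ∃ hu : u ∈ L, toBar L ⟨u, hu⟩ = b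

/-- The subgroup `qL` of `M`. -/
def qLat (L : Submodule A M) : Submodule A M := L.map (Module.toModuleEnd A M qA)

theorem qLat_le : qLat L ≤ L := by
  rintro _ ⟨w, hw, rfl⟩
  exact L.smul_mem qA hw

theorem map_mem_qLat {T : Module.End Kq M} (hT : ∀ u ∈ L, T u ∈ L) : ∀ u ∈ qLat L, T u ∈ qLat L := by
  rintro _ ⟨w, hw, rfl⟩
  exact ⟨T w, hT w hw, (T.map_smul q w).symm⟩

theorem exists_isCls (b : Lbar L) : ∃ u, IsCls L u b := by
  obtain ⟨u, rfl⟩ := Submodule.mkQ_surjective (qSub L) b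
  exact ⟨u, u.2, rfl⟩

namespace IsCls

variable {u v : M} {b b' : Lbar L}

theorem mem (hu : IsCls L u b) : u ∈ L := hu.1

theorem of_mem (hu : u ∈ L) : IsCls L u (toBar L ⟨u, hu⟩) := ⟨hu, rfl⟩

theorem unique (h : IsCls L u b) (h' : IsCls L u b') : b = b' := h.2.symm.trans h'.2

theorem zero : IsCls L 0 (0 : Lbar L) := ⟨L.zero_mem, map_zero _⟩

theorem add (h : IsCls L u b) (h' : IsCls L v b') : IsCls L (u + v) (b + b') :=
  ⟨L.add_mem h.1 h'.1, by rw [← h.2, ← h'.2, ← map_add]; rfl⟩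

theorem neg (h : IsCls L u b) : IsCls L (-u) (-b) :=
  ⟨L.neg_mem h.1, by rw [← h.2, ← map_neg]; rfl⟩

theorem zero_iff : IsCls L u 0 ↔ u ∈ qLat L := by
  constructor
  · rintro ⟨hu, h⟩
    have h1 : (⟨u, hu⟩ : L) ∈ qSub L := (Submodule.Quotient.mk_eq_zero _).mp h
    rw [qSub, Submodule.ideal_span_singleton_smul] at h1
    obtain ⟨w, -, hw⟩ := h1
    exact ⟨w, w.2, congrArg Subtype.val hw⟩
  · rintro ⟨w, hw, rfl⟩
    exact ⟨L.smul_mem qA hw, toBar_q_smul L ⟨w, hw⟩⟩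

theorem congr (h : IsCls L u b) (huv : v - u ∈ qLat L) : IsCls L v b := by
  have := (zero_iff.mpr huv).add h
  rwa [zero_add, sub_add_cancel] at this

theorem sub_mem (h : IsCls L u b) (h' : IsCls L v b) : u - v ∈ qLat L := by
  rw [← zero_iff, sub_eq_add_neg, ← add_neg_cancel b]
  exact h.add h'.neg

theorem bar {T : Module.End Kq M} (hT : ∀ u ∈ L, T u ∈ L) (h : IsCls L u b) :
    IsCls L (T u) (bar L T b) := by
  obtain ⟨hu, rfl⟩ := h
  refine ⟨hT u hu, ?_⟩
  have h1 : ∀ u ∈ L, opA T u ∈ L := hT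
  rw [QSuper.bar, dif_pos h1]
  rfl

theorem bar_pow {T : Module.End Kq M} (hT : ∀ u ∈ L, T u ∈ L) (h : IsCls L u b) (n : ℕ) :
    IsCls L ((T ^ n) u) ((QSuper.bar L T ^ n) b) := by
  induction n with
  | zero => exact h
  | succ n ih =>
    rw [pow_succ', pow_succ']
    exact ih.bar hT

end IsCls

end Classes

section Strings

variable {I P : Type*} [AddCommGroup P] {D : Datum I P}
  {M : Type*} [AddCommGroup M] [Module Kq M] {ρ : Uq D →ₐ[Kq] Module.End Kq M} {i : I}
  {L : Submodule A M} {B : Set (Lbar L)}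

/-- The element `b` of the crystal is the `a`-th element of the `i`-string of length `l` which
begins with the class of the vector `u` of weight `μ`. -/
structure IsStrRep (ρ : Uq D →ₐ[Kq] Module.End Kq M) (i : I) (L : Submodule A M) (b : Lbar L)
    (l a : ℕ) (μ : P) (u : M) : Prop where
  mem : u ∈ L
  wt : u ∈ weightSpace ρ μ
  e_eq : evE ρ i u = 0
  h_eq : D.h i μ = l
  le : a ≤ l
  cls : IsCls L (dpow (evP D i) (evF ρ i) a u) b
  ne : u ∉ qLat L

theorem IsPseudoBase.ne_zero (hB : IsPseudoBase L B) {b : Lbar L} (hb : b ∈ B) : b ≠ 0 := by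
  let _ := ratModule L
  obtain ⟨B₀, hli, -, rfl⟩ := hB
  rcases hb with hb | hb
  · exact hli.ne_zero ⟨b, hb⟩
  · exact fun h => hli.ne_zero ⟨-b, hb⟩ (by simp [h])

namespace IsStrRep

variable {b : Lbar L} {l a : ℕ} {μ : P} {u : M}

/-- `E^k` brings the divided power back to `u` and preserves `qL`. -/
theorem not_mem_qLat (S : IsStrRep ρ i L b l a μ u) (hM : IsIntegrable ρ)
    (hL : IsCrystalLattice ρ L) (hi : D.p i = 0) {k : ℕ} (hk : k ≤ l) :
    dpow (evP D i) (evF ρ i) k u ∉ qLat L := by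
  intro h
  have h1 := RankOne.pow_mem (L := (qLat L).toAddSubgroup) (map_mem_qLat (hL.kashE_mem i)) k h
  have h2 := (hM.isE_kashE hi).pow_dpow S.wt S.e_eq k 0 (by rw [S.h_eq]; omega)
  rw [zero_add, dpow_zero] at h2
  rw [h2] at h1
  exact S.ne h1

theorem kashE (S : IsStrRep ρ i L b l a μ u) (hM : IsIntegrable ρ)
    (hL : IsCrystalLattice ρ L) (hi : D.p i = 0) :
    IsCls L (if a = 0 then 0 else dpow (evP D i) (evF ρ i) (a - 1) u) (bar L (kashE ρ i) b) := by
  have := S.cls.bar (hL.kashE_mem i)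
  rwa [hM.isE_kashE hi μ u S.wt S.e_eq a (by rw [S.h_eq]; exact_mod_cast S.le)] at this

theorem kashF (S : IsStrRep ρ i L b l a μ u) (hM : IsIntegrable ρ)
    (hL : IsCrystalLattice ρ L) (hi : D.p i = 0) :
    IsCls L (dpow (evP D i) (evF ρ i) (a + 1) u) (bar L (kashF ρ i) b) := by
  have := S.cls.bar (hL.kashF_mem i)
  rwa [hM.isF_kashF hi μ u S.wt S.e_eq a (by rw [S.h_eq]; exact_mod_cast S.le)] at this

/-- On the string the operator is a shift, and its vectors are nonzero modulo `q` until the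
beginning is passed. -/
theorem eps_eq (S : IsStrRep ρ i L b l a μ u) (hM : IsIntegrable ρ)
    (hL : IsCrystalLattice ρ L) (hi : D.p i = 0) : eps ρ L i b = a := by
  have hle := S.le
  have h0 : {n : ℕ | (bar L (QSuper.kashE ρ i) ^ n) b ≠ 0} = Set.Iic a := by
    ext n
    rw [Set.mem_ofPred_eq, Set.mem_Iic]
    have h1 := S.cls.bar_pow (hL.kashE_mem i) n
    by_cases hn : n ≤ a
    · refine iff_of_true (fun h2 => ?_) hn
      have h3 := (hM.isE_kashE hi).pow_dpow S.wt S.e_eq n (a - n) (by rw [S.h_eq]; omega)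
      rw [Nat.sub_add_cancel hn] at h3
      rw [h2, h3, IsCls.zero_iff] at h1
      exact S.not_mem_qLat hM hL hi (by omega) h1
    · refine iff_of_false (not_not.mpr ?_) hn
      rw [(hM.isE_kashE hi).pow_dpow_eq_zero S.wt S.e_eq n a (by rw [S.h_eq]; omega)
        (by omega)] at h1
      exact h1.unique IsCls.zero
  rw [eps, h0, csSup_Iic]

theorem phi_eq (S : IsStrRep ρ i L b l a μ u) (hM : IsIntegrable ρ)
    (hL : IsCrystalLattice ρ L) (hi : D.p i = 0) : phi ρ L i b = l - a := by
  have hle := S.le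
  have h0 : {n : ℕ | (bar L (QSuper.kashF ρ i) ^ n) b ≠ 0} = Set.Iic (l - a) := by
    ext n
    rw [Set.mem_ofPred_eq, Set.mem_Iic]
    have h1 := S.cls.bar_pow (hL.kashF_mem i) n
    by_cases hn : n ≤ l - a
    · refine iff_of_true (fun h2 => ?_) hn
      rw [h2, (hM.isF_kashF hi).pow_dpow S.wt S.e_eq n a (by rw [S.h_eq]; omega),
        IsCls.zero_iff] at h1
      exact S.not_mem_qLat hM hL hi (by omega) h1
    · refine iff_of_false (not_not.mpr ?_) hn
      rw [(hM.isF_kashF hi).pow_dpow_eq_zero (hM.rankOne_ev hi) S.wt S.e_eq n a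
        (by rw [S.h_eq]; omega) (by rw [S.h_eq]; omega)] at h1
      exact h1.unique IsCls.zero
  rw [phi, h0, csSup_Iic]

end IsStrRep

/-- Every element of a crystal base belongs to an `i`-string. -/
theorem IsCrystalBase.exists_isStrRep (hB : IsCrystalBase ρ L B) (hM : IsIntegrable ρ)
    (hi : D.p i = 0) {b : Lbar L} (hb : b ∈ B) : ∃ l a μ u, IsStrRep ρ i L b l a μ u := by
  have hL := hB.lattice
  have key : ∀ n : ℕ, ∀ b ∈ B, (bar L (kashE ρ i) ^ n) b = 0 →
      ∃ l a μ u, IsStrRep ρ i L b l a μ u := by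
    intro n
    induction n with
    | zero => exact fun b hb h => absurd h (hB.pseudoBase.ne_zero hb)
    | succ n ih =>
      intro b hb h
      rcases hB.kashE_mem i b hb with h1 | h1
      -- If `ẽ b` belongs to the base it lies on a string by induction, and `b = f̃ ẽ b` is the next
      -- element. As `b` is nonzero, the string has not ended.
      · obtain ⟨l, a, μ, u, S⟩ := ih _ h1 (by
          rwa [pow_succ, Module.End.mul_apply] at h)
        have h2 : b = bar L (kashF ρ i) (bar L (kashE ρ i) b) :=
          (hB.kash_iff i b hb _ h1).mpr rfl
        have h3 := S.kashF hM hL hi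
        rw [← h2] at h3
        refine ⟨l, a + 1, μ, u, S.mem, S.wt, S.e_eq, S.h_eq, ?_, h3, S.ne⟩
        by_contra h4
        rw [(hM.rankOne_ev hi).dpow_eq_zero S.wt S.e_eq (by rw [S.h_eq]; omega)] at h3
        exact hB.pseudoBase.ne_zero hb (h3.unique IsCls.zero)
      -- If `ẽ b = 0`, a representative of `b` may be replaced by its highest weight component,
      -- which starts a string.
      · obtain ⟨μ, ⟨u, hu, rfl⟩, -⟩ := hB.weight b hb
        obtain ⟨c, hc, hcu⟩ := (hM.rankOne_ev hi).exists_isStr hu.2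
        have h2 := (IsCls.of_mem u.2).bar (hL.kashE_mem i)
        rw [h1, IsCls.zero_iff, ← hcu] at h2
        have h3 := hc.strSum_sub_mem (hM.isE_kashE hi) (hM.isF_kashF hi)
          (qLat L).toAddSubgroup (map_mem_qLat (hL.kashE_mem i)) (map_mem_qLat (hL.kashF_mem i)) h2
        rw [hcu] at h3
        have h4 : IsCls L (c 0) (toBar L u) := (IsCls.of_mem u.2).congr (by
          rw [← neg_sub]
          exact Submodule.neg_mem _ h3)
        have h5 : c 0 ∉ qLat L := fun h5 =>
          hB.pseudoBase.ne_zero hb (h4.unique (IsCls.zero_iff.mpr h5))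
        have h6 : c 0 ≠ 0 := fun h6 => h5 (h6 ▸ Submodule.zero_mem _)
        have h7 := hc.mem 0
        have h8 := hc.le 0 h6
        rw [zero_smul, add_zero] at h7 h8
        obtain ⟨l, hl⟩ := Int.eq_ofNat_of_zero_le h8
        exact ⟨l, 0, μ, c 0, h4.mem, h7, hc.e_eq 0, hl, Nat.zero_le _, by rwa [dpow_zero], h5⟩
  obtain ⟨μ, ⟨u, hu, rfl⟩, -⟩ := hB.weight b hb
  obtain ⟨c, hc, hcu⟩ := (hM.rankOne_ev hi).exists_isStr hu.2
  obtain ⟨n, hn⟩ := c.support.exists_nat_subset_range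
  have hn : ∀ j, n ≤ j → c j = 0 := fun j hj => by
    by_contra h0
    have := Finset.mem_range.mp (hn (Finsupp.mem_support_iff.mpr h0))
    omega
  -- A representative has finitely many components, so a high enough power of `ẽ` kills its class.
  refine key n _ hb ?_
  have h1 := (IsCls.of_mem u.2).bar_pow (hL.kashE_mem i) n
  have h2 := (hM.isE_kashE hi).pow_strSum hc fun j hj => hn j hj.le
  rw [hcu, hn n le_rfl] at h2
  rw [h2] at h1
  exact h1.unique IsCls.zero

end Strings

end QSuper

end

noncomputable section

namespace QSuper

/-! ## The tensor product rule for an even index -/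

section Pairing

variable {K P : Type*} [Field K] [AddCommGroup P]
variable {N₁ N₂ M : Type*} [AddCommGroup N₁] [Module K N₁] [AddCommGroup N₂] [Module K N₂]
  [AddCommGroup M] [Module K M]

/-- The divided power of an operator, with `0` for the negative exponents. -/
def dpowInt (p : K) (f : Module.End K M) (a : ℤ) (u : M) : M :=
  if 0 ≤ a then dpow p f a.toNat u else 0

theorem dpowInt_natCast (p : K) (f : Module.End K M) (a : ℕ) (u : M) :
    dpowInt p f a u = dpow p f a u := by
  rw [dpowInt, if_pos (by omega), Int.toNat_natCast]

theorem dpowInt_neg (p : K) (f : Module.End K M) {a : ℤ} (ha : a < 0) (u : M) :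
    dpowInt p f a u = 0 := if_neg (by omega)

theorem ite_dpow_pred (p : K) (f : Module.End K M) (k : ℕ) (w : M) :
    (if k = 0 then 0 else dpow p f (k - 1) w) = dpowInt p f (k - 1) w := by
  rcases Nat.eq_zero_or_pos k with rfl | hk
  · rw [if_pos rfl, dpowInt_neg _ _ (by simp)]
  · rw [if_neg (by omega), ← dpowInt_natCast, Nat.cast_sub hk, Nat.cast_one]

namespace RankOne

variable {p : K} {h : Module.Dual ℤ P} {α : P} {W : P → Submodule K M} {e f : Module.End K M}
  {μ : P} {u : M} {l : ℕ}

theorem dpowInt_mem (H : RankOne p h α W e f) (hu : u ∈ W μ) (a : ℤ) :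
    dpowInt p f a u ∈ W (μ - a • α) := by
  by_cases ha : 0 ≤ a
  · obtain ⟨a, rfl⟩ := Int.eq_ofNat_of_zero_le ha
    rw [dpowInt_natCast, natCast_zsmul]
    exact H.dpow_mem hu a
  · rw [dpowInt_neg _ _ (by omega)]
    exact Submodule.zero_mem _

theorem dpowInt_eq_zero (H : RankOne p h α W e f) (hu : u ∈ W μ) (he : e u = 0) (hl : h μ = l)
    {a : ℤ} (ha : a < 0 ∨ l < a) : dpowInt p f a u = 0 := by
  by_cases ha' : 0 ≤ a
  · obtain ⟨a, rfl⟩ := Int.eq_ofNat_of_zero_le ha'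
    rw [dpowInt_natCast]
    exact H.dpow_eq_zero hu he (by omega)
  · exact dpowInt_neg _ _ (by omega) _

theorem e_dpowInt (H : RankOne p h α W e f) (hu : u ∈ W μ) (he : e u = 0) (hl : h μ = l) (a : ℤ) :
    e (dpowInt p f a u) = qn p (l - a + 1) • dpowInt p f (a - 1) u := by
  rcases lt_trichotomy a 0 with ha | rfl | ha
  · rw [dpowInt_neg _ _ ha, dpowInt_neg _ _ (by omega), map_zero, smul_zero]
  · rw [dpowInt_neg _ _ (show (0 : ℤ) - 1 < 0 by omega), smul_zero, ← Nat.cast_zero,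
      dpowInt_natCast, dpow_zero, he]
  · obtain ⟨a, rfl⟩ : ∃ b : ℕ, a = (b + 1 : ℕ) := ⟨a.toNat - 1, by omega⟩
    rw [dpowInt_natCast, H.e_dpow hu he, hl, Nat.cast_succ, add_sub_cancel_right, dpowInt_natCast]
    congr 2
    ring

theorem f_dpowInt (H : RankOne p h α W e f) (a : ℤ) :
    f (dpowInt p f a u) = qn p (a + 1) • dpowInt p f (a + 1) u := by
  by_cases ha : 0 ≤ a
  · obtain ⟨a, rfl⟩ := Int.eq_ofNat_of_zero_le ha
    rw [dpowInt_natCast, H.f_dpow, ← Nat.cast_succ, dpowInt_natCast]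
  · rw [dpowInt_neg _ _ (by omega), map_zero]
    rcases eq_or_ne a (-1) with rfl | h1
    · rw [neg_add_cancel, qn_zero, zero_smul]
    · rw [dpowInt_neg _ _ (by omega), smul_zero]

theorem dpowInt_dual (H : RankOne p h α W e f) (hu : u ∈ W μ) (he : e u = 0) (hl : h μ = l)
    (hu0 : u ≠ 0) {a : ℤ} (ha : 0 ≤ a) (ha' : a ≤ l) :
    ∃ φ : M →ₗ[K] K, ∀ a', φ (dpowInt p f a' u) = if a' = a then 1 else 0 := by
  classical
  have hne : dpowInt p f a u ≠ 0 := by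
    obtain ⟨a, rfl⟩ := Int.eq_ofNat_of_zero_le ha
    obtain ⟨c, hc, h1⟩ := H.e_pow_dpow hu he 0 a (by omega)
    rw [zero_add, dpow_zero] at h1
    intro h2
    rw [dpowInt_natCast] at h2
    rw [h2, map_zero] at h1
    exact smul_ne_zero hc hu0 h1.symm
  obtain ⟨ψ, hψ⟩ : ∃ ψ : M →ₗ[K] K, ψ (dpowInt p f a u) = 1 := by
    obtain ⟨ψ, hψ⟩ := not_forall.mp (mt (Module.forall_dual_apply_eq_zero_iff K _).mp hne)
    exact ⟨(ψ (dpowInt p f a u))⁻¹ • ψ, inv_mul_cancel₀ hψ⟩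
  -- The functional is extended by zero to the other weights; the vectors of the string have
  -- distinct weights.
  obtain ⟨φ, hφ⟩ := exists_linearMap_of_graded H.indep H.top (fun ν =>
    if ν = μ - a • α then ψ.comp (W ν).subtype else 0)
  refine ⟨φ, fun a' => ?_⟩
  have h1 := hφ _ ⟨_, H.dpowInt_mem hu a'⟩
  rw [h1]
  rcases eq_or_ne a' a with rfl | h2
  · rw [if_pos rfl, if_pos rfl]
    exact hψ
  · rw [if_neg, if_neg h2, LinearMap.zero_apply]
    intro h3
    have h4 := congrArg h h3
    rw [map_sub, map_sub, map_zsmul, map_zsmul, H.h_α] at h4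
    simp at h4
    exact h2 h4

end RankOne

/-- The bilinear map `B` is a morphism of representations of rank one for the comultiplication
`e ↦ e ⊗ t⁻¹ + 1 ⊗ e`, `f ↦ f ⊗ 1 + t ⊗ f`, and embeds the tensor product. -/
structure IsPairing (p : K) (h : Module.Dual ℤ P)
    (W₁ : P → Submodule K N₁) (e₁ f₁ : Module.End K N₁)
    (W₂ : P → Submodule K N₂) (e₂ f₂ : Module.End K N₂)
    (W : P → Submodule K M) (e f : Module.End K M) (B : N₁ →ₗ[K] N₂ →ₗ[K] M) : Prop where
  mem : ∀ ν μ, ∀ u ∈ W₁ ν, ∀ v ∈ W₂ μ, B u v ∈ W (ν + μ)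
  e_apply : ∀ u μ, ∀ v ∈ W₂ μ, e (B u v) = p ^ (-h μ) • B (e₁ u) v + B u (e₂ v)
  f_apply : ∀ ν, ∀ u ∈ W₁ ν, ∀ v, f (B u v) = B (f₁ u) v + p ^ h ν • B u (f₂ v)
  dual : ∀ (φ₁ : N₁ →ₗ[K] K) (φ₂ : N₂ →ₗ[K] K), ∃ φ : M →ₗ[K] K, ∀ u v, φ (B u v) = φ₁ u * φ₂ v

variable {p : K} {h : Module.Dual ℤ P} {α : P}
  {W₁ : P → Submodule K N₁} {e₁ f₁ : Module.End K N₁}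
  {W₂ : P → Submodule K N₂} {e₂ f₂ : Module.End K N₂}
  {W : P → Submodule K M} {e f : Module.End K M} {B : N₁ →ₗ[K] N₂ →ₗ[K] M}

theorem IsPairing.isGrid (hB : IsPairing p h W₁ e₁ f₁ W₂ e₂ f₂ W e f B)
    (H₁ : RankOne p h α W₁ e₁ f₁) (H₂ : RankOne p h α W₂ e₂ f₂) {ν μ : P} {u : N₁} {v : N₂}
    (hu : u ∈ W₁ ν) (hv : v ∈ W₂ μ) (heu : e₁ u = 0) (hev : e₂ v = 0) {l m : ℕ} (hl : h ν = l)
    (hm : h μ = m) (hu0 : u ≠ 0) (hv0 : v ≠ 0) :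
    IsGrid p e f l m (fun a b => B (dpowInt p f₁ a u) (dpowInt p f₂ b v)) where
  zero a b hab := by
    by_cases h1 : a < 0 ∨ (l : ℤ) < a
    · rw [H₁.dpowInt_eq_zero hu heu hl h1, map_zero, LinearMap.zero_apply]
    · rw [H₂.dpowInt_eq_zero hv hev hm (a := b) (by omega), map_zero]
  e_apply a b := by
    rw [hB.e_apply _ _ _ (H₂.dpowInt_mem hv b), H₁.e_dpowInt hu heu hl, H₂.e_dpowInt hv hev hm,
      map_smul, map_smul, LinearMap.smul_apply, smul_smul, map_sub, map_zsmul, H₁.h_α, hm,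
      smul_eq_mul]
    congr 4
    ring
  f_apply a b := by
    rw [hB.f_apply _ _ (H₁.dpowInt_mem hu a), H₁.f_dpowInt, H₂.f_dpowInt,
      map_smul, map_smul, LinearMap.smul_apply, smul_smul, map_sub, map_zsmul, H₁.h_α, hl,
      smul_eq_mul]
    congr 4
    ring
  dual a b ha ha' hb hb' := by
    obtain ⟨φ₁, h1⟩ := H₁.dpowInt_dual hu heu hl hu0 ha ha'
    obtain ⟨φ₂, h2⟩ := H₂.dpowInt_dual hv hev hm hv0 hb hb'
    obtain ⟨φ, hφ⟩ := hB.dual φ₁ φ₂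
    refine ⟨φ, fun a' b' => ?_⟩
    rw [hφ, h1, h2, ite_and]
    split_ifs <;> simp

theorem IsPairing.grid_mem (hB : IsPairing p h W₁ e₁ f₁ W₂ e₂ f₂ W e f B)
    (H₁ : RankOne p h α W₁ e₁ f₁) (H₂ : RankOne p h α W₂ e₂ f₂) {ν μ : P} {u : N₁} {v : N₂}
    (hu : u ∈ W₁ ν) (hv : v ∈ W₂ μ) (a b : ℤ) :
    B (dpowInt p f₁ a u) (dpowInt p f₂ b v) ∈ W (ν + μ - (a + b) • α) := by
  have := hB.mem _ _ _ (H₁.dpowInt_mem hu a) _ (H₂.dpowInt_mem hv b)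
  rwa [show ν - a • α + (μ - b • α) = ν + μ - (a + b) • α by rw [add_smul]; abel] at this

end Pairing

section EvenTensor

variable {I P : Type*} [AddCommGroup P] {D : Datum I P}
  {N₁ N₂ M : Type*} [AddCommGroup N₁] [Module Kq N₁] [AddCommGroup N₂] [Module Kq N₂]
  [AddCommGroup M] [Module Kq M]
  {ρ₁ : Uq D →ₐ[Kq] Module.End Kq N₁} {ρ₂ : Uq D →ₐ[Kq] Module.End Kq N₂}
  {ρ : Uq D →ₐ[Kq] Module.End Kq M} {i : I}
  {L₁ : Submodule A N₁} {L₂ : Submodule A N₂} {L : Submodule A M}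
  {B : N₁ →ₗ[Kq] N₂ →ₗ[Kq] M}

/-- The bilinear map `B` is compatible with the operators of the even index `i`. -/
def IsEvPairing (i : I) (ρ₁ : Uq D →ₐ[Kq] Module.End Kq N₁) (ρ₂ : Uq D →ₐ[Kq] Module.End Kq N₂)
    (ρ : Uq D →ₐ[Kq] Module.End Kq M) (B : N₁ →ₗ[Kq] N₂ →ₗ[Kq] M) : Prop :=
  IsPairing (evP D i) (D.h i) (weightSpace ρ₁) (evE ρ₁ i) (evF ρ₁ i) (weightSpace ρ₂) (evE ρ₂ i)
    (evF ρ₂ i) (weightSpace ρ) (evE ρ i) (evF ρ i) B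

theorem gridLattice_le_of_mem {x : ℤ → ℤ → M} (hx : ∀ a b, x a b ∈ L) {w : M}
    (hw : w ∈ gridLattice Asub.toSubring x) : w ∈ L := by
  refine Submodule.span_induction (p := fun w _ => w ∈ L) ?_ ?_ ?_ ?_ hw
  · rintro _ ⟨a, b, rfl⟩
    exact hx a b
  · exact L.zero_mem
  · exact fun u v _ _ hu hv => L.add_mem hu hv
  · exact fun c u _ hu => L.smul_mem (show A from c) hu

/-- The parameter `p` is a positive power of `q`, so congruences modulo `p` in the grid become
congruences modulo `q` in `L`. -/
theorem gridRadical_le_of_mem {x : ℤ → ℤ → M} (hx : ∀ a b, x a b ∈ L) {w : M}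
    (hw : w ∈ gridRadical Asub.toSubring (evP D i) x) : w ∈ qLat L := by
  obtain ⟨y, hy, rfl⟩ := hw
  have h1 := gridLattice_le_of_mem hx hy
  obtain ⟨n, hn⟩ := Nat.exists_eq_succ_of_ne_zero (Int.natAbs_ne_zero.mpr (D.ℓ_ne_zero i))
  rw [evP, hn, pow_succ', mul_smul]
  exact ⟨_, L.smul_mem (show A from ⟨_, q_pow_mem n⟩) h1, rfl⟩

/-- The vector `u` of the lattice is a highest weight vector of weight `l`. -/
structure IsHW (ρ : Uq D →ₐ[Kq] Module.End Kq M) (i : I) (L : Submodule A M) (l : ℕ) (μ : P)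
    (u : M) : Prop where
  mem : u ∈ L
  wt : u ∈ weightSpace ρ μ
  e_eq : evE ρ i u = 0
  h_eq : D.h i μ = l

theorem IsStrRep.isHW {b : Lbar L} {l a : ℕ} {μ : P} {u : M} (S : IsStrRep ρ i L b l a μ u) :
    IsHW ρ i L l μ u := ⟨S.mem, S.wt, S.e_eq, S.h_eq⟩

theorem IsHW.dpowInt_mem {l : ℕ} {μ : P} {u : M} (S : IsHW ρ i L l μ u) (hM : IsIntegrable ρ)
    (hL : IsCrystalLattice ρ L) (hi : D.p i = 0) (k : ℤ) :
    dpowInt (evP D i) (evF ρ i) k u ∈ L := by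
  by_cases hk : 0 ≤ k ∧ k ≤ l
  · obtain ⟨k, rfl⟩ := Int.eq_ofNat_of_zero_le hk.1
    rw [dpowInt_natCast]
    exact (hM.isF_kashF hi).dpow_mem (L := L.toAddSubgroup) (hL.kashF_mem i) S.wt S.e_eq S.mem
      (by rw [S.h_eq]; exact hk.2)
  · rw [(hM.rankOne_ev hi).dpowInt_eq_zero S.wt S.e_eq S.h_eq (by omega)]
    exact L.zero_mem

/-- A crystal lattice is spanned by the divided powers of its highest weight vectors. -/
theorem IsCrystalLattice.induction_hw (hL : IsCrystalLattice ρ L) (hM : IsIntegrable ρ)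
    (hi : D.p i = 0) {C : M → Prop} (h0 : C 0) (ha : ∀ u v, C u → C v → C (u + v))
    (hs : ∀ l μ u, IsHW ρ i L l μ u → ∀ a : ℕ, a ≤ l → C (dpow (evP D i) (evF ρ i) a u))
    {u : M} (hu : u ∈ L) : C u := by
  rw [← hL.weight_sup] at hu
  refine Submodule.iSup_induction _ (motive := C) hu (fun μ u hu => ?_) h0 ha
  obtain ⟨c, hc, rfl⟩ := (hM.rankOne_ev hi).exists_isStr hu.2
  refine Finset.sum_induction _ C ha h0 fun k _ => ?_
  have h1 : c k ∈ L := hc.mem_lattice (hM.isE_kashE hi) (hM.isF_kashF hi) L.toAddSubgroup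
    (hL.kashE_mem i) (hL.kashF_mem i) hu.1 k
  by_cases h2 : c k = 0
  · change C (dpow _ _ k (c k))
    rw [h2, map_zero]
    exact h0
  have h3 := hc.le k h2
  obtain ⟨l, hl⟩ := Int.eq_ofNat_of_zero_le (le_trans (Int.natCast_nonneg k) h3)
  exact hs l _ _ ⟨h1, hc.mem k, hc.e_eq k, hl⟩ k (by omega)

section

variable (hB : IsEvPairing i ρ₁ ρ₂ ρ B) (hN₁ : IsIntegrable ρ₁) (hN₂ : IsIntegrable ρ₂)
  (hM : IsIntegrable ρ) (hi : D.p i = 0) (hL₁ : IsCrystalLattice ρ₁ L₁)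
  (hL₂ : IsCrystalLattice ρ₂ L₂) (hBL : ∀ u ∈ L₁, ∀ v ∈ L₂, B u v ∈ L)
include hB hN₁ hN₂ hM hi hL₁ hL₂ hBL

/-- The rule for a single grid, transferred to `L` modulo `qL`. -/
theorem ev_tensor_kash {l m : ℕ} {ν μ : P} {u : N₁} {v : N₂} (hu : IsHW ρ₁ i L₁ l ν u)
    (hv : IsHW ρ₂ i L₂ m μ v) {a b : ℕ} (ha : a ≤ l) (hb : b ≤ m) :
    kashE ρ i (B (dpow (evP D i) (evF ρ₁ i) a u) (dpow (evP D i) (evF ρ₂ i) b v)) -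
      (if a + b ≤ l then
        B (dpowInt (evP D i) (evF ρ₁ i) (a - 1) u) (dpow (evP D i) (evF ρ₂ i) b v)
      else B (dpow (evP D i) (evF ρ₁ i) a u) (dpowInt (evP D i) (evF ρ₂ i) (b - 1) v)) ∈ qLat L ∧
    kashF ρ i (B (dpow (evP D i) (evF ρ₁ i) a u) (dpow (evP D i) (evF ρ₂ i) b v)) -
      (if a + b < l then
        B (dpow (evP D i) (evF ρ₁ i) (a + 1) u) (dpow (evP D i) (evF ρ₂ i) b v)
      else B (dpow (evP D i) (evF ρ₁ i) a u) (dpow (evP D i) (evF ρ₂ i) (b + 1) v)) ∈ qLat L := by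
  -- Dual functionals on the grid exist only for nonzero highest weight vectors.
  by_cases h0 : u = 0 ∨ v = 0
  · rcases h0 with rfl | rfl <;> simp [dpowInt]
  push Not at h0
  have H := hM.rankOne_ev hi
  have G := hB.isGrid (hN₁.rankOne_ev hi) (hN₂.rankOne_ev hi) hu.wt hv.wt hu.e_eq hv.e_eq hu.h_eq
    hv.h_eq h0.1 h0.2
  have hW := hB.grid_mem (hN₁.rankOne_ev hi) (hN₂.rankOne_ev hi) hu.wt hv.wt
  have hμ : D.h i (ν + μ) = l + m := by rw [map_add, hu.h_eq, hv.h_eq]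
  have hx : ∀ a b : ℤ, B (dpowInt (evP D i) (evF ρ₁ i) a u) (dpowInt (evP D i) (evF ρ₂ i) b v) ∈ L :=
    fun a b => hBL _ (hu.dpowInt_mem hN₁ hL₁ hi a) _ (hv.dpowInt_mem hN₂ hL₂ hi b)
  have h1 := gridRadical_le_of_mem hx (G.isE_apply H (evP_isLocalParam D i) hW hμ
    (hM.isE_kashE hi) (a := a) (b := b) (by omega) (by omega) (by omega) (by omega))
  have h2 := gridRadical_le_of_mem hx (G.isF_apply H (evP_isLocalParam D i) hW hμ
    (hM.isF_kashF hi) (a := a) (b := b) (by omega) (by omega) (by omega) (by omega))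
  simp only [← Nat.cast_add, ← Nat.cast_succ, Nat.cast_le, Nat.cast_lt, dpowInt_natCast] at h1 h2
  exact ⟨h1, h2⟩

theorem ev_tensor_kash_mem {u : N₁} (hu : u ∈ L₁) {v : N₂} (hv : v ∈ L₂) :
    kashE ρ i (B u v) ∈ L ∧ kashF ρ i (B u v) ∈ L := by
  revert v
  refine hL₁.induction_hw hN₁ hi (C := fun u => ∀ {v : N₂}, v ∈ L₂ →
    kashE ρ i (B u v) ∈ L ∧ kashF ρ i (B u v) ∈ L) ?_ ?_ ?_ hu
  · intro v _
    simp
  · intro u u' h1 h2 v hv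
    rw [map_add, LinearMap.add_apply, map_add, map_add]
    exact ⟨L.add_mem (h1 hv).1 (h2 hv).1, L.add_mem (h1 hv).2 (h2 hv).2⟩
  intro l ν u hu a ha v hv
  refine hL₂.induction_hw hN₂ hi (C := fun v => kashE ρ i (B _ v) ∈ L ∧ kashF ρ i (B _ v) ∈ L)
    ?_ ?_ ?_ hv
  · simp
  · intro v v' h1 h2
    rw [map_add, map_add, map_add]
    exact ⟨L.add_mem h1.1 h2.1, L.add_mem h1.2 h2.2⟩
  intro m μ v hv b hb
  have hx : ∀ a b : ℤ, B (dpowInt (evP D i) (evF ρ₁ i) a u) (dpowInt (evP D i) (evF ρ₂ i) b v) ∈ L :=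
    fun a b => hBL _ (hu.dpowInt_mem hN₁ hL₁ hi a) _ (hv.dpowInt_mem hN₂ hL₂ hi b)
  obtain ⟨h1, h2⟩ := ev_tensor_kash hB hN₁ hN₂ hM hi hL₁ hL₂ hBL hu hv ha hb
  simp only [← dpowInt_natCast] at h1 h2 ⊢
  refine ⟨(Submodule.sub_mem_iff_left L ?_).mp (qLat_le h1),
    (Submodule.sub_mem_iff_left L ?_).mp (qLat_le h2)⟩
  · split_ifs <;> exact hx _ _
  · split_ifs <;> exact hx _ _

/-- The tensor product rule for an even index. -/
theorem ev_tensor_rule {T : Lbar L₁ → Lbar L₂ → Lbar L}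
    (hT : ∀ {u v b₁ b₂}, IsCls L₁ u b₁ → IsCls L₂ v b₂ → IsCls L (B u v) (T b₁ b₂))
    (hE : ∀ w ∈ L, kashE ρ i w ∈ L) (hF : ∀ w ∈ L, kashF ρ i w ∈ L)
    {b₁ : Lbar L₁} {b₂ : Lbar L₂} {l m a b : ℕ} {ν μ : P} {u : N₁} {v : N₂}
    (S₁ : IsStrRep ρ₁ i L₁ b₁ l a ν u) (S₂ : IsStrRep ρ₂ i L₂ b₂ m b μ v) :
    (eps ρ₂ L₂ i b₂ ≤ phi ρ₁ L₁ i b₁ →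
      bar L (kashE ρ i) (T b₁ b₂) = T (bar L₁ (kashE ρ₁ i) b₁) b₂) ∧
    (phi ρ₁ L₁ i b₁ < eps ρ₂ L₂ i b₂ →
      bar L (kashE ρ i) (T b₁ b₂) = T b₁ (bar L₂ (kashE ρ₂ i) b₂)) ∧
    (eps ρ₂ L₂ i b₂ < phi ρ₁ L₁ i b₁ →
      bar L (kashF ρ i) (T b₁ b₂) = T (bar L₁ (kashF ρ₁ i) b₁) b₂) ∧
    (phi ρ₁ L₁ i b₁ ≤ eps ρ₂ L₂ i b₂ →
      bar L (kashF ρ i) (T b₁ b₂) = T b₁ (bar L₂ (kashF ρ₂ i) b₂)) := by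
  have hla := S₁.le
  -- Here `φ` is `l - a` and `ε` is `b`, so the condition `a + b ≤ l` of the grid is `ε ≤ φ`.
  rw [S₁.phi_eq hN₁ hL₁ hi, S₂.eps_eq hN₂ hL₂ hi]
  obtain ⟨h1, h2⟩ := ev_tensor_kash hB hN₁ hN₂ hM hi hL₁ hL₂ hBL S₁.isHW S₂.isHW S₁.le S₂.le
  have h3 := (hT S₁.cls S₂.cls).bar hE
  have h4 := (hT S₁.cls S₂.cls).bar hF
  have h5 := S₁.kashE hN₁ hL₁ hi
  have h6 := S₂.kashE hN₂ hL₂ hi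
  have h7 := S₁.kashF hN₁ hL₁ hi
  have h8 := S₂.kashF hN₂ hL₂ hi
  have hneg : ∀ {x y : M}, x - y ∈ qLat L → y - x ∈ qLat L := by
    intro x y hxy
    rw [← neg_sub]
    exact Submodule.neg_mem _ hxy
  refine ⟨fun hc => ?_, fun hc => ?_, fun hc => ?_, fun hc => ?_⟩
  · rw [if_pos (by omega), ← ite_dpow_pred] at h1
    exact (h3.congr (hneg h1)).unique (hT h5 S₂.cls)
  · rw [if_neg (by omega), ← ite_dpow_pred] at h1
    exact (h3.congr (hneg h1)).unique (hT S₁.cls h6)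
  · rw [if_pos (by omega)] at h2
    exact (h4.congr (hneg h2)).unique (hT h7 S₂.cls)
  · rw [if_neg (by omega)] at h2
    exact (h4.congr (hneg h2)).unique (hT S₁.cls h8)

end

end EvenTensor

end QSuper

end

noncomputable section

namespace QSuper

/-! ## The action on the tensor product -/

section TensorAction

variable {I P : Type*} [AddCommGroup P] {D : Datum I P}
  {M₁ M₂ : Type*} [AddCommGroup M₁] [Module Kq M₁] [AddCommGroup M₂] [Module Kq M₂]
  {Δ : Uq D →ₐ[Kq] Uq D ⊗[Kq] Uq D}
  {ρ₁ : Uq D →ₐ[Kq] Module.End Kq M₁} {ρ₂ : Uq D →ₐ[Kq] Module.End Kq M₂}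

theorem tensorRep_apply {x : Uq D} {a b : Uq D} (h : Δ x = a ⊗ₜ b) (u : M₁) (v : M₂) :
    tensorRep Δ ρ₁ ρ₂ x (u ⊗ₜ v) = ρ₁ a u ⊗ₜ ρ₂ b v := by
  simp [tensorRep, h, Module.endTensorEndAlgHom_apply]

theorem tensorRep_apply_add {x : Uq D} {a b a' b' : Uq D} (h : Δ x = a ⊗ₜ b + a' ⊗ₜ b')
    (u : M₁) (v : M₂) :
    tensorRep Δ ρ₁ ρ₂ x (u ⊗ₜ v) = ρ₁ a u ⊗ₜ ρ₂ b v + ρ₁ a' u ⊗ₜ ρ₂ b' v := by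
  simp [tensorRep, h, Module.endTensorEndAlgHom_apply]

variable (hΔ : IsComul D Δ)
include hΔ

theorem IsComul.rep_σ (u : M₁) (v : M₂) : tensorRep Δ ρ₁ ρ₂ (gen D .σ) (u ⊗ₜ v) =
    ρ₁ (gen D .σ) u ⊗ₜ ρ₂ (gen D .σ) v := tensorRep_apply hΔ.σ u v

theorem IsComul.rep_qpow (h : Module.Dual ℤ P) (u : M₁) (v : M₂) :
    tensorRep Δ ρ₁ ρ₂ (gen D (.qpow h)) (u ⊗ₜ v) =
      ρ₁ (gen D (.qpow h)) u ⊗ₜ ρ₂ (gen D (.qpow h)) v := tensorRep_apply (hΔ.qpow h) u v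

theorem IsComul.rep_e (i : I) (u : M₁) (v : M₂) : tensorRep Δ ρ₁ ρ₂ (gen D (.e i)) (u ⊗ₜ v) =
    ρ₁ (gen D (.e i)) u ⊗ₜ ρ₂ (tinv D i) v +
      (ρ₁ (gen D .σ) ^ (D.p i : ℕ)) u ⊗ₜ ρ₂ (gen D (.e i)) v := by
  rw [tensorRep_apply_add (hΔ.e i), map_pow]

theorem IsComul.rep_f (i : I) (u : M₁) (v : M₂) : tensorRep Δ ρ₁ ρ₂ (gen D (.f i)) (u ⊗ₜ v) =
    ρ₁ (gen D (.f i)) u ⊗ₜ v +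
      (ρ₁ (gen D .σ) ^ (D.p i : ℕ)) (ρ₁ (t D i) u) ⊗ₜ ρ₂ (gen D (.f i)) v := by
  rw [tensorRep_apply_add (hΔ.f i), map_mul, map_pow, map_one]
  rfl

theorem IsComul.rep_t (i : I) (u : M₁) (v : M₂) : tensorRep Δ ρ₁ ρ₂ (t D i) (u ⊗ₜ v) =
    ρ₁ (t D i) u ⊗ₜ ρ₂ (t D i) v := hΔ.rep_qpow _ u v

theorem IsComul.rep_tinv (i : I) (u : M₁) (v : M₂) : tensorRep Δ ρ₁ ρ₂ (tinv D i) (u ⊗ₜ v) =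
    ρ₁ (tinv D i) u ⊗ₜ ρ₂ (tinv D i) v := hΔ.rep_qpow _ u v

theorem IsComul.tmul_mem {ν μ : P} {u : M₁} {v : M₂} (hu : u ∈ weightSpace ρ₁ ν)
    (hv : v ∈ weightSpace ρ₂ μ) : u ⊗ₜ[Kq] v ∈ weightSpace (tensorRep Δ ρ₁ ρ₂) (ν + μ) := by
  intro h
  rw [hΔ.rep_qpow, hu h, hv h, TensorProduct.smul_tmul_smul, map_add, zpow_add₀ q_ne_zero]

end TensorAction

section Weights

variable {I P : Type*} [AddCommGroup P] {D : Datum I P}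
  {M : Type*} [AddCommGroup M] [Module Kq M] {ρ : Uq D →ₐ[Kq] Module.End Kq M}

theorem t_tinv_apply (i : I) (u : M) : ρ (t D i) (ρ (tinv D i) u) = u := by
  rw [← Module.End.mul_apply, ← map_mul, t, tinv, ← (relations_gen D).qpow_add, add_neg_cancel,
    (relations_gen D).qpow_zero, map_one, Module.End.one_apply]

theorem tinv_t_apply (i : I) (u : M) : ρ (tinv D i) (ρ (t D i) u) = u := by
  rw [← Module.End.mul_apply, ← map_mul, t, tinv, ← (relations_gen D).qpow_add, neg_add_cancel,
    (relations_gen D).qpow_zero, map_one, Module.End.one_apply]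

theorem evE_of_pos {i : I} (h : 0 < D.ℓ i) (u : M) : evE ρ i u = ρ (gen D (.e i)) u := by
  rw [evE, if_pos h]

theorem evE_of_neg {i : I} (h : ¬0 < D.ℓ i) (u : M) :
    evE ρ i u = evP D i • ρ (t D i) (ρ (gen D (.e i)) u) := by
  rw [evE, if_neg h, map_mul]; rfl

theorem evF_of_pos {i : I} (h : 0 < D.ℓ i) (u : M) : evF ρ i u = ρ (gen D (.f i)) u := by
  rw [evF, if_pos h]

theorem evF_of_neg {i : I} (h : ¬0 < D.ℓ i) (u : M) :
    evF ρ i u = (evP D i)⁻¹ • ρ (gen D (.f i)) (ρ (tinv D i) u) := by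
  rw [evF, if_neg h, map_mul]; rfl

/-- Weight spaces of the weights separated by `P*` are independent. -/
theorem weightSpace_iSupIndep [Module.Free ℤ P] : iSupIndep (weightSpace ρ) := by
  -- Weight spaces are contained in simultaneous generalized eigenspaces of commuting operators.
  -- Distinct weights give distinct systems of eigenvalues, because `P*` separates the points of a
  -- free module and `q` is not a root of unity.
  have h1 := Module.End.independent_iInf_maxGenEigenspace_of_forall_mapsTo
    (fun h : Module.Dual ℤ P => ρ (gen D (.qpow h))) (fun h h' φ =>
      Module.End.mapsTo_maxGenEigenspace_of_comm (by
        rw [commute_iff_eq, ← map_mul, ← map_mul, ← (relations_gen D).qpow_add,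
          ← (relations_gen D).qpow_add, add_comm]) φ)
  have h2 : Function.Injective (fun (μ : P) (h : Module.Dual ℤ P) => q ^ h μ) := by
    intro μ ν hμν
    rw [← sub_eq_zero, ← Module.forall_dual_apply_eq_zero_iff ℤ]
    intro h
    rw [map_sub, sub_eq_zero]
    exact q_zpow_injective (congrFun hμν h)
  refine (h1.comp h2).mono fun μ u hu => ?_
  rw [Function.comp_apply, Submodule.mem_iInf]
  intro h
  rw [Module.End.mem_maxGenEigenspace]
  refine ⟨1, ?_⟩
  rw [pow_one, LinearMap.sub_apply, hu h]
  exact sub_self _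

end Weights

section EvPairing

variable {I P : Type*} [AddCommGroup P] {D : Datum I P}
  {M₁ M₂ : Type*} [AddCommGroup M₁] [Module Kq M₁] [AddCommGroup M₂] [Module Kq M₂]
  {Δ : Uq D →ₐ[Kq] Uq D ⊗[Kq] Uq D}
  {ρ₁ : Uq D →ₐ[Kq] Module.End Kq M₁} {ρ₂ : Uq D →ₐ[Kq] Module.End Kq M₂} {i : I}

theorem exists_dual_tmul (φ₁ : M₁ →ₗ[Kq] Kq) (φ₂ : M₂ →ₗ[Kq] Kq) :
    ∃ φ : M₁ ⊗[Kq] M₂ →ₗ[Kq] Kq, ∀ u v, φ (u ⊗ₜ v) = φ₁ u * φ₂ v :=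
  ⟨LinearMap.mul' Kq Kq ∘ₗ TensorProduct.map φ₁ φ₂, fun u v => by simp⟩

theorem IsComul.isEvPairing_mk (hΔ : IsComul D Δ) (hi : D.p i = 0) (hℓ : 0 < D.ℓ i) :
    IsEvPairing i ρ₁ ρ₂ (tensorRep Δ ρ₁ ρ₂) (TensorProduct.mk Kq M₁ M₂) where
  mem ν μ u hu v hv := hΔ.tmul_mem hu hv
  e_apply u μ v hv := by
    rw [TensorProduct.mk_apply, evE_of_pos hℓ, evE_of_pos hℓ, evE_of_pos hℓ, hΔ.rep_e, hi,
      Fin.val_zero, pow_zero, Module.End.one_apply, tinv_apply hv, evP_of_pos hℓ,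
      TensorProduct.tmul_smul]
    rfl
  f_apply ν u hu v := by
    rw [TensorProduct.mk_apply, evF_of_pos hℓ, evF_of_pos hℓ, evF_of_pos hℓ, hΔ.rep_f, hi,
      Fin.val_zero, pow_zero, Module.End.one_apply, t_apply hu, evP_of_pos hℓ,
      ← TensorProduct.smul_tmul']
    rfl
  dual φ₁ φ₂ := exists_dual_tmul φ₁ φ₂

/-- The coproduct of `t e` is `t e ⊗ 1 + t ⊗ t e`, and that of `f t⁻¹` is `f t⁻¹ ⊗ t⁻¹ + 1 ⊗ f t⁻¹`.
As `t` acts by `p^(-h)`, this is the comultiplication of the positive case with the factors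
exchanged. -/
theorem IsComul.isEvPairing_flip (hΔ : IsComul D Δ) (hi : D.p i = 0) (hℓ : ¬0 < D.ℓ i) :
    IsEvPairing i ρ₂ ρ₁ (tensorRep Δ ρ₁ ρ₂) (TensorProduct.mk Kq M₁ M₂).flip where
  mem ν μ v hv u hu := by
    rw [add_comm]
    exact hΔ.tmul_mem hu hv
  e_apply v μ u hu := by
    rw [LinearMap.flip_apply, LinearMap.flip_apply, LinearMap.flip_apply, TensorProduct.mk_apply,
      TensorProduct.mk_apply, TensorProduct.mk_apply, evE_of_neg hℓ, evE_of_neg hℓ, evE_of_neg hℓ,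
      hΔ.rep_e, hi, Fin.val_zero, pow_zero, Module.End.one_apply, map_add, hΔ.rep_t, hΔ.rep_t,
      t_tinv_apply, t_apply hu, evP_of_neg hℓ, inv_zpow', neg_neg, smul_add,
      TensorProduct.tmul_smul, ← TensorProduct.smul_tmul', ← TensorProduct.smul_tmul', add_comm,
      smul_comm]
  f_apply ν v hv u := by
    rw [LinearMap.flip_apply, LinearMap.flip_apply, LinearMap.flip_apply, TensorProduct.mk_apply,
      TensorProduct.mk_apply, TensorProduct.mk_apply, evF_of_neg hℓ, evF_of_neg hℓ, evF_of_neg hℓ,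
      hΔ.rep_tinv, hΔ.rep_f, hi, Fin.val_zero, pow_zero, Module.End.one_apply,
      t_tinv_apply, tinv_apply hv, evP_of_neg hℓ, inv_zpow', smul_add, map_smul,
      TensorProduct.tmul_smul, TensorProduct.tmul_smul, TensorProduct.tmul_smul,
      ← TensorProduct.smul_tmul', add_comm]
    congr 1
    rw [TensorProduct.tmul_smul]
    exact smul_comm _ _ _
  dual φ₂ φ₁ := by
    obtain ⟨φ, hφ⟩ := exists_dual_tmul φ₁ φ₂
    exact ⟨φ, fun v u => (hφ u v).trans (mul_comm _ _)⟩

end EvPairing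

end QSuper

end

noncomputable section

namespace QSuper

/-! ## Integrability of the tensor product -/

section Integrable

variable {I P : Type*} [AddCommGroup P] {D : Datum I P}

section Orbit

variable {M : Type*} [AddCommGroup M] [Module Kq M] (ρ : Uq D →ₐ[Kq] Module.End Kq M) (i : I)

/-- The submodule generated by `u` over the subalgebra attached to an even index. -/
def orbit (u : M) : Submodule Kq M := Submodule.span Kq {v | ∃ x ∈ rankOne D i, v = ρ x u}

variable {ρ i}

theorem self_mem_orbit (u : M) : u ∈ orbit ρ i u :=
  Submodule.subset_span ⟨1, Subalgebra.one_mem _, by simp⟩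

theorem map_mem_orbit {x : Uq D} (hx : x ∈ rankOne D i) {u v : M} (hv : v ∈ orbit ρ i u) :
    ρ x v ∈ orbit ρ i u := by
  refine Submodule.span_induction (p := fun v _ => ρ x v ∈ orbit ρ i u) ?_ ?_ ?_ ?_ hv
  · rintro _ ⟨y, hy, rfl⟩
    exact Submodule.subset_span ⟨x * y, Subalgebra.mul_mem _ hx hy, by rw [map_mul]; rfl⟩
  · rw [map_zero]; exact Submodule.zero_mem _
  · intro v w _ _ hv hw; rw [map_add]; exact Submodule.add_mem _ hv hw
  · intro c v _ hv; rw [map_smul]; exact Submodule.smul_mem _ _ hv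

theorem e_mem_rankOne : gen D (.e i) ∈ rankOne D i := Algebra.subset_adjoin (by simp)

theorem f_mem_rankOne : gen D (.f i) ∈ rankOne D i := Algebra.subset_adjoin (by simp)

theorem t_mem_rankOne : t D i ∈ rankOne D i := Algebra.subset_adjoin (by simp)

/-- `t⁻¹` is not among the generators of the rank one subalgebra, but `t` is injective on the
finite-dimensional orbit and hence bijective. -/
theorem tinv_mem_orbit {u v : M} [FiniteDimensional Kq (orbit ρ i u)] (hv : v ∈ orbit ρ i u) :
    ρ (tinv D i) v ∈ orbit ρ i u := by
  let T := (ρ (t D i)).restrict (p := orbit ρ i u) (q := orbit ρ i u)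
    fun _ hw => map_mem_orbit t_mem_rankOne hw
  have h1 : Function.Injective T := by
    intro a b hab
    refine Subtype.ext ?_
    rw [← tinv_t_apply (ρ := ρ) i (a : M), ← tinv_t_apply (ρ := ρ) i (b : M)]
    exact congrArg _ (congrArg Subtype.val hab)
  obtain ⟨w, hw⟩ := LinearMap.injective_iff_surjective.mp h1 ⟨v, hv⟩
  have h2 : ρ (t D i) w = v := congrArg Subtype.val hw
  rw [← h2, tinv_t_apply]
  exact w.2

theorem orbit_le {V : Submodule Kq M} (he : ∀ v ∈ V, ρ (gen D (.e i)) v ∈ V)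
    (hf : ∀ v ∈ V, ρ (gen D (.f i)) v ∈ V) (ht : ∀ v ∈ V, ρ (t D i) v ∈ V) {u : M} (hu : u ∈ V) :
    orbit ρ i u ≤ V := by
  refine Submodule.span_le.mpr ?_
  rintro _ ⟨x, hx, rfl⟩
  refine Algebra.adjoin_induction (p := fun x _ => ∀ u ∈ V, ρ x u ∈ V) ?_ ?_ ?_ ?_ hx u hu
  · rintro x (rfl | rfl | rfl)
    exacts [he, hf, ht]
  · intro c u hu
    rw [AlgHom.commutes]
    exact V.smul_mem c hu
  · intro x y _ _ hx hy u hu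
    rw [map_add]
    exact V.add_mem (hx u hu) (hy u hu)
  · intro x y _ _ hx hy u hu
    rw [map_mul]
    exact hx _ (hy u hu)

end Orbit

variable {M₁ M₂ : Type*} [AddCommGroup M₁] [Module Kq M₁] [AddCommGroup M₂] [Module Kq M₂]
  {Δ : Uq D →ₐ[Kq] Uq D ⊗[Kq] Uq D}
  {ρ₁ : Uq D →ₐ[Kq] Module.End Kq M₁} {ρ₂ : Uq D →ₐ[Kq] Module.End Kq M₂}

/-- The product of the orbits of `u` and `v` is finite-dimensional and stable under the coproducts
of the generators; sums of such spaces handle sums of pure tensors. -/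
theorem IsComul.locally_finite (hΔ : IsComul D Δ) (h₁ : IsIntegrable ρ₁) (h₂ : IsIntegrable ρ₂)
    {i : I} (hi : D.p i = 0) (w : M₁ ⊗[Kq] M₂) :
    FiniteDimensional Kq (orbit (tensorRep Δ ρ₁ ρ₂) i w) := by
  have key : ∃ V : Submodule Kq (M₁ ⊗[Kq] M₂), FiniteDimensional Kq V ∧ w ∈ V ∧
      (∀ v ∈ V, tensorRep Δ ρ₁ ρ₂ (gen D (.e i)) v ∈ V) ∧
      (∀ v ∈ V, tensorRep Δ ρ₁ ρ₂ (gen D (.f i)) v ∈ V) ∧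
      (∀ v ∈ V, tensorRep Δ ρ₁ ρ₂ (t D i) v ∈ V) := by
    induction w with
    | zero => exact ⟨⊥, inferInstance, Submodule.zero_mem _, by simp, by simp, by simp⟩
    | add x y hx hy =>
      obtain ⟨V, hV, h1, h2, h3, h4⟩ := hx
      obtain ⟨V', hV', h1', h2', h3', h4'⟩ := hy
      have hadd : ∀ T : Module.End Kq (M₁ ⊗[Kq] M₂), (∀ v ∈ V, T v ∈ V) → (∀ v ∈ V', T v ∈ V') →
          ∀ v ∈ V ⊔ V', T v ∈ V ⊔ V' := by
        intro T hT hT' v hv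
        obtain ⟨a, ha, b, hb, rfl⟩ := Submodule.mem_sup.mp hv
        rw [map_add]
        exact Submodule.add_mem_sup (hT a ha) (hT' b hb)
      exact ⟨V ⊔ V', inferInstance, Submodule.add_mem_sup h1 h1', hadd _ h2 h2', hadd _ h3 h3',
        hadd _ h4 h4'⟩
    | tmul u v =>
      have hf₁ : FiniteDimensional Kq (orbit ρ₁ i u) := h₁.locally_finite i hi u
      have hf₂ : FiniteDimensional Kq (orbit ρ₂ i v) := h₂.locally_finite i hi v
      let V := LinearMap.range (TensorProduct.map (orbit ρ₁ i u).subtype (orbit ρ₂ i v).subtype)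
      have hV : ∀ {a b}, a ∈ orbit ρ₁ i u → b ∈ orbit ρ₂ i v → a ⊗ₜ b ∈ V :=
        fun {a b} ha hb => ⟨⟨a, ha⟩ ⊗ₜ ⟨b, hb⟩, rfl⟩
      have hst : ∀ T : Module.End Kq (M₁ ⊗[Kq] M₂),
          (∀ a ∈ orbit ρ₁ i u, ∀ b ∈ orbit ρ₂ i v, T (a ⊗ₜ b) ∈ V) → ∀ x ∈ V, T x ∈ V := by
        rintro T hT _ ⟨x, rfl⟩
        induction x with
        | zero => rw [map_zero, map_zero]; exact V.zero_mem
        | add x y hx hy => rw [map_add, map_add]; exact V.add_mem hx hy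
        | tmul a b => exact hT a a.2 b b.2
      refine ⟨V, inferInstance, hV (self_mem_orbit u) (self_mem_orbit v), hst _ ?_, hst _ ?_,
        hst _ ?_⟩
      · intro a ha b hb
        rw [hΔ.rep_e, hi, Fin.val_zero, pow_zero, Module.End.one_apply]
        exact V.add_mem (hV (map_mem_orbit e_mem_rankOne ha) (tinv_mem_orbit hb))
          (hV ha (map_mem_orbit e_mem_rankOne hb))
      · intro a ha b hb
        rw [hΔ.rep_f, hi, Fin.val_zero, pow_zero, Module.End.one_apply]
        exact V.add_mem (hV (map_mem_orbit f_mem_rankOne ha) hb)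
          (hV (map_mem_orbit t_mem_rankOne ha) (map_mem_orbit f_mem_rankOne hb))
      · intro a ha b hb
        rw [hΔ.rep_t]
        exact hV (map_mem_orbit t_mem_rankOne ha) (map_mem_orbit t_mem_rankOne hb)
  obtain ⟨V, hV, h1, h2, h3, h4⟩ := key
  exact Submodule.finiteDimensional_of_le (orbit_le h2 h3 h4 h1)

/-- Submodules of independent submodules which span everything are not smaller. -/
theorem le_of_iSupIndep {R N κ : Type*} [Ring R] [AddCommGroup N] [Module R N]
    {W T : κ → Submodule R N} (hW : iSupIndep W) (hTW : ∀ μ, T μ ≤ W μ) (hT : ⨆ μ, T μ = ⊤) (μ : κ) :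
    W μ ≤ T μ := by
  intro w hw
  have h1 : w ∈ T μ ⊔ ⨆ (ν) (_ : ν ≠ μ), T ν := by
    have h2 : ⨆ ν, T ν ≤ T μ ⊔ ⨆ (ν) (_ : ν ≠ μ), T ν := by
      refine iSup_le fun ν => ?_
      rcases eq_or_ne ν μ with rfl | h
      · exact le_sup_left
      · exact le_sup_of_le_right (le_iSup₂_of_le ν h le_rfl)
    rw [hT] at h2
    exact h2 trivial
  obtain ⟨a, ha, b, hb, rfl⟩ := Submodule.mem_sup.mp h1
  have h3 : b ∈ W μ := by
    rw [← add_sub_cancel_left a b]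
    exact Submodule.sub_mem _ hw (hTW μ ha)
  have h4 : b ∈ ⨆ (ν) (_ : ν ≠ μ), W ν := iSup₂_mono (fun ν _ => hTW ν) hb
  have h5 : b = 0 := Submodule.disjoint_def.mp (hW μ) b h3 h4
  rwa [h5, add_zero]

theorem tensor_weight_top (h₁ : IsIntegrable ρ₁) (h₂ : IsIntegrable ρ₂) :
    ⨆ l, Submodule.span Kq {x | ∃ ν μ, ν + μ = l ∧ ∃ u ∈ weightSpace ρ₁ ν, ∃ v ∈ weightSpace ρ₂ μ,
      x = u ⊗ₜ[Kq] v} = (⊤ : Submodule Kq (M₁ ⊗[Kq] M₂)) := by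
  rw [eq_top_iff, ← TensorProduct.span_tmul_eq_top, Submodule.span_le]
  rintro _ ⟨u, v, rfl⟩
  rw [SetLike.mem_coe]
  refine graded_induction h₁.weight_top (p := fun u => u ⊗ₜ[Kq] v ∈ _) ?_ ?_ ?_ u
  · rw [TensorProduct.zero_tmul]; exact Submodule.zero_mem _
  · intro a b ha hb; rw [TensorProduct.add_tmul]; exact Submodule.add_mem _ ha hb
  intro ν u hu
  refine graded_induction h₂.weight_top (p := fun v => u ⊗ₜ[Kq] v ∈ _) ?_ ?_ ?_ v
  · rw [TensorProduct.tmul_zero]; exact Submodule.zero_mem _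
  · intro a b ha hb; rw [TensorProduct.tmul_add]; exact Submodule.add_mem _ ha hb
  intro μ v hv
  exact Submodule.mem_iSup_of_mem (ν + μ) (Submodule.subset_span ⟨ν, μ, rfl, u, hu, v, hv, rfl⟩)

theorem IsComul.span_le_weightSpace (hΔ : IsComul D Δ) (l : P) :
    Submodule.span Kq {x | ∃ ν μ, ν + μ = l ∧ ∃ u ∈ weightSpace ρ₁ ν, ∃ v ∈ weightSpace ρ₂ μ,
      x = u ⊗ₜ[Kq] v} ≤ weightSpace (tensorRep Δ ρ₁ ρ₂) l := by
  refine Submodule.span_le.mpr ?_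
  rintro _ ⟨ν, μ, rfl, u, hu, v, hv, rfl⟩
  exact hΔ.tmul_mem hu hv

/-- The tensor product of integrable modules is integrable. -/
theorem IsComul.isIntegrable [Module.Free ℤ P] (hΔ : IsComul D Δ) (h₁ : IsIntegrable ρ₁)
    (h₂ : IsIntegrable ρ₂) : IsIntegrable (tensorRep Δ ρ₁ ρ₂) := by
  -- The products of weight spaces lie in independent weight spaces and span everything, so each
  -- weight space is a sum of products. The conditions on weights may then be checked on pure
  -- tensors.
  have hle : ∀ l, weightSpace (tensorRep Δ ρ₁ ρ₂) l ≤ _ :=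
    le_of_iSupIndep weightSpace_iSupIndep (fun l => hΔ.span_le_weightSpace l)
      (tensor_weight_top h₁ h₂)
  have hnn : ∀ i, D.p i = 1 → ∀ ν, ∀ u ∈ weightSpace ρ₁ ν, u ≠ 0 → 0 ≤ D.h i ν :=
    fun i hi ν u hu h0 => h₁.odd_nonneg i hi ν ((Submodule.ne_bot_iff _).mpr ⟨u, hu, h0⟩)
  have hnn' : ∀ i, D.p i = 1 → ∀ ν, ∀ u ∈ weightSpace ρ₂ ν, u ≠ 0 → 0 ≤ D.h i ν :=
    fun i hi ν u hu h0 => h₂.odd_nonneg i hi ν ((Submodule.ne_bot_iff _).mpr ⟨u, hu, h0⟩)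
  refine ⟨weightSpace_iSupIndep, ?_, fun i hi u => hΔ.locally_finite h₁ h₂ hi u, ?_, ?_⟩
  · rw [eq_top_iff, ← tensor_weight_top h₁ h₂]
    exact iSup_mono fun l => hΔ.span_le_weightSpace l
  · intro i hi l hl
    by_contra hneg
    refine hl (eq_bot_iff.mpr ((hle l).trans (Submodule.span_le.mpr ?_)))
    rintro _ ⟨ν, μ, rfl, u, hu, v, hv, rfl⟩
    rw [SetLike.mem_coe, Submodule.mem_bot]
    by_contra h0
    refine hneg ?_
    rw [map_add]
    refine add_nonneg (hnn i hi ν u hu ?_) (hnn' i hi μ v hv ?_)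
    · rintro rfl; simp at h0
    · rintro rfl; simp at h0
  · intro i hi l hl w hw
    refine Submodule.span_induction (p := fun w _ => tensorRep Δ ρ₁ ρ₂ (gen D (.e i)) w = 0 ∧
      tensorRep Δ ρ₁ ρ₂ (gen D (.f i)) w = 0) ?_ ?_ ?_ ?_ (hle l hw)
    · rintro _ ⟨ν, μ, rfl, u, hu, v, hv, rfl⟩
      by_cases h0 : u = 0 ∨ v = 0
      · rcases h0 with rfl | rfl <;> simp
      push Not at h0
      have h3 := hnn i hi ν u hu h0.1
      have h4 := hnn' i hi μ v hv h0.2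
      rw [map_add] at hl
      -- Two nonnegative pairings with zero sum are both zero, so the odd operators vanish on both
      -- factors.
      obtain ⟨h5, h6⟩ := h₁.odd_zero i hi ν (by omega) u hu
      obtain ⟨h7, h8⟩ := h₂.odd_zero i hi μ (by omega) v hv
      rw [hΔ.rep_e, hΔ.rep_f, h5, h6, h7, h8]
      simp
    · simp
    · rintro x y _ _ ⟨h1, h2⟩ ⟨h3, h4⟩
      simp [h1, h2, h3, h4]
    · rintro c x _ ⟨h1, h2⟩
      simp [h1, h2]

end Integrable

end QSuper

end

noncomputable section

namespace QSuper

/-! ## Bases of lattices and of their reductions -/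

theorem algebraMap_A_injective : Function.Injective (algebraMap A Kq) := Subtype.val_injective

instance : FaithfulSMul A Kq :=
  (faithfulSMul_iff_algebraMap_injective A Kq).mpr algebraMap_A_injective

instance : IsFractionRing A Kq := IsFractionRing.of_field A Kq fun z => by
  have hpoly : ∀ f : Polynomial ℚ, ∃ x : A, algebraMap A Kq x = algebraMap (Polynomial ℚ) Kq f :=
    fun f => ⟨(⟨algebraMap (Polynomial ℚ) Kq f, f, 1, by simp, by rw [map_one, div_one]⟩ : Asub), rfl⟩
  obtain ⟨x, hx⟩ := hpoly z.num
  obtain ⟨y, hy⟩ := hpoly z.denom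
  exact ⟨x, y, by rw [hx, hy, RatFunc.num_div_denom]⟩

theorem linearIndependent_A_iff {V κ : Type*} [AddCommGroup V] [Module Kq V] {b : κ → V} :
    LinearIndependent A b ↔ LinearIndependent Kq b :=
  have : IsScalarTower A Kq V := ⟨fun a b m => by rw [Algebra.smul_def, mul_smul]; rfl⟩
  LinearIndependent.iff_fractionRing A Kq

/-- After subtraction of its value at `0`, the function has a numerator divisible by the
indeterminate. This identifies the residue field of `A` with `ℚ`. -/
theorem exists_rat_add_q_mul (a : A) : ∃ (c : ℚ) (a' : A), a = algebraMap ℚ A c + qA * a' := by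
  obtain ⟨a, f, g, hg, ha⟩ := a
  have h0 := algebraMap_eval_zero_ne hg
  obtain ⟨r, hr⟩ : Polynomial.X ∣ f - Polynomial.C (f.eval 0 / g.eval 0) * g := by
    rw [Polynomial.X_dvd_iff, Polynomial.coeff_zero_eq_eval_zero, Polynomial.eval_sub,
      Polynomial.eval_mul, Polynomial.eval_C, div_mul_cancel₀ _ hg, sub_self]
  refine ⟨f.eval 0 / g.eval 0, (⟨_, r, g, hg, rfl⟩ : Asub), algebraMap_A_injective ?_⟩
  change a = algebraMap ℚ Kq _ + q * (algebraMap (Polynomial ℚ) Kq r / algebraMap (Polynomial ℚ) Kq g)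
  have h1 := congrArg (algebraMap (Polynomial ℚ) Kq) hr
  have h2 : algebraMap (Polynomial ℚ) Kq (Polynomial.C (f.eval 0 / g.eval 0)) =
      algebraMap ℚ Kq (f.eval 0 / g.eval 0) :=
    (IsScalarTower.algebraMap_apply ℚ (Polynomial ℚ) Kq _).symm
  rw [map_sub, map_mul, map_mul, RatFunc.algebraMap_X, h2] at h1
  rw [ha, div_eq_iff h0, add_mul, mul_assoc, div_mul_cancel₀ _ h0]
  change _ = _ + RatFunc.X * _
  rw [← h1]
  ring

theorem rat_eq_zero_of_q_mul {c : ℚ} {a : A} (h : algebraMap ℚ A c = qA * a) : c = 0 := by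
  by_contra hc
  have h1 : algebraMap ℚ A c⁻¹ * (qA * a) = 1 := by
    rw [← h, ← map_mul, inv_mul_cancel₀ hc, map_one]
  have h2 := congrArg (algebraMap A Kq) h1
  rw [map_mul, map_mul, map_one] at h2
  have h3 := (isLocalParam_q_pow one_ne_zero).one_add_ne
    (algebraMap A Kq (-(algebraMap ℚ A c⁻¹ * a))) (Subtype.property (p := (· ∈ Asub)) _)
  apply h3
  rw [map_neg, map_mul, pow_one, mul_neg, mul_left_comm, ← algebraMap_qA, h2, add_neg_cancel]

section Reduction

attribute [local instance] ratModule

variable {M : Type*} [AddCommGroup M] [Module Kq M] {L : Submodule A M}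

theorem rat_smul_def (c : ℚ) (b : Lbar L) : c • b = algebraMap ℚ A c • b := rfl

theorem qA_smul_bar (b : Lbar L) : qA • b = 0 := by
  obtain ⟨u, rfl⟩ := Submodule.mkQ_surjective (qSub L) b
  have := toBar_q_smul L u
  rwa [map_smul] at this

theorem exists_rat_smul (a : A) : ∃ c : ℚ, ∀ b : Lbar L, a • b = c • b := by
  obtain ⟨c, a', rfl⟩ := exists_rat_add_q_mul a
  refine ⟨c, fun b => ?_⟩
  rw [add_smul, mul_comm, mul_smul, qA_smul_bar, smul_zero, add_zero, rat_smul_def]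

theorem mem_qSub {u : L} : u ∈ qSub L ↔ ∃ w : L, qA • w = u := by
  rw [qSub, Submodule.ideal_span_singleton_smul]
  constructor
  · rintro ⟨w, -, hw⟩
    exact ⟨w, hw⟩
  · rintro ⟨w, hw⟩
    exact ⟨w, trivial, hw⟩

/-- A rational relation among the classes lifts to an element of `qL`. Its coordinates in the basis
are rational constants divisible by `q`, hence zero. -/
theorem linearIndependent_toBar {κ : Type*} (β : Module.Basis κ A L) :
    LinearIndependent ℚ (fun k => toBar L (β k)) := by
  rw [linearIndependent_iff]
  intro l hl
  have h1 : toBar L (Finsupp.linearCombination A β (l.mapRange (algebraMap ℚ A) (map_zero _))) =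
      0 := by
    rw [← hl, Finsupp.linearCombination_apply, Finsupp.linearCombination_apply,
      Finsupp.sum_mapRange_index (by simp), Finsupp.sum, Finsupp.sum, map_sum]
    exact Finset.sum_congr rfl fun k _ => by rw [map_smul]; rfl
  obtain ⟨w, hw⟩ := mem_qSub.mp ((Submodule.Quotient.mk_eq_zero _).mp h1)
  ext k
  have h2 := congrArg (fun u => β.repr u k) hw
  simp only [map_smul, Module.Basis.repr_linearCombination, Finsupp.smul_apply,
    Finsupp.mapRange_apply, smul_eq_mul] at h2
  exact rat_eq_zero_of_q_mul h2.symm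

theorem span_toBar {κ : Type*} (β : Module.Basis κ A L) :
    ⊤ ≤ Submodule.span ℚ (Set.range fun k => toBar L (β k)) := by
  intro b _
  obtain ⟨u, rfl⟩ := Submodule.mkQ_surjective (qSub L) b
  change toBar L u ∈ _
  rw [← β.linearCombination_repr u, Finsupp.linearCombination_apply, Finsupp.sum, map_sum]
  refine Submodule.sum_mem _ fun k _ => ?_
  obtain ⟨c, hc⟩ := exists_rat_smul (L := L) (β.repr u k)
  rw [map_smul, hc]
  exact Submodule.smul_mem _ _ (Submodule.subset_span ⟨k, rfl⟩)

/-- The classes of a basis of a lattice form a basis of its reduction. -/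
def barBasis {κ : Type*} (β : Module.Basis κ A L) : Module.Basis κ ℚ (Lbar L) :=
  Module.Basis.mk (linearIndependent_toBar β) (span_toBar β)

theorem barBasis_apply {κ : Type*} (β : Module.Basis κ A L) (k : κ) :
    barBasis β k = toBar L (β k) := by
  rw [barBasis, Module.Basis.mk_apply]

variable {M₁ M₂ : Type*} [AddCommGroup M₁] [Module Kq M₁] [AddCommGroup M₂] [Module Kq M₂]
  {L₁ : Submodule A M₁} {L₂ : Submodule A M₂}

theorem tmul_mem_tensorLattice {u : M₁} {v : M₂} (hu : u ∈ L₁) (hv : v ∈ L₂) :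
    u ⊗ₜ[Kq] v ∈ tensorLattice L₁ L₂ := Submodule.subset_span ⟨u, hu, v, hv, rfl⟩

theorem IsCls.tmul {u : M₁} {v : M₂} {b₁ : Lbar L₁} {b₂ : Lbar L₂} (h₁ : IsCls L₁ u b₁)
    (h₂ : IsCls L₂ v b₂) : IsCls (tensorLattice L₁ L₂) (u ⊗ₜ v) (tensorBar L₁ L₂ b₁ b₂) := by
  obtain ⟨hu, rfl⟩ := h₁
  obtain ⟨hv, rfl⟩ := h₂
  exact ⟨tmul_mem_tensorLattice hu hv, rfl⟩

/-- A basis of a lattice which spans the vector space is a basis of the vector space. -/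
theorem exists_basis_of_lattice {κ : Type*} (β : Module.Basis κ A L)
    (hL : Submodule.span Kq (L : Set M) = ⊤) :
    ∃ β' : Module.Basis κ Kq M, ∀ k, β' k = β k := by
  have h1 : LinearIndependent A (fun k => (β k : M)) :=
    β.linearIndependent.map' L.subtype (Submodule.ker_subtype L)
  have h2 : ⊤ ≤ Submodule.span Kq (Set.range fun k => (β k : M)) := by
    rw [← hL, Submodule.span_le]
    intro u hu
    have h3 := congrArg Subtype.val (β.linearCombination_repr ⟨u, hu⟩)
    rw [Finsupp.linearCombination_apply, Finsupp.sum, AddSubmonoidClass.coe_finsetSum] at h3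
    change _ = u at h3
    rw [← h3]
    exact Submodule.sum_mem _ fun k _ =>
      Submodule.smul_mem _ (algebraMap A Kq _) (Submodule.subset_span ⟨k, rfl⟩)
  exact ⟨Module.Basis.mk (linearIndependent_A_iff.mp h1) h2,
    fun k => Module.Basis.mk_apply _ _ k⟩

/-- The tensor products of the elements of bases of two lattices form a basis of the tensor
product of the lattices. -/
theorem exists_basis_tensorLattice {κ₁ κ₂ : Type*} (β₁ : Module.Basis κ₁ A L₁)
    (β₂ : Module.Basis κ₂ A L₂) (hL₁ : Submodule.span Kq (L₁ : Set M₁) = ⊤)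
    (hL₂ : Submodule.span Kq (L₂ : Set M₂) = ⊤) :
    ∃ β : Module.Basis (κ₁ × κ₂) A (tensorLattice L₁ L₂),
      ∀ j k, (β (j, k) : M₁ ⊗[Kq] M₂) = (β₁ j : M₁) ⊗ₜ (β₂ k : M₂) := by
  obtain ⟨β₁', h1⟩ := exists_basis_of_lattice β₁ hL₁
  obtain ⟨β₂', h2⟩ := exists_basis_of_lattice β₂ hL₂
  have h3 : LinearIndependent A (β₁'.tensorProduct β₂') :=
    linearIndependent_A_iff.mpr (β₁'.tensorProduct β₂').linearIndependent
  have h4 : Submodule.span A (Set.range (β₁'.tensorProduct β₂')) = tensorLattice L₁ L₂ := by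
    refine le_antisymm (Submodule.span_le.mpr ?_) (Submodule.span_le.mpr ?_)
    · rintro _ ⟨⟨j, k⟩, rfl⟩
      rw [Module.Basis.tensorProduct_apply, h1, h2]
      exact tmul_mem_tensorLattice (β₁ j).2 (β₂ k).2
    · rintro _ ⟨u, hu, v, hv, rfl⟩
      have h5 := congrArg Subtype.val (β₁.linearCombination_repr ⟨u, hu⟩)
      have h6 := congrArg Subtype.val (β₂.linearCombination_repr ⟨v, hv⟩)
      rw [Finsupp.linearCombination_apply, Finsupp.sum, AddSubmonoidClass.coe_finsetSum] at h5 h6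
      change _ = u at h5
      change _ = v at h6
      rw [← h5, ← h6, TensorProduct.sum_tmul]
      refine Submodule.sum_mem _ fun j _ => ?_
      rw [TensorProduct.tmul_sum]
      refine Submodule.sum_mem _ fun k _ => ?_
      have h7 : ((β₁.repr ⟨u, hu⟩ j • β₁ j : L₁) : M₁) ⊗ₜ[Kq] ((β₂.repr ⟨v, hv⟩ k • β₂ k : L₂) : M₂) =
          (β₁.repr ⟨u, hu⟩ j * β₂.repr ⟨v, hv⟩ k) • (β₁'.tensorProduct β₂') (j, k) := by
        rw [Module.Basis.tensorProduct_apply, h1, h2, Submodule.coe_smul, Submodule.coe_smul,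
          A_smul_def, A_smul_def, A_smul_def, TensorProduct.smul_tmul_smul, map_mul]
      rw [h7]
      exact Submodule.smul_mem _ _ (Submodule.subset_span ⟨_, rfl⟩)
  refine ⟨(Module.Basis.span h3).map (LinearEquiv.ofEq _ _ h4), fun j k => ?_⟩
  rw [Module.Basis.map_apply, LinearEquiv.coe_ofEq_apply, Module.Basis.span_apply]
  change (β₁'.tensorProduct β₂') (j, k) = _
  rw [Module.Basis.tensorProduct_apply, h1, h2]

/-- The reduction of the tensor product of lattices is the tensor product of the reductions. -/
theorem exists_tensorBar_equiv [Module.Free A L₁] [Module.Free A L₂]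
    (hL₁ : Submodule.span Kq (L₁ : Set M₁) = ⊤) (hL₂ : Submodule.span Kq (L₂ : Set M₂) = ⊤) :
    ∃ Φ : (Lbar L₁ ⊗[ℚ] Lbar L₂) ≃ₗ[ℚ] Lbar (tensorLattice L₁ L₂),
      ∀ b₁ b₂, Φ (b₁ ⊗ₜ b₂) = tensorBar L₁ L₂ b₁ b₂ := by
  let β₁ := Module.Free.chooseBasis A L₁
  let β₂ := Module.Free.chooseBasis A L₂
  obtain ⟨β, hβ⟩ := exists_basis_tensorLattice β₁ β₂ hL₁ hL₂
  let Ψ : Lbar L₁ →ₗ[ℚ] Lbar L₂ →ₗ[ℚ] Lbar (tensorLattice L₁ L₂) := LinearMap.mk₂ ℚ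
    (fun b₁ b₂ => tensorBar L₁ L₂ b₁ b₂) (fun _ _ _ => by rw [map_add, LinearMap.add_apply])
    (fun c b₁ b₂ => by rw [rat_smul_def, map_smul, LinearMap.smul_apply]; rfl)
    (fun _ _ _ => by rw [map_add]) (fun c b₁ b₂ => by rw [rat_smul_def, map_smul]; rfl)
  let Φ := ((barBasis β₁).tensorProduct (barBasis β₂)).equiv (barBasis β) (Equiv.refl _)
  have hΦ : (Φ : (Lbar L₁ ⊗[ℚ] Lbar L₂) →ₗ[ℚ] Lbar (tensorLattice L₁ L₂)) = TensorProduct.lift Ψ := by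
    refine ((barBasis β₁).tensorProduct (barBasis β₂)).ext ?_
    rintro ⟨j, k⟩
    rw [LinearEquiv.coe_coe, Module.Basis.equiv_apply, Module.Basis.tensorProduct_apply,
      TensorProduct.lift.tmul, barBasis_apply, barBasis_apply, barBasis_apply]
    refine IsCls.unique (IsCls.of_mem (β (j, k)).2) ?_
    rw [hβ]
    exact (IsCls.of_mem (β₁ j).2).tmul (IsCls.of_mem (β₂ k).2)
  refine ⟨Φ, fun b₁ b₂ => ?_⟩
  rw [← LinearEquiv.coe_coe, hΦ, TensorProduct.lift.tmul]
  rfl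

/-- The products of the two underlying bases form a basis, and a sign on either factor is a sign on
the product. -/
theorem IsPseudoBase.tensor [Module.Free A L₁] [Module.Free A L₂]
    (hL₁ : Submodule.span Kq (L₁ : Set M₁) = ⊤) (hL₂ : Submodule.span Kq (L₂ : Set M₂) = ⊤)
    {B₁ : Set (Lbar L₁)} {B₂ : Set (Lbar L₂)} (h₁ : IsPseudoBase L₁ B₁) (h₂ : IsPseudoBase L₂ B₂) :
    IsPseudoBase (tensorLattice L₁ L₂) (tensorB L₁ L₂ B₁ B₂) := by
  obtain ⟨Φ, hΦ⟩ := exists_tensorBar_equiv hL₁ hL₂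
  obtain ⟨C₁, hi₁, hs₁, rfl⟩ := h₁
  obtain ⟨C₂, hi₂, hs₂, rfl⟩ := h₂
  let γ₁ := Module.Basis.mk hi₁ (by rw [Subtype.range_coe, hs₁])
  let γ₂ := Module.Basis.mk hi₂ (by rw [Subtype.range_coe, hs₂])
  let γ := (γ₁.tensorProduct γ₂).map Φ
  have hγ : ∀ b₁ b₂, γ (b₁, b₂) = tensorBar L₁ L₂ b₁ b₂ := by
    intro b₁ b₂
    rw [Module.Basis.map_apply, Module.Basis.tensorProduct_apply, hΦ, Module.Basis.mk_apply,
      Module.Basis.mk_apply]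
  refine ⟨Set.range γ, γ.linearIndependent.linearIndepOn_id, γ.span_eq, ?_⟩
  ext b
  constructor
  · rintro ⟨b₁, h1 | h1, b₂, h2 | h2, rfl⟩
    · exact Or.inl ⟨(⟨b₁, h1⟩, ⟨b₂, h2⟩), hγ _ _⟩
    · exact Or.inr ⟨(⟨b₁, h1⟩, ⟨-b₂, h2⟩), by rw [hγ, map_neg]⟩
    · exact Or.inr ⟨(⟨-b₁, h1⟩, ⟨b₂, h2⟩), by rw [hγ, map_neg, LinearMap.neg_apply]⟩
    · exact Or.inl ⟨(⟨-b₁, h1⟩, ⟨-b₂, h2⟩), by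
        rw [hγ, map_neg, map_neg, LinearMap.neg_apply, neg_neg]⟩
  · rintro (⟨⟨b₁, b₂⟩, rfl⟩ | ⟨⟨b₁, b₂⟩, hb⟩)
    · exact ⟨b₁, Or.inl b₁.2, b₂, Or.inl b₂.2, hγ _ _⟩
    · refine ⟨b₁, Or.inl b₁.2, -b₂, Or.inr ?_, ?_⟩
      · change -(-(b₂ : Lbar L₂)) ∈ C₂
        rw [neg_neg]
        exact b₂.2
      · rw [map_neg, ← hγ, hb, neg_neg]

end Reduction

end QSuper

end

noncomputable section

namespace QSuper

/-! ## The tensor product of crystal lattices -/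

section Single

variable {I P : Type*} [AddCommGroup P] {D : Datum I P}
  {M : Type*} [AddCommGroup M] [Module Kq M] {ρ : Uq D →ₐ[Kq] Module.End Kq M}
  {L : Submodule A M} {i : I}

theorem σ_σ_apply (u : M) : ρ (gen D .σ) (ρ (gen D .σ) u) = u := by
  rw [← Module.End.mul_apply, ← map_mul, (relations_gen D).σ_sq, map_one, Module.End.one_apply]

theorem σ_mem_weightSpace {μ : P} {u : M} (hu : u ∈ weightSpace ρ μ) :
    ρ (gen D .σ) u ∈ weightSpace ρ μ := by
  intro h
  have h1 := congrArg (fun x => ρ x (ρ (gen D .σ) u)) ((relations_gen D).σ_qpow h)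
  simp only [map_mul, Module.End.mul_apply, σ_σ_apply] at h1
  rw [← h1, hu h, map_smul]

theorem IsCrystalLattice.σ_mem (hL : IsCrystalLattice ρ L) {u : M} (hu : u ∈ L) :
    ρ (gen D .σ) u ∈ L := by
  have : ρ (gen D .σ) u ∈ ρ (gen D .σ) '' (L : Set M) := ⟨u, hu, rfl⟩
  rwa [hL.σ_image] at this

theorem latticeWeight_iSupIndep (h : iSupIndep (weightSpace ρ)) (L : Submodule A M) :
    iSupIndep (latticeWeight ρ L) := by
  intro μ
  rw [Submodule.disjoint_def]
  intro u hu hu'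
  let N : Submodule A M :=
    { (⨆ (ν) (_ : ν ≠ μ), weightSpace ρ ν).toAddSubmonoid with
      smul_mem' := fun c _ hw => Submodule.smul_mem _ (algebraMap A Kq c) hw }
  have h1 : ⨆ (ν) (_ : ν ≠ μ), latticeWeight ρ L ν ≤ N :=
    iSup₂_le fun ν hν w hw =>
      (le_iSup₂ (f := fun (ν : P) (_ : ν ≠ μ) => weightSpace ρ ν) ν hν) hw.2
  exact Submodule.disjoint_def.mp (h μ) u hu.2 (h1 hu')

theorem odd_ne_zero (hi : D.p i = 1) : D.p i ≠ 0 := by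
  rw [hi]
  exact one_ne_zero

theorem evP_zpow_smul_mem {n : ℤ} (hn : 0 ≤ n) {w : M} (hw : w ∈ L) : evP D i ^ n • w ∈ L := by
  obtain ⟨n, rfl⟩ := Int.eq_ofNat_of_zero_le hn
  rw [zpow_natCast, evP, ← pow_mul]
  exact L.smul_mem (show A from ⟨_, q_pow_mem _⟩) hw

theorem evP_zpow_smul_mem_qLat {n : ℤ} (hn : 0 < n) {w : M} (hw : w ∈ L) :
    evP D i ^ n • w ∈ qLat L := by
  obtain ⟨n, rfl⟩ := Int.eq_ofNat_of_zero_le hn.le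
  obtain ⟨k, hk⟩ := Nat.exists_eq_succ_of_ne_zero (n := (D.ℓ i).natAbs * n)
    (mul_ne_zero (Int.natAbs_ne_zero.mpr (D.ℓ_ne_zero i)) (by omega))
  rw [zpow_natCast, evP, ← pow_mul, hk, pow_succ', mul_smul]
  exact ⟨_, L.smul_mem (show A from ⟨_, q_pow_mem _⟩) hw, rfl⟩

theorem kashE_odd_of_pos (hi : D.p i = 1) (hℓ : 0 < D.ℓ i) (u : M) :
    kashE ρ i u = (D.qi i)⁻¹ • ρ (t D i) (ρ (gen D (.e i)) u) := by
  rw [kashE, if_neg (odd_ne_zero hi), if_pos hℓ, map_mul]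
  rfl

theorem kashE_odd_of_neg (hi : D.p i = 1) (hℓ : ¬0 < D.ℓ i) (u : M) :
    kashE ρ i u = ρ (gen D (.e i)) u := by
  rw [kashE, if_neg (odd_ne_zero hi), if_neg hℓ]

theorem kashF_odd_of_pos (hi : D.p i = 1) (hℓ : 0 < D.ℓ i) (u : M) :
    kashF ρ i u = ρ (gen D (.f i)) u := by
  rw [kashF, if_neg (odd_ne_zero hi), if_pos hℓ]

theorem kashF_odd_of_neg (hi : D.p i = 1) (hℓ : ¬0 < D.ℓ i) (u : M) :
    kashF ρ i u = D.qi i • ρ (gen D (.f i)) (ρ (tinv D i) u) := by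
  rw [kashF, if_neg (odd_ne_zero hi), if_neg hℓ, map_mul]
  rfl

theorem kashE_odd_mem (hi : D.p i = 1) {μ : P} {u : M} (hu : u ∈ weightSpace ρ μ) :
    kashE ρ i u ∈ weightSpace ρ (μ + D.α i) := by
  by_cases hℓ : 0 < D.ℓ i
  · rw [kashE_odd_of_pos hi hℓ, t_apply (e_mem_weightSpace hu i)]
    exact Submodule.smul_mem _ _ (Submodule.smul_mem _ _ (e_mem_weightSpace hu i))
  · rw [kashE_odd_of_neg hi hℓ]
    exact e_mem_weightSpace hu i

theorem kashF_odd_mem (hi : D.p i = 1) {μ : P} {u : M} (hu : u ∈ weightSpace ρ μ) :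
    kashF ρ i u ∈ weightSpace ρ (μ - D.α i) := by
  by_cases hℓ : 0 < D.ℓ i
  · rw [kashF_odd_of_pos hi hℓ]
    exact f_mem_weightSpace hu i
  · rw [kashF_odd_of_neg hi hℓ, tinv_apply hu, map_smul]
    exact Submodule.smul_mem _ _ (Submodule.smul_mem _ _ (f_mem_weightSpace hu i))

theorem IsIntegrable.kash_odd_eq_zero (hM : IsIntegrable ρ) (hi : D.p i = 1) {μ : P}
    (hμ : D.h i μ = 0) {u : M} (hu : u ∈ weightSpace ρ μ) :
    kashE ρ i u = 0 ∧ kashF ρ i u = 0 := by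
  obtain ⟨h1, h2⟩ := hM.odd_zero i hi μ hμ u hu
  by_cases hℓ : 0 < D.ℓ i
  · rw [kashE_odd_of_pos hi hℓ, kashF_odd_of_pos hi hℓ, h1, h2, map_zero, smul_zero]
    exact ⟨rfl, rfl⟩
  · rw [kashE_odd_of_neg hi hℓ, kashF_odd_of_neg hi hℓ, tinv_apply hu, map_smul, h1, h2, smul_zero,
      smul_zero]
    exact ⟨rfl, rfl⟩

theorem IsIntegrable.odd_h_nonneg (hM : IsIntegrable ρ) (hi : D.p i = 1) {μ : P} {u : M}
    (hu : u ∈ weightSpace ρ μ) (h0 : u ≠ 0) : 0 ≤ D.h i μ :=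
  hM.odd_nonneg i hi μ ((Submodule.ne_bot_iff _).mpr ⟨u, hu, h0⟩)

end Single

section Lattice

variable {I P : Type*} [AddCommGroup P] {D : Datum I P}
  {M₁ M₂ : Type*} [AddCommGroup M₁] [Module Kq M₁] [AddCommGroup M₂] [Module Kq M₂]
  {Δ : Uq D →ₐ[Kq] Uq D ⊗[Kq] Uq D}
  {ρ₁ : Uq D →ₐ[Kq] Module.End Kq M₁} {ρ₂ : Uq D →ₐ[Kq] Module.End Kq M₂} {i : I}
  {L₁ : Submodule A M₁} {L₂ : Submodule A M₂}

/-- For `ℓ i > 0` the factor `t_i` in `ẽ_i` cancels the `t_i⁻¹` of the coproduct on the second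
factor and leaves a `t_i` on the first, as in the coproduct of `f_i`. It acts by a power of `q` with
exponent `ℓ_i⟨h_i, ν⟩`. -/
theorem IsComul.kash_tmul_of_pos (hΔ : IsComul D Δ) (hi : D.p i = 1) (hℓ : 0 < D.ℓ i) {ν : P}
    {u : M₁} (hu : u ∈ weightSpace ρ₁ ν) (v : M₂) :
    kashE (tensorRep Δ ρ₁ ρ₂) i (u ⊗ₜ v) = kashE ρ₁ i u ⊗ₜ v +
        evP D i ^ D.h i ν • (ρ₁ (gen D .σ) u ⊗ₜ kashE ρ₂ i v) ∧
      kashF (tensorRep Δ ρ₁ ρ₂) i (u ⊗ₜ v) = kashF ρ₁ i u ⊗ₜ v +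
        evP D i ^ D.h i ν • (ρ₁ (gen D .σ) u ⊗ₜ kashF ρ₂ i v) := by
  constructor
  · rw [kashE_odd_of_pos hi hℓ, kashE_odd_of_pos hi hℓ, kashE_odd_of_pos hi hℓ, hΔ.rep_e, hi,
      Fin.val_one, pow_one, map_add, hΔ.rep_t, hΔ.rep_t, t_tinv_apply,
      t_apply (σ_mem_weightSpace hu), smul_add, evP_of_pos hℓ, ← TensorProduct.smul_tmul',
      TensorProduct.tmul_smul, ← TensorProduct.smul_tmul', smul_comm]
  · rw [kashF_odd_of_pos hi hℓ, kashF_odd_of_pos hi hℓ, kashF_odd_of_pos hi hℓ, hΔ.rep_f, hi,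
      Fin.val_one, pow_one, t_apply hu, map_smul, evP_of_pos hℓ, ← TensorProduct.smul_tmul']

/-- For `ℓ i < 0` the remaining factor is a `t_i⁻¹` on the second tensor factor, so the weight of
`v` governs the power of `q`. -/
theorem IsComul.kash_tmul_of_neg (hΔ : IsComul D Δ) (hi : D.p i = 1) (hℓ : ¬0 < D.ℓ i) {μ : P}
    (u : M₁) {v : M₂} (hv : v ∈ weightSpace ρ₂ μ) :
    kashE (tensorRep Δ ρ₁ ρ₂) i (u ⊗ₜ v) = evP D i ^ D.h i μ • (kashE ρ₁ i u ⊗ₜ v) +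
        ρ₁ (gen D .σ) u ⊗ₜ kashE ρ₂ i v ∧
      kashF (tensorRep Δ ρ₁ ρ₂) i (u ⊗ₜ v) = evP D i ^ D.h i μ • (kashF ρ₁ i u ⊗ₜ v) +
        ρ₁ (gen D .σ) u ⊗ₜ kashF ρ₂ i v := by
  constructor
  · rw [kashE_odd_of_neg hi hℓ, kashE_odd_of_neg hi hℓ, kashE_odd_of_neg hi hℓ, hΔ.rep_e, hi,
      Fin.val_one, pow_one, tinv_apply hv, evP_of_neg hℓ, inv_zpow', TensorProduct.tmul_smul]
  · rw [kashF_odd_of_neg hi hℓ, kashF_odd_of_neg hi hℓ, kashF_odd_of_neg hi hℓ, hΔ.rep_tinv,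
      hΔ.rep_f, hi, Fin.val_one, pow_one, t_tinv_apply, smul_add, tinv_apply hv, evP_of_neg hℓ,
      inv_zpow', TensorProduct.tmul_smul, ← TensorProduct.smul_tmul',
      TensorProduct.tmul_smul (D.qi i), smul_comm]

theorem tensorLattice_induction (hL₁ : IsCrystalLattice ρ₁ L₁) (hL₂ : IsCrystalLattice ρ₂ L₂)
    {C : M₁ ⊗[Kq] M₂ → Prop} (h0 : C 0) (hadd : ∀ x y, C x → C y → C (x + y))
    (hsmul : ∀ (c : A) x, C x → C (c • x))
    (htmul : ∀ ν μ, ∀ u ∈ latticeWeight ρ₁ L₁ ν, ∀ v ∈ latticeWeight ρ₂ L₂ μ, C (u ⊗ₜ v))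
    {w : M₁ ⊗[Kq] M₂} (hw : w ∈ tensorLattice L₁ L₂) : C w := by
  refine Submodule.span_induction (p := fun w _ => C w) ?_ h0 (fun x y _ _ => hadd x y)
    (fun c x _ => hsmul c x) hw
  rintro _ ⟨u, hu, v, hv, rfl⟩
  rw [← hL₁.weight_sup] at hu
  rw [← hL₂.weight_sup] at hv
  refine Submodule.iSup_induction _ (motive := fun u => C (u ⊗ₜ v)) hu (fun ν u hu => ?_) ?_ ?_
  · refine Submodule.iSup_induction _ (motive := fun v => C (u ⊗ₜ v)) hv
      (fun μ v hv => htmul ν μ u hu v hv) ?_ ?_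
    · rwa [TensorProduct.tmul_zero]
    · intro a b ha hb
      rw [TensorProduct.tmul_add]
      exact hadd _ _ ha hb
  · rwa [TensorProduct.zero_tmul]
  · intro a b ha hb
    rw [TensorProduct.add_tmul]
    exact hadd _ _ ha hb

theorem tensorLattice_map_mem (hL₁ : IsCrystalLattice ρ₁ L₁) (hL₂ : IsCrystalLattice ρ₂ L₂)
    {T : Module.End Kq (M₁ ⊗[Kq] M₂)}
    (hT : ∀ ν μ, ∀ u ∈ latticeWeight ρ₁ L₁ ν, ∀ v ∈ latticeWeight ρ₂ L₂ μ,
      T (u ⊗ₜ v) ∈ tensorLattice L₁ L₂) :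
    ∀ w ∈ tensorLattice L₁ L₂, T w ∈ tensorLattice L₁ L₂ := by
  intro w hw
  refine tensorLattice_induction hL₁ hL₂ (C := fun w => T w ∈ tensorLattice L₁ L₂) ?_ ?_ ?_ hT hw
  · rw [map_zero]; exact Submodule.zero_mem _
  · intro x y hx hy; rw [map_add]; exact Submodule.add_mem _ hx hy
  · intro c x hx
    have : T (c • x) = c • T x := T.map_smul (algebraMap A Kq c) x
    rw [this]
    exact Submodule.smul_mem _ _ hx

/-- Integrability makes the exponent of `q` nonnegative on nonzero vectors, so the scalar is in `A`.
-/
theorem IsComul.kash_odd_mem (hΔ : IsComul D Δ) (h₁ : IsIntegrable ρ₁) (h₂ : IsIntegrable ρ₂)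
    (hL₁ : IsCrystalLattice ρ₁ L₁) (hL₂ : IsCrystalLattice ρ₂ L₂) (hi : D.p i = 1) :
    ∀ ν μ, ∀ u ∈ latticeWeight ρ₁ L₁ ν, ∀ v ∈ latticeWeight ρ₂ L₂ μ,
      kashE (tensorRep Δ ρ₁ ρ₂) i (u ⊗ₜ v) ∈ tensorLattice L₁ L₂ ∧
      kashF (tensorRep Δ ρ₁ ρ₂) i (u ⊗ₜ v) ∈ tensorLattice L₁ L₂ := by
  intro ν μ u hu v hv
  by_cases h0 : u = 0 ∨ v = 0
  · rcases h0 with rfl | rfl <;> simp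
  push Not at h0
  have hν := h₁.odd_h_nonneg hi hu.2 h0.1
  have hμ := h₂.odd_h_nonneg hi hv.2 h0.2
  have m : ∀ {u : M₁} {v : M₂}, u ∈ L₁ → v ∈ L₂ → u ⊗ₜ[Kq] v ∈ tensorLattice L₁ L₂ :=
    fun hu hv => tmul_mem_tensorLattice hu hv
  by_cases hℓ : 0 < D.ℓ i
  · rw [(hΔ.kash_tmul_of_pos hi hℓ hu.2 v).1, (hΔ.kash_tmul_of_pos hi hℓ hu.2 v).2]
    exact ⟨Submodule.add_mem _ (m (hL₁.kashE_mem i u hu.1) hv.1)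
        (evP_zpow_smul_mem hν (m (hL₁.σ_mem hu.1) (hL₂.kashE_mem i v hv.1))),
      Submodule.add_mem _ (m (hL₁.kashF_mem i u hu.1) hv.1)
        (evP_zpow_smul_mem hν (m (hL₁.σ_mem hu.1) (hL₂.kashF_mem i v hv.1)))⟩
  · rw [(hΔ.kash_tmul_of_neg hi hℓ u hv.2).1, (hΔ.kash_tmul_of_neg hi hℓ u hv.2).2]
    exact ⟨Submodule.add_mem _ (evP_zpow_smul_mem hμ (m (hL₁.kashE_mem i u hu.1) hv.1))
        (m (hL₁.σ_mem hu.1) (hL₂.kashE_mem i v hv.1)),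
      Submodule.add_mem _ (evP_zpow_smul_mem hμ (m (hL₁.kashF_mem i u hu.1) hv.1))
        (m (hL₁.σ_mem hu.1) (hL₂.kashF_mem i v hv.1))⟩

theorem IsComul.kash_mem [Module.Free ℤ P] (hΔ : IsComul D Δ) (h₁ : IsIntegrable ρ₁)
    (h₂ : IsIntegrable ρ₂) (hL₁ : IsCrystalLattice ρ₁ L₁) (hL₂ : IsCrystalLattice ρ₂ L₂) (i : I) :
    ∀ ν μ, ∀ u ∈ latticeWeight ρ₁ L₁ ν, ∀ v ∈ latticeWeight ρ₂ L₂ μ,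
      kashE (tensorRep Δ ρ₁ ρ₂) i (u ⊗ₜ v) ∈ tensorLattice L₁ L₂ ∧
      kashF (tensorRep Δ ρ₁ ρ₂) i (u ⊗ₜ v) ∈ tensorLattice L₁ L₂ := by
  by_cases hi : D.p i = 0
  · intro ν μ u hu v hv
    by_cases hℓ : 0 < D.ℓ i
    · exact ev_tensor_kash_mem (hΔ.isEvPairing_mk hi hℓ) h₁ h₂ (hΔ.isIntegrable h₁ h₂) hi hL₁ hL₂
        (fun u hu v hv => tmul_mem_tensorLattice hu hv) hu.1 hv.1
    · exact ev_tensor_kash_mem (hΔ.isEvPairing_flip hi hℓ) h₂ h₁ (hΔ.isIntegrable h₁ h₂) hi hL₂ hL₁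
        (fun v hv u hu => tmul_mem_tensorLattice hu hv) hv.1 hu.1
  · exact hΔ.kash_odd_mem h₁ h₂ hL₁ hL₂ (by omega)

/-- The tensor product of crystal lattices is a crystal lattice. -/
theorem IsComul.isCrystalLattice [Module.Free ℤ P] (hΔ : IsComul D Δ) (h₁ : IsIntegrable ρ₁)
    (h₂ : IsIntegrable ρ₂) (hL₁ : IsCrystalLattice ρ₁ L₁) (hL₂ : IsCrystalLattice ρ₂ L₂) :
    IsCrystalLattice (tensorRep Δ ρ₁ ρ₂) (tensorLattice L₁ L₂) where
  free := by
    have := hL₁.free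
    have := hL₂.free
    obtain ⟨β, -⟩ := exists_basis_tensorLattice (Module.Free.chooseBasis A L₁)
      (Module.Free.chooseBasis A L₂) hL₁.span hL₂.span
    exact Module.Free.of_basis β
  span := by
    have h1 : ∀ u v, u ⊗ₜ[Kq] v ∈
        Submodule.span Kq (tensorLattice L₁ L₂ : Set (M₁ ⊗[Kq] M₂)) := by
      intro u v
      have hu : u ∈ Submodule.span Kq (L₁ : Set M₁) := hL₁.span ▸ trivial
      have hv : v ∈ Submodule.span Kq (L₂ : Set M₂) := hL₂.span ▸ trivial
      refine Submodule.span_induction (p := fun u _ => u ⊗ₜ[Kq] v ∈ _) ?_ ?_ ?_ ?_ hu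
      · intro u hu
        refine Submodule.span_induction (p := fun v _ => u ⊗ₜ[Kq] v ∈ _) ?_ ?_ ?_ ?_ hv
        · exact fun v hv => Submodule.subset_span (tmul_mem_tensorLattice hu hv)
        · rw [TensorProduct.tmul_zero]; exact Submodule.zero_mem _
        · intro a b _ _ ha hb; rw [TensorProduct.tmul_add]; exact Submodule.add_mem _ ha hb
        · intro c a _ ha; rw [TensorProduct.tmul_smul]; exact Submodule.smul_mem _ _ ha
      · rw [TensorProduct.zero_tmul]; exact Submodule.zero_mem _
      · intro a b _ _ ha hb; rw [TensorProduct.add_tmul]; exact Submodule.add_mem _ ha hb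
      · intro c a _ ha; rw [← TensorProduct.smul_tmul']; exact Submodule.smul_mem _ _ ha
    rw [eq_top_iff, ← TensorProduct.span_tmul_eq_top, Submodule.span_le]
    rintro _ ⟨u, v, rfl⟩
    exact h1 u v
  σ_image := by
    have h1 := tensorLattice_map_mem hL₁ hL₂ (T := tensorRep Δ ρ₁ ρ₂ (gen D .σ))
      fun ν μ u hu v hv => by
        rw [hΔ.rep_σ]
        exact tmul_mem_tensorLattice (hL₁.σ_mem hu.1) (hL₂.σ_mem hv.1)
    refine subset_antisymm ?_ fun w hw => ⟨_, h1 w hw, σ_σ_apply w⟩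
    rintro _ ⟨w, hw, rfl⟩
    exact h1 w hw
  weight_indep := latticeWeight_iSupIndep weightSpace_iSupIndep _
  weight_sup := by
    refine le_antisymm (iSup_le fun μ w hw => hw.1) fun w hw => ?_
    refine tensorLattice_induction hL₁ hL₂ (C := fun w => w ∈ ⨆ μ, latticeWeight
      (tensorRep Δ ρ₁ ρ₂) (tensorLattice L₁ L₂) μ) (Submodule.zero_mem _)
      (fun x y => Submodule.add_mem _) (fun c x => Submodule.smul_mem _ c) ?_ hw
    intro ν μ u hu v hv
    exact Submodule.mem_iSup_of_mem (ν + μ)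
      ⟨tmul_mem_tensorLattice hu.1 hv.1, hΔ.tmul_mem hu.2 hv.2⟩
  kashE_mem i := tensorLattice_map_mem hL₁ hL₂ fun ν μ u hu v hv =>
    (hΔ.kash_mem h₁ h₂ hL₁ hL₂ i ν μ u hu v hv).1
  kashF_mem i := tensorLattice_map_mem hL₁ hL₂ fun ν μ u hu v hv =>
    (hΔ.kash_mem h₁ h₂ hL₁ hL₂ i ν μ u hu v hv).2

end Lattice

end QSuper

end

noncomputable section

namespace QSuper

/-! ## The tensor product of crystal bases -/

section Single

variable {I P : Type*} [AddCommGroup P] {D : Datum I P}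
  {M : Type*} [AddCommGroup M] [Module Kq M] {ρ : Uq D →ₐ[Kq] Module.End Kq M}
  {L : Submodule A M} {B : Set (Lbar L)} {i : I}

theorem IsPseudoBase.neg_mem (hB : IsPseudoBase L B) {b : Lbar L} (hb : b ∈ B) : -b ∈ B := by
  let _ := ratModule L
  obtain ⟨B₀, -, -, rfl⟩ := hB
  rcases hb with hb | hb
  · exact Or.inr (by simpa using hb)
  · exact Or.inl hb

theorem IsCrystalBase.σ_mem_base (hB : IsCrystalBase ρ L B) {b : Lbar L} (hb : b ∈ B) :
    bar L (ρ (gen D .σ)) b ∈ B := by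
  rcases hB.σ_mem b hb with h | h
  · rwa [h]
  · rw [h]
    exact hB.pseudoBase.neg_mem hb

theorem IsCrystalLattice.bar_σ_σ (hL : IsCrystalLattice ρ L) (b : Lbar L) :
    bar L (ρ (gen D .σ)) (bar L (ρ (gen D .σ)) b) = b := by
  obtain ⟨u, hu⟩ := exists_isCls b
  have h1 := (hu.bar fun _ => hL.σ_mem).bar fun _ => hL.σ_mem
  rw [σ_σ_apply] at h1
  exact h1.unique hu

theorem bar_mem_barWeight {T : Module.End Kq M} (hT : ∀ u ∈ L, T u ∈ L) {μ ν : P}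
    (hμ : ∀ u ∈ weightSpace ρ μ, T u ∈ weightSpace ρ ν) {b : Lbar L} (hb : b ∈ barWeight ρ L μ) :
    bar L T b ∈ barWeight ρ L ν := by
  obtain ⟨u, hu, rfl⟩ := hb
  obtain ⟨h1, h2⟩ := (IsCls.of_mem u.2).bar hT
  exact ⟨⟨_, h1⟩, ⟨h1, hμ _ hu.2⟩, h2.symm⟩

/-- A nonzero element of `L / qL` has at most one weight. -/
theorem barWeight_unique (hM : IsIntegrable ρ) (hL : IsCrystalLattice ρ L) {b : Lbar L} (hb : b ≠ 0)
    {μ ν : P} (hμ : b ∈ barWeight ρ L μ) (hν : b ∈ barWeight ρ L ν) : μ = ν := by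
  classical
  by_contra hne
  obtain ⟨u, hu, rfl⟩ := hμ
  obtain ⟨v, hv, huv⟩ := hν
  -- The projection to the weight space of `μ` preserves `L`, which is graded, and so preserves
  -- `qL`. Applied to the difference of two representatives of weights `μ ≠ ν`, it shows that the
  -- first is in `qL`.
  obtain ⟨T, hT⟩ := exists_linearMap_of_graded hM.weight_indep hM.weight_top
    (fun l => if l = μ then (weightSpace ρ l).subtype else 0)
  have h1 : ∀ w ∈ L, T w ∈ L := by
    intro w hw
    rw [← hL.weight_sup] at hw
    refine Submodule.iSup_induction _ (motive := fun w => T w ∈ L) hw (fun l w hw => ?_) ?_ ?_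
    · have := hT l ⟨w, hw.2⟩
      change T w ∈ L
      rw [this]
      split_ifs
      · exact hw.1
      · exact L.zero_mem
    · rw [map_zero]; exact L.zero_mem
    · intro a b ha hb; rw [map_add]; exact L.add_mem ha hb
  have h2 := (IsCls.of_mem u.2).sub_mem (v := (v : M)) (by rw [Subtype.coe_eta, huv]; exact ⟨v.2, rfl⟩)
  have h3 := map_mem_qLat h1 _ h2
  have h4 : T u = u := by
    have := hT μ ⟨u, hu.2⟩
    rwa [if_pos rfl] at this
  have h5 : T v = 0 := by
    have := hT ν ⟨v, hv.2⟩
    rwa [if_neg (Ne.symm hne)] at this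
  rw [map_sub, h4, h5, sub_zero, ← IsCls.zero_iff] at h3
  exact hb ((IsCls.of_mem u.2).unique h3)

theorem IsCrystalBase.exists_odd_weight (hB : IsCrystalBase ρ L B) (hM : IsIntegrable ρ)
    (hi : D.p i = 1) {b : Lbar L} (hb : b ∈ B) :
    ∃ μ, b ∈ barWeight ρ L μ ∧ (0 < D.h i μ ∨ D.h i μ = 0) := by
  obtain ⟨μ, ⟨u, hu, rfl⟩, -⟩ := hB.weight b hb
  refine ⟨μ, ⟨u, hu, rfl⟩, (hM.odd_h_nonneg hi hu.2 fun h0 => ?_).lt_or_eq'⟩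
  refine hB.pseudoBase.ne_zero hb ?_
  rw [show u = 0 from Subtype.ext h0, map_zero]

namespace IsStrRep

variable {b : Lbar L} {l a : ℕ} {μ : P} {u : M}

theorem kashF_rep (S : IsStrRep ρ i L b l a μ u) (hM : IsIntegrable ρ) (hL : IsCrystalLattice ρ L)
    (hi : D.p i = 0) (ha : a < l) : IsStrRep ρ i L (bar L (QSuper.kashF ρ i) b) l (a + 1) μ u :=
  ⟨S.mem, S.wt, S.e_eq, S.h_eq, ha, S.kashF hM hL hi, S.ne⟩

theorem kashE_rep (S : IsStrRep ρ i L b l a μ u) (hM : IsIntegrable ρ) (hL : IsCrystalLattice ρ L)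
    (hi : D.p i = 0) (ha : 0 < a) : IsStrRep ρ i L (bar L (QSuper.kashE ρ i) b) l (a - 1) μ u := by
  have h1 := S.kashE hM hL hi
  rw [if_neg ha.ne'] at h1
  exact ⟨S.mem, S.wt, S.e_eq, S.h_eq, (Nat.sub_le _ _).trans S.le, h1, S.ne⟩

theorem kashF_eq_zero (S : IsStrRep ρ i L b l a μ u) (hM : IsIntegrable ρ)
    (hL : IsCrystalLattice ρ L) (hi : D.p i = 0) (ha : ¬a < l) :
    bar L (QSuper.kashF ρ i) b = 0 := by
  have h1 := S.kashF hM hL hi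
  rw [(hM.rankOne_ev hi).dpow_eq_zero S.wt S.e_eq (by rw [S.h_eq]; omega)] at h1
  exact h1.unique IsCls.zero

theorem kashE_eq_zero (S : IsStrRep ρ i L b l a μ u) (hM : IsIntegrable ρ)
    (hL : IsCrystalLattice ρ L) (hi : D.p i = 0) (ha : ¬0 < a) :
    bar L (QSuper.kashE ρ i) b = 0 := by
  have h1 := S.kashE hM hL hi
  rw [if_pos (by omega)] at h1
  exact h1.unique IsCls.zero

theorem kashE_kashF (S : IsStrRep ρ i L b l a μ u) (hM : IsIntegrable ρ)
    (hL : IsCrystalLattice ρ L) (hi : D.p i = 0) (ha : a < l) :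
    bar L (QSuper.kashE ρ i) (bar L (QSuper.kashF ρ i) b) = b := by
  have h1 := (S.kashF_rep hM hL hi ha).kashE hM hL hi
  rw [if_neg (Nat.succ_ne_zero a), Nat.add_sub_cancel] at h1
  exact h1.unique S.cls

theorem kashF_kashE (S : IsStrRep ρ i L b l a μ u) (hM : IsIntegrable ρ)
    (hL : IsCrystalLattice ρ L) (hi : D.p i = 0) (ha : 0 < a) :
    bar L (QSuper.kashF ρ i) (bar L (QSuper.kashE ρ i) b) = b := by
  have h1 := (S.kashE_rep hM hL hi ha).kashF hM hL hi
  rw [Nat.sub_add_cancel ha] at h1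
  exact h1.unique S.cls

end IsStrRep

end Single

section EvenInverse

variable {I P : Type*} [AddCommGroup P] {D : Datum I P}
  {N₁ N₂ M : Type*} [AddCommGroup N₁] [Module Kq N₁] [AddCommGroup N₂] [Module Kq N₂]
  [AddCommGroup M] [Module Kq M]
  {ρ₁ : Uq D →ₐ[Kq] Module.End Kq N₁} {ρ₂ : Uq D →ₐ[Kq] Module.End Kq N₂}
  {ρ : Uq D →ₐ[Kq] Module.End Kq M} {i : I}
  {L₁ : Submodule A N₁} {L₂ : Submodule A N₂} {L : Submodule A M}
  {B : N₁ →ₗ[Kq] N₂ →ₗ[Kq] M}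

/-- On the tensor product of two strings the two operators of an even index are inverse to each
other as long as they do not vanish. -/
theorem ev_tensor_inverse (hB : IsEvPairing i ρ₁ ρ₂ ρ B) (hN₁ : IsIntegrable ρ₁)
    (hN₂ : IsIntegrable ρ₂) (hM : IsIntegrable ρ) (hi : D.p i = 0) (hL₁ : IsCrystalLattice ρ₁ L₁)
    (hL₂ : IsCrystalLattice ρ₂ L₂) (hBL : ∀ u ∈ L₁, ∀ v ∈ L₂, B u v ∈ L)
    {T : Lbar L₁ → Lbar L₂ → Lbar L}
    (hT : ∀ {u v b₁ b₂}, IsCls L₁ u b₁ → IsCls L₂ v b₂ → IsCls L (B u v) (T b₁ b₂))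
    (hE : ∀ w ∈ L, kashE ρ i w ∈ L) (hF : ∀ w ∈ L, kashF ρ i w ∈ L)
    {b₁ : Lbar L₁} {b₂ : Lbar L₂} {l m a b : ℕ} {ν μ : P} {u : N₁} {v : N₂}
    (S₁ : IsStrRep ρ₁ i L₁ b₁ l a ν u) (S₂ : IsStrRep ρ₂ i L₂ b₂ m b μ v) :
    (bar L (kashF ρ i) (T b₁ b₂) ≠ 0 →
      bar L (kashE ρ i) (bar L (kashF ρ i) (T b₁ b₂)) = T b₁ b₂) ∧
    (bar L (kashE ρ i) (T b₁ b₂) ≠ 0 →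
      bar L (kashF ρ i) (bar L (kashE ρ i) (T b₁ b₂)) = T b₁ b₂) := by
  have R := fun {b₁ : Lbar L₁} {b₂ : Lbar L₂} {l m a b : ℕ} {ν μ : P} {u : N₁} {v : N₂}
    (S₁ : IsStrRep ρ₁ i L₁ b₁ l a ν u) (S₂ : IsStrRep ρ₂ i L₂ b₂ m b μ v) =>
    ev_tensor_rule hB hN₁ hN₂ hM hi hL₁ hL₂ hBL hT hE hF S₁ S₂
  have hT0 : ∀ b₂, T 0 b₂ = 0 := by
    intro b₂
    obtain ⟨v, hv⟩ := exists_isCls b₂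
    have := hT IsCls.zero hv
    rw [map_zero, LinearMap.zero_apply] at this
    exact this.unique IsCls.zero
  have hT0' : ∀ b₁, T b₁ 0 = 0 := by
    intro b₁
    obtain ⟨u, hu⟩ := exists_isCls b₁
    have := hT hu IsCls.zero
    rw [map_zero] at this
    exact this.unique IsCls.zero
  have hla := S₁.le
  have hmb := S₂.le
  have e2 := S₂.eps_eq hN₂ hL₂ hi
  have p1 := S₁.phi_eq hN₁ hL₁ hi
  constructor
  · intro h0
    rcases lt_or_ge (eps ρ₂ L₂ i b₂) (phi ρ₁ L₁ i b₁) with hc | hc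
    · rw [(R S₁ S₂).2.2.1 hc] at h0 ⊢
      have ha : a < l := by
        by_contra ha
        rw [S₁.kashF_eq_zero hN₁ hL₁ hi ha, hT0] at h0
        exact h0 rfl
      have S₁' := S₁.kashF_rep hN₁ hL₁ hi ha
      have p1' := S₁'.phi_eq hN₁ hL₁ hi
      -- Acting with `f̃` on the first factor lowers `φ` by one: `ε < φ` becomes `ε ≤ φ`, exactly
      -- the case in which `ẽ` acts on the first factor.
      rw [(R S₁' S₂).1 (by omega), S₁.kashE_kashF hN₁ hL₁ hi ha]
    · rw [(R S₁ S₂).2.2.2 hc] at h0 ⊢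
      have hb : b < m := by
        by_contra hb
        rw [S₂.kashF_eq_zero hN₂ hL₂ hi hb, hT0'] at h0
        exact h0 rfl
      have S₂' := S₂.kashF_rep hN₂ hL₂ hi hb
      have e2' := S₂'.eps_eq hN₂ hL₂ hi
      -- Acting with `f̃` on the second factor raises `ε` by one: `φ ≤ ε` becomes `φ < ε`, the case
      -- in which `ẽ` acts on the second factor.
      rw [(R S₁ S₂').2.1 (by omega), S₂.kashE_kashF hN₂ hL₂ hi hb]
  · intro h0
    rcases lt_or_ge (phi ρ₁ L₁ i b₁) (eps ρ₂ L₂ i b₂) with hc | hc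
    · rw [(R S₁ S₂).2.1 hc] at h0 ⊢
      have hb : 0 < b := by omega
      have S₂' := S₂.kashE_rep hN₂ hL₂ hi hb
      have e2' := S₂'.eps_eq hN₂ hL₂ hi
      rw [(R S₁ S₂').2.2.2 (by omega), S₂.kashF_kashE hN₂ hL₂ hi hb]
    · rw [(R S₁ S₂).1 hc] at h0 ⊢
      have ha : 0 < a := by
        by_contra ha
        rw [S₁.kashE_eq_zero hN₁ hL₁ hi ha, hT0] at h0
        exact h0 rfl
      have S₁' := S₁.kashE_rep hN₁ hL₁ hi ha
      have p1' := S₁'.phi_eq hN₁ hL₁ hi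
      rw [(R S₁' S₂).2.2.1 (by omega), S₁.kashF_kashE hN₁ hL₁ hi ha]

end EvenInverse

section OddTensor

variable {I P : Type*} [AddCommGroup P] {D : Datum I P}
  {M₁ M₂ : Type*} [AddCommGroup M₁] [Module Kq M₁] [AddCommGroup M₂] [Module Kq M₂]
  {Δ : Uq D →ₐ[Kq] Uq D ⊗[Kq] Uq D}
  {ρ₁ : Uq D →ₐ[Kq] Module.End Kq M₁} {ρ₂ : Uq D →ₐ[Kq] Module.End Kq M₂} {i : I}
  {L₁ : Submodule A M₁} {L₂ : Submodule A M₂} {B₁ : Set (Lbar L₁)} {B₂ : Set (Lbar L₂)}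

/-- With a positive pairing the second term of `kash_tmul_of_pos` lies in `qL`. With a zero pairing
its scalar is `1`, and the first term vanishes by integrability. -/
theorem IsComul.odd_rule_of_pos (hΔ : IsComul D Δ) (h₁ : IsIntegrable ρ₁)
    (hL₁ : IsCrystalLattice ρ₁ L₁) (hL₂ : IsCrystalLattice ρ₂ L₂)
    (hL : IsCrystalLattice (tensorRep Δ ρ₁ ρ₂) (tensorLattice L₁ L₂)) (hi : D.p i = 1)
    (hℓ : 0 < D.ℓ i) {μ : P} {b₁ : Lbar L₁} (hb₁ : b₁ ∈ barWeight ρ₁ L₁ μ) (b₂ : Lbar L₂) :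
    (0 < D.h i μ →
      bar (tensorLattice L₁ L₂) (kashE (tensorRep Δ ρ₁ ρ₂) i) (tensorBar L₁ L₂ b₁ b₂) =
        tensorBar L₁ L₂ (bar L₁ (kashE ρ₁ i) b₁) b₂ ∧
      bar (tensorLattice L₁ L₂) (kashF (tensorRep Δ ρ₁ ρ₂) i) (tensorBar L₁ L₂ b₁ b₂) =
        tensorBar L₁ L₂ (bar L₁ (kashF ρ₁ i) b₁) b₂) ∧
    (D.h i μ = 0 →
      bar (tensorLattice L₁ L₂) (kashE (tensorRep Δ ρ₁ ρ₂) i) (tensorBar L₁ L₂ b₁ b₂) =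
        tensorBar L₁ L₂ (bar L₁ (ρ₁ (gen D .σ)) b₁) (bar L₂ (kashE ρ₂ i) b₂) ∧
      bar (tensorLattice L₁ L₂) (kashF (tensorRep Δ ρ₁ ρ₂) i) (tensorBar L₁ L₂ b₁ b₂) =
        tensorBar L₁ L₂ (bar L₁ (ρ₁ (gen D .σ)) b₁) (bar L₂ (kashF ρ₂ i) b₂)) := by
  obtain ⟨u, hu, rfl⟩ := hb₁
  obtain ⟨v, hv⟩ := exists_isCls b₂
  have hu' := IsCls.of_mem u.2
  have hE := (hu'.tmul hv).bar (hL.kashE_mem i)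
  have hF := (hu'.tmul hv).bar (hL.kashF_mem i)
  have hσ := hu'.bar (T := ρ₁ (gen D .σ)) fun _ => hL₁.σ_mem
  have hEr := hσ.tmul (hv.bar (hL₂.kashE_mem i))
  have hFr := hσ.tmul (hv.bar (hL₂.kashF_mem i))
  rw [(hΔ.kash_tmul_of_pos hi hℓ hu.2 v).1] at hE
  rw [(hΔ.kash_tmul_of_pos hi hℓ hu.2 v).2] at hF
  constructor
  · intro hμ
    have hEl := (hu'.bar (hL₁.kashE_mem i)).tmul hv
    have hFl := (hu'.bar (hL₁.kashF_mem i)).tmul hv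
    exact ⟨hE.unique (hEl.congr (by
        rw [add_sub_cancel_left]; exact evP_zpow_smul_mem_qLat hμ hEr.mem)),
      hF.unique (hFl.congr (by
        rw [add_sub_cancel_left]; exact evP_zpow_smul_mem_qLat hμ hFr.mem))⟩
  · intro hμ
    obtain ⟨h1, h2⟩ := h₁.kash_odd_eq_zero hi hμ hu.2
    rw [h1, hμ, TensorProduct.zero_tmul, zero_add, zpow_zero, one_smul] at hE
    rw [h2, hμ, TensorProduct.zero_tmul, zero_add, zpow_zero, one_smul] at hF
    exact ⟨hE.unique hEr, hF.unique hFr⟩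

theorem IsComul.odd_rule_of_neg (hΔ : IsComul D Δ) (h₂ : IsIntegrable ρ₂)
    (hL₁ : IsCrystalLattice ρ₁ L₁) (hL₂ : IsCrystalLattice ρ₂ L₂)
    (hL : IsCrystalLattice (tensorRep Δ ρ₁ ρ₂) (tensorLattice L₁ L₂)) (hi : D.p i = 1)
    (hℓ : ¬0 < D.ℓ i) {μ : P} (b₁ : Lbar L₁) {b₂ : Lbar L₂} (hb₂ : b₂ ∈ barWeight ρ₂ L₂ μ) :
    (0 < D.h i μ →
      bar (tensorLattice L₁ L₂) (kashE (tensorRep Δ ρ₁ ρ₂) i) (tensorBar L₁ L₂ b₁ b₂) =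
        tensorBar L₁ L₂ (bar L₁ (ρ₁ (gen D .σ)) b₁) (bar L₂ (kashE ρ₂ i) b₂) ∧
      bar (tensorLattice L₁ L₂) (kashF (tensorRep Δ ρ₁ ρ₂) i) (tensorBar L₁ L₂ b₁ b₂) =
        tensorBar L₁ L₂ (bar L₁ (ρ₁ (gen D .σ)) b₁) (bar L₂ (kashF ρ₂ i) b₂)) ∧
    (D.h i μ = 0 →
      bar (tensorLattice L₁ L₂) (kashE (tensorRep Δ ρ₁ ρ₂) i) (tensorBar L₁ L₂ b₁ b₂) =
        tensorBar L₁ L₂ (bar L₁ (kashE ρ₁ i) b₁) b₂ ∧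
      bar (tensorLattice L₁ L₂) (kashF (tensorRep Δ ρ₁ ρ₂) i) (tensorBar L₁ L₂ b₁ b₂) =
        tensorBar L₁ L₂ (bar L₁ (kashF ρ₁ i) b₁) b₂) := by
  obtain ⟨v, hv, rfl⟩ := hb₂
  obtain ⟨u, hu⟩ := exists_isCls b₁
  have hv' := IsCls.of_mem v.2
  have hE := (hu.tmul hv').bar (hL.kashE_mem i)
  have hF := (hu.tmul hv').bar (hL.kashF_mem i)
  have hEl := (hu.bar (hL₁.kashE_mem i)).tmul hv'
  have hFl := (hu.bar (hL₁.kashF_mem i)).tmul hv'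
  rw [(hΔ.kash_tmul_of_neg hi hℓ u hv.2).1] at hE
  rw [(hΔ.kash_tmul_of_neg hi hℓ u hv.2).2] at hF
  constructor
  · intro hμ
    have hσ := hu.bar (T := ρ₁ (gen D .σ)) fun _ => hL₁.σ_mem
    have hEr := hσ.tmul (hv'.bar (hL₂.kashE_mem i))
    have hFr := hσ.tmul (hv'.bar (hL₂.kashF_mem i))
    exact ⟨hE.unique (hEr.congr (by
        rw [add_sub_cancel_right]; exact evP_zpow_smul_mem_qLat hμ hEl.mem)),
      hF.unique (hFr.congr (by
        rw [add_sub_cancel_right]; exact evP_zpow_smul_mem_qLat hμ hFl.mem))⟩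
  · intro hμ
    obtain ⟨h1, h2⟩ := h₂.kash_odd_eq_zero hi hμ hv.2
    rw [h1, hμ, TensorProduct.tmul_zero, add_zero, zpow_zero, one_smul] at hE
    rw [h2, hμ, TensorProduct.tmul_zero, add_zero, zpow_zero, one_smul] at hF
    exact ⟨hE.unique hEl, hF.unique hFl⟩

end OddTensor

end QSuper

end

noncomputable section

namespace QSuper

/-! ## The crystal base of the tensor product -/

section OddInverse

variable {I P : Type*} [AddCommGroup P] {D : Datum I P}
  {M : Type*} [AddCommGroup M] [Module Kq M] {ρ : Uq D →ₐ[Kq] Module.End Kq M}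
  {L : Submodule A M} {B : Set (Lbar L)} {i : I}

theorem IsCrystalBase.kashF_odd (hB : IsCrystalBase ρ L B) (hi : D.p i = 1) {b : Lbar L}
    (hb : b ∈ B) (h0 : bar L (kashF ρ i) b ≠ 0) :
    bar L (kashE ρ i) (bar L (kashF ρ i) b) = b ∧
      ∀ μ, b ∈ barWeight ρ L μ → bar L (kashF ρ i) b ∈ barWeight ρ L (μ - D.α i) :=
  ⟨((hB.kash_iff i _ ((hB.kashF_mem i b hb).resolve_right h0) b hb).mp rfl).symm,
    fun _ hμ => bar_mem_barWeight (hB.lattice.kashF_mem i) (fun _ => kashF_odd_mem hi) hμ⟩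

theorem IsCrystalBase.kashE_odd (hB : IsCrystalBase ρ L B) (hi : D.p i = 1) {b : Lbar L}
    (hb : b ∈ B) (h0 : bar L (kashE ρ i) b ≠ 0) :
    bar L (kashF ρ i) (bar L (kashE ρ i) b) = b ∧
      ∀ μ, b ∈ barWeight ρ L μ → bar L (kashE ρ i) b ∈ barWeight ρ L (μ + D.α i) :=
  ⟨((hB.kash_iff i b hb _ ((hB.kashE_mem i b hb).resolve_right h0)).mpr rfl).symm,
    fun _ hμ => bar_mem_barWeight (hB.lattice.kashE_mem i) (fun _ => kashE_odd_mem hi) hμ⟩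

variable {M₁ M₂ : Type*} [AddCommGroup M₁] [Module Kq M₁] [AddCommGroup M₂] [Module Kq M₂]
  {Δ : Uq D →ₐ[Kq] Uq D ⊗[Kq] Uq D}
  {ρ₁ : Uq D →ₐ[Kq] Module.End Kq M₁} {ρ₂ : Uq D →ₐ[Kq] Module.End Kq M₂}
  {L₁ : Submodule A M₁} {L₂ : Submodule A M₂} {B₁ : Set (Lbar L₁)} {B₂ : Set (Lbar L₂)}
  {b₁ : Lbar L₁} {b₂ : Lbar L₂}

theorem left_ne_zero_of_tensorBar (h : tensorBar L₁ L₂ b₁ b₂ ≠ 0) : b₁ ≠ 0 := by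
  rintro rfl
  exact h (by rw [map_zero, LinearMap.zero_apply])

theorem right_ne_zero_of_tensorBar (h : tensorBar L₁ L₂ b₁ b₂ ≠ 0) : b₂ ≠ 0 := by
  rintro rfl
  exact h (map_zero _)

/-- For an odd index and `ℓ i > 0` the two operators on the tensor product of crystal bases are
inverse to each other as long as they do not vanish. -/
theorem IsComul.odd_inverse_of_pos (hΔ : IsComul D Δ) (hM₁ : IsIntegrable ρ₁)
    (hL : IsCrystalLattice (tensorRep Δ ρ₁ ρ₂) (tensorLattice L₁ L₂))
    (h₁ : IsCrystalBase ρ₁ L₁ B₁) (h₂ : IsCrystalBase ρ₂ L₂ B₂) (hi : D.p i = 1)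
    (hα : D.h i (D.α i) = 0) (hℓ : 0 < D.ℓ i) (hb₁ : b₁ ∈ B₁) (hb₂ : b₂ ∈ B₂) :
    (bar (tensorLattice L₁ L₂) (kashF (tensorRep Δ ρ₁ ρ₂) i) (tensorBar L₁ L₂ b₁ b₂) ≠ 0 →
      bar (tensorLattice L₁ L₂) (kashE (tensorRep Δ ρ₁ ρ₂) i)
        (bar (tensorLattice L₁ L₂) (kashF (tensorRep Δ ρ₁ ρ₂) i) (tensorBar L₁ L₂ b₁ b₂)) =
          tensorBar L₁ L₂ b₁ b₂) ∧
    (bar (tensorLattice L₁ L₂) (kashE (tensorRep Δ ρ₁ ρ₂) i) (tensorBar L₁ L₂ b₁ b₂) ≠ 0 →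
      bar (tensorLattice L₁ L₂) (kashF (tensorRep Δ ρ₁ ρ₂) i)
        (bar (tensorLattice L₁ L₂) (kashE (tensorRep Δ ρ₁ ρ₂) i) (tensorBar L₁ L₂ b₁ b₂)) =
          tensorBar L₁ L₂ b₁ b₂) := by
  have R := fun {μ : P} {b₁ : Lbar L₁} (hb₁ : b₁ ∈ barWeight ρ₁ L₁ μ) (b₂ : Lbar L₂) =>
    hΔ.odd_rule_of_pos hM₁ h₁.lattice h₂.lattice hL hi hℓ hb₁ b₂
  obtain ⟨μ, hμ, h0 | h0⟩ := h₁.exists_odd_weight hM₁ hi hb₁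
  -- Both operators act on the first factor. Since `⟨h_i, α_i⟩ = 0`, they leave its pairing with
  -- `h_i` unchanged, so the same case applies to the second operator.
  · rw [((R hμ b₂).1 h0).1, ((R hμ b₂).1 h0).2]
    constructor
    · intro h
      obtain ⟨h3, h4⟩ := h₁.kashF_odd hi hb₁ (left_ne_zero_of_tensorBar h)
      rw [((R (h4 μ hμ) b₂).1 (by rwa [map_sub, hα, sub_zero])).1, h3]
    · intro h
      obtain ⟨h3, h4⟩ := h₁.kashE_odd hi hb₁ (left_ne_zero_of_tensorBar h)
      rw [((R (h4 μ hμ) b₂).1 (by rwa [map_add, hα, add_zero])).2, h3]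
  -- Both operators act on the second factor and each puts a `σ` on the first. The weight of `b₁` is
  -- not changed by `σ`, and the two copies of `σ` cancel.
  · have hσ : bar L₁ (ρ₁ (gen D .σ)) b₁ ∈ barWeight ρ₁ L₁ μ :=
      bar_mem_barWeight (fun _ => h₁.lattice.σ_mem) (fun _ => σ_mem_weightSpace) hμ
    rw [((R hμ b₂).2 h0).1, ((R hμ b₂).2 h0).2]
    constructor
    · intro h
      obtain ⟨h3, -⟩ := h₂.kashF_odd hi hb₂ (right_ne_zero_of_tensorBar h)
      rw [((R hσ _).2 h0).1, h3, h₁.lattice.bar_σ_σ]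
    · intro h
      obtain ⟨h3, -⟩ := h₂.kashE_odd hi hb₂ (right_ne_zero_of_tensorBar h)
      rw [((R hσ _).2 h0).2, h3, h₁.lattice.bar_σ_σ]

/-- For an odd index and `ℓ i < 0` the two operators on the tensor product of crystal bases are
inverse to each other as long as they do not vanish. -/
theorem IsComul.odd_inverse_of_neg (hΔ : IsComul D Δ) (hM₂ : IsIntegrable ρ₂)
    (hL : IsCrystalLattice (tensorRep Δ ρ₁ ρ₂) (tensorLattice L₁ L₂))
    (h₁ : IsCrystalBase ρ₁ L₁ B₁) (h₂ : IsCrystalBase ρ₂ L₂ B₂) (hi : D.p i = 1)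
    (hα : D.h i (D.α i) = 0) (hℓ : ¬0 < D.ℓ i) (hb₁ : b₁ ∈ B₁) (hb₂ : b₂ ∈ B₂) :
    (bar (tensorLattice L₁ L₂) (kashF (tensorRep Δ ρ₁ ρ₂) i) (tensorBar L₁ L₂ b₁ b₂) ≠ 0 →
      bar (tensorLattice L₁ L₂) (kashE (tensorRep Δ ρ₁ ρ₂) i)
        (bar (tensorLattice L₁ L₂) (kashF (tensorRep Δ ρ₁ ρ₂) i) (tensorBar L₁ L₂ b₁ b₂)) =
          tensorBar L₁ L₂ b₁ b₂) ∧
    (bar (tensorLattice L₁ L₂) (kashE (tensorRep Δ ρ₁ ρ₂) i) (tensorBar L₁ L₂ b₁ b₂) ≠ 0 →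
      bar (tensorLattice L₁ L₂) (kashF (tensorRep Δ ρ₁ ρ₂) i)
        (bar (tensorLattice L₁ L₂) (kashE (tensorRep Δ ρ₁ ρ₂) i) (tensorBar L₁ L₂ b₁ b₂)) =
          tensorBar L₁ L₂ b₁ b₂) := by
  have R := fun {μ : P} (b₁ : Lbar L₁) {b₂ : Lbar L₂} (hb₂ : b₂ ∈ barWeight ρ₂ L₂ μ) =>
    hΔ.odd_rule_of_neg hM₂ h₁.lattice h₂.lattice hL hi hℓ b₁ hb₂
  obtain ⟨μ, hμ, h0 | h0⟩ := h₂.exists_odd_weight hM₂ hi hb₂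
  -- Here `b₂` is moved, its pairing with `h_i` stays positive because `⟨h_i, α_i⟩ = 0`, and the two
  -- copies of `σ` on `b₁` cancel.
  · rw [((R b₁ hμ).1 h0).1, ((R b₁ hμ).1 h0).2]
    constructor
    · intro h
      obtain ⟨h3, h4⟩ := h₂.kashF_odd hi hb₂ (right_ne_zero_of_tensorBar h)
      rw [((R _ (h4 μ hμ)).1 (by rwa [map_sub, hα, sub_zero])).1, h3, h₁.lattice.bar_σ_σ]
    · intro h
      obtain ⟨h3, h4⟩ := h₂.kashE_odd hi hb₂ (right_ne_zero_of_tensorBar h)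
      rw [((R _ (h4 μ hμ)).1 (by rwa [map_add, hα, add_zero])).2, h3, h₁.lattice.bar_σ_σ]
  · rw [((R b₁ hμ).2 h0).1, ((R b₁ hμ).2 h0).2]
    constructor
    · intro h
      obtain ⟨h3, -⟩ := h₁.kashF_odd hi hb₁ (left_ne_zero_of_tensorBar h)
      rw [((R _ hμ).2 h0).1, h3]
    · intro h
      obtain ⟨h3, -⟩ := h₁.kashE_odd hi hb₁ (left_ne_zero_of_tensorBar h)
      rw [((R _ hμ).2 h0).2, h3]

theorem tensorBar_left_mem {c : Lbar L₁} (hc : c ∈ B₁ ∨ c = 0) (hb₂ : b₂ ∈ B₂) :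
    tensorBar L₁ L₂ c b₂ ∈ tensorB L₁ L₂ B₁ B₂ ∨ tensorBar L₁ L₂ c b₂ = 0 := by
  rcases hc with hc | rfl
  · exact Or.inl ⟨c, hc, b₂, hb₂, rfl⟩
  · exact Or.inr (by rw [map_zero, LinearMap.zero_apply])

theorem tensorBar_right_mem {c : Lbar L₂} (hb₁ : b₁ ∈ B₁) (hc : c ∈ B₂ ∨ c = 0) :
    tensorBar L₁ L₂ b₁ c ∈ tensorB L₁ L₂ B₁ B₂ ∨ tensorBar L₁ L₂ b₁ c = 0 := by
  rcases hc with hc | rfl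
  · exact Or.inl ⟨b₁, hb₁, c, hc, rfl⟩
  · exact Or.inr (map_zero _)

variable [Module.Free ℤ P]

theorem IsComul.even_rule_of_pos (hΔ : IsComul D Δ) (hM₁ : IsIntegrable ρ₁) (hM₂ : IsIntegrable ρ₂)
    (h₁ : IsCrystalBase ρ₁ L₁ B₁) (h₂ : IsCrystalBase ρ₂ L₂ B₂) (hi : D.p i = 0)
    (hℓ : 0 < D.ℓ i) (hb₁ : b₁ ∈ B₁) (hb₂ : b₂ ∈ B₂) :
    (eps ρ₂ L₂ i b₂ ≤ phi ρ₁ L₁ i b₁ →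
      bar (tensorLattice L₁ L₂) (kashE (tensorRep Δ ρ₁ ρ₂) i) (tensorBar L₁ L₂ b₁ b₂) =
        tensorBar L₁ L₂ (bar L₁ (kashE ρ₁ i) b₁) b₂) ∧
    (phi ρ₁ L₁ i b₁ < eps ρ₂ L₂ i b₂ →
      bar (tensorLattice L₁ L₂) (kashE (tensorRep Δ ρ₁ ρ₂) i) (tensorBar L₁ L₂ b₁ b₂) =
        tensorBar L₁ L₂ b₁ (bar L₂ (kashE ρ₂ i) b₂)) ∧
    (eps ρ₂ L₂ i b₂ < phi ρ₁ L₁ i b₁ →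
      bar (tensorLattice L₁ L₂) (kashF (tensorRep Δ ρ₁ ρ₂) i) (tensorBar L₁ L₂ b₁ b₂) =
        tensorBar L₁ L₂ (bar L₁ (kashF ρ₁ i) b₁) b₂) ∧
    (phi ρ₁ L₁ i b₁ ≤ eps ρ₂ L₂ i b₂ →
      bar (tensorLattice L₁ L₂) (kashF (tensorRep Δ ρ₁ ρ₂) i) (tensorBar L₁ L₂ b₁ b₂) =
        tensorBar L₁ L₂ b₁ (bar L₂ (kashF ρ₂ i) b₂)) := by
  have hL := hΔ.isCrystalLattice hM₁ hM₂ h₁.lattice h₂.lattice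
  obtain ⟨l, a, ν, u, S₁⟩ := h₁.exists_isStrRep hM₁ hi hb₁
  obtain ⟨m, b, μ, v, S₂⟩ := h₂.exists_isStrRep hM₂ hi hb₂
  exact ev_tensor_rule (hΔ.isEvPairing_mk hi hℓ) hM₁ hM₂ (hΔ.isIntegrable hM₁ hM₂) hi
    h₁.lattice h₂.lattice (fun u hu v hv => tmul_mem_tensorLattice hu hv)
    (T := fun b₁ b₂ => tensorBar L₁ L₂ b₁ b₂) (fun hu hv => hu.tmul hv)
    (hL.kashE_mem i) (hL.kashF_mem i) S₁ S₂

theorem IsComul.even_rule_of_neg (hΔ : IsComul D Δ) (hM₁ : IsIntegrable ρ₁) (hM₂ : IsIntegrable ρ₂)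
    (h₁ : IsCrystalBase ρ₁ L₁ B₁) (h₂ : IsCrystalBase ρ₂ L₂ B₂) (hi : D.p i = 0)
    (hℓ : ¬0 < D.ℓ i) (hb₁ : b₁ ∈ B₁) (hb₂ : b₂ ∈ B₂) :
    (eps ρ₁ L₁ i b₁ ≤ phi ρ₂ L₂ i b₂ →
      bar (tensorLattice L₁ L₂) (kashE (tensorRep Δ ρ₁ ρ₂) i) (tensorBar L₁ L₂ b₁ b₂) =
        tensorBar L₁ L₂ b₁ (bar L₂ (kashE ρ₂ i) b₂)) ∧
    (phi ρ₂ L₂ i b₂ < eps ρ₁ L₁ i b₁ →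
      bar (tensorLattice L₁ L₂) (kashE (tensorRep Δ ρ₁ ρ₂) i) (tensorBar L₁ L₂ b₁ b₂) =
        tensorBar L₁ L₂ (bar L₁ (kashE ρ₁ i) b₁) b₂) ∧
    (eps ρ₁ L₁ i b₁ < phi ρ₂ L₂ i b₂ →
      bar (tensorLattice L₁ L₂) (kashF (tensorRep Δ ρ₁ ρ₂) i) (tensorBar L₁ L₂ b₁ b₂) =
        tensorBar L₁ L₂ b₁ (bar L₂ (kashF ρ₂ i) b₂)) ∧
    (phi ρ₂ L₂ i b₂ ≤ eps ρ₁ L₁ i b₁ →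
      bar (tensorLattice L₁ L₂) (kashF (tensorRep Δ ρ₁ ρ₂) i) (tensorBar L₁ L₂ b₁ b₂) =
        tensorBar L₁ L₂ (bar L₁ (kashF ρ₁ i) b₁) b₂) := by
  have hL := hΔ.isCrystalLattice hM₁ hM₂ h₁.lattice h₂.lattice
  obtain ⟨l, a, ν, u, S₁⟩ := h₁.exists_isStrRep hM₁ hi hb₁
  obtain ⟨m, b, μ, v, S₂⟩ := h₂.exists_isStrRep hM₂ hi hb₂
  exact ev_tensor_rule (hΔ.isEvPairing_flip hi hℓ) hM₂ hM₁ (hΔ.isIntegrable hM₁ hM₂) hi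
    h₂.lattice h₁.lattice (fun v hv u hu => tmul_mem_tensorLattice hu hv)
    (T := fun b₂ b₁ => tensorBar L₁ L₂ b₁ b₂) (fun hv hu => hu.tmul hv)
    (hL.kashE_mem i) (hL.kashF_mem i) S₂ S₁

theorem IsComul.kash_mem_tensorB (hΔ : IsComul D Δ) (hM₁ : IsIntegrable ρ₁)
    (hM₂ : IsIntegrable ρ₂) (h₁ : IsCrystalBase ρ₁ L₁ B₁) (h₂ : IsCrystalBase ρ₂ L₂ B₂) (i : I)
    {b : Lbar (tensorLattice L₁ L₂)} (hb : b ∈ tensorB L₁ L₂ B₁ B₂) :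
    (bar (tensorLattice L₁ L₂) (kashE (tensorRep Δ ρ₁ ρ₂) i) b ∈ tensorB L₁ L₂ B₁ B₂ ∨
      bar (tensorLattice L₁ L₂) (kashE (tensorRep Δ ρ₁ ρ₂) i) b = 0) ∧
    (bar (tensorLattice L₁ L₂) (kashF (tensorRep Δ ρ₁ ρ₂) i) b ∈ tensorB L₁ L₂ B₁ B₂ ∨
      bar (tensorLattice L₁ L₂) (kashF (tensorRep Δ ρ₁ ρ₂) i) b = 0) := by
  have hL := hΔ.isCrystalLattice hM₁ hM₂ h₁.lattice h₂.lattice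
  obtain ⟨b₁, hb₁, b₂, hb₂, rfl⟩ := hb
  have hE₁ := fun {b} (hb : b ∈ B₂) => tensorBar_left_mem (L₂ := L₂) (h₁.kashE_mem i b₁ hb₁) hb
  have hF₁ := fun {b} (hb : b ∈ B₂) => tensorBar_left_mem (L₂ := L₂) (h₁.kashF_mem i b₁ hb₁) hb
  have hE₂ := fun {b} (hb : b ∈ B₁) => tensorBar_right_mem (L₁ := L₁) hb (h₂.kashE_mem i b₂ hb₂)
  have hF₂ := fun {b} (hb : b ∈ B₁) => tensorBar_right_mem (L₁ := L₁) hb (h₂.kashF_mem i b₂ hb₂)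
  have hσ := h₁.σ_mem_base hb₁
  by_cases hi : D.p i = 0
  · by_cases hℓ : 0 < D.ℓ i
    · obtain ⟨r1, r2, r3, r4⟩ := hΔ.even_rule_of_pos hM₁ hM₂ h₁ h₂ hi hℓ hb₁ hb₂
      constructor
      · rcases le_or_gt (eps ρ₂ L₂ i b₂) (phi ρ₁ L₁ i b₁) with hc | hc
        · rw [r1 hc]; exact hE₁ hb₂
        · rw [r2 hc]; exact hE₂ hb₁
      · rcases lt_or_ge (eps ρ₂ L₂ i b₂) (phi ρ₁ L₁ i b₁) with hc | hc
        · rw [r3 hc]; exact hF₁ hb₂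
        · rw [r4 hc]; exact hF₂ hb₁
    · obtain ⟨r1, r2, r3, r4⟩ := hΔ.even_rule_of_neg hM₁ hM₂ h₁ h₂ hi hℓ hb₁ hb₂
      constructor
      · rcases le_or_gt (eps ρ₁ L₁ i b₁) (phi ρ₂ L₂ i b₂) with hc | hc
        · rw [r1 hc]; exact hE₂ hb₁
        · rw [r2 hc]; exact hE₁ hb₂
      · rcases lt_or_ge (eps ρ₁ L₁ i b₁) (phi ρ₂ L₂ i b₂) with hc | hc
        · rw [r3 hc]; exact hF₂ hb₁
        · rw [r4 hc]; exact hF₁ hb₂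
  · replace hi : D.p i = 1 := by omega
    by_cases hℓ : 0 < D.ℓ i
    · obtain ⟨μ, hμ, h0 | h0⟩ := h₁.exists_odd_weight hM₁ hi hb₁
      · obtain ⟨r1, r2⟩ :=
          (hΔ.odd_rule_of_pos hM₁ h₁.lattice h₂.lattice hL hi hℓ hμ b₂).1 h0
        rw [r1, r2]; exact ⟨hE₁ hb₂, hF₁ hb₂⟩
      · obtain ⟨r1, r2⟩ :=
          (hΔ.odd_rule_of_pos hM₁ h₁.lattice h₂.lattice hL hi hℓ hμ b₂).2 h0
        rw [r1, r2]; exact ⟨hE₂ hσ, hF₂ hσ⟩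
    · obtain ⟨μ, hμ, h0 | h0⟩ := h₂.exists_odd_weight hM₂ hi hb₂
      · obtain ⟨r1, r2⟩ :=
          (hΔ.odd_rule_of_neg hM₂ h₁.lattice h₂.lattice hL hi hℓ b₁ hμ).1 h0
        rw [r1, r2]; exact ⟨hE₂ hσ, hF₂ hσ⟩
      · obtain ⟨r1, r2⟩ :=
          (hΔ.odd_rule_of_neg hM₂ h₁.lattice h₂.lattice hL hi hℓ b₁ hμ).2 h0
        rw [r1, r2]; exact ⟨hE₁ hb₂, hF₁ hb₂⟩

theorem IsComul.kash_inverse (hΔ : IsComul D Δ) (hD : ∀ i, D.p i = 1 → D.h i (D.α i) = 0)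
    (hM₁ : IsIntegrable ρ₁) (hM₂ : IsIntegrable ρ₂) (h₁ : IsCrystalBase ρ₁ L₁ B₁)
    (h₂ : IsCrystalBase ρ₂ L₂ B₂) (i : I) {b : Lbar (tensorLattice L₁ L₂)}
    (hb : b ∈ tensorB L₁ L₂ B₁ B₂) :
    (bar (tensorLattice L₁ L₂) (kashF (tensorRep Δ ρ₁ ρ₂) i) b ≠ 0 →
      bar (tensorLattice L₁ L₂) (kashE (tensorRep Δ ρ₁ ρ₂) i)
        (bar (tensorLattice L₁ L₂) (kashF (tensorRep Δ ρ₁ ρ₂) i) b) = b) ∧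
    (bar (tensorLattice L₁ L₂) (kashE (tensorRep Δ ρ₁ ρ₂) i) b ≠ 0 →
      bar (tensorLattice L₁ L₂) (kashF (tensorRep Δ ρ₁ ρ₂) i)
        (bar (tensorLattice L₁ L₂) (kashE (tensorRep Δ ρ₁ ρ₂) i) b) = b) := by
  have hL := hΔ.isCrystalLattice hM₁ hM₂ h₁.lattice h₂.lattice
  obtain ⟨b₁, hb₁, b₂, hb₂, rfl⟩ := hb
  by_cases hi : D.p i = 0
  · obtain ⟨l, a, ν, u, S₁⟩ := h₁.exists_isStrRep hM₁ hi hb₁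
    obtain ⟨m, b, μ, v, S₂⟩ := h₂.exists_isStrRep hM₂ hi hb₂
    by_cases hℓ : 0 < D.ℓ i
    · exact ev_tensor_inverse (hΔ.isEvPairing_mk hi hℓ) hM₁ hM₂ (hΔ.isIntegrable hM₁ hM₂) hi
        h₁.lattice h₂.lattice (fun u hu v hv => tmul_mem_tensorLattice hu hv)
        (T := fun b₁ b₂ => tensorBar L₁ L₂ b₁ b₂) (fun hu hv => hu.tmul hv)
        (hL.kashE_mem i) (hL.kashF_mem i) S₁ S₂
    · exact ev_tensor_inverse (hΔ.isEvPairing_flip hi hℓ) hM₂ hM₁ (hΔ.isIntegrable hM₁ hM₂) hi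
        h₂.lattice h₁.lattice (fun v hv u hu => tmul_mem_tensorLattice hu hv)
        (T := fun b₂ b₁ => tensorBar L₁ L₂ b₁ b₂) (fun hv hu => hu.tmul hv)
        (hL.kashE_mem i) (hL.kashF_mem i) S₂ S₁
  · replace hi : D.p i = 1 := by omega
    by_cases hℓ : 0 < D.ℓ i
    · exact hΔ.odd_inverse_of_pos hM₁ hL h₁ h₂ hi (hD i hi) hℓ hb₁ hb₂
    · exact hΔ.odd_inverse_of_neg hM₂ hL h₁ h₂ hi (hD i hi) hℓ hb₁ hb₂

/-- The tensor product of crystal bases is a crystal base. -/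
theorem IsComul.isCrystalBase (hΔ : IsComul D Δ) (hD : ∀ i, D.p i = 1 → D.h i (D.α i) = 0)
    (hM₁ : IsIntegrable ρ₁) (hM₂ : IsIntegrable ρ₂) (h₁ : IsCrystalBase ρ₁ L₁ B₁)
    (h₂ : IsCrystalBase ρ₂ L₂ B₂) :
    IsCrystalBase (tensorRep Δ ρ₁ ρ₂) (tensorLattice L₁ L₂) (tensorB L₁ L₂ B₁ B₂) := by
  have hL := hΔ.isCrystalLattice hM₁ hM₂ h₁.lattice h₂.lattice
  have := h₁.lattice.free
  have := h₂.lattice.free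
  have hB : IsPseudoBase (tensorLattice L₁ L₂) (tensorB L₁ L₂ B₁ B₂) :=
    .tensor h₁.lattice.span h₂.lattice.span h₁.pseudoBase h₂.pseudoBase
  refine ⟨hL, ?_, ?_, hB, fun i b hb => (hΔ.kash_mem_tensorB hM₁ hM₂ h₁ h₂ i hb).1,
    fun i b hb => (hΔ.kash_mem_tensorB hM₁ hM₂ h₁ h₂ i hb).2, ?_⟩
  · rintro _ ⟨b₁, hb₁, b₂, hb₂, rfl⟩
    obtain ⟨u, hu⟩ := exists_isCls b₁
    obtain ⟨v, hv⟩ := exists_isCls b₂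
    have h3 := (hu.tmul hv).bar (T := tensorRep Δ ρ₁ ρ₂ (gen D .σ)) fun _ => hL.σ_mem
    rw [hΔ.rep_σ] at h3
    rw [h3.unique ((hu.bar fun _ => h₁.lattice.σ_mem).tmul (hv.bar fun _ => h₂.lattice.σ_mem))]
    rcases h₁.σ_mem b₁ hb₁ with h4 | h4 <;> rcases h₂.σ_mem b₂ hb₂ with h5 | h5 <;>
      rw [h4, h5] <;> simp
  · intro b hb
    have h0 := hB.ne_zero hb
    obtain ⟨b₁, hb₁, b₂, hb₂, rfl⟩ := hb
    obtain ⟨ν, ⟨u, hu, rfl⟩, -⟩ := h₁.weight b₁ hb₁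
    obtain ⟨μ, ⟨v, hv, rfl⟩, -⟩ := h₂.weight b₂ hb₂
    have h3 : tensorBar L₁ L₂ (toBar L₁ u) (toBar L₂ v) ∈
        barWeight (tensorRep Δ ρ₁ ρ₂) (tensorLattice L₁ L₂) (ν + μ) := by
      obtain ⟨h4, h5⟩ := (IsCls.of_mem u.2).tmul (IsCls.of_mem v.2)
      exact ⟨⟨_, h4⟩, ⟨h4, hΔ.tmul_mem hu.2 hv.2⟩, h5.symm⟩
    exact ⟨ν + μ, h3, fun l hl => barWeight_unique (hΔ.isIntegrable hM₁ hM₂) hL h0 hl h3⟩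
  · intro i b hb b' hb'
    -- Elements of a pseudo-base are nonzero, so the hypothesis of `IsComul.kash_inverse` that the
    -- operator does not vanish holds whenever the image belongs to the base.
    constructor
    · rintro rfl
      exact ((hΔ.kash_inverse hD hM₁ hM₂ h₁ h₂ i hb').1 (hB.ne_zero hb)).symm
    · rintro rfl
      exact ((hΔ.kash_inverse hD hM₁ hM₂ h₁ h₂ i hb).2 (hB.ne_zero hb')).symm

end OddInverse

end QSuper

end

theorem mainTheorem9 {I P : Type*} [AddCommGroup P] [Module.Free ℤ P] (D : QSuper.Datum I P)
    (hD : ∀ i, D.p i = 1 → D.h i (D.α i) = 0)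
    {M₁ M₂ : Type*} [AddCommGroup M₁] [Module QSuper.Kq M₁] [AddCommGroup M₂] [Module QSuper.Kq M₂]
    (ρ₁ : QSuper.Uq D →ₐ[QSuper.Kq] Module.End QSuper.Kq M₁)
    (ρ₂ : QSuper.Uq D →ₐ[QSuper.Kq] Module.End QSuper.Kq M₂)
    (hM₁ : QSuper.InOint ρ₁) (hM₂ : QSuper.InOint ρ₂)
    (L₁ : Submodule QSuper.A M₁) (B₁ : Set (QSuper.Lbar L₁))
    (L₂ : Submodule QSuper.A M₂) (B₂ : Set (QSuper.Lbar L₂))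
    (h₁ : QSuper.IsCrystalBase ρ₁ L₁ B₁) (h₂ : QSuper.IsCrystalBase ρ₂ L₂ B₂) :
    ∃ Δ : QSuper.Uq D →ₐ[QSuper.Kq] QSuper.Uq D ⊗[QSuper.Kq] QSuper.Uq D, QSuper.IsComul D Δ ∧
      let ρ := QSuper.tensorRep Δ ρ₁ ρ₂
      let L := QSuper.tensorLattice L₁ L₂
      let E := fun i => QSuper.bar L (QSuper.kashE ρ i)
      let F := fun i => QSuper.bar L (QSuper.kashF ρ i)
      let E₁ := fun i => QSuper.bar L₁ (QSuper.kashE ρ₁ i)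
      let F₁ := fun i => QSuper.bar L₁ (QSuper.kashF ρ₁ i)
      let E₂ := fun i => QSuper.bar L₂ (QSuper.kashE ρ₂ i)
      let F₂ := fun i => QSuper.bar L₂ (QSuper.kashF ρ₂ i)
      let σ₁ := QSuper.bar L₁ (ρ₁ (QSuper.gen D .σ))
      let T := fun b₁ b₂ => QSuper.tensorBar L₁ L₂ b₁ b₂
      QSuper.IsIntegrable ρ ∧
      QSuper.IsCrystalBase ρ L (QSuper.tensorB L₁ L₂ B₁ B₂) ∧
      ∀ b₁ ∈ B₁, ∀ b₂ ∈ B₂, ∀ i,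
        (D.p i = 0 → 0 < D.ℓ i →
          (QSuper.eps ρ₂ L₂ i b₂ ≤ QSuper.phi ρ₁ L₁ i b₁ → E i (T b₁ b₂) = T (E₁ i b₁) b₂) ∧
          (QSuper.phi ρ₁ L₁ i b₁ < QSuper.eps ρ₂ L₂ i b₂ → E i (T b₁ b₂) = T b₁ (E₂ i b₂)) ∧
          (QSuper.eps ρ₂ L₂ i b₂ < QSuper.phi ρ₁ L₁ i b₁ → F i (T b₁ b₂) = T (F₁ i b₁) b₂) ∧
          (QSuper.phi ρ₁ L₁ i b₁ ≤ QSuper.eps ρ₂ L₂ i b₂ → F i (T b₁ b₂) = T b₁ (F₂ i b₂))) ∧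
        (D.p i = 0 → D.ℓ i < 0 →
          (QSuper.eps ρ₁ L₁ i b₁ ≤ QSuper.phi ρ₂ L₂ i b₂ → E i (T b₁ b₂) = T b₁ (E₂ i b₂)) ∧
          (QSuper.phi ρ₂ L₂ i b₂ < QSuper.eps ρ₁ L₁ i b₁ → E i (T b₁ b₂) = T (E₁ i b₁) b₂) ∧
          (QSuper.eps ρ₁ L₁ i b₁ < QSuper.phi ρ₂ L₂ i b₂ → F i (T b₁ b₂) = T b₁ (F₂ i b₂)) ∧
          (QSuper.phi ρ₂ L₂ i b₂ ≤ QSuper.eps ρ₁ L₁ i b₁ → F i (T b₁ b₂) = T (F₁ i b₁) b₂)) ∧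
        (D.p i = 1 → 0 < D.ℓ i → ∀ μ, b₁ ∈ QSuper.barWeight ρ₁ L₁ μ →
          (0 < D.h i μ → E i (T b₁ b₂) = T (E₁ i b₁) b₂ ∧ F i (T b₁ b₂) = T (F₁ i b₁) b₂) ∧
          (D.h i μ = 0 →
            E i (T b₁ b₂) = T (σ₁ b₁) (E₂ i b₂) ∧ F i (T b₁ b₂) = T (σ₁ b₁) (F₂ i b₂))) ∧
        (D.p i = 1 → D.ℓ i < 0 → ∀ μ, b₂ ∈ QSuper.barWeight ρ₂ L₂ μ →
          (0 < D.h i μ →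
            E i (T b₁ b₂) = T (σ₁ b₁) (E₂ i b₂) ∧ F i (T b₁ b₂) = T (σ₁ b₁) (F₂ i b₂)) ∧
          (D.h i μ = 0 →
            E i (T b₁ b₂) = T (E₁ i b₁) b₂ ∧ F i (T b₁ b₂) = T (F₁ i b₁) b₂)) := by
  have hI₁ := hM₁.toIsIntegrable
  have hI₂ := hM₂.toIsIntegrable
  obtain ⟨Δ, hΔ⟩ := QSuper.exists_isComul D
  have hB := hΔ.isCrystalBase hD hI₁ hI₂ h₁ h₂
  exact ⟨Δ, hΔ, hΔ.isIntegrable hI₁ hI₂, hB, fun b₁ hb₁ b₂ hb₂ i =>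
    ⟨fun hi hℓ => hΔ.even_rule_of_pos hI₁ hI₂ h₁ h₂ hi hℓ hb₁ hb₂,
      fun hi hℓ => hΔ.even_rule_of_neg hI₁ hI₂ h₁ h₂ hi hℓ.le.not_gt hb₁ hb₂,
      fun hi hℓ _ hμ => hΔ.odd_rule_of_pos hI₁ h₁.lattice h₂.lattice hB.lattice hi hℓ hμ b₂,
      fun hi hℓ _ hμ =>
        hΔ.odd_rule_of_neg hI₂ h₁.lattice h₂.lattice hB.lattice hi hℓ.le.not_gt b₁ hμ⟩⟩
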